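/- Let $k$ be a field and $H$ a finite-dimensional Hopf algebra over $k$ with antipode $S$ (which is then bijective), and let $G=\mathrm{Aut}_{Hopf}(H)\times\mathrm{Aut}_{Hopf}(H)$ with the group law $(\alpha,\beta)*(\gamma,\delta)=(\delta\alpha\delta^{-1}\gamma,\ \delta\beta)$. We write $\Delta(h)=h_1\otimes h_2$ and, for a right comodule, $m\mapsto m_0\otimes m_1$. **Notions.** A *braided $T$-category over $G$* is a monoidal category that is a disjoint union of components $\mathcal C_a$ ($a\in G$; there are no morphisms between different components) with $\mathcal C_a\otimes\mathcal C_b\subseteq\mathcal C_{ab}$, with a strict action of $G$ by strict monoidal functors $X\mapsto{}^aX$, $\mathcal C_b\to\mathcal C_{aba^{-1}}$, and with natural isomorphisms $c_{X,Y}:X\otimes Y\to{}^aY\otimes X$ ($X\in\mathcal C_a$) that satisfy, up to the associativity constraints, $c_{X\otimes Y,Z}=(c_{X,{}^bZ}\otimes 1)(1\otimes c_{Y,Z})$ for $Y\in\mathcal C_b$, $c_{X,Y\otimes Z}=(1\otimes c_{X,Z})(c_{X,Y}\otimes 1)$ and ${}^ac_{X,Y}=c_{{}^aX,{}^aY}$.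 An *isomorphism* of braided $T$-categories over $G$ is an isomorphism of categories that strictly preserves the components, the unit and the tensor product with its constraints, the action of $G$ and the braiding. A *Turaev $G$-algebra* is a family of coalgebras $A_a$ ($a\in G$) with an associative multiplication by coalgebra maps $A_a\otimes A_b\to A_{ab}$, a unit $1\in A_e$ ($e$ the neutral element of $G$) with $\Delta(1)=1\otimes1$, $\varepsilon(1)=1$, and antipode maps $S_a:A_a\to A_{a^{-1}}$ with $x_1S_a(x_2)=\varepsilon(x)1=S_a(x_1)x_2$. It is *crossed* if it has coalgebra isomorphisms $\psi_b:A_a\to A_{bab^{-1}}$ with $\psi_a\psi_b=\psi_{ab}$ that preserve products, the unit and the antipode. It is *coquasitriangular* if it has convolution-invertible forms $\sigma_{a,b}:A_a\otimes A_b\to k$ such that for $x\in A_a$, $y\in A_b$, $z\in A_c$, $d\in G$ $$\sigma(xy,z)=\sigma(x,z_2)\sigma(y,z_1),\qquad \sigma(x,yz)=\sigma(x_1,y)\,\sigma(\psi_{b^{-1}}(x_2),z),$$ $$\sigma(x_1,y_1)\,y_2\,\psi_{b^{-1}}(x_2)=x_1y_1\,\sigma(x_2,y_2),\qquad \sigma(x,y)=\sigma(\psi_d(x),\psi_d(y)).$$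 For such an $A$, $\mathrm{Corep}(A)$ is the disjoint union over $a\in G$ of the categories of right $A_a$-comodules, with the coaction $v\otimes w\mapsto v_0\otimes w_0\otimes v_1w_1$ on tensor products, with the unit object $k$ with coaction $r\mapsto r\otimes 1$, with ${}^aV=V$ as a space and the coaction $v\mapsto v_0\otimes\psi_a(v_1)$, and with the braiding $c(v\otimes w)=\sigma_{aba^{-1},a}(\psi_a(w_1),v_1)\,w_0\otimes v_0$ for $V$ over $A_a$ and $W$ over $A_b$. (For the categories of spaces with extra structure in this statement, the associativity and unit constraints are those of vector spaces.) **The category $\widehat{\mathcal{YD}(H)}$.** An $(\alpha,\beta)$-Yetter–Drinfeld module is a left $H$-module and right $H$-comodule $M$ with $$h_1\cdot m_0\otimes\beta(h_2)m_1=(h_2\cdot m)_0\otimes(h_2\cdot m)_1\,\alpha(h_1).$$ $\widehat{\mathcal{YD}(H)}$ is the disjoint union over $(\alpha,\beta)\in G$ of the categories of $(\alpha,\beta)$-Yetter–Drinfeld modules with the $H$-linear and $H$-colinear maps. For $M$ of index $(\alpha,\beta)$ and $N$ of index $(\gamma,\delta)$, $M\otimes N$ has the action $h\cdot(m\otimes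 n)=h_2\cdot m\otimes h_1\cdot n$ and the coaction $m\otimes n\mapsto m_0\otimes n_0\otimes\delta(m_1)\,\delta\alpha\delta^{-1}(n_1)$; the unit object is $k$ with the trivial structures, of index $(\mathrm{id},\mathrm{id})$; ${}^{(\alpha,\beta)}N=N$ as a space, with the action $h\rightharpoonup n=\alpha^{-1}\beta(h)\cdot n$ and the coaction $n\mapsto n_0\otimes\beta^{-1}\delta\alpha\delta^{-1}(n_1)$; the braiding is $c_{M,N}(m\otimes n)=\alpha^{-1}(m_1)\cdot n\otimes m_0$. With this structure $\widehat{\mathcal{YD}(H)}$ is a braided $T$-category over $G$. **The algebra $CT(H)$.** Let $H^*$ be the dual of $H$ with the convolution product and with $p\mapsto p_1\otimes p_2$ given by $p_1(x)p_2(y)=p(xy)$, and let $(h_i)$, $(h^i)$ be dual bases of $H$ and $H^*$. For $(\alpha,\beta)\in G$ let $CT(H)_{(\alpha,\beta)}=H^{*op}\bowtie H(\alpha,\beta)$ be the space $H^*\otimes H$, with elements $p\bowtie h$, with the counit $p(1)\varepsilon(h)$ and the comultiplication $$p\bowtie h\mapsto\sum_{i,j}\big(p_1\bowtie\beta(h_j)\,h_1\,S^{-1}(\alpha(h_i))\big)\otimes\big(h^ip_2h^j\bowtie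 h_2\big).$$ For $p\bowtie h$ of index $(\alpha,\beta)$ and $q\bowtie h'$ of index $(\gamma,\delta)$ put $$(p\bowtie h)(q\bowtie h')=qp\bowtie\delta(h)\,\delta\alpha\delta^{-1}(h'),\qquad 1=\varepsilon\bowtie1,$$ $$S_{(\alpha,\beta)}(p\bowtie h)=\sum_{i,j}h^i\,(p\circ S^{-1})\,(h^j\circ S^{-1})\bowtie\beta^{-1}(h_j)\,\beta^{-1}\alpha^{-1}(S(h))\,\beta^{-1}\alpha^{-1}\beta(h_i),$$ $$\psi_{(\alpha,\beta)}(q\bowtie h')=q\circ\alpha^{-1}\beta\bowtie\beta^{-1}\delta\alpha\delta^{-1}(h'),\qquad \sigma_{(\alpha,\beta),(\gamma,\delta)}(p\bowtie h,\,q\bowtie h')=p(\delta^{-1}(h'))\,q(1)\,\varepsilon(h).$$ **Theorem 3.13.** With these structure maps $CT(H)$ is a coquasitriangular crossed Turaev $G$-algebra, and the braided $T$-categories $\mathrm{Corep}(CT(H))$ and $\widehat{\mathcal{YD}(H)}$ are isomorphic as braided $T$-categories over $G$. -/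

import Mathlib

set_option linter.unusedSimpArgs false
open CategoryTheory MonoidalCategory
open scoped TensorProduct

universe w v u v₁ u₁ v₂ u₂

/-- A braided `T`-category (Turaev braided `G`-category) over a group `G`. The disjoint union of the
components is recorded by the degree of an object: morphisms exist only between objects of the same
degree, and the component of `a : G` is the full subcategory of the objects of degree `a`.
The conjugation is a strict action of `G` by strict tensor functors (`≍` compares morphisms whose
sources and targets are equal objects); the tensor product itself is taken with its associativity
and unit constraints, as for vector spaces. -/
structure BraidedTCategory (G : Type w) [Group G] where
  Obj : Type u₁
  [category : Category.{v₁} Obj]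
  [monoidal : MonoidalCategory Obj]
  /-- the index of the component containing an object -/
  deg : Obj → G
  deg_eq_of_hom : ∀ {X Y : Obj}, (X ⟶ Y) → deg X = deg Y
  deg_tensor : ∀ X Y : Obj, deg (X ⊗ Y) = deg X * deg Y
  /-- the conjugation functors `X ↦ ᵃX` -/
  conj : G → Obj ⥤ Obj
  conj_one : conj 1 = 𝟭 Obj
  conj_mul : ∀ a b : G, conj (a * b) = conj b ⋙ conj a
  deg_conj : ∀ (a : G) (X : Obj), deg ((conj a).obj X) = a * deg X * a⁻¹
  conj_unit : ∀ a : G, (conj a).obj (𝟙_ Obj) = 𝟙_ Obj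
  conj_tensorObj : ∀ (a : G) (X Y : Obj),
    (conj a).obj (X ⊗ Y) = (conj a).obj X ⊗ (conj a).obj Y
  conj_tensorHom : ∀ (a : G) {X Y X' Y' : Obj} (f : X ⟶ X') (g : Y ⟶ Y'),
    (conj a).map (f ⊗ₘ g) ≍ ((conj a).map f ⊗ₘ (conj a).map g)
  conj_associator : ∀ (a : G) (X Y Z : Obj),
    (conj a).map (α_ X Y Z).hom ≍ (α_ ((conj a).obj X) ((conj a).obj Y) ((conj a).obj Z)).hom
  conj_leftUnitor : ∀ (a : G) (X : Obj), (conj a).map (λ_ X).hom ≍ (λ_ ((conj a).obj X)).hom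
  conj_rightUnitor : ∀ (a : G) (X : Obj), (conj a).map (ρ_ X).hom ≍ (ρ_ ((conj a).obj X)).hom
  /-- the braiding `c_{X,Y} : X ⊗ Y ≅ ˣY ⊗ X` -/
  braiding : ∀ X Y : Obj, X ⊗ Y ≅ (conj (deg X)).obj Y ⊗ X
  braiding_naturality : ∀ {X X' Y Y' : Obj} (f : X ⟶ X') (g : Y ⟶ Y'),
    (braiding X Y).hom ≫ ((conj (deg X)).map g ⊗ₘ f) ≫ eqToHom (by rw [deg_eq_of_hom f]) =
      (f ⊗ₘ g) ≫ (braiding X' Y').hom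
  braiding_tensor_left : ∀ X Y Z : Obj,
    (braiding (X ⊗ Y) Z).hom ≫ eqToHom (by rw [deg_tensor, conj_mul]; rfl) =
      (α_ X Y Z).hom ≫ (X ◁ (braiding Y Z).hom) ≫ (α_ X ((conj (deg Y)).obj Z) Y).inv ≫
        ((braiding X ((conj (deg Y)).obj Z)).hom ▷ Y) ≫
          (α_ ((conj (deg X)).obj ((conj (deg Y)).obj Z)) X Y).hom
  braiding_tensor_right : ∀ X Y Z : Obj,
    (braiding X (Y ⊗ Z)).hom ≫ eqToHom (by rw [conj_tensorObj]) =
      (α_ X Y Z).inv ≫ ((braiding X Y).hom ▷ Z) ≫ (α_ ((conj (deg X)).obj Y) X Z).hom ≫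
        ((conj (deg X)).obj Y ◁ (braiding X Z).hom) ≫
          (α_ ((conj (deg X)).obj Y) ((conj (deg X)).obj Z) X).inv
  conj_braiding : ∀ (a : G) (X Y : Obj),
    (conj a).map (braiding X Y).hom ≍ (braiding ((conj a).obj X) ((conj a).obj Y)).hom

namespace BraidedTCategory

attribute [instance] BraidedTCategory.category BraidedTCategory.monoidal

/-- An isomorphism of braided `T`-categories over `G`: an isomorphism of categories which preserves
strictly the components, the tensor product with its constraints, the conjugation and the
braiding. -/
structure Iso {G : Type w} [Group G] (C : BraidedTCategory.{w, v₁, u₁} G)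
    (D : BraidedTCategory.{w, v₂, u₂} G) where
  functor : C.Obj ⥤ D.Obj
  inverse : D.Obj ⥤ C.Obj
  functor_comp_inverse : functor ⋙ inverse = 𝟭 C.Obj
  inverse_comp_functor : inverse ⋙ functor = 𝟭 D.Obj
  deg_obj : ∀ X : C.Obj, D.deg (functor.obj X) = C.deg X
  obj_unit : functor.obj (𝟙_ C.Obj) = 𝟙_ D.Obj
  obj_tensor : ∀ X Y : C.Obj, functor.obj (X ⊗ Y) = functor.obj X ⊗ functor.obj Y
  map_tensor : ∀ {X X' Y Y' : C.Obj} (f : X ⟶ X') (g : Y ⟶ Y'),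
    functor.map (f ⊗ₘ g) ≍ (functor.map f ⊗ₘ functor.map g)
  map_associator : ∀ X Y Z : C.Obj,
    functor.map (α_ X Y Z).hom ≍ (α_ (functor.obj X) (functor.obj Y) (functor.obj Z)).hom
  map_leftUnitor : ∀ X : C.Obj, functor.map (λ_ X).hom ≍ (λ_ (functor.obj X)).hom
  map_rightUnitor : ∀ X : C.Obj, functor.map (ρ_ X).hom ≍ (ρ_ (functor.obj X)).hom
  conj_comp : ∀ a : G, C.conj a ⋙ functor = functor ⋙ D.conj a
  map_braiding : ∀ X Y : C.Obj,
    functor.map (C.braiding X Y).hom ≍ (D.braiding (functor.obj X) (functor.obj Y)).hom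

end BraidedTCategory

namespace Coact

variable {k : Type u} [Field k]
variable {C D E F K L : Type*} [AddCommGroup C] [Module k C] [AddCommGroup D] [Module k D]
  [AddCommGroup E] [Module k E] [AddCommGroup F] [Module k F] [AddCommGroup K] [Module k K]
  [AddCommGroup L] [Module k L]
variable {V W U : Type*} [AddCommGroup V] [Module k V] [AddCommGroup W] [Module k W]
  [AddCommGroup U] [Module k U]

/-- Induction on a tensor, from pure tensors and sums. -/
@[elab_as_elim]
theorem ind {motive : V ⊗[k] W → Prop} (tmul : ∀ v w, motive (v ⊗ₜ w))
    (add : ∀ a b, motive a → motive b → motive (a + b)) (x : V ⊗[k] W) : motive x :=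
  TensorProduct.induction_on x (by simpa using tmul 0 0) tmul add

/-- `ρ : V → V ⊗ C` is a right coaction: coassociative and counital. -/
structure IsCoaction (Δ : C →ₗ[k] C ⊗[k] C) (ε : C →ₗ[k] k) (ρ : V →ₗ[k] V ⊗[k] C) : Prop where
  coassoc : ∀ x, TensorProduct.assoc k V C C (TensorProduct.map ρ LinearMap.id (ρ x)) =
    TensorProduct.map LinearMap.id Δ (ρ x)
  counit : ∀ x, TensorProduct.rid k V (TensorProduct.map LinearMap.id ε (ρ x)) = x

/-- `x ⊗ y ↦ (x₁ ⊗ y₁) ⊗ (x₂ ⊗ y₂)` -/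
noncomputable def tensorComul (ΔC : C →ₗ[k] C ⊗[k] C) (ΔD : D →ₗ[k] D ⊗[k] D) :
    C ⊗[k] D →ₗ[k] (C ⊗[k] D) ⊗[k] (C ⊗[k] D) :=
  (TensorProduct.tensorTensorTensorComm k C C D D).toLinearMap ∘ₗ TensorProduct.map ΔC ΔD

/-- `x ⊗ y ↦ ε(x) ε(y)` -/
noncomputable def tensorCounit (εC : C →ₗ[k] k) (εD : D →ₗ[k] k) : C ⊗[k] D →ₗ[k] k :=
  LinearMap.mul' k k ∘ₗ TensorProduct.map εC εD

/-- the coaction `v ⊗ w ↦ v₀ ⊗ w₀ ⊗ m(v₁ ⊗ w₁)` on a tensor product -/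
noncomputable def tensor (m : C ⊗[k] D →ₗ[k] E) (ρ : V →ₗ[k] V ⊗[k] C) (τ : W →ₗ[k] W ⊗[k] D) :
    V ⊗[k] W →ₗ[k] (V ⊗[k] W) ⊗[k] E :=
  TensorProduct.map LinearMap.id m ∘ₗ
    (TensorProduct.tensorTensorTensorComm k V C W D).toLinearMap ∘ₗ TensorProduct.map ρ τ

/-- the coaction `v ↦ v₀ ⊗ f(v₁)` -/
noncomputable def push (f : C →ₗ[k] D) (ρ : V →ₗ[k] V ⊗[k] C) : V →ₗ[k] V ⊗[k] D :=
  TensorProduct.map LinearMap.id f ∘ₗ ρ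

/-- Two linear maps out of `(V ⊗ C) ⊗ (W ⊗ D)` agree if they do on pure tensors. -/
theorem ext₄ {P : Type*} [AddCommGroup P] [Module k P]
    {f g : (V ⊗[k] C) ⊗[k] (W ⊗[k] D) →ₗ[k] P}
    (h : ∀ v c w d, f ((v ⊗ₜ c) ⊗ₜ (w ⊗ₜ d)) = g ((v ⊗ₜ c) ⊗ₜ (w ⊗ₜ d))) : f = g :=
  TensorProduct.ext_fourfold' h

theorem push_isCoaction {ΔC : C →ₗ[k] C ⊗[k] C} {εC : C →ₗ[k] k} {ΔD : D →ₗ[k] D ⊗[k] D}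
    {εD : D →ₗ[k] k} {f : C →ₗ[k] D} {ρ : V →ₗ[k] V ⊗[k] C}
    (hΔ : ∀ x, TensorProduct.map f f (ΔC x) = ΔD (f x)) (hε : ∀ x, εD (f x) = εC x)
    (h : IsCoaction ΔC εC ρ) : IsCoaction ΔD εD (push f ρ) where
  coassoc x := by
    have h1 : ∀ s : V ⊗[k] C, TensorProduct.assoc k V D D (TensorProduct.map (push f ρ)
        LinearMap.id (TensorProduct.map LinearMap.id f s)) =
        TensorProduct.map LinearMap.id (TensorProduct.map f f)
          (TensorProduct.assoc k V C C (TensorProduct.map ρ LinearMap.id s)) := by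
      intro s
      induction s using Coact.ind with
      | add a b ha hb => simp only [LinearMap.map_add, LinearEquiv.map_add, ha, hb]
      | tmul v c =>
        simp only [TensorProduct.map_tmul, LinearMap.id_apply, push, LinearMap.comp_apply]
        generalize ρ v = t
        induction t using Coact.ind with
        | add a b ha hb => simp only [LinearMap.map_add, LinearEquiv.map_add,
            ha, hb, TensorProduct.add_tmul]
        | tmul v c => simp
    have h2 : ∀ s : V ⊗[k] C, TensorProduct.map LinearMap.id (TensorProduct.map f f)
        (TensorProduct.map LinearMap.id ΔC s) =
        TensorProduct.map LinearMap.id ΔD (TensorProduct.map (LinearMap.id : V →ₗ[k] V) f s) := by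
      intro s
      induction s using Coact.ind with
      | add a b ha hb => simp only [LinearMap.map_add, LinearEquiv.map_add, ha, hb]
      | tmul v c => simp [hΔ]
    rw [push, LinearMap.comp_apply, ← push, h1, h.coassoc, h2]
  counit x := by
    have : εD ∘ₗ f = εC := LinearMap.ext hε
    rw [push, LinearMap.comp_apply, ← LinearMap.comp_apply, ← TensorProduct.map_comp, this,
      LinearMap.id_comp, h.counit]

theorem tensor_isCoaction {ΔC : C →ₗ[k] C ⊗[k] C} {εC : C →ₗ[k] k} {ΔD : D →ₗ[k] D ⊗[k] D}
    {εD : D →ₗ[k] k} {ΔE : E →ₗ[k] E ⊗[k] E} {εE : E →ₗ[k] k} {m : C ⊗[k] D →ₗ[k] E}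
    {ρ : V →ₗ[k] V ⊗[k] C} {τ : W →ₗ[k] W ⊗[k] D}
    (hΔ : TensorProduct.map m m ∘ₗ tensorComul ΔC ΔD = ΔE ∘ₗ m)
    (hε : εE ∘ₗ m = tensorCounit εC εD)
    (h : IsCoaction ΔC εC ρ) (h' : IsCoaction ΔD εD τ) : IsCoaction ΔE εE (tensor m ρ τ) where
  coassoc x := by
    -- both sides are images of a common map applied to the twofold coactions
    let Φ : (V ⊗[k] (C ⊗[k] C)) ⊗[k] (W ⊗[k] (D ⊗[k] D)) →ₗ[k] (V ⊗[k] W) ⊗[k] (E ⊗[k] E) :=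
      TensorProduct.map LinearMap.id (TensorProduct.map m m ∘ₗ
        (TensorProduct.tensorTensorTensorComm k C C D D).toLinearMap) ∘ₗ
      (TensorProduct.tensorTensorTensorComm k V (C ⊗[k] C) W (D ⊗[k] D)).toLinearMap
    have h1 : ∀ (s : V ⊗[k] C) (t : W ⊗[k] D),
        TensorProduct.assoc k (V ⊗[k] W) E E (TensorProduct.map (tensor m ρ τ) LinearMap.id
          (TensorProduct.map LinearMap.id m
            (TensorProduct.tensorTensorTensorComm k V C W D (s ⊗ₜ t)))) =
        Φ (TensorProduct.assoc k V C C (TensorProduct.map ρ LinearMap.id s) ⊗ₜ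
          TensorProduct.assoc k W D D (TensorProduct.map τ LinearMap.id t)) := by
      intro s t
      induction s using Coact.ind with
      | add a b ha hb => simp only [LinearMap.map_add, LinearEquiv.map_add,
          ha, hb, TensorProduct.add_tmul]
      | tmul v c =>
      induction t using Coact.ind with
      | add a b ha hb => simp only [LinearMap.map_add, LinearEquiv.map_add,
          ha, hb, TensorProduct.tmul_add]
      | tmul w d =>
        simp only [TensorProduct.tensorTensorTensorComm_tmul, TensorProduct.map_tmul, tensor,
          LinearMap.comp_apply, LinearMap.id_apply, LinearEquiv.coe_coe]
        generalize ρ v = s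
        generalize τ w = t
        induction s using Coact.ind with
        | add a b ha hb => simp only [LinearMap.map_add, LinearEquiv.map_add,
            ha, hb, TensorProduct.add_tmul]
        | tmul v c' =>
        induction t using Coact.ind with
        | add a b ha hb => simp only [LinearMap.map_add, LinearEquiv.map_add,
            ha, hb, TensorProduct.tmul_add,
            TensorProduct.add_tmul]
        | tmul w d' => simp [Φ]
    have h2 : ∀ (s : V ⊗[k] C) (t : W ⊗[k] D),
        Φ (TensorProduct.map LinearMap.id ΔC s ⊗ₜ TensorProduct.map LinearMap.id ΔD t) =
        TensorProduct.map LinearMap.id ΔE (TensorProduct.map LinearMap.id m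
          (TensorProduct.tensorTensorTensorComm k V C W D (s ⊗ₜ t))) := by
      intro s t
      induction s using Coact.ind with
      | add a b ha hb => simp only [LinearMap.map_add, LinearEquiv.map_add,
          ha, hb, TensorProduct.add_tmul]
      | tmul v c =>
      induction t using Coact.ind with
      | add a b ha hb => simp only [LinearMap.map_add, LinearEquiv.map_add,
          ha, hb, TensorProduct.tmul_add]
      | tmul w d =>
        have := LinearMap.congr_fun hΔ (c ⊗ₜ d)
        simp only [tensorComul, LinearMap.comp_apply, TensorProduct.map_tmul,
          LinearEquiv.coe_coe] at this
        simp [Φ, this]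
    induction x using Coact.ind with
    | add a b ha hb => simp only [LinearMap.map_add, LinearEquiv.map_add, ha, hb]
    | tmul v w =>
      have e : tensor m ρ τ (v ⊗ₜ w) = TensorProduct.map LinearMap.id m
        (TensorProduct.tensorTensorTensorComm k V C W D (ρ v ⊗ₜ τ w)) := by simp [tensor]
      rw [e, h1, h.coassoc, h'.coassoc, h2]
  counit x := by
    have h2 : ∀ (s : V ⊗[k] C) (t : W ⊗[k] D),
        TensorProduct.rid k _ (TensorProduct.map LinearMap.id εE (TensorProduct.map LinearMap.id m
          (TensorProduct.tensorTensorTensorComm k V C W D (s ⊗ₜ t)))) =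
        TensorProduct.rid k _ (TensorProduct.map LinearMap.id εC s) ⊗ₜ
          TensorProduct.rid k _ (TensorProduct.map LinearMap.id εD t) := by
      intro s t
      induction s using Coact.ind with
      | add a b ha hb => simp only [LinearMap.map_add, LinearEquiv.map_add,
          ha, hb, TensorProduct.add_tmul]
      | tmul v c =>
      induction t using Coact.ind with
      | add a b ha hb => simp only [LinearMap.map_add, LinearEquiv.map_add,
          ha, hb, TensorProduct.tmul_add]
      | tmul w d =>
        have := LinearMap.congr_fun hε (c ⊗ₜ d)
        simp only [tensorCounit, LinearMap.comp_apply, TensorProduct.map_tmul,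
          LinearMap.mul'_apply] at this
        simp [this, TensorProduct.smul_tmul', mul_smul, TensorProduct.tmul_smul]
        try rw [smul_comm]
    induction x using Coact.ind with
    | add a b ha hb => simp only [LinearMap.map_add, LinearEquiv.map_add, ha, hb]
    | tmul v w =>
      have e : tensor m ρ τ (v ⊗ₜ w) = TensorProduct.map LinearMap.id m
        (TensorProduct.tensorTensorTensorComm k V C W D (ρ v ⊗ₜ τ w)) := by simp [tensor]
      rw [e, h2, h.counit, h'.counit]

end Coact

namespace Coact

variable {k : Type u} [Field k]
variable {C D E F K L : Type*} [AddCommGroup C] [Module k C] [AddCommGroup D] [Module k D]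
  [AddCommGroup E] [Module k E] [AddCommGroup F] [Module k F] [AddCommGroup K] [Module k K]
  [AddCommGroup L] [Module k L]
variable {C' D' E' : Type*} [AddCommGroup C'] [Module k C'] [AddCommGroup D'] [Module k D']
  [AddCommGroup E'] [Module k E']
variable {V W U V' W' : Type*} [AddCommGroup V] [Module k V] [AddCommGroup W] [Module k W]
  [AddCommGroup U] [Module k U] [AddCommGroup V'] [Module k V'] [AddCommGroup W'] [Module k W']

theorem tensor_map {m : C ⊗[k] D →ₗ[k] E} {m' : C' ⊗[k] D' →ₗ[k] E'} {κ : E →ₗ[k] E'}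
    {κ₁ : C →ₗ[k] C'} {κ₂ : D →ₗ[k] D'}
    {ρ : V →ₗ[k] V ⊗[k] C} {τ : W →ₗ[k] W ⊗[k] D} {ρ' : V' →ₗ[k] V' ⊗[k] C'}
    {τ' : W' →ₗ[k] W' ⊗[k] D'} {f : V →ₗ[k] V'} {g : W →ₗ[k] W'}
    (hm : ∀ c d, κ (m (c ⊗ₜ d)) = m' (κ₁ c ⊗ₜ κ₂ d))
    (hf : ∀ v, TensorProduct.map f κ₁ (ρ v) = ρ' (f v))
    (hg : ∀ w, TensorProduct.map g κ₂ (τ w) = τ' (g w)) (x : V ⊗[k] W) :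
    TensorProduct.map (TensorProduct.map f g) κ (tensor m ρ τ x) =
      tensor m' ρ' τ' (TensorProduct.map f g x) := by
  induction x using Coact.ind with
  | add a b ha hb => simp only [LinearMap.map_add, LinearEquiv.map_add, ha, hb]
  | tmul v w =>
    simp only [tensor, LinearMap.comp_apply, TensorProduct.map_tmul, ← hf, ← hg,
      LinearEquiv.coe_coe]
    generalize ρ v = s
    generalize τ w = t
    induction s using Coact.ind with
    | add a b ha hb => simp only [LinearMap.map_add, LinearEquiv.map_add,
        ha, hb, TensorProduct.add_tmul]
    | tmul v c =>
    induction t using Coact.ind with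
    | add a b ha hb => simp only [LinearMap.map_add, LinearEquiv.map_add,
        ha, hb, TensorProduct.tmul_add]
    | tmul w d => simp [hm]

theorem tensor_assoc {m : C ⊗[k] D →ₗ[k] E} {m' : E ⊗[k] F →ₗ[k] K} {n : D ⊗[k] F →ₗ[k] L}
    {n' : C ⊗[k] L →ₗ[k] E'} {κ : K →ₗ[k] E'}
    {ρ : V →ₗ[k] V ⊗[k] C} {τ : W →ₗ[k] W ⊗[k] D} {υ : U →ₗ[k] U ⊗[k] F}
    (h : ∀ c d f, κ (m' (m (c ⊗ₜ d) ⊗ₜ f)) = n' (c ⊗ₜ n (d ⊗ₜ f))) (x : (V ⊗[k] W) ⊗[k] U) :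
    TensorProduct.map (TensorProduct.assoc k V W U).toLinearMap κ
      (tensor m' (tensor m ρ τ) υ x) =
      tensor n' ρ (tensor n τ υ) (TensorProduct.assoc k V W U x) := by
  induction x using Coact.ind with
  | add a b ha hb => simp only [LinearMap.map_add, LinearEquiv.map_add, ha, hb]
  | tmul x u =>
  induction x using Coact.ind with
  | add a b ha hb => simp only [LinearMap.map_add, LinearEquiv.map_add,
      ha, hb, TensorProduct.add_tmul]
  | tmul v w =>
    simp only [tensor, LinearMap.comp_apply, TensorProduct.map_tmul, LinearEquiv.coe_coe,
      TensorProduct.assoc_tmul]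
    generalize ρ v = s
    generalize τ w = t
    generalize υ u = r
    induction s using Coact.ind with
    | add a b ha hb => simp only [LinearMap.map_add, LinearEquiv.map_add,
        ha, hb, TensorProduct.add_tmul]
    | tmul v c =>
    induction t using Coact.ind with
    | add a b ha hb => simp only [LinearMap.map_add, LinearEquiv.map_add,
        ha, hb, TensorProduct.tmul_add, TensorProduct.add_tmul]
    | tmul w d =>
    induction r using Coact.ind with
    | add a b ha hb => simp only [LinearMap.map_add, LinearEquiv.map_add,
        ha, hb, TensorProduct.tmul_add]
    | tmul u f => simp [h]

/-- the coaction `r ↦ r ⊗ e` on the ground field -/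
noncomputable def unit (e : C) : k →ₗ[k] k ⊗[k] C := (TensorProduct.mk k k C).flip e

theorem unit_isCoaction {Δ : C →ₗ[k] C ⊗[k] C} {ε : C →ₗ[k] k} {e : C} (h : Δ e = e ⊗ₜ e)
    (h' : ε e = 1) : IsCoaction Δ ε (unit e) where
  coassoc x := by simp [unit, h]
  counit x := by simp [unit, h']

theorem tensor_unit_left {m : C ⊗[k] D →ₗ[k] E} {κ : E →ₗ[k] D} {e : C}
    {τ : W →ₗ[k] W ⊗[k] D} (h : ∀ d, κ (m (e ⊗ₜ d)) = d) (x : k ⊗[k] W) :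
    TensorProduct.map (TensorProduct.lid k W).toLinearMap κ (tensor m (unit e) τ x) =
      τ (TensorProduct.lid k W x) := by
  induction x using Coact.ind with
  | add a b ha hb => simp only [LinearMap.map_add, LinearEquiv.map_add, ha, hb]
  | tmul r w =>
    simp only [tensor, LinearMap.comp_apply, TensorProduct.map_tmul, LinearEquiv.coe_coe,
      TensorProduct.lid_tmul, map_smul, unit, LinearMap.flip_apply, TensorProduct.mk_apply]
    generalize τ w = t
    induction t using Coact.ind with
    | add a b ha hb => simp only [LinearMap.map_add, LinearEquiv.map_add,
        ha, hb, TensorProduct.tmul_add, smul_add]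
    | tmul w d => simp [h, TensorProduct.smul_tmul']

theorem tensor_unit_right {m : C ⊗[k] D →ₗ[k] E} {κ : E →ₗ[k] C} {e : D}
    {ρ : V →ₗ[k] V ⊗[k] C} (h : ∀ c, κ (m (c ⊗ₜ e)) = c) (x : V ⊗[k] k) :
    TensorProduct.map (TensorProduct.rid k V).toLinearMap κ (tensor m ρ (unit e) x) =
      ρ (TensorProduct.rid k V x) := by
  induction x using Coact.ind with
  | add a b ha hb => simp only [LinearMap.map_add, LinearEquiv.map_add, ha, hb]
  | tmul v r =>
    simp only [tensor, LinearMap.comp_apply, TensorProduct.map_tmul, LinearEquiv.coe_coe,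
      TensorProduct.rid_tmul, map_smul, unit, LinearMap.flip_apply, TensorProduct.mk_apply]
    generalize ρ v = t
    induction t using Coact.ind with
    | add a b ha hb => simp only [LinearMap.map_add, LinearEquiv.map_add,
        ha, hb, TensorProduct.add_tmul, smul_add]
    | tmul w d => simp [h, TensorProduct.smul_tmul']

theorem map_map {V₂ C₂ : Type*} [AddCommGroup V₂] [Module k V₂] [AddCommGroup C₂]
    [Module k C₂] (f : V →ₗ[k] V') (g : C →ₗ[k] C') (f' : V' →ₗ[k] V₂)
    (g' : C' →ₗ[k] C₂) (x : V ⊗[k] C) :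
    TensorProduct.map f' g' (TensorProduct.map f g x) =
      TensorProduct.map (f' ∘ₗ f) (g' ∘ₗ g) x := by
  rw [TensorProduct.map_comp, LinearMap.comp_apply]

theorem push_apply (f : C →ₗ[k] D) (ρ : V →ₗ[k] V ⊗[k] C) (v : V) :
    push f ρ v = TensorProduct.map LinearMap.id f (ρ v) := rfl

theorem push_push (f : C →ₗ[k] D) (g : D →ₗ[k] E) (ρ : V →ₗ[k] V ⊗[k] C) :
    push g (push f ρ) = push (g ∘ₗ f) ρ := by
  ext v
  simp only [push_apply, map_map, LinearMap.id_comp]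

theorem push_unit (f : C →ₗ[k] D) (e : C) : push f (unit (k := k) e) = unit (f e) := by
  ext
  simp [push, unit]

theorem push_tensor {m : C ⊗[k] D →ₗ[k] E} {m' : C' ⊗[k] D' →ₗ[k] E'} {κ : E →ₗ[k] E'}
    {κ₁ : C →ₗ[k] C'} {κ₂ : D →ₗ[k] D'}
    {ρ : V →ₗ[k] V ⊗[k] C} {τ : W →ₗ[k] W ⊗[k] D}
    (hm : ∀ c d, κ (m (c ⊗ₜ d)) = m' (κ₁ c ⊗ₜ κ₂ d)) :
    push κ (tensor m ρ τ) = tensor m' (push κ₁ ρ) (push κ₂ τ) := by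
  have := tensor_map (ρ' := push κ₁ ρ) (τ' := push κ₂ τ) (ρ := ρ) (τ := τ)
    (f := LinearMap.id) (g := LinearMap.id) hm (fun _ => rfl) (fun _ => rfl)
  ext1
  ext v w
  simpa [push] using this (v ⊗ₜ w)

/-- `v ⊗ w ↦ s(v₁ ⊗ w₁) v₀ ⊗ w₀` -/
noncomputable def pair (s : C ⊗[k] D →ₗ[k] k) (ρ : V →ₗ[k] V ⊗[k] C) (τ : W →ₗ[k] W ⊗[k] D) :
    V ⊗[k] W →ₗ[k] V ⊗[k] W :=
  (TensorProduct.rid k (V ⊗[k] W)).toLinearMap ∘ₗ tensor s ρ τ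

/-- convolution product of two forms on `C ⊗ D` -/
noncomputable def conv (ΔC : C →ₗ[k] C ⊗[k] C) (ΔD : D →ₗ[k] D ⊗[k] D)
    (s t : C ⊗[k] D →ₗ[k] k) : C ⊗[k] D →ₗ[k] k :=
  LinearMap.mul' k k ∘ₗ TensorProduct.map s t ∘ₗ tensorComul ΔC ΔD

theorem pair_pair {ΔC : C →ₗ[k] C ⊗[k] C} {εC : C →ₗ[k] k} {ΔD : D →ₗ[k] D ⊗[k] D}
    {εD : D →ₗ[k] k} {ρ : V →ₗ[k] V ⊗[k] C} {τ : W →ₗ[k] W ⊗[k] D}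
    (h : IsCoaction ΔC εC ρ) (h' : IsCoaction ΔD εD τ) (s t : C ⊗[k] D →ₗ[k] k) (x : V ⊗[k] W) :
    pair s ρ τ (pair t ρ τ x) = pair (conv ΔC ΔD s t) ρ τ x := by
  let Φ : (V ⊗[k] (C ⊗[k] C)) ⊗[k] (W ⊗[k] (D ⊗[k] D)) →ₗ[k] (V ⊗[k] W) :=
    (TensorProduct.rid k (V ⊗[k] W)).toLinearMap ∘ₗ
    TensorProduct.map LinearMap.id (LinearMap.mul' k k ∘ₗ TensorProduct.map s t ∘ₗ
        (TensorProduct.tensorTensorTensorComm k C C D D).toLinearMap) ∘ₗ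
      (TensorProduct.tensorTensorTensorComm k V (C ⊗[k] C) W (D ⊗[k] D)).toLinearMap
  have h1 : ∀ (p : V ⊗[k] C) (q : W ⊗[k] D),
      pair s ρ τ (TensorProduct.rid k (V ⊗[k] W) (TensorProduct.map LinearMap.id t
        (TensorProduct.tensorTensorTensorComm k V C W D (p ⊗ₜ q)))) =
      Φ (TensorProduct.assoc k V C C (TensorProduct.map ρ LinearMap.id p) ⊗ₜ
          TensorProduct.assoc k W D D (TensorProduct.map τ LinearMap.id q)) := by
    intro p q
    induction p using Coact.ind with
    | add a b ha hb => simp only [LinearMap.map_add, LinearEquiv.map_add,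
        ha, hb, TensorProduct.add_tmul]
    | tmul v c =>
    induction q using Coact.ind with
    | add a b ha hb => simp only [LinearMap.map_add, LinearEquiv.map_add,
        ha, hb, TensorProduct.tmul_add]
    | tmul w d =>
      simp only [TensorProduct.tensorTensorTensorComm_tmul, TensorProduct.map_tmul, tensor, pair,
        LinearMap.comp_apply, LinearMap.id_apply, LinearEquiv.coe_coe, TensorProduct.rid_tmul,
        map_smul]
      generalize ρ v = p
      generalize τ w = q
      induction p using Coact.ind with
      | add a b ha hb => simp only [LinearMap.map_add, LinearEquiv.map_add,
          ha, hb, TensorProduct.add_tmul, smul_add]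
      | tmul v c' =>
      induction q using Coact.ind with
      | add a b ha hb => simp only [LinearMap.map_add, LinearEquiv.map_add,
          ha, hb, TensorProduct.tmul_add,
          TensorProduct.add_tmul, smul_add]
      | tmul w d' => simp [Φ, smul_smul, mul_comm]
  have h2 : ∀ (p : V ⊗[k] C) (q : W ⊗[k] D),
      Φ (TensorProduct.map LinearMap.id ΔC p ⊗ₜ TensorProduct.map LinearMap.id ΔD q) =
      TensorProduct.rid k (V ⊗[k] W) (TensorProduct.map LinearMap.id (conv ΔC ΔD s t)
        (TensorProduct.tensorTensorTensorComm k V C W D (p ⊗ₜ q))) := by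
    intro p q
    induction p using Coact.ind with
    | add a b ha hb => simp only [LinearMap.map_add, LinearEquiv.map_add,
        ha, hb, TensorProduct.add_tmul]
    | tmul v c =>
    induction q using Coact.ind with
    | add a b ha hb => simp only [LinearMap.map_add, LinearEquiv.map_add,
        ha, hb, TensorProduct.tmul_add]
    | tmul w d => simp [Φ, conv, tensorComul]
  induction x using Coact.ind with
  | add a b ha hb => simp only [LinearMap.map_add, LinearEquiv.map_add, ha, hb]
  | tmul v w =>
    have e : ∀ r : C ⊗[k] D →ₗ[k] k, pair r ρ τ (v ⊗ₜ w) =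
      TensorProduct.rid k (V ⊗[k] W) (TensorProduct.map LinearMap.id r
        (TensorProduct.tensorTensorTensorComm k V C W D (ρ v ⊗ₜ τ w))) := by
      intro r; simp [pair, tensor]
    rw [e, e, h1, h.coassoc, h'.coassoc, h2]

theorem pair_counit {ΔC : C →ₗ[k] C ⊗[k] C} {εC : C →ₗ[k] k} {ΔD : D →ₗ[k] D ⊗[k] D}
    {εD : D →ₗ[k] k} {ρ : V →ₗ[k] V ⊗[k] C} {τ : W →ₗ[k] W ⊗[k] D}
    (h : IsCoaction ΔC εC ρ) (h' : IsCoaction ΔD εD τ) (x : V ⊗[k] W) :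
    pair (tensorCounit εC εD) ρ τ x = x := by
  have h2 : ∀ (s : V ⊗[k] C) (t : W ⊗[k] D),
      TensorProduct.rid k _ (TensorProduct.map LinearMap.id (tensorCounit εC εD)
        (TensorProduct.tensorTensorTensorComm k V C W D (s ⊗ₜ t))) =
      TensorProduct.rid k _ (TensorProduct.map LinearMap.id εC s) ⊗ₜ
        TensorProduct.rid k _ (TensorProduct.map LinearMap.id εD t) := by
    intro s t
    induction s using Coact.ind with
    | add a b ha hb => simp only [LinearMap.map_add, LinearEquiv.map_add,
        ha, hb, TensorProduct.add_tmul]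
    | tmul v c =>
    induction t using Coact.ind with
    | add a b ha hb => simp only [LinearMap.map_add, LinearEquiv.map_add,
        ha, hb, TensorProduct.tmul_add]
    | tmul w d =>
      simp [tensorCounit, TensorProduct.smul_tmul', mul_smul, TensorProduct.tmul_smul]
      try rw [smul_comm]
  induction x using Coact.ind with
  | add a b ha hb => simp only [LinearMap.map_add, LinearEquiv.map_add, ha, hb]
  | tmul v w =>
    have e : pair (tensorCounit εC εD) ρ τ (v ⊗ₜ w) =
      TensorProduct.rid k (V ⊗[k] W) (TensorProduct.map LinearMap.id (tensorCounit εC εD)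
        (TensorProduct.tensorTensorTensorComm k V C W D (ρ v ⊗ₜ τ w))) := by
      simp [pair, tensor]
    rw [e, h2, h.counit, h'.counit]

/-- the isomorphism `v ⊗ w ↦ s(v₁ ⊗ w₁) w₀ ⊗ v₀` of a convolution invertible form `s` -/
noncomputable def braid {ΔC : C →ₗ[k] C ⊗[k] C} {εC : C →ₗ[k] k} {ΔD : D →ₗ[k] D ⊗[k] D}
    {εD : D →ₗ[k] k} {ρ : V →ₗ[k] V ⊗[k] C} {τ : W →ₗ[k] W ⊗[k] D}
    (h : IsCoaction ΔC εC ρ) (h' : IsCoaction ΔD εD τ) {s : C ⊗[k] D →ₗ[k] k}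
    (hs : ∃ t, conv ΔC ΔD s t = tensorCounit εC εD ∧ conv ΔC ΔD t s = tensorCounit εC εD) :
    V ⊗[k] W ≃ₗ[k] W ⊗[k] V :=
  LinearEquiv.ofBijective ((TensorProduct.comm k V W).toLinearMap ∘ₗ pair s ρ τ) (by
    obtain ⟨t, h1, h2⟩ := hs
    rw [LinearMap.coe_comp]
    refine (TensorProduct.comm k V W).bijective.comp
      (Function.bijective_iff_has_inverse.2 ⟨pair t ρ τ, fun x => ?_, fun x => ?_⟩)
    · rw [pair_pair h h', h2, pair_counit h h']
    · rw [pair_pair h h', h1, pair_counit h h'])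

theorem pair_colinear {ΔC : C →ₗ[k] C ⊗[k] C} {εC : C →ₗ[k] k} {ΔD : D →ₗ[k] D ⊗[k] D}
    {εD : D →ₗ[k] k} {ρ : V →ₗ[k] V ⊗[k] C} {τ : W →ₗ[k] W ⊗[k] D}
    (h : IsCoaction ΔC εC ρ) (h' : IsCoaction ΔD εD τ) {s : C ⊗[k] D →ₗ[k] k}
    {m : C ⊗[k] D →ₗ[k] E} {κ : E →ₗ[k] E'} {f : D →ₗ[k] D'} {m' : D' ⊗[k] C →ₗ[k] E'}
    (hm : ∀ c d, TensorProduct.lid k E' (TensorProduct.map s (κ ∘ₗ m)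
        (tensorComul ΔC ΔD (c ⊗ₜ d))) =
      TensorProduct.rid k E' (TensorProduct.map (m' ∘ₗ TensorProduct.map f LinearMap.id ∘ₗ
        (TensorProduct.comm k C D).toLinearMap) s (tensorComul ΔC ΔD (c ⊗ₜ d))))
    (x : V ⊗[k] W) :
    TensorProduct.map ((TensorProduct.comm k V W).toLinearMap ∘ₗ pair s ρ τ) κ (tensor m ρ τ x) =
      tensor m' (push f τ) ρ (TensorProduct.comm k V W (pair s ρ τ x)) := by
  let Φ (N : (C ⊗[k] D) ⊗[k] (C ⊗[k] D) →ₗ[k] E') :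
      (V ⊗[k] (C ⊗[k] C)) ⊗[k] (W ⊗[k] (D ⊗[k] D)) →ₗ[k] (W ⊗[k] V) ⊗[k] E' :=
    TensorProduct.map (TensorProduct.comm k V W).toLinearMap (N ∘ₗ
        (TensorProduct.tensorTensorTensorComm k C C D D).toLinearMap) ∘ₗ
      (TensorProduct.tensorTensorTensorComm k V (C ⊗[k] C) W (D ⊗[k] D)).toLinearMap
  let N₁ : (C ⊗[k] D) ⊗[k] (C ⊗[k] D) →ₗ[k] E' :=
    (TensorProduct.lid k E').toLinearMap ∘ₗ TensorProduct.map s (κ ∘ₗ m)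
  let N₂ : (C ⊗[k] D) ⊗[k] (C ⊗[k] D) →ₗ[k] E' :=
    (TensorProduct.rid k E').toLinearMap ∘ₗ TensorProduct.map (m' ∘ₗ
      TensorProduct.map f LinearMap.id ∘ₗ (TensorProduct.comm k C D).toLinearMap) s
  have h1 : ∀ (p : V ⊗[k] C) (q : W ⊗[k] D),
      TensorProduct.map ((TensorProduct.comm k V W).toLinearMap ∘ₗ pair s ρ τ) κ
        (TensorProduct.map LinearMap.id m
        (TensorProduct.tensorTensorTensorComm k V C W D (p ⊗ₜ q))) =
      Φ N₁ (TensorProduct.assoc k V C C (TensorProduct.map ρ LinearMap.id p) ⊗ₜ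
          TensorProduct.assoc k W D D (TensorProduct.map τ LinearMap.id q)) := by
    intro p q
    induction p using Coact.ind with
    | add a b ha hb => simp only [LinearMap.map_add, LinearEquiv.map_add,
        ha, hb, TensorProduct.add_tmul]
    | tmul v c =>
    induction q using Coact.ind with
    | add a b ha hb => simp only [LinearMap.map_add, LinearEquiv.map_add,
        ha, hb, TensorProduct.tmul_add]
    | tmul w d =>
      simp only [TensorProduct.tensorTensorTensorComm_tmul, TensorProduct.map_tmul, tensor, pair,
        LinearMap.comp_apply, LinearMap.id_apply, LinearEquiv.coe_coe]
      generalize ρ v = p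
      generalize τ w = q
      induction p using Coact.ind with
      | add a b ha hb => simp only [LinearMap.map_add, LinearEquiv.map_add,
          ha, hb, TensorProduct.add_tmul]
      | tmul v c' =>
      induction q using Coact.ind with
      | add a b ha hb => simp only [LinearMap.map_add, LinearEquiv.map_add,
          ha, hb, TensorProduct.tmul_add,
          TensorProduct.add_tmul]
      | tmul w d' => simp [Φ, N₁, TensorProduct.smul_tmul']
  have h3 : ∀ (p : V ⊗[k] C) (q : W ⊗[k] D),
      tensor m' (push f τ) ρ (TensorProduct.comm k V W (TensorProduct.rid k (V ⊗[k] W)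
        (TensorProduct.map LinearMap.id s
        (TensorProduct.tensorTensorTensorComm k V C W D (p ⊗ₜ q))))) =
      Φ N₂ (TensorProduct.assoc k V C C (TensorProduct.map ρ LinearMap.id p) ⊗ₜ
          TensorProduct.assoc k W D D (TensorProduct.map τ LinearMap.id q)) := by
    intro p q
    induction p using Coact.ind with
    | add a b ha hb => simp only [LinearMap.map_add, LinearEquiv.map_add,
        ha, hb, TensorProduct.add_tmul]
    | tmul v c =>
    induction q using Coact.ind with
    | add a b ha hb => simp only [LinearMap.map_add, LinearEquiv.map_add,
        ha, hb, TensorProduct.tmul_add]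
    | tmul w d =>
      simp only [TensorProduct.tensorTensorTensorComm_tmul, TensorProduct.map_tmul, tensor, push,
        LinearMap.comp_apply, LinearMap.id_apply, LinearEquiv.coe_coe, TensorProduct.rid_tmul,
        map_smul, TensorProduct.comm_tmul]
      generalize ρ v = p
      generalize τ w = q
      induction p using Coact.ind with
      | add a b ha hb => simp only [LinearMap.map_add, LinearEquiv.map_add,
          ha, hb, TensorProduct.add_tmul,
          TensorProduct.tmul_add, smul_add]
      | tmul v c' =>
      induction q using Coact.ind with
      | add a b ha hb => simp only [LinearMap.map_add, LinearEquiv.map_add,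
          ha, hb, TensorProduct.tmul_add,
          TensorProduct.add_tmul, smul_add]
      | tmul w d' => simp [Φ, N₂]
  have h2 : ∀ (p : V ⊗[k] C) (q : W ⊗[k] D),
      Φ N₁ (TensorProduct.map LinearMap.id ΔC p ⊗ₜ TensorProduct.map LinearMap.id ΔD q) =
      Φ N₂ (TensorProduct.map LinearMap.id ΔC p ⊗ₜ TensorProduct.map LinearMap.id ΔD q) := by
    intro p q
    induction p using Coact.ind with
    | add a b ha hb => simp only [LinearMap.map_add, LinearEquiv.map_add,
        ha, hb, TensorProduct.add_tmul]
    | tmul v c =>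
    induction q using Coact.ind with
    | add a b ha hb => simp only [LinearMap.map_add, LinearEquiv.map_add,
        ha, hb, TensorProduct.tmul_add]
    | tmul w d =>
      have := hm c d
      simp only [tensorComul, LinearMap.comp_apply, LinearEquiv.coe_coe,
        TensorProduct.map_tmul] at this
      simp [Φ, N₁, N₂, this]
  induction x using Coact.ind with
  | add a b ha hb => simp only [LinearMap.map_add, LinearEquiv.map_add, ha, hb]
  | tmul v w =>
    have e : pair s ρ τ (v ⊗ₜ w) =
      TensorProduct.rid k (V ⊗[k] W) (TensorProduct.map LinearMap.id s
        (TensorProduct.tensorTensorTensorComm k V C W D (ρ v ⊗ₜ τ w))) := by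
      simp [pair, tensor]
    have e' : tensor m ρ τ (v ⊗ₜ w) = TensorProduct.map LinearMap.id m
        (TensorProduct.tensorTensorTensorComm k V C W D (ρ v ⊗ₜ τ w)) := by simp [tensor]
    rw [e, e', h1, h3, h.coassoc, h'.coassoc, h2]

theorem pair_tensor_left {ΔF : F →ₗ[k] F ⊗[k] F} {εF : F →ₗ[k] k}
    {ρ : V →ₗ[k] V ⊗[k] C} {τ : W →ₗ[k] W ⊗[k] D} {υ : U →ₗ[k] U ⊗[k] F}
    (h : IsCoaction ΔF εF υ) {m : C ⊗[k] D →ₗ[k] E} {f : F →ₗ[k] K} {s₁ : C ⊗[k] K →ₗ[k] k}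
    {s₂ : D ⊗[k] F →ₗ[k] k} {s : E ⊗[k] F →ₗ[k] k}
    (hs : ∀ c d e, s (m (c ⊗ₜ d) ⊗ₜ e) = LinearMap.mul' k k (TensorProduct.map
      (s₁ ∘ₗ TensorProduct.mk k C K c ∘ₗ f) (s₂ ∘ₗ TensorProduct.mk k D F d) (ΔF e)))
    (x : V) (y : W) (z : U) :
    TensorProduct.comm k (V ⊗[k] W) U (pair s (tensor m ρ τ) υ ((x ⊗ₜ y) ⊗ₜ z)) =
      TensorProduct.assoc k U V W (TensorProduct.map ((TensorProduct.comm k V U).toLinearMap ∘ₗ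
        pair s₁ ρ (push f υ)) LinearMap.id ((TensorProduct.assoc k V U W).symm
          (x ⊗ₜ TensorProduct.comm k W U (pair s₂ τ υ (y ⊗ₜ z))))) := by
  let S : C ⊗[k] (D ⊗[k] (F ⊗[k] F)) →ₗ[k] k := LinearMap.mul' k k ∘ₗ
    TensorProduct.map (s₁ ∘ₗ TensorProduct.map LinearMap.id f) s₂ ∘ₗ
    (TensorProduct.assoc k C F (D ⊗[k] F)).symm.toLinearMap ∘ₗ
    TensorProduct.map LinearMap.id (TensorProduct.leftComm k D F F).toLinearMap
  let Φ : (V ⊗[k] C) ⊗[k] ((W ⊗[k] D) ⊗[k] (U ⊗[k] (F ⊗[k] F))) →ₗ[k] U ⊗[k] (V ⊗[k] W) :=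
    (TensorProduct.rid k (U ⊗[k] (V ⊗[k] W))).toLinearMap ∘ₗ
    TensorProduct.map ((TensorProduct.comm k (V ⊗[k] W) U).toLinearMap ∘ₗ
      (TensorProduct.assoc k V W U).symm.toLinearMap) S ∘ₗ
    (TensorProduct.tensorTensorTensorComm k V C (W ⊗[k] U) (D ⊗[k] (F ⊗[k] F))).toLinearMap ∘ₗ
    TensorProduct.map LinearMap.id
      (TensorProduct.tensorTensorTensorComm k W D U (F ⊗[k] F)).toLinearMap
  have h1 : ∀ (q : W ⊗[k] D) (t : U ⊗[k] F),
      TensorProduct.assoc k U V W (TensorProduct.map ((TensorProduct.comm k V U).toLinearMap ∘ₗ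
        pair s₁ ρ (push f υ)) LinearMap.id ((TensorProduct.assoc k V U W).symm
          (x ⊗ₜ TensorProduct.comm k W U (TensorProduct.rid k (W ⊗[k] U)
        (TensorProduct.map LinearMap.id s₂
        (TensorProduct.tensorTensorTensorComm k W D U F (q ⊗ₜ t))))))) =
      Φ (ρ x ⊗ₜ (q ⊗ₜ TensorProduct.assoc k U F F (TensorProduct.map υ LinearMap.id t))) := by
    intro q t
    induction q using Coact.ind with
    | add a b ha hb => simp only [LinearMap.map_add, LinearEquiv.map_add,
        ha, hb, TensorProduct.add_tmul, TensorProduct.tmul_add]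
    | tmul w d =>
    induction t using Coact.ind with
    | add a b ha hb => simp only [LinearMap.map_add, LinearEquiv.map_add,
        ha, hb, TensorProduct.tmul_add]
    | tmul u e =>
      simp only [TensorProduct.tensorTensorTensorComm_tmul, TensorProduct.map_tmul, tensor, push,
        pair, LinearMap.comp_apply, LinearMap.id_apply, LinearEquiv.coe_coe,
        TensorProduct.rid_tmul, map_smul, TensorProduct.comm_tmul, TensorProduct.tmul_smul,
        TensorProduct.assoc_symm_tmul]
      generalize ρ x = p
      generalize υ u = r
      induction p using Coact.ind with
      | add a b ha hb => simp only [LinearMap.map_add, LinearEquiv.map_add,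
          ha, hb, TensorProduct.add_tmul, smul_add]
      | tmul v c =>
      induction r using Coact.ind with
      | add a b ha hb => simp only [LinearMap.map_add, LinearEquiv.map_add,
          ha, hb, TensorProduct.tmul_add,
          TensorProduct.add_tmul, smul_add]
      | tmul u e' => simp [Φ, S, TensorProduct.smul_tmul', smul_smul, mul_comm]
  have h2 : ∀ (p : V ⊗[k] C) (q : W ⊗[k] D) (t : U ⊗[k] F),
      TensorProduct.comm k (V ⊗[k] W) U (TensorProduct.rid k ((V ⊗[k] W) ⊗[k] U)
        (TensorProduct.map LinearMap.id s
        (TensorProduct.tensorTensorTensorComm k (V ⊗[k] W) E U F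
          (TensorProduct.map LinearMap.id m
            (TensorProduct.tensorTensorTensorComm k V C W D (p ⊗ₜ q)) ⊗ₜ t)))) =
      Φ (p ⊗ₜ (q ⊗ₜ TensorProduct.map LinearMap.id ΔF t)) := by
    intro p q t
    induction p using Coact.ind with
    | add a b ha hb => simp only [LinearMap.map_add, LinearEquiv.map_add,
        ha, hb, TensorProduct.add_tmul]
    | tmul v c =>
    induction q using Coact.ind with
    | add a b ha hb => simp only [LinearMap.map_add, LinearEquiv.map_add,
        ha, hb, TensorProduct.tmul_add, TensorProduct.add_tmul]
    | tmul w d =>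
    induction t using Coact.ind with
    | add a b ha hb => simp only [LinearMap.map_add, LinearEquiv.map_add,
        ha, hb, TensorProduct.tmul_add]
    | tmul u e =>
      simp only [TensorProduct.tensorTensorTensorComm_tmul, TensorProduct.map_tmul,
        LinearMap.id_apply, TensorProduct.rid_tmul, map_smul, hs]
      generalize ΔF e = r
      induction r using Coact.ind with
      | add a b ha hb => simp only [LinearMap.map_add, LinearEquiv.map_add,
          ha, hb, TensorProduct.tmul_add, add_smul]
      | tmul e e' => simp [Φ, S]
  have e1 : pair s (tensor m ρ τ) υ ((x ⊗ₜ y) ⊗ₜ z) =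
      TensorProduct.rid k ((V ⊗[k] W) ⊗[k] U) (TensorProduct.map LinearMap.id s
        (TensorProduct.tensorTensorTensorComm k (V ⊗[k] W) E U F
          (TensorProduct.map LinearMap.id m
            (TensorProduct.tensorTensorTensorComm k V C W D (ρ x ⊗ₜ τ y)) ⊗ₜ υ z))) := by
    simp [pair, tensor]
  have e2 : pair s₂ τ υ (y ⊗ₜ z) = TensorProduct.rid k (W ⊗[k] U)
        (TensorProduct.map LinearMap.id s₂
        (TensorProduct.tensorTensorTensorComm k W D U F (τ y ⊗ₜ υ z))) := by
    simp [pair, tensor]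
  rw [e1, e2, h1, h2, h.coassoc]

theorem pair_tensor_right {ΔC : C →ₗ[k] C ⊗[k] C} {εC : C →ₗ[k] k}
    {ρ : V →ₗ[k] V ⊗[k] C} {τ : W →ₗ[k] W ⊗[k] D} {υ : U →ₗ[k] U ⊗[k] F}
    (h : IsCoaction ΔC εC ρ) {m : D ⊗[k] F →ₗ[k] E} {s₁ : C ⊗[k] D →ₗ[k] k}
    {s₂ : C ⊗[k] F →ₗ[k] k} {s : C ⊗[k] E →ₗ[k] k}
    (hs : ∀ c d e, s (c ⊗ₜ m (d ⊗ₜ e)) = LinearMap.mul' k k (TensorProduct.map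
      (s₂ ∘ₗ (TensorProduct.mk k C F).flip e) (s₁ ∘ₗ (TensorProduct.mk k C D).flip d) (ΔC c)))
    (x : V) (y : W) (z : U) :
    TensorProduct.comm k V (W ⊗[k] U) (pair s ρ (tensor m τ υ) (x ⊗ₜ (y ⊗ₜ z))) =
      (TensorProduct.assoc k W U V).symm (TensorProduct.map LinearMap.id
        ((TensorProduct.comm k V U).toLinearMap ∘ₗ pair s₂ ρ υ) (TensorProduct.assoc k W V U
          (TensorProduct.comm k V W (pair s₁ ρ τ (x ⊗ₜ y)) ⊗ₜ z))) := by
  let S : (C ⊗[k] C) ⊗[k] (D ⊗[k] F) →ₗ[k] k := LinearMap.mul' k k ∘ₗ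
    TensorProduct.map s₂ s₁ ∘ₗ
    (TensorProduct.tensorTensorTensorComm k C C F D).toLinearMap ∘ₗ
    TensorProduct.map LinearMap.id (TensorProduct.comm k D F).toLinearMap
  let Φ : (V ⊗[k] (C ⊗[k] C)) ⊗[k] ((W ⊗[k] D) ⊗[k] (U ⊗[k] F)) →ₗ[k] (W ⊗[k] U) ⊗[k] V :=
    (TensorProduct.rid k ((W ⊗[k] U) ⊗[k] V)).toLinearMap ∘ₗ
    TensorProduct.map (TensorProduct.comm k V (W ⊗[k] U)).toLinearMap S ∘ₗ
    (TensorProduct.tensorTensorTensorComm k V (C ⊗[k] C) (W ⊗[k] U) (D ⊗[k] F)).toLinearMap ∘ₗ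
    TensorProduct.map LinearMap.id
      (TensorProduct.tensorTensorTensorComm k W D U F).toLinearMap
  have h1 : ∀ (p : V ⊗[k] C) (q : W ⊗[k] D),
      (TensorProduct.assoc k W U V).symm (TensorProduct.map LinearMap.id
        ((TensorProduct.comm k V U).toLinearMap ∘ₗ pair s₂ ρ υ) (TensorProduct.assoc k W V U
          (TensorProduct.comm k V W (TensorProduct.rid k (V ⊗[k] W)
        (TensorProduct.map LinearMap.id s₁
        (TensorProduct.tensorTensorTensorComm k V C W D (p ⊗ₜ q)))) ⊗ₜ z))) =
      Φ (TensorProduct.assoc k V C C (TensorProduct.map ρ LinearMap.id p) ⊗ₜ (q ⊗ₜ υ z)) := by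
    intro p q
    induction p using Coact.ind with
    | add a b ha hb => simp only [LinearMap.map_add, LinearEquiv.map_add,
        ha, hb, TensorProduct.add_tmul]
    | tmul v c =>
    induction q using Coact.ind with
    | add a b ha hb => simp only [LinearMap.map_add, LinearEquiv.map_add,
        ha, hb, TensorProduct.tmul_add, TensorProduct.add_tmul]
    | tmul w d =>
      simp only [TensorProduct.tensorTensorTensorComm_tmul, TensorProduct.map_tmul, tensor,
        pair, LinearMap.comp_apply, LinearMap.id_apply, LinearEquiv.coe_coe,
        TensorProduct.rid_tmul, map_smul, TensorProduct.comm_tmul, ← TensorProduct.smul_tmul',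
        TensorProduct.assoc_tmul]
      generalize ρ v = p
      generalize υ z = r
      induction p using Coact.ind with
      | add a b ha hb => simp only [LinearMap.map_add, LinearEquiv.map_add,
          ha, hb, TensorProduct.add_tmul,
          TensorProduct.tmul_add, smul_add]
      | tmul v c' =>
      induction r using Coact.ind with
      | add a b ha hb => simp only [LinearMap.map_add, LinearEquiv.map_add,
          ha, hb, TensorProduct.tmul_add, smul_add]
      | tmul u e' => simp [Φ, S, TensorProduct.smul_tmul', smul_smul, mul_comm]
  have h2 : ∀ (p : V ⊗[k] C) (q : W ⊗[k] D) (t : U ⊗[k] F),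
      TensorProduct.comm k V (W ⊗[k] U) (TensorProduct.rid k (V ⊗[k] (W ⊗[k] U))
        (TensorProduct.map LinearMap.id s
        (TensorProduct.tensorTensorTensorComm k V C (W ⊗[k] U) E
          (p ⊗ₜ TensorProduct.map LinearMap.id m
            (TensorProduct.tensorTensorTensorComm k W D U F (q ⊗ₜ t)))))) =
      Φ (TensorProduct.map LinearMap.id ΔC p ⊗ₜ (q ⊗ₜ t)) := by
    intro p q t
    induction p using Coact.ind with
    | add a b ha hb => simp only [LinearMap.map_add, LinearEquiv.map_add,
        ha, hb, TensorProduct.add_tmul]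
    | tmul v c =>
    induction q using Coact.ind with
    | add a b ha hb => simp only [LinearMap.map_add, LinearEquiv.map_add,
        ha, hb, TensorProduct.tmul_add, TensorProduct.add_tmul]
    | tmul w d =>
    induction t using Coact.ind with
    | add a b ha hb => simp only [LinearMap.map_add, LinearEquiv.map_add,
        ha, hb, TensorProduct.tmul_add]
    | tmul u e =>
      simp only [TensorProduct.tensorTensorTensorComm_tmul, TensorProduct.map_tmul,
        LinearMap.id_apply, TensorProduct.rid_tmul, map_smul, hs]
      generalize ΔC c = r
      induction r using Coact.ind with
      | add a b ha hb => simp only [LinearMap.map_add, LinearEquiv.map_add,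
          ha, hb, TensorProduct.tmul_add, add_smul,
          TensorProduct.add_tmul]
      | tmul e e' => simp [Φ, S]
  have e1 : pair s ρ (tensor m τ υ) (x ⊗ₜ (y ⊗ₜ z)) =
      TensorProduct.rid k (V ⊗[k] (W ⊗[k] U)) (TensorProduct.map LinearMap.id s
        (TensorProduct.tensorTensorTensorComm k V C (W ⊗[k] U) E
          (ρ x ⊗ₜ TensorProduct.map LinearMap.id m
            (TensorProduct.tensorTensorTensorComm k W D U F (τ y ⊗ₜ υ z))))) := by
    simp [pair, tensor]
  have e2 : pair s₁ ρ τ (x ⊗ₜ y) = TensorProduct.rid k (V ⊗[k] W)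
        (TensorProduct.map LinearMap.id s₁
        (TensorProduct.tensorTensorTensorComm k V C W D (ρ x ⊗ₜ τ y))) := by
    simp [pair, tensor]
  rw [e1, e2, h1, h2, h.coassoc]

theorem pair_map {s : C ⊗[k] D →ₗ[k] k} {s' : C' ⊗[k] D' →ₗ[k] k}
    {κ₁ : C →ₗ[k] C'} {κ₂ : D →ₗ[k] D'}
    {ρ : V →ₗ[k] V ⊗[k] C} {τ : W →ₗ[k] W ⊗[k] D} {ρ' : V' →ₗ[k] V' ⊗[k] C'}
    {τ' : W' →ₗ[k] W' ⊗[k] D'} {f : V →ₗ[k] V'} {g : W →ₗ[k] W'}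
    (hs : ∀ c d, s (c ⊗ₜ d) = s' (κ₁ c ⊗ₜ κ₂ d))
    (hf : ∀ v, TensorProduct.map f κ₁ (ρ v) = ρ' (f v))
    (hg : ∀ w, TensorProduct.map g κ₂ (τ w) = τ' (g w)) (x : V ⊗[k] W) :
    TensorProduct.map f g (pair s ρ τ x) = pair s' ρ' τ' (TensorProduct.map f g x) := by
  have := congrArg (TensorProduct.rid k (V' ⊗[k] W'))
    (tensor_map (κ := LinearMap.id) (m := s) (m' := s') hs hf hg x)
  simp only [pair, LinearMap.comp_apply, LinearEquiv.coe_coe]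
  rw [← this]
  generalize tensor s ρ τ x = y
  induction y using Coact.ind with
  | add a b ha hb => simp only [LinearMap.map_add, LinearEquiv.map_add, ha, hb]
  | tmul v r => simp

end Coact

/-- The data of a crossed Turaev `G`-algebra with a family of forms `σ`: a family of spaces
`C a`, each with a comultiplication and a counit, a graded multiplication with a unit, an antipode,
a crossing, and bilinear forms `σ_{a,b} : C a ⊗ C b → k`. The laws are stated separately below. -/
structure TuraevData (k : Type u) [Field k] (G : Type w) [Group G] where
  C : G → Type v
  [addCommGroup : ∀ a, AddCommGroup (C a)]
  [module : ∀ a, Module k (C a)]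
  comul : ∀ a, C a →ₗ[k] C a ⊗[k] C a
  counit : ∀ a, C a →ₗ[k] k
  mul : ∀ a b, C a ⊗[k] C b →ₗ[k] C (a * b)
  one : C 1
  antipode : ∀ a, C a →ₗ[k] C a⁻¹
  crossing : ∀ b a, C a →ₗ[k] C (b * a * b⁻¹)
  sigma : ∀ a b, C a ⊗[k] C b →ₗ[k] k

namespace TuraevData

attribute [instance] TuraevData.addCommGroup TuraevData.module

variable {k : Type u} [Field k] {G : Type w} [Group G] (A : TuraevData.{w, v, u} k G)

/-- The identification of `C a` and `C b` for equal indices `a = b`. -/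
def cast {a b : G} (h : a = b) : A.C a →ₗ[k] A.C b :=
  (LinearEquiv.cast (R := k) (M := A.C) h).toLinearMap

/-- The laws of a Turaev `G`-algebra. -/
structure IsTuraevAlgebra : Prop where
  mul_assoc : ∀ a b c (x : A.C a) (y : A.C b) (z : A.C c),
    A.cast (_root_.mul_assoc a b c) (A.mul (a * b) c (A.mul a b (x ⊗ₜ y) ⊗ₜ z)) =
      A.mul a (b * c) (x ⊗ₜ A.mul b c (y ⊗ₜ z))
  mul_one : ∀ a (x : A.C a), A.cast (_root_.mul_one a) (A.mul a 1 (x ⊗ₜ A.one)) = x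
  one_mul : ∀ a (x : A.C a), A.cast (_root_.one_mul a) (A.mul 1 a (A.one ⊗ₜ x)) = x
  coassoc : ∀ a (x : A.C a), TensorProduct.assoc k _ _ _
      (TensorProduct.map (A.comul a) LinearMap.id (A.comul a x)) =
    TensorProduct.map LinearMap.id (A.comul a) (A.comul a x)
  counit_left : ∀ a (x : A.C a),
    TensorProduct.lid k _ (TensorProduct.map (A.counit a) LinearMap.id (A.comul a x)) = x
  counit_right : ∀ a (x : A.C a),
    TensorProduct.rid k _ (TensorProduct.map LinearMap.id (A.counit a) (A.comul a x)) = x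
  comul_mul : ∀ a b, TensorProduct.map (A.mul a b) (A.mul a b) ∘ₗ
    Coact.tensorComul (A.comul a) (A.comul b) = A.comul (a * b) ∘ₗ A.mul a b
  counit_mul : ∀ a b,
    A.counit (a * b) ∘ₗ A.mul a b = Coact.tensorCounit (A.counit a) (A.counit b)
  comul_one : A.comul 1 A.one = A.one ⊗ₜ A.one
  counit_one : A.counit 1 A.one = 1
  mul_antipode : ∀ a (x : A.C a),
    A.mul a a⁻¹ (TensorProduct.map LinearMap.id (A.antipode a) (A.comul a x)) =
      A.counit a x • A.cast (mul_inv_cancel a).symm A.one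
  antipode_mul : ∀ a (x : A.C a),
    A.mul a⁻¹ a (TensorProduct.map (A.antipode a) LinearMap.id (A.comul a x)) =
      A.counit a x • A.cast (inv_mul_cancel a).symm A.one

/-- The laws of a crossed Turaev `G`-algebra. -/
structure IsCrossed : Prop extends A.IsTuraevAlgebra where
  crossing_bijective : ∀ b a, Function.Bijective (A.crossing b a)
  comul_crossing : ∀ b a (x : A.C a),
    TensorProduct.map (A.crossing b a) (A.crossing b a) (A.comul a x) =
      A.comul (b * a * b⁻¹) (A.crossing b a x)
  counit_crossing : ∀ b a (x : A.C a), A.counit (b * a * b⁻¹) (A.crossing b a x) = A.counit a x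
  crossing_crossing : ∀ a b c (x : A.C c),
    A.cast (by group) (A.crossing a (b * c * b⁻¹) (A.crossing b c x)) = A.crossing (a * b) c x
  crossing_mul : ∀ c a b (x : A.C a) (y : A.C b),
    A.cast (by group) (A.mul (c * a * c⁻¹) (c * b * c⁻¹)
      (A.crossing c a x ⊗ₜ A.crossing c b y)) = A.crossing c (a * b) (A.mul a b (x ⊗ₜ y))
  crossing_one : ∀ c, A.cast (by group) (A.crossing c 1 A.one) = A.one
  crossing_antipode : ∀ b a (x : A.C a),
    A.cast (by group) (A.crossing b a⁻¹ (A.antipode a x)) =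
      A.antipode (b * a * b⁻¹) (A.crossing b a x)

/-- The laws of a coquasitriangular crossed Turaev `G`-algebra. -/
structure IsCoquasitriangular : Prop extends A.IsCrossed where
  /-- `σ_{a,b}` is convolution invertible -/
  sigma_invertible : ∀ a b, ∃ τ : A.C a ⊗[k] A.C b →ₗ[k] k,
    Coact.conv (A.comul a) (A.comul b) (A.sigma a b) τ =
      Coact.tensorCounit (A.counit a) (A.counit b) ∧
    Coact.conv (A.comul a) (A.comul b) τ (A.sigma a b) =
      Coact.tensorCounit (A.counit a) (A.counit b)
  /-- `σ(xy, z) = σ(x, z₂) σ(y, z₁)` -/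
  sigma_mul_left : ∀ a b c (x : A.C a) (y : A.C b) (z : A.C c),
    A.sigma (a * b) c (A.mul a b (x ⊗ₜ y) ⊗ₜ z) =
      LinearMap.mul' k k (TensorProduct.map
        (A.sigma b c ∘ₗ TensorProduct.mk k _ _ y) (A.sigma a c ∘ₗ TensorProduct.mk k _ _ x)
          (A.comul c z))
  /-- `σ(x, yz) = σ(x₁, y) σ(ψ_{b⁻¹}(x₂), z)` -/
  sigma_mul_right : ∀ a b c (x : A.C a) (y : A.C b) (z : A.C c),
    A.sigma a (b * c) (x ⊗ₜ A.mul b c (y ⊗ₜ z)) =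
      LinearMap.mul' k k (TensorProduct.map
        (A.sigma a b ∘ₗ (TensorProduct.mk k _ _).flip y)
        (A.sigma (b⁻¹ * a * b⁻¹⁻¹) c ∘ₗ (TensorProduct.mk k _ _).flip z ∘ₗ A.crossing b⁻¹ a)
          (A.comul a x))
  /-- `σ(x₁, y₁) y₂ ψ_{b⁻¹}(x₂) = x₁ y₁ σ(x₂, y₂)` -/
  sigma_comm : ∀ a b (x : A.C a) (y : A.C b),
    TensorProduct.lid k _ (TensorProduct.map (A.sigma a b)
      (A.cast (show b * (b⁻¹ * a * b⁻¹⁻¹) = a * b by group) ∘ₗ A.mul b (b⁻¹ * a * b⁻¹⁻¹) ∘ₗ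
        (TensorProduct.comm k _ _).toLinearMap ∘ₗ
          TensorProduct.map (A.crossing b⁻¹ a) LinearMap.id)
      (Coact.tensorComul (A.comul a) (A.comul b) (x ⊗ₜ y))) =
    TensorProduct.rid k _ (TensorProduct.map (A.mul a b) (A.sigma a b)
      (Coact.tensorComul (A.comul a) (A.comul b) (x ⊗ₜ y)))
  /-- `σ(x, y) = σ(ψ_c(x), ψ_c(y))` -/
  sigma_crossing : ∀ c a b (x : A.C a) (y : A.C b),
    A.sigma a b (x ⊗ₜ y) = A.sigma (c * a * c⁻¹) (c * b * c⁻¹)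
      (A.crossing c a x ⊗ₜ A.crossing c b y)

section cast

variable {A}

@[simp] theorem cast_rfl {a : G} (h : a = a) (x : A.C a) : A.cast h x = x := rfl

@[simp] theorem cast_cast {a b c : G} (h : a = b) (h' : b = c) (x : A.C a) :
    A.cast h' (A.cast h x) = A.cast (h.trans h') x := by
  subst h h'; rfl

theorem cast_comp_cast {a b c : G} (h : a = b) (h' : b = c) :
    A.cast h' ∘ₗ A.cast h = A.cast (h.trans h') := by
  subst h h'; rfl

theorem cast_self {a : G} (h : a = a) : A.cast h = LinearMap.id := rfl

theorem cast_mul {a b a' b' : G} (h : a = a') (h' : b = b') (x : A.C a) (y : A.C b) :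
    A.cast (by rw [h, h']) (A.mul a b (x ⊗ₜ y)) = A.mul a' b' (A.cast h x ⊗ₜ A.cast h' y) := by
  subst h h'; rfl

theorem cast_crossing {b b' a a' : G} (hb : b = b') (ha : a = a') (x : A.C a) :
    A.cast (by rw [ha, hb]) (A.crossing b a x) = A.crossing b' a' (A.cast ha x) := by
  subst ha hb; rfl

theorem sigma_cast {a b a' b' : G} (h : a = a') (h' : b = b') (x : A.C a) (y : A.C b) :
    A.sigma a b (x ⊗ₜ y) = A.sigma a' b' (A.cast h x ⊗ₜ A.cast h' y) := by
  subst h h'; rfl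

theorem cast_injective {a b : G} (h : a = b) : Function.Injective (A.cast h) := by
  subst h; exact fun _ _ h => h

end cast

namespace IsCrossed

variable {A} 


theorem crossing_one_apply (hA : A.IsCrossed) (a : G) (x : A.C a) : A.cast (by group) (A.crossing 1 a x) = x := by
  apply (hA.crossing_bijective 1 a).1
  rw [← cast_crossing rfl (by group : 1 * a * 1⁻¹ = a)]
  have h := hA.crossing_crossing 1 1 a x
  have e := cast_crossing (by simp : (1 : G) = 1 * 1) (rfl : a = a) x
  apply cast_injective (by simp : 1 * a * 1⁻¹ = 1 * 1 * a * (1 * 1)⁻¹)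
  rw [e, cast_rfl, ← h, cast_cast]

end IsCrossed
end TuraevData

/-- A right comodule over one component `C a` of the family `A`; such comodules are the objects of
the corepresentation category. -/
structure Comod {k : Type u} [Field k] {G : Type w} [Group G] (A : TuraevData.{w, v, u} k G) where
  deg : G
  V : Type u
  [addCommGroup : AddCommGroup V]
  [module : Module k V]
  coact : V →ₗ[k] V ⊗[k] A.C deg
  isCoaction : Coact.IsCoaction (A.comul deg) (A.counit deg) coact

namespace Comod

attribute [instance] Comod.addCommGroup Comod.module

variable {k : Type u} [Field k] {G : Type w} [Group G] {A : TuraevData.{w, v, u} k G}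

/-- Morphisms exist only between comodules over the same component, and are the colinear maps. -/
@[ext]
structure Hom (X Y : Comod A) where
  deg_eq : X.deg = Y.deg
  lin : X.V →ₗ[k] Y.V
  colinear : ∀ x, TensorProduct.map lin (A.cast deg_eq) (X.coact x) = Y.coact (lin x)

instance : Category (Comod A) where
  Hom := Hom
  id X := ⟨rfl, LinearMap.id, fun x => by simp [TuraevData.cast_self]⟩
  comp f g := ⟨f.deg_eq.trans g.deg_eq, g.lin ∘ₗ f.lin, fun x => by
    rw [LinearMap.comp_apply, ← g.colinear, ← f.colinear, Coact.map_map,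
      TuraevData.cast_comp_cast]⟩

@[ext] theorem hom_ext {X Y : Comod A} {f g : X ⟶ Y} (h : f.lin = g.lin) : f = g := Hom.ext h

@[simp] theorem id_lin (X : Comod A) : Hom.lin (𝟙 X) = LinearMap.id := rfl
@[simp] theorem comp_lin {X Y Z : Comod A} (f : X ⟶ Y) (g : Y ⟶ Z) :
    (f ≫ g).lin = g.lin ∘ₗ f.lin := rfl

theorem coaction_eq {X Y : Comod A} (f : X ⟶ Y) : X.deg = Y.deg := f.deg_eq

/-- A bijective colinear map is an isomorphism. -/
def isoMk {X Y : Comod A} (h : X.deg = Y.deg) (e : X.V ≃ₗ[k] Y.V)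
    (he : ∀ x, TensorProduct.map e.toLinearMap (A.cast h) (X.coact x) = Y.coact (e x)) :
    X ≅ Y where
  hom := ⟨h, e.toLinearMap, he⟩
  inv := ⟨h.symm, e.symm.toLinearMap, fun y => by
    obtain ⟨x, rfl⟩ := e.surjective y
    rw [← he, Coact.map_map, TuraevData.cast_comp_cast]
    simp [TuraevData.cast_self]⟩
  hom_inv_id := by ext; simp
  inv_hom_id := by ext; simp

theorem mk_eq {V : Type u} [AddCommGroup V] [Module k V] {a b : G} (h : a = b)
    {ρ : V →ₗ[k] V ⊗[k] A.C a} {τ : V →ₗ[k] V ⊗[k] A.C b} (hρ hτ)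
    (e : Coact.push (A.cast h) ρ = τ) : (⟨a, V, ρ, hρ⟩ : Comod A) = ⟨b, V, τ, hτ⟩ := by
  subst h
  have : ρ = τ := by rw [← e]; ext; simp [Coact.push, TuraevData.cast_self]
  subst this
  rfl

theorem eqToHom_lin {V : Type u} [AddCommGroup V] [Module k V] {a b : G}
    {ρ : V →ₗ[k] V ⊗[k] A.C a} {τ : V →ₗ[k] V ⊗[k] A.C b} (hρ hτ)
    (h : (⟨a, V, ρ, hρ⟩ : Comod A) = ⟨b, V, τ, hτ⟩) :
    Hom.lin (eqToHom h) = (LinearMap.id : V →ₗ[k] V) := by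
  have h1 : a = b := congrArg Comod.deg h
  subst h1
  have h2 : ρ = τ := by simpa using h
  subst h2
  rfl

theorem hom_heq {X Y X' Y' : Comod A} (hX : X = X') (hY : Y = Y') (f : X ⟶ Y) (g : X' ⟶ Y')
    (h : f.lin ≍ g.lin) : f ≍ g := by
  subst hX hY
  exact heq_of_eq (hom_ext (eq_of_heq h))

section monoidal

variable (hA : A.IsTuraevAlgebra)

/-- the tensor product `v ⊗ w ↦ v₀ ⊗ w₀ ⊗ v₁ w₁` -/
@[reducible] noncomputable def tensorObj (X Y : Comod A) : Comod A where
  deg := X.deg * Y.deg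
  V := X.V ⊗[k] Y.V
  coact := Coact.tensor (A.mul X.deg Y.deg) X.coact Y.coact
  isCoaction := Coact.tensor_isCoaction (hA.comul_mul _ _) (hA.counit_mul _ _)
    X.isCoaction Y.isCoaction

/-- the ground field with the coaction `r ↦ r ⊗ 1` -/
@[reducible] noncomputable def unitObj : Comod A where
  deg := 1
  V := k
  coact := Coact.unit A.one
  isCoaction := Coact.unit_isCoaction hA.comul_one hA.counit_one

/-- the tensor product of two morphisms -/
noncomputable def tensorHom {X Y X' Y' : Comod A} (f : X ⟶ X') (g : Y ⟶ Y') :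
    tensorObj hA X Y ⟶ tensorObj hA X' Y' :=
  ⟨congrArg₂ (· * ·) f.deg_eq g.deg_eq, TensorProduct.map f.lin g.lin,
    Coact.tensor_map (TuraevData.cast_mul f.deg_eq g.deg_eq) f.colinear g.colinear⟩

/-- The monoidal structure on the comodules, with the constraints of vector spaces. -/
@[reducible] noncomputable def monoidal : MonoidalCategory (Comod A) :=
  letI : MonoidalCategoryStruct (Comod A) :=
    { tensorObj := tensorObj hA
      tensorHom := tensorHom hA
      whiskerLeft := fun X _ _ f => tensorHom hA (𝟙 X) f
      whiskerRight := fun f Y => tensorHom hA f (𝟙 Y)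
      tensorUnit := unitObj hA
      associator := fun X Y Z => isoMk (mul_assoc _ _ _) (TensorProduct.assoc k X.V Y.V Z.V)
        (Coact.tensor_assoc (hA.mul_assoc _ _ _))
      leftUnitor := fun X => isoMk (one_mul _) (TensorProduct.lid k X.V)
        (Coact.tensor_unit_left (k := k) (e := A.one) (τ := X.coact) (hA.one_mul _))
      rightUnitor := fun X => isoMk (mul_one _) (TensorProduct.rid k X.V)
        (Coact.tensor_unit_right (k := k) (e := A.one) (ρ := X.coact) (hA.mul_one _)) }
  MonoidalCategory.ofTensorHom
    (id_tensorHom_id := fun _ _ => hom_ext TensorProduct.map_id)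
    (id_tensorHom := fun _ _ _ _ => rfl)
    (tensorHom_id := fun _ _ => rfl)
    (tensorHom_comp_tensorHom := fun f₁ f₂ g₁ g₂ =>
      hom_ext (TensorProduct.map_comp g₁.lin g₂.lin f₁.lin f₂.lin).symm)
    (associator_naturality := fun _ _ _ => hom_ext (TensorProduct.ext_threefold fun _ _ _ => rfl))
    (leftUnitor_naturality := fun f => hom_ext (TensorProduct.ext' fun r x =>
      (f.lin.map_smul (show k from r) x).symm))
    (rightUnitor_naturality := fun f => hom_ext (TensorProduct.ext' fun x r =>
      (f.lin.map_smul (show k from r) x).symm))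
    (pentagon := fun _ _ _ _ => hom_ext (TensorProduct.ext_fourfold fun _ _ _ _ => rfl))
    (triangle := fun _ _ => hom_ext (TensorProduct.ext_threefold fun x r y =>
      (TensorProduct.smul_tmul (show k from r) x y).symm))

end monoidal

section crossed

variable (hA : A.IsCrossed)

/-- the comodule `ᵃX`: the space of `X` with the coaction `x ↦ x₀ ⊗ ψ_a(x₁)` -/
@[reducible] noncomputable def conjObj (a : G) (X : Comod A) : Comod A where
  deg := a * X.deg * a⁻¹
  V := X.V
  coact := Coact.push (A.crossing a X.deg) X.coact
  isCoaction := Coact.push_isCoaction (hA.comul_crossing _ _) (hA.counit_crossing _ _)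
    X.isCoaction

/-- the conjugation functor, the identity on the underlying linear maps -/
noncomputable def conj (a : G) : Comod A ⥤ Comod A where
  obj := conjObj hA a
  map {X Y} f := ⟨congrArg (fun c => a * c * a⁻¹) (coaction_eq f), f.lin, fun x => by
    have e : A.cast (by rw [coaction_eq f]) ∘ₗ A.crossing a X.deg =
        A.crossing a Y.deg ∘ₗ A.cast (coaction_eq f) :=
      LinearMap.ext fun c => TuraevData.cast_crossing rfl f.deg_eq c
    exact (Coact.map_map _ _ _ _ _).trans ((congrArg (fun g => TensorProduct.map (f.lin) g
      (X.coact x)) e).trans ((Coact.map_map f.lin _ LinearMap.id _ _).symm.trans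
        (congrArg _ (f.colinear x))))⟩
  map_id _ := rfl
  map_comp _ _ := rfl

theorem conjObj_one (X : Comod A) : conjObj hA 1 X = X := by
  refine mk_eq (by group) _ _ ?_
  rw [Coact.push_push]
  have : A.cast (by group) ∘ₗ A.crossing 1 X.deg = LinearMap.id :=
    LinearMap.ext fun c => hA.crossing_one_apply _ c
  rw [this]
  ext; simp [Coact.push]

theorem conjObj_mul (a b : G) (X : Comod A) :
    conjObj hA (a * b) X = conjObj hA a (conjObj hA b X) := by
  have e : A.cast (by group) ∘ₗ A.crossing a (b * X.deg * b⁻¹) ∘ₗ A.crossing b X.deg =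
      A.crossing (a * b) X.deg := LinearMap.ext fun c => hA.crossing_crossing a b _ c
  refine (mk_eq (by group) _ _ ?_).symm
  exact (Coact.push_push _ _ _).trans ((Coact.push_push _ _ _).trans
    (congrArg (fun g => Coact.push g X.coact) e))

theorem conjObj_unit (a : G) :
    conjObj hA a (unitObj hA.toIsTuraevAlgebra) = unitObj hA.toIsTuraevAlgebra := by
  refine mk_eq (by group) _ _ ?_
  exact (Coact.push_push _ _ _).trans ((Coact.push_unit _ _).trans
    (congrArg _ (hA.crossing_one a)))

theorem conjObj_tensor (a : G) (X Y : Comod A) :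
    conjObj hA a (tensorObj hA.toIsTuraevAlgebra X Y) =
      tensorObj hA.toIsTuraevAlgebra (conjObj hA a X) (conjObj hA a Y) := by
  have e : Coact.push (A.cast (by group)) (Coact.tensor (A.mul _ _)
      (Coact.push (A.crossing a X.deg) X.coact) (Coact.push (A.crossing a Y.deg) Y.coact)) =
      Coact.push (A.crossing a (X.deg * Y.deg)) (Coact.tensor (A.mul _ _) X.coact Y.coact) := by
    have h := Coact.push_tensor (ρ := X.coact) (τ := Y.coact) (κ := A.cast
      (show a * (X.deg * Y.deg) * a⁻¹ = (a * X.deg * a⁻¹) * (a * Y.deg * a⁻¹) by group) ∘ₗ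
        A.crossing a (X.deg * Y.deg)) (m := A.mul X.deg Y.deg) (m' := A.mul _ _)
      (κ₁ := A.crossing a X.deg) (κ₂ := A.crossing a Y.deg) (fun c d => by
        rw [LinearMap.comp_apply, ← hA.crossing_mul, TuraevData.cast_cast,
          TuraevData.cast_rfl])
    rw [← h, Coact.push_push, ← LinearMap.comp_assoc, TuraevData.cast_comp_cast,
      TuraevData.cast_self, LinearMap.id_comp]
  exact (mk_eq (by group) _ _ e).symm

end crossed

end Comod

namespace Coact

variable {k : Type u} [Field k]
variable {C D D' E E' : Type*} [AddCommGroup C] [Module k C] [AddCommGroup D] [Module k D]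
  [AddCommGroup D'] [Module k D'] [AddCommGroup E] [Module k E] [AddCommGroup E'] [Module k E']

/-- `c ⊗ d ↦ s(f(d) ⊗ c)` -/
noncomputable def twist (s : D' ⊗[k] C →ₗ[k] k) (f : D →ₗ[k] D') : C ⊗[k] D →ₗ[k] k :=
  s ∘ₗ TensorProduct.map f LinearMap.id ∘ₗ (TensorProduct.comm k C D).toLinearMap

@[simp] theorem twist_tmul (s : D' ⊗[k] C →ₗ[k] k) (f : D →ₗ[k] D') (c : C) (d : D) :
    twist s f (c ⊗ₜ d) = s (f d ⊗ₜ c) := by simp [twist]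

theorem conv_twist {ΔC : C →ₗ[k] C ⊗[k] C} {ΔD : D →ₗ[k] D ⊗[k] D} {ΔD' : D' →ₗ[k] D' ⊗[k] D'}
    {f : D →ₗ[k] D'} (hf : ∀ d, TensorProduct.map f f (ΔD d) = ΔD' (f d))
    (s t : D' ⊗[k] C →ₗ[k] k) (c : C) (d : D) :
    conv ΔC ΔD (twist s f) (twist t f) (c ⊗ₜ d) = conv ΔD' ΔC s t (f d ⊗ₜ c) := by
  simp only [conv, tensorComul, LinearMap.comp_apply, TensorProduct.map_tmul, ← hf,
    LinearEquiv.coe_coe]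
  generalize ΔC c = p
  generalize ΔD d = q
  induction p using Coact.ind with
  | add a b ha hb => simp only [LinearMap.map_add, LinearEquiv.map_add,
      ha, hb, TensorProduct.tmul_add, TensorProduct.add_tmul]
  | tmul c c' =>
  induction q using Coact.ind with
  | add a b ha hb => simp only [LinearMap.map_add, LinearEquiv.map_add,
      ha, hb, TensorProduct.tmul_add, TensorProduct.add_tmul]
  | tmul d d' => simp

theorem twist_invertible {ΔC : C →ₗ[k] C ⊗[k] C} {εC : C →ₗ[k] k} {ΔD : D →ₗ[k] D ⊗[k] D}
    {εD : D →ₗ[k] k} {ΔD' : D' →ₗ[k] D' ⊗[k] D'} {εD' : D' →ₗ[k] k}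
    {f : D →ₗ[k] D'} (hf : ∀ d, TensorProduct.map f f (ΔD d) = ΔD' (f d))
    (hε : ∀ d, εD' (f d) = εD d) {s : D' ⊗[k] C →ₗ[k] k}
    (hs : ∃ t, conv ΔD' ΔC s t = tensorCounit εD' εC ∧ conv ΔD' ΔC t s = tensorCounit εD' εC) :
    ∃ t, conv ΔC ΔD (twist s f) t = tensorCounit εC εD ∧
      conv ΔC ΔD t (twist s f) = tensorCounit εC εD := by
  obtain ⟨t, h1, h2⟩ := hs
  refine ⟨twist t f, TensorProduct.ext' fun c d => ?_, TensorProduct.ext' fun c d => ?_⟩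
  · rw [conv_twist hf, h1]; simp [tensorCounit, hε, mul_comm]
  · rw [conv_twist hf, h2]; simp [tensorCounit, hε, mul_comm]

theorem twist_comm {ΔC : C →ₗ[k] C ⊗[k] C} {ΔD : D →ₗ[k] D ⊗[k] D} {ΔD' : D' →ₗ[k] D' ⊗[k] D'}
    {f : D →ₗ[k] D'} (hf : ∀ d, TensorProduct.map f f (ΔD d) = ΔD' (f d))
    {s : D' ⊗[k] C →ₗ[k] k} {m : C ⊗[k] D →ₗ[k] E} {κ : E →ₗ[k] E'} {m' : D' ⊗[k] C →ₗ[k] E'}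
    {n : D' ⊗[k] C →ₗ[k] E'} (hn : ∀ d c, n (f d ⊗ₜ c) = κ (m (c ⊗ₜ d)))
    (h : ∀ x y, TensorProduct.lid k E' (TensorProduct.map s n (tensorComul ΔD' ΔC (x ⊗ₜ y))) =
      TensorProduct.rid k E' (TensorProduct.map m' s (tensorComul ΔD' ΔC (x ⊗ₜ y))))
    (c : C) (d : D) :
    TensorProduct.lid k E' (TensorProduct.map (twist s f) (κ ∘ₗ m)
        (tensorComul ΔC ΔD (c ⊗ₜ d))) =
      TensorProduct.rid k E' (TensorProduct.map (m' ∘ₗ TensorProduct.map f LinearMap.id ∘ₗ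
        (TensorProduct.comm k C D).toLinearMap) (twist s f) (tensorComul ΔC ΔD (c ⊗ₜ d))) := by
  have h' := h (f d) c
  simp only [tensorComul, LinearMap.comp_apply, TensorProduct.map_tmul, ← hf,
    LinearEquiv.coe_coe] at h' ⊢
  have e1 : ∀ (p : C ⊗[k] C) (q : D ⊗[k] D),
      TensorProduct.lid k E' (TensorProduct.map (twist s f) (κ ∘ₗ m)
        (TensorProduct.tensorTensorTensorComm k C C D D (p ⊗ₜ q))) =
      TensorProduct.lid k E' (TensorProduct.map s n
        (TensorProduct.tensorTensorTensorComm k D' D' C C (TensorProduct.map f f q ⊗ₜ p))) := by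
    intro p q
    induction p using Coact.ind with
    | add a b ha hb => simp only [LinearMap.map_add, LinearEquiv.map_add,
        ha, hb, TensorProduct.tmul_add, TensorProduct.add_tmul]
    | tmul c c' =>
    induction q using Coact.ind with
    | add a b ha hb => simp only [LinearMap.map_add, LinearEquiv.map_add,
        ha, hb, TensorProduct.tmul_add, TensorProduct.add_tmul]
    | tmul d d' => simp [hn]
  have e2 : ∀ (p : C ⊗[k] C) (q : D ⊗[k] D),
      TensorProduct.rid k E' (TensorProduct.map (m' ∘ₗ TensorProduct.map f LinearMap.id ∘ₗ
        (TensorProduct.comm k C D).toLinearMap) (twist s f)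
        (TensorProduct.tensorTensorTensorComm k C C D D (p ⊗ₜ q))) =
      TensorProduct.rid k E' (TensorProduct.map m' s
        (TensorProduct.tensorTensorTensorComm k D' D' C C (TensorProduct.map f f q ⊗ₜ p))) := by
    intro p q
    induction p using Coact.ind with
    | add a b ha hb => simp only [LinearMap.map_add, LinearEquiv.map_add,
        ha, hb, TensorProduct.tmul_add, TensorProduct.add_tmul]
    | tmul c c' =>
    induction q using Coact.ind with
    | add a b ha hb => simp only [LinearMap.map_add, LinearEquiv.map_add,
        ha, hb, TensorProduct.tmul_add, TensorProduct.add_tmul]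
    | tmul d d' => simp
  rw [e1, e2, h']

end Coact

namespace TuraevData

variable {k : Type u} [Field k] {G : Type w} [Group G] (A : TuraevData.{w, v, u} k G)

/-- the form `x ⊗ y ↦ σ_{aba⁻¹,a}(ψ_a(y), x)` on `C a ⊗ C b` -/
noncomputable def braidForm (a b : G) : A.C a ⊗[k] A.C b →ₗ[k] k :=
  Coact.twist (A.sigma (a * b * a⁻¹) a) (A.crossing a b)

variable {A}

theorem braidForm_cast {a b a' b' : G} (h : a = a') (h' : b = b') (x : A.C a) (y : A.C b) :
    A.braidForm a b (x ⊗ₜ y) = A.braidForm a' b' (A.cast h x ⊗ₜ A.cast h' y) := by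
  subst h h'; rfl

namespace IsCoquasitriangular

theorem braidForm_invertible (hA : A.IsCoquasitriangular) (a b : G) :
    ∃ t, Coact.conv (A.comul a) (A.comul b) (A.braidForm a b) t =
      Coact.tensorCounit (A.counit a) (A.counit b) ∧
    Coact.conv (A.comul a) (A.comul b) t (A.braidForm a b) =
      Coact.tensorCounit (A.counit a) (A.counit b) :=
  Coact.twist_invertible (hA.comul_crossing a b) (hA.counit_crossing a b)
    (hA.sigma_invertible _ _)

theorem crossing_inv (hA : A.IsCoquasitriangular) (a b : G) (y : A.C b) :
    A.cast (by group) (A.crossing a⁻¹ (a * b * a⁻¹) (A.crossing a b y)) = y := by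
  have h := hA.crossing_crossing a⁻¹ a b y
  have e := cast_crossing (by simp : a⁻¹ * a = 1) (rfl : b = b) y
  rw [cast_rfl, ← h, cast_cast] at e
  have h1 := hA.crossing_one_apply b y
  rw [← e, cast_cast] at h1
  exact h1

theorem braidForm_comm (hA : A.IsCoquasitriangular) (a b : G) (c : A.C a) (d : A.C b) :
    TensorProduct.lid k _ (TensorProduct.map (A.braidForm a b)
      (A.cast (show a * b = a * b * a⁻¹ * a by group) ∘ₗ A.mul a b)
        (Coact.tensorComul (A.comul a) (A.comul b) (c ⊗ₜ d))) =
      TensorProduct.rid k _ (TensorProduct.map (A.mul (a * b * a⁻¹) a ∘ₗ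
        TensorProduct.map (A.crossing a b) LinearMap.id ∘ₗ
        (TensorProduct.comm k _ _).toLinearMap) (A.braidForm a b)
          (Coact.tensorComul (A.comul a) (A.comul b) (c ⊗ₜ d))) := by
  refine Coact.twist_comm (hA.comul_crossing a b) ?_ (hA.sigma_comm (a * b * a⁻¹) a) c d
  intro d c
  simp only [LinearMap.comp_apply, TensorProduct.map_tmul, LinearEquiv.coe_coe,
    TensorProduct.comm_tmul, LinearMap.id_apply]
  have h1 := cast_mul (rfl : a = a) (show a⁻¹ * (a * b * a⁻¹) * a⁻¹⁻¹ = b by group) c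
    (A.crossing a⁻¹ (a * b * a⁻¹) (A.crossing a b d))
  rw [hA.crossing_inv, cast_rfl] at h1
  rw [← h1, cast_cast]

theorem braidForm_mul_left (hA : A.IsCoquasitriangular) (a b c : G) (x : A.C a) (y : A.C b)
    (z : A.C c) :
    A.braidForm (a * b) c (A.mul a b (x ⊗ₜ y) ⊗ₜ z) = LinearMap.mul' k k (TensorProduct.map
      (A.braidForm a (b * c * b⁻¹) ∘ₗ TensorProduct.mk k _ _ x ∘ₗ A.crossing b c)
      (A.braidForm b c ∘ₗ TensorProduct.mk k _ _ y) (A.comul c z)) := by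
  rw [braidForm, Coact.twist_tmul, hA.sigma_mul_right, ← hA.comul_crossing]
  generalize A.comul c z = p
  induction p using Coact.ind with
  | add a b ha hb => simp only [LinearMap.map_add, LinearEquiv.map_add, ha, hb]
  | tmul p q =>
    simp only [TensorProduct.map_tmul, LinearMap.comp_apply, LinearMap.flip_apply,
      TensorProduct.mk_apply, LinearMap.mul'_apply, braidForm, Coact.twist_tmul]
    congr 1
    · rw [← hA.crossing_crossing, sigma_cast (show a * b * c * (a * b)⁻¹ =
        a * (b * c * b⁻¹) * a⁻¹ by group) rfl, cast_cast, cast_rfl, cast_rfl]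
    · have h1 := hA.crossing_crossing a⁻¹ (a * b) c q
      have e := cast_crossing (by simp : a⁻¹ * (a * b) = b) (rfl : c = c) q
      rw [cast_rfl, ← h1, cast_cast] at e
      rw [sigma_cast (show a⁻¹ * (a * b * c * (a * b)⁻¹) * a⁻¹⁻¹ = b * c * b⁻¹ by group) rfl,
        e, cast_rfl]

theorem braidForm_mul_right (hA : A.IsCoquasitriangular) (a b c : G) (x : A.C a) (y : A.C b)
    (z : A.C c) :
    A.braidForm a (b * c) (x ⊗ₜ A.mul b c (y ⊗ₜ z)) = LinearMap.mul' k k (TensorProduct.map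
      (A.braidForm a c ∘ₗ (TensorProduct.mk k _ _).flip z)
      (A.braidForm a b ∘ₗ (TensorProduct.mk k _ _).flip y) (A.comul a x)) := by
  rw [braidForm, Coact.twist_tmul, ← hA.crossing_mul,
    sigma_cast (show a * (b * c) * a⁻¹ = a * b * a⁻¹ * (a * c * a⁻¹) by group) rfl,
    cast_cast, cast_rfl, cast_rfl, hA.sigma_mul_left]
  generalize A.comul a x = p
  induction p using Coact.ind with
  | add a b ha hb => simp only [LinearMap.map_add, LinearEquiv.map_add, ha, hb]
  | tmul p q => simp [braidForm]

theorem braidForm_crossing (hA : A.IsCoquasitriangular) (g a b : G) (x : A.C a) (y : A.C b) :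
    A.braidForm a b (x ⊗ₜ y) = A.braidForm (g * a * g⁻¹) (g * b * g⁻¹)
      (A.crossing g a x ⊗ₜ A.crossing g b y) := by
  simp only [braidForm, Coact.twist_tmul]
  rw [hA.sigma_crossing g]
  have h1 := hA.crossing_crossing g a b y
  have h2 := hA.crossing_crossing (g * a * g⁻¹) g b y
  have e := cast_crossing (show g * a = g * a * g⁻¹ * g by group) (rfl : b = b) y
  rw [cast_rfl, ← h1, ← h2, cast_cast] at e
  rw [sigma_cast (show g * (a * b * a⁻¹) * g⁻¹ =
    g * a * g⁻¹ * (g * b * g⁻¹) * (g * a * g⁻¹)⁻¹ by group) rfl, cast_rfl]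
  congr 2
  apply cast_injective (show g * a * g⁻¹ * (g * b * g⁻¹) * (g * a * g⁻¹)⁻¹ =
    g * a * g⁻¹ * g * b * (g * a * g⁻¹ * g)⁻¹ by group)
  rw [← e, cast_cast]

end IsCoquasitriangular
end TuraevData

namespace Comod

variable {k : Type u} [Field k] {G : Type w} [Group G] {A : TuraevData.{w, v, u} k G}
variable (hA : A.IsCoquasitriangular)

/-- the braiding `c_{X,Y}(x ⊗ y) = σ(ψ_a(y₁), x₁) y₀ ⊗ x₀` for `X` of degree `a` -/
noncomputable def braiding (X Y : Comod A) :
    tensorObj hA.toIsTuraevAlgebra X Y ≅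
      tensorObj hA.toIsTuraevAlgebra (conjObj hA.toIsCrossed X.deg Y) X :=
  isoMk (show X.deg * Y.deg = X.deg * Y.deg * X.deg⁻¹ * X.deg by group)
    (Coact.braid X.isCoaction Y.isCoaction (hA.braidForm_invertible X.deg Y.deg))
    (Coact.pair_colinear X.isCoaction Y.isCoaction (hA.braidForm_comm X.deg Y.deg))

theorem braiding_apply (X Y : Comod A) (x : X.V) (y : Y.V) :
    (braiding hA X Y).hom.lin (x ⊗ₜ y) = TensorProduct.comm k X.V Y.V
      (Coact.pair (A.braidForm X.deg Y.deg) X.coact Y.coact (x ⊗ₜ y)) := rfl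

theorem braiding_naturality {X X' Y Y' : Comod A} (f : X ⟶ X') (g : Y ⟶ Y')
    (g' : conjObj hA.toIsCrossed X.deg Y ⟶ conjObj hA.toIsCrossed X.deg Y') (hg : g'.lin = g.lin)
    (h : tensorObj hA.toIsTuraevAlgebra (conjObj hA.toIsCrossed X.deg Y') X' =
      tensorObj hA.toIsTuraevAlgebra (conjObj hA.toIsCrossed X'.deg Y') X') :
    (braiding hA X Y).hom ≫ tensorHom hA.toIsTuraevAlgebra g' f ≫ eqToHom h =
      tensorHom hA.toIsTuraevAlgebra f g ≫ (braiding hA X' Y').hom := by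
  refine hom_ext ?_
  have e : Hom.lin (eqToHom h) = (LinearMap.id : Y'.V ⊗[k] X'.V →ₗ[k] Y'.V ⊗[k] X'.V) :=
    eqToHom_lin _ _ h
  rw [comp_lin, comp_lin, e]
  have e' : (tensorHom hA.toIsTuraevAlgebra g' f).lin = TensorProduct.map g.lin f.lin :=
    congrArg (fun r => TensorProduct.map r f.lin) hg
  rw [e']
  refine TensorProduct.ext' fun x y => ?_
  have h1 := Coact.pair_map (s := A.braidForm X.deg Y.deg) (s' := A.braidForm X'.deg Y'.deg)
    (TuraevData.braidForm_cast (coaction_eq f) (coaction_eq g)) f.colinear g.colinear (x ⊗ₜ y)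
  exact (TensorProduct.map_comm g.lin f.lin _).trans (congrArg _ h1)

theorem braiding_tensor_left (X Y Z : Comod A)
    (h : tensorObj hA.toIsTuraevAlgebra (conjObj hA.toIsCrossed (X.deg * Y.deg) Z)
        (tensorObj hA.toIsTuraevAlgebra X Y) =
      tensorObj hA.toIsTuraevAlgebra
        (conjObj hA.toIsCrossed X.deg (conjObj hA.toIsCrossed Y.deg Z))
        (tensorObj hA.toIsTuraevAlgebra X Y)) :
    Hom.lin ((braiding hA (tensorObj hA.toIsTuraevAlgebra X Y) Z).hom ≫ eqToHom h) =
      (TensorProduct.assoc k Z.V X.V Y.V).toLinearMap ∘ₗ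
        TensorProduct.map (braiding hA X (conjObj hA.toIsCrossed Y.deg Z)).hom.lin LinearMap.id ∘ₗ
        (TensorProduct.assoc k X.V Z.V Y.V).symm.toLinearMap ∘ₗ
        TensorProduct.map LinearMap.id (braiding hA Y Z).hom.lin ∘ₗ
        (TensorProduct.assoc k X.V Y.V Z.V).toLinearMap := by
  have e : Hom.lin (eqToHom h) = (LinearMap.id : Z.V ⊗[k] (X.V ⊗[k] Y.V) →ₗ[k] _) :=
    eqToHom_lin _ _ h
  rw [comp_lin, e]
  exact TensorProduct.ext_threefold fun x y z => Coact.pair_tensor_left Z.isCoaction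
    (hA.braidForm_mul_left X.deg Y.deg Z.deg) x y z

theorem braiding_tensor_right (X Y Z : Comod A)
    (h : tensorObj hA.toIsTuraevAlgebra
        (conjObj hA.toIsCrossed X.deg (tensorObj hA.toIsTuraevAlgebra Y Z)) X =
      tensorObj hA.toIsTuraevAlgebra (tensorObj hA.toIsTuraevAlgebra
        (conjObj hA.toIsCrossed X.deg Y) (conjObj hA.toIsCrossed X.deg Z)) X) :
    Hom.lin ((braiding hA X (tensorObj hA.toIsTuraevAlgebra Y Z)).hom ≫ eqToHom h) =
      (TensorProduct.assoc k Y.V Z.V X.V).symm.toLinearMap ∘ₗ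
        TensorProduct.map LinearMap.id (braiding hA X Z).hom.lin ∘ₗ
        (TensorProduct.assoc k Y.V X.V Z.V).toLinearMap ∘ₗ
        TensorProduct.map (braiding hA X Y).hom.lin LinearMap.id ∘ₗ
        (TensorProduct.assoc k X.V Y.V Z.V).symm.toLinearMap := by
  have e : Hom.lin (eqToHom h) = (LinearMap.id : (Y.V ⊗[k] Z.V) ⊗[k] X.V →ₗ[k] _) :=
    eqToHom_lin _ _ h
  rw [comp_lin, e]
  exact TensorProduct.ext_threefold' fun x y z => Coact.pair_tensor_right X.isCoaction
    (hA.braidForm_mul_right X.deg Y.deg Z.deg) x y z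

theorem conj_braiding_lin (a : G) (X Y : Comod A) :
    (braiding hA (conjObj hA.toIsCrossed a X) (conjObj hA.toIsCrossed a Y)).hom.lin =
      (braiding hA X Y).hom.lin := by
  refine TensorProduct.ext' fun x y => ?_
  have h1 := Coact.pair_map (s := A.braidForm X.deg Y.deg)
    (s' := A.braidForm (a * X.deg * a⁻¹) (a * Y.deg * a⁻¹))
    (ρ := X.coact) (τ := Y.coact) (ρ' := (conjObj hA.toIsCrossed a X).coact)
    (τ' := (conjObj hA.toIsCrossed a Y).coact) (f := LinearMap.id) (g := LinearMap.id)
    (hA.braidForm_crossing a X.deg Y.deg) (fun _ => rfl) (fun _ => rfl) (x ⊗ₜ y)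
  rw [TensorProduct.map_id] at h1
  exact congrArg (TensorProduct.comm k X.V Y.V) h1.symm

theorem conj_braiding_obj (a : G) (X Y : Comod A) :
    conjObj hA.toIsCrossed a (tensorObj hA.toIsTuraevAlgebra
        (conjObj hA.toIsCrossed X.deg Y) X) =
      tensorObj hA.toIsTuraevAlgebra (conjObj hA.toIsCrossed (a * X.deg * a⁻¹)
        (conjObj hA.toIsCrossed a Y)) (conjObj hA.toIsCrossed a X) := by
  rw [conjObj_tensor, ← conjObj_mul, ← conjObj_mul]
  congr 2
  group

end Comod

/-- The category `Corep(A)` of corepresentations of a coquasitriangular crossed Turaev `G`-algebra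
as a braided `T`-category: the disjoint union of the categories of right comodules over the
components of `A`. -/
noncomputable def Corep {k : Type u} [Field k] {G : Type w} [Group G]
    (A : TuraevData.{w, v, u} k G) (hA : A.IsCoquasitriangular) :
    BraidedTCategory.{w, u, max (u + 1) v w} G :=
  letI := Comod.monoidal hA.toIsTuraevAlgebra
  { Obj := Comod A
    deg := Comod.deg
    deg_eq_of_hom := Comod.coaction_eq
    deg_tensor := fun _ _ => rfl
    conj := Comod.conj hA.toIsCrossed
    conj_one := CategoryTheory.Functor.hext (Comod.conjObj_one hA.toIsCrossed) (fun _ _ _ =>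
      Comod.hom_heq (Comod.conjObj_one hA.toIsCrossed _) (Comod.conjObj_one hA.toIsCrossed _) _ _ HEq.rfl)
    conj_mul := fun a b => CategoryTheory.Functor.hext (Comod.conjObj_mul hA.toIsCrossed a b)
      (fun _ _ _ => Comod.hom_heq (Comod.conjObj_mul hA.toIsCrossed _ _ _)
        (Comod.conjObj_mul hA.toIsCrossed _ _ _) _ _ HEq.rfl)
    deg_conj := fun _ _ => rfl
    conj_unit := Comod.conjObj_unit hA.toIsCrossed
    conj_tensorObj := Comod.conjObj_tensor hA.toIsCrossed
    conj_tensorHom := fun a _ _ _ _ _ _ => Comod.hom_heq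
      (Comod.conjObj_tensor hA.toIsCrossed a _ _) (Comod.conjObj_tensor hA.toIsCrossed a _ _)
      _ _ HEq.rfl
    conj_associator := fun a X Y Z => Comod.hom_heq
      ((Comod.conjObj_tensor hA.toIsCrossed a _ _).trans (congrArg
        (fun W => Comod.tensorObj hA.toIsTuraevAlgebra W (Comod.conjObj hA.toIsCrossed a Z))
        (Comod.conjObj_tensor hA.toIsCrossed a X Y)))
      ((Comod.conjObj_tensor hA.toIsCrossed a _ _).trans (congrArg
        (fun W => Comod.tensorObj hA.toIsTuraevAlgebra (Comod.conjObj hA.toIsCrossed a X) W)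
        (Comod.conjObj_tensor hA.toIsCrossed a Y Z))) _ _ HEq.rfl
    conj_leftUnitor := fun a X => Comod.hom_heq
      ((Comod.conjObj_tensor hA.toIsCrossed a _ _).trans (congrArg
        (fun W => Comod.tensorObj hA.toIsTuraevAlgebra W (Comod.conjObj hA.toIsCrossed a X))
        (Comod.conjObj_unit hA.toIsCrossed a))) rfl _ _ HEq.rfl
    conj_rightUnitor := fun a X => Comod.hom_heq
      ((Comod.conjObj_tensor hA.toIsCrossed a _ _).trans (congrArg
        (fun W => Comod.tensorObj hA.toIsTuraevAlgebra (Comod.conjObj hA.toIsCrossed a X) W)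
        (Comod.conjObj_unit hA.toIsCrossed a))) rfl _ _ HEq.rfl
    braiding := Comod.braiding hA
    braiding_naturality := fun f g => Comod.braiding_naturality hA f g _ rfl _
    braiding_tensor_left := fun X Y Z =>
      Comod.hom_ext (Comod.braiding_tensor_left hA X Y Z _)
    braiding_tensor_right := fun X Y Z =>
      Comod.hom_ext (Comod.braiding_tensor_right hA X Y Z _)
    conj_braiding := fun a X Y => Comod.hom_heq (Comod.conjObj_tensor hA.toIsCrossed a X Y)
      (Comod.conj_braiding_obj hA a X Y) _ _ (heq_of_eq (Comod.conj_braiding_lin hA a X Y).symm) }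

namespace YD

variable {k : Type u} [Field k] {H : Type v} [Ring H] [HopfAlgebra k H]
variable {V W U : Type*} [AddCommGroup V] [Module k V] [AddCommGroup W] [Module k W]
  [AddCommGroup U] [Module k U]

variable (k H) in
/-- the comultiplication of `H` -/
@[reducible] noncomputable def cm : H →ₗ[k] H ⊗[k] H := Coalgebra.comul

/-- `h ⊗ v ↦ h₁ · v₀ ⊗ β(h₂) v₁` -/
noncomputable def left (β : H →ₗ[k] H) (act : H →ₗ[k] V →ₗ[k] V) (ρ : V →ₗ[k] V ⊗[k] H) :
    H ⊗[k] V →ₗ[k] V ⊗[k] H :=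
  TensorProduct.map (TensorProduct.lift act) (LinearMap.mul' k H ∘ₗ TensorProduct.map β LinearMap.id)
    ∘ₗ (TensorProduct.tensorTensorTensorComm k H H V H).toLinearMap ∘ₗ TensorProduct.map (cm k H) ρ

/-- `a ⊗ (v ⊗ b) ↦ v ⊗ b α(a)` -/
noncomputable def mulIn (α : H →ₗ[k] H) : H ⊗[k] (V ⊗[k] H) →ₗ[k] V ⊗[k] H :=
  TensorProduct.map LinearMap.id (LinearMap.mul' k H ∘ₗ (TensorProduct.comm k H H).toLinearMap ∘ₗ
    TensorProduct.map α LinearMap.id) ∘ₗ (TensorProduct.leftComm k H V H).toLinearMap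

/-- `h ⊗ v ↦ (h₂ · v)₀ ⊗ (h₂ · v)₁ α(h₁)` -/
noncomputable def right (α : H →ₗ[k] H) (act : H →ₗ[k] V →ₗ[k] V) (ρ : V →ₗ[k] V ⊗[k] H) :
    H ⊗[k] V →ₗ[k] V ⊗[k] H :=
  mulIn α ∘ₗ TensorProduct.map LinearMap.id (ρ ∘ₗ TensorProduct.lift act) ∘ₗ
    (TensorProduct.assoc k H H V).toLinearMap ∘ₗ TensorProduct.map (cm k H) LinearMap.id

@[simp] theorem mulIn_tmul (α : H →ₗ[k] H) (a b : H) (v : V) :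
    mulIn (k := k) α (a ⊗ₜ (v ⊗ₜ b)) = v ⊗ₜ (b * α a) := by simp [mulIn]

/-- the action `h ⊗ (v ⊗ w) ↦ h₂ · v ⊗ h₁ · w` on a tensor product -/
noncomputable def tensorAct (actV : H →ₐ[k] Module.End k V) (actW : H →ₐ[k] Module.End k W) :
    H →ₐ[k] Module.End k (V ⊗[k] W) :=
  (Module.endTensorEndAlgHom (R := k) (S := k) (A := k) (M := V) (N := W)).comp
    ((Algebra.TensorProduct.map actV actW).comp
      ((Algebra.TensorProduct.comm k H H).toAlgHom.comp (Bialgebra.comulAlgHom k H)))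

theorem tensorAct_apply (actV : H →ₐ[k] Module.End k V) (actW : H →ₐ[k] Module.End k W) (h : H)
    (v : V) (w : W) : tensorAct actV actW h (v ⊗ₜ w) = TensorProduct.comm k W V
      (TensorProduct.map (actW.toLinearMap.flip w) (actV.toLinearMap.flip v) (cm k H h)) := by
  simp only [tensorAct, AlgHom.comp_apply, Bialgebra.comulAlgHom_apply]
  generalize cm k H h = p
  induction p using Coact.ind with
  | add a b ha hb => simp only [ map_add, ← ha, ← hb, LinearMap.add_apply]
  | tmul x y => simp [Module.endTensorEndAlgHom_apply]

theorem compat_tensor {α β γ δ A B : H →ₗ[k] H} {f g : H →ₐ[k] H}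
    {actV : H →ₐ[k] Module.End k V} {ρ : V →ₗ[k] V ⊗[k] H}
    {actW : H →ₐ[k] Module.End k W} {τ : W →ₗ[k] W ⊗[k] H}
    (hV : left β actV.toLinearMap ρ = right α actV.toLinearMap ρ)
    (hW : left δ actW.toLinearMap τ = right γ actW.toLinearMap τ)
    (hfg : ∀ x, f (α x) = g (δ x)) (hA : ∀ x, A x = g (γ x)) (hB : ∀ x, B x = f (β x)) :
    left B (tensorAct actV actW).toLinearMap (Coact.tensor (LinearMap.mul' k H ∘ₗ
        TensorProduct.map f.toLinearMap g.toLinearMap) ρ τ) =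
      right A (tensorAct actV actW).toLinearMap (Coact.tensor (LinearMap.mul' k H ∘ₗ
        TensorProduct.map f.toLinearMap g.toLinearMap) ρ τ) := by
  refine TensorProduct.ext_threefold' fun h m n => ?_
  let Ψ' : (V ⊗[k] H) ⊗[k] (W ⊗[k] H) →ₗ[k] (V ⊗[k] W) ⊗[k] H :=
    TensorProduct.map LinearMap.id (LinearMap.mul' k H ∘ₗ
        TensorProduct.map f.toLinearMap g.toLinearMap) ∘ₗ
      (TensorProduct.tensorTensorTensorComm k V H W H).toLinearMap
  let Ψ : (H ⊗[k] (V ⊗[k] H)) ⊗[k] (W ⊗[k] H) →ₗ[k] (V ⊗[k] W) ⊗[k] H :=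
    Ψ' ∘ₗ TensorProduct.map LinearMap.id
        (TensorProduct.map (TensorProduct.lift actW.toLinearMap) LinearMap.id ∘ₗ
        (TensorProduct.assoc k H W H).symm.toLinearMap) ∘ₗ
      (TensorProduct.leftComm k H (V ⊗[k] H) (W ⊗[k] H)).toLinearMap ∘ₗ
      (TensorProduct.assoc k H (V ⊗[k] H) (W ⊗[k] H)).toLinearMap
  have C : ∀ h : H, TensorProduct.assoc k H H H (TensorProduct.map (cm k H) LinearMap.id (cm k H h)) =
      TensorProduct.map LinearMap.id (cm k H) (cm k H h) := Coalgebra.coassoc_apply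
  -- step 1
  have C1 : ∀ (p : H ⊗[k] H) (v : V) (a : H) (w : W) (b : H),
      TensorProduct.map (TensorProduct.lift (tensorAct actV actW).toLinearMap)
        (LinearMap.mul' k H ∘ₗ TensorProduct.map B LinearMap.id)
        (TensorProduct.tensorTensorTensorComm k H H (V ⊗[k] W) H
          (p ⊗ₜ Ψ' ((v ⊗ₜ a) ⊗ₜ (w ⊗ₜ b)))) =
      TensorProduct.map ((TensorProduct.comm k W V).toLinearMap ∘ₗ
        TensorProduct.map (actW.toLinearMap.flip w) (actV.toLinearMap.flip v))
        (LinearMap.mulRight k (g b) ∘ₗ f.toLinearMap ∘ₗ LinearMap.mulRight k a ∘ₗ β)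
        ((TensorProduct.assoc k H H H).symm (TensorProduct.assoc k H H H
          (TensorProduct.map (cm k H) LinearMap.id p))) := by
    intro p v a w b
    induction p using Coact.ind with
    | add a b ha hb => simp only [LinearMap.map_add, LinearEquiv.map_add,
        ha, hb, TensorProduct.add_tmul]
    | tmul x y => simp [Ψ', tensorAct_apply, hB, mul_assoc]
  have C2 : ∀ (p : H ⊗[k] H) (s : V ⊗[k] H) (t : W ⊗[k] H),
      TensorProduct.map (TensorProduct.lift (tensorAct actV actW).toLinearMap)
        (LinearMap.mul' k H ∘ₗ TensorProduct.map B LinearMap.id)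
        (TensorProduct.tensorTensorTensorComm k H H (V ⊗[k] W) H
          (cm k H h ⊗ₜ Ψ' (s ⊗ₜ t))) =
      Ψ (TensorProduct.map LinearMap.id (TensorProduct.map (TensorProduct.lift actV.toLinearMap)
        (LinearMap.mul' k H ∘ₗ TensorProduct.map β LinearMap.id)
        ∘ₗ (TensorProduct.tensorTensorTensorComm k H H V H).toLinearMap ∘ₗ
          (TensorProduct.mk k (H ⊗[k] H) (V ⊗[k] H)).flip s ∘ₗ cm k H) (cm k H h) ⊗ₜ t) := by
    intro p s t
    induction s using Coact.ind with
    | add a b ha hb => simp only [LinearMap.map_add, LinearEquiv.map_add,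
        ha, hb, TensorProduct.tmul_add, TensorProduct.add_tmul,
        LinearMap.comp_add, LinearMap.add_comp, TensorProduct.map_add_right, LinearMap.add_apply]
    | tmul v a =>
    induction t using Coact.ind with
    | add a b ha hb => simp only [LinearMap.map_add, LinearEquiv.map_add,
        ha, hb, TensorProduct.tmul_add]
    | tmul w b =>
      rw [C1, C]
      generalize cm k H h = p
      induction p using Coact.ind with
      | add a b ha hb => simp only [LinearMap.map_add, LinearEquiv.map_add,
          ha, hb, TensorProduct.add_tmul]
      | tmul x y =>
        simp only [TensorProduct.map_tmul, LinearMap.comp_apply, LinearMap.id_apply,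
          LinearMap.flip_apply, TensorProduct.mk_apply, LinearEquiv.coe_coe]
        generalize cm k H y = q
        induction q using Coact.ind with
        | add a b ha hb => simp only [LinearMap.map_add, LinearEquiv.map_add,
            ha, hb, TensorProduct.add_tmul,
            TensorProduct.tmul_add]
        | tmul y z => simp [Ψ, Ψ']
  -- step 2
  have C3 : ∀ (t : W ⊗[k] H),
      Ψ (TensorProduct.map LinearMap.id (right α actV.toLinearMap ρ ∘ₗ
        (TensorProduct.mk k H V).flip m) (cm k H h) ⊗ₜ t) =
      Ψ' (TensorProduct.comm k _ _ (TensorProduct.map (TensorProduct.map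
        (TensorProduct.lift actW.toLinearMap)
        (LinearMap.mul' k H ∘ₗ TensorProduct.map δ LinearMap.id)
        ∘ₗ (TensorProduct.tensorTensorTensorComm k H H W H).toLinearMap ∘ₗ
          (TensorProduct.mk k (H ⊗[k] H) (W ⊗[k] H)).flip t ∘ₗ cm k H)
          (ρ ∘ₗ actV.toLinearMap.flip m) (cm k H h))) := by
    intro t
    induction t using Coact.ind with
    | add a b ha hb => simp only [LinearMap.map_add, LinearEquiv.map_add,
        ha, hb, TensorProduct.tmul_add, LinearMap.comp_add,
        LinearMap.add_comp, TensorProduct.map_add_left, LinearMap.add_apply]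
    | tmul w b =>
    have D1 : ∀ p : H ⊗[k] H, Ψ (TensorProduct.map LinearMap.id (right α actV.toLinearMap ρ ∘ₗ
        (TensorProduct.mk k H V).flip m) p ⊗ₜ (w ⊗ₜ b)) =
        Ψ' (TensorProduct.comm k _ _ (TensorProduct.map
          ((TensorProduct.mk k W H).flip b ∘ₗ actW.toLinearMap.flip w)
          (mulIn α ∘ₗ TensorProduct.map LinearMap.id (ρ ∘ₗ actV.toLinearMap.flip m))
            (TensorProduct.map LinearMap.id (cm k H) p))) := by
      intro p
      induction p using Coact.ind with
      | add a b ha hb => simp only [LinearMap.map_add, LinearEquiv.map_add,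
          ha, hb, TensorProduct.add_tmul]
      | tmul x y =>
        simp only [TensorProduct.map_tmul, LinearMap.comp_apply, LinearMap.id_apply,
          LinearMap.flip_apply, TensorProduct.mk_apply, LinearEquiv.coe_coe, right]
        generalize cm k H y = q
        induction q using Coact.ind with
        | add a b ha hb => simp only [LinearMap.map_add, LinearEquiv.map_add,
            ha, hb, TensorProduct.add_tmul,
            TensorProduct.tmul_add]
        | tmul y z => simp [Ψ]
    have D2 : ∀ p : H ⊗[k] H, Ψ' (TensorProduct.comm k _ _ (TensorProduct.map (TensorProduct.map
        (TensorProduct.lift actW.toLinearMap)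
        (LinearMap.mul' k H ∘ₗ TensorProduct.map δ LinearMap.id)
        ∘ₗ (TensorProduct.tensorTensorTensorComm k H H W H).toLinearMap ∘ₗ
          (TensorProduct.mk k (H ⊗[k] H) (W ⊗[k] H)).flip (w ⊗ₜ b) ∘ₗ cm k H)
          (ρ ∘ₗ actV.toLinearMap.flip m) p)) =
        Ψ' (TensorProduct.comm k _ _ (TensorProduct.map
          ((TensorProduct.mk k W H).flip b ∘ₗ actW.toLinearMap.flip w)
          (mulIn α ∘ₗ TensorProduct.map LinearMap.id (ρ ∘ₗ actV.toLinearMap.flip m))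
            (TensorProduct.assoc k H H H (TensorProduct.map (cm k H) LinearMap.id p)))) := by
      intro p
      induction p using Coact.ind with
      | add a b ha hb => simp only [LinearMap.map_add, LinearEquiv.map_add,
          ha, hb, TensorProduct.add_tmul]
      | tmul x z =>
        simp only [TensorProduct.map_tmul, LinearMap.comp_apply, LinearMap.id_apply,
          LinearMap.flip_apply, TensorProduct.mk_apply, LinearEquiv.coe_coe]
        generalize cm k H x = q
        induction q using Coact.ind with
        | add a b ha hb => simp only [LinearMap.map_add, LinearEquiv.map_add,
            ha, hb, TensorProduct.add_tmul,
            TensorProduct.tmul_add]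
        | tmul x y =>
          simp only [TensorProduct.map_tmul, LinearMap.comp_apply, LinearMap.id_apply,
            LinearMap.flip_apply, TensorProduct.mk_apply, LinearEquiv.coe_coe,
            TensorProduct.assoc_tmul, TensorProduct.tensorTensorTensorComm_tmul,
            TensorProduct.lift.tmul, LinearMap.mul'_apply, TensorProduct.comm_tmul]
          generalize ρ (actV.toLinearMap z m) = s
          induction s using Coact.ind with
          | add a b ha hb => simp only [LinearMap.map_add, LinearEquiv.map_add,
              ha, hb, TensorProduct.add_tmul,
              TensorProduct.tmul_add]
          | tmul v a => simp [Ψ', hfg, mul_assoc]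
    rw [D1, D2, C]
  -- step 3
  have C4 : Ψ' (TensorProduct.comm k _ _ (TensorProduct.map (right γ actW.toLinearMap τ ∘ₗ
        (TensorProduct.mk k H W).flip n) (ρ ∘ₗ actV.toLinearMap.flip m) (cm k H h))) =
      right A (tensorAct actV actW).toLinearMap (Coact.tensor (LinearMap.mul' k H ∘ₗ
        TensorProduct.map f.toLinearMap g.toLinearMap) ρ τ) (h ⊗ₜ (m ⊗ₜ n)) := by
    let L : H ⊗[k] (H ⊗[k] H) →ₗ[k] (V ⊗[k] W) ⊗[k] H :=
      Ψ' ∘ₗ (TensorProduct.comm k _ _).toLinearMap ∘ₗ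
        TensorProduct.map (mulIn γ ∘ₗ TensorProduct.map LinearMap.id
          (τ ∘ₗ actW.toLinearMap.flip n)) (ρ ∘ₗ actV.toLinearMap.flip m) ∘ₗ
        (TensorProduct.assoc k H H H).symm.toLinearMap
    have D1 : ∀ p : H ⊗[k] H, Ψ' (TensorProduct.comm k _ _ (TensorProduct.map
        (right γ actW.toLinearMap τ ∘ₗ
        (TensorProduct.mk k H W).flip n) (ρ ∘ₗ actV.toLinearMap.flip m) p)) =
        L (TensorProduct.assoc k H H H (TensorProduct.map (cm k H) LinearMap.id p)) := by
      intro p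
      induction p using Coact.ind with
      | add a b ha hb => simp only [LinearMap.map_add, LinearEquiv.map_add, ha, hb]
      | tmul x z =>
        simp only [TensorProduct.map_tmul, LinearMap.comp_apply, LinearMap.id_apply,
          LinearMap.flip_apply, TensorProduct.mk_apply, LinearEquiv.coe_coe, right]
        generalize cm k H x = q
        induction q using Coact.ind with
        | add a b ha hb => simp only [LinearMap.map_add, LinearEquiv.map_add,
            ha, hb, TensorProduct.add_tmul,
            TensorProduct.tmul_add]
        | tmul y z => simp [L]
    have D2 : ∀ p : H ⊗[k] H, mulIn A (TensorProduct.map LinearMap.id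
        (Coact.tensor (LinearMap.mul' k H ∘ₗ
        TensorProduct.map f.toLinearMap g.toLinearMap) ρ τ ∘ₗ
          TensorProduct.lift (tensorAct actV actW).toLinearMap)
        (TensorProduct.assoc k H H (V ⊗[k] W) (p ⊗ₜ (m ⊗ₜ n)))) =
        L (TensorProduct.map LinearMap.id (cm k H) p) := by
      intro p
      induction p using Coact.ind with
      | add a b ha hb => simp only [LinearMap.map_add, LinearEquiv.map_add,
          ha, hb, TensorProduct.add_tmul]
      | tmul x y =>
        simp only [TensorProduct.map_tmul, LinearMap.comp_apply, LinearMap.id_apply,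
          LinearMap.flip_apply, TensorProduct.mk_apply, LinearEquiv.coe_coe,
          TensorProduct.assoc_tmul, TensorProduct.lift.tmul, AlgHom.toLinearMap_apply,
          tensorAct_apply]
        generalize cm k H y = q
        induction q using Coact.ind with
        | add a b ha hb => simp only [LinearMap.map_add, LinearEquiv.map_add,
            ha, hb, TensorProduct.add_tmul,
            TensorProduct.tmul_add]
        | tmul y z =>
          simp only [TensorProduct.map_tmul, TensorProduct.comm_tmul, Coact.tensor,
            LinearMap.comp_apply, LinearEquiv.coe_coe, LinearMap.flip_apply,
            AlgHom.toLinearMap_apply, L, TensorProduct.assoc_symm_tmul, LinearMap.id_apply]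
          generalize ρ (actV z m) = s
          generalize τ (actW y n) = t
          induction s using Coact.ind with
          | add a b ha hb => simp only [LinearMap.map_add, LinearEquiv.map_add,
              ha, hb, TensorProduct.add_tmul,
              TensorProduct.tmul_add]
          | tmul v a =>
          induction t using Coact.ind with
          | add a b ha hb => simp only [LinearMap.map_add, LinearEquiv.map_add,
              ha, hb, TensorProduct.add_tmul,
              TensorProduct.tmul_add]
          | tmul w b => simp [Ψ', hA, mul_assoc]
    rw [D1, C, ← D2]
    simp [right]
  have E1 : left B (tensorAct actV actW).toLinearMap (Coact.tensor (LinearMap.mul' k H ∘ₗ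
        TensorProduct.map f.toLinearMap g.toLinearMap) ρ τ) (h ⊗ₜ (m ⊗ₜ n)) =
      TensorProduct.map (TensorProduct.lift (tensorAct actV actW).toLinearMap)
        (LinearMap.mul' k H ∘ₗ TensorProduct.map B LinearMap.id)
        (TensorProduct.tensorTensorTensorComm k H H (V ⊗[k] W) H
          (cm k H h ⊗ₜ Ψ' (ρ m ⊗ₜ τ n))) := by simp [left, Coact.tensor, Ψ']
  have E2 : TensorProduct.map (TensorProduct.lift actV.toLinearMap)
        (LinearMap.mul' k H ∘ₗ TensorProduct.map β LinearMap.id)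
        ∘ₗ (TensorProduct.tensorTensorTensorComm k H H V H).toLinearMap ∘ₗ
          (TensorProduct.mk k (H ⊗[k] H) (V ⊗[k] H)).flip (ρ m) ∘ₗ cm k H =
      right α actV.toLinearMap ρ ∘ₗ (TensorProduct.mk k H V).flip m := by
    rw [← hV]; ext x; simp [left]
  have E3 : TensorProduct.map (TensorProduct.lift actW.toLinearMap)
        (LinearMap.mul' k H ∘ₗ TensorProduct.map δ LinearMap.id)
        ∘ₗ (TensorProduct.tensorTensorTensorComm k H H W H).toLinearMap ∘ₗ
          (TensorProduct.mk k (H ⊗[k] H) (W ⊗[k] H)).flip (τ n) ∘ₗ cm k H =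
      right γ actW.toLinearMap τ ∘ₗ (TensorProduct.mk k H W).flip n := by
    rw [← hW]; ext x; simp [left]
  rw [E1, C2 0, E2, C3, E3, C4]

theorem compat_conj {γ δ A B : H →ₗ[k] H} {f : H →ₐ[k] H} {θ : H →ₐc[k] H}
    {act : H →ₐ[k] Module.End k V} {ρ : V →ₗ[k] V ⊗[k] H}
    (hV : left δ act.toLinearMap ρ = right γ act.toLinearMap ρ)
    (hA : ∀ x, A x = f (γ (θ x))) (hB : ∀ x, B x = f (δ (θ x))) :
    left B (act.comp (θ : H →ₐ[k] H)).toLinearMap (Coact.push f.toLinearMap ρ) =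
      right A (act.comp (θ : H →ₐ[k] H)).toLinearMap (Coact.push f.toLinearMap ρ) := by
  refine TensorProduct.ext' fun h m => ?_
  have hΔ : ∀ h : H, cm k H (θ h) = TensorProduct.map (θ : H →ₗ[k] H) (θ : H →ₗ[k] H) (cm k H h) :=
    fun h => (CoalgHomClass.map_comp_comul_apply θ h).symm
  have e1 : ∀ (p : H ⊗[k] H) (s : V ⊗[k] H),
      TensorProduct.map (TensorProduct.lift (act.comp (θ : H →ₐ[k] H)).toLinearMap)
        (LinearMap.mul' k H ∘ₗ TensorProduct.map B LinearMap.id)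
        (TensorProduct.tensorTensorTensorComm k H H V H
          (p ⊗ₜ TensorProduct.map LinearMap.id f.toLinearMap s)) =
      TensorProduct.map LinearMap.id f.toLinearMap
        (TensorProduct.map (TensorProduct.lift act.toLinearMap)
        (LinearMap.mul' k H ∘ₗ TensorProduct.map δ LinearMap.id)
        (TensorProduct.tensorTensorTensorComm k H H V H
          (TensorProduct.map (θ : H →ₗ[k] H) (θ : H →ₗ[k] H) p ⊗ₜ s))) := by
    intro p s
    induction p using Coact.ind with
    | add a b ha hb => simp only [LinearMap.map_add, LinearEquiv.map_add,
        ha, hb, TensorProduct.add_tmul]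
    | tmul x y =>
    induction s using Coact.ind with
    | add a b ha hb => simp only [LinearMap.map_add, LinearEquiv.map_add,
        ha, hb, TensorProduct.tmul_add]
    | tmul v a => simp [hB]
  have e2 : ∀ (p : H ⊗[k] H),
      mulIn A (TensorProduct.map LinearMap.id (Coact.push f.toLinearMap ρ ∘ₗ
        TensorProduct.lift (act.comp (θ : H →ₐ[k] H)).toLinearMap)
          (TensorProduct.assoc k H H V (p ⊗ₜ m))) =
      TensorProduct.map LinearMap.id f.toLinearMap (mulIn γ (TensorProduct.map LinearMap.id (ρ ∘ₗ
        TensorProduct.lift act.toLinearMap) (TensorProduct.assoc k H H V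
          (TensorProduct.map (θ : H →ₗ[k] H) (θ : H →ₗ[k] H) p ⊗ₜ m)))) := by
    intro p
    induction p using Coact.ind with
    | add a b ha hb => simp only [LinearMap.map_add, LinearEquiv.map_add,
        ha, hb, TensorProduct.add_tmul]
    | tmul x y =>
      simp only [TensorProduct.map_tmul, TensorProduct.assoc_tmul, LinearMap.comp_apply,
        TensorProduct.lift.tmul, Coact.push, LinearMap.id_apply, AlgHom.toLinearMap_apply,
        AlgHom.comp_apply]
      have : act ((θ : H →ₐ[k] H) y) m = act ((θ : H →ₗ[k] H) y) m := rfl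
      rw [this]
      generalize ρ (act ((θ : H →ₗ[k] H) y) m) = s
      induction s using Coact.ind with
      | add a b ha hb => simp only [LinearMap.map_add, LinearEquiv.map_add,
          ha, hb, TensorProduct.tmul_add]
      | tmul v a => simp [hA]
  have h1 := LinearMap.congr_fun hV (θ h ⊗ₜ m)
  simp only [left, right, LinearMap.comp_apply, TensorProduct.map_tmul, hΔ,
    LinearEquiv.coe_coe, LinearMap.id_apply] at h1
  simp only [left, right, LinearMap.comp_apply, TensorProduct.map_tmul,
    LinearEquiv.coe_coe, LinearMap.id_apply, Coact.push_apply, e1, e2, h1]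

end YD

namespace Coact

variable {k : Type u} [Field k]
variable {C D E : Type*} [AddCommGroup C] [Module k C] [AddCommGroup D] [Module k D]
  [AddCommGroup E] [Module k E]
variable {V W U V' W' : Type*} [AddCommGroup V] [Module k V] [AddCommGroup W] [Module k W]
  [AddCommGroup U] [Module k U] [AddCommGroup V'] [Module k V'] [AddCommGroup W'] [Module k W']

/-- `v ⊗ w ↦ v₀ ⊗ l(v₁)(w)` -/
noncomputable def actMap (l : C →ₗ[k] Module.End k W) (ρ : V →ₗ[k] V ⊗[k] C) :
    V ⊗[k] W →ₗ[k] V ⊗[k] W :=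
  TensorProduct.map LinearMap.id (TensorProduct.lift l) ∘ₗ
    (TensorProduct.assoc k V C W).toLinearMap ∘ₗ TensorProduct.map ρ LinearMap.id

theorem actMap_tmul (l : C →ₗ[k] Module.End k W) (ρ : V →ₗ[k] V ⊗[k] C) (v : V) (w : W) :
    actMap l ρ (v ⊗ₜ w) = TensorProduct.map LinearMap.id (LinearMap.flip l w) (ρ v) := by
  simp only [actMap, LinearMap.comp_apply, TensorProduct.map_tmul, LinearMap.id_apply]
  generalize ρ v = s
  induction s using Coact.ind with
  | add a b ha hb => simp only [LinearMap.map_add, LinearEquiv.map_add,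
      ← ha, ← hb, TensorProduct.add_tmul]
  | tmul v c => simp

theorem actMap_actMap {ΔC : C →ₗ[k] C ⊗[k] C} {εC : C →ₗ[k] k} {ρ : V →ₗ[k] V ⊗[k] C}
    (h : IsCoaction ΔC εC ρ) (l m : C →ₗ[k] Module.End k W) (x : V ⊗[k] W) :
    actMap l ρ (actMap m ρ x) =
      actMap (LinearMap.mul' k (Module.End k W) ∘ₗ TensorProduct.map l m ∘ₗ ΔC) ρ x := by
  induction x using Coact.ind with
  | add a b ha hb => simp only [LinearMap.map_add, LinearEquiv.map_add, ha, hb]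
  | tmul v w =>
    let L : V ⊗[k] (C ⊗[k] C) →ₗ[k] V ⊗[k] W := TensorProduct.map LinearMap.id
      (LinearMap.applyₗ w ∘ₗ LinearMap.mul' k (Module.End k W) ∘ₗ TensorProduct.map l m)
    have e1 : ∀ s : V ⊗[k] C, actMap l ρ (TensorProduct.map LinearMap.id (LinearMap.flip m w) s) =
        L (TensorProduct.assoc k V C C (TensorProduct.map ρ LinearMap.id s)) := by
      intro s
      induction s using Coact.ind with
      | add a b ha hb => simp only [LinearMap.map_add, LinearEquiv.map_add, ha, hb]
      | tmul v c =>
        simp only [TensorProduct.map_tmul, actMap_tmul, LinearMap.id_apply]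
        generalize ρ v = t
        induction t using Coact.ind with
        | add a b ha hb => simp only [LinearMap.map_add, LinearEquiv.map_add,
            ha, hb, TensorProduct.add_tmul]
        | tmul v c' => simp [L]
    rw [actMap_tmul, actMap_tmul, e1, h.coassoc]
    generalize ρ v = s
    induction s using Coact.ind with
    | add a b ha hb => simp only [LinearMap.map_add, LinearEquiv.map_add, ha, hb]
    | tmul v c => simp [L]

theorem actMap_counit {ΔC : C →ₗ[k] C ⊗[k] C} {εC : C →ₗ[k] k} {ρ : V →ₗ[k] V ⊗[k] C}
    (h : IsCoaction ΔC εC ρ) {l : C →ₗ[k] Module.End k W} (hl : ∀ c, l c = εC c • 1)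
    (x : V ⊗[k] W) : actMap l ρ x = x := by
  induction x using Coact.ind with
  | add a b ha hb => simp only [LinearMap.map_add, LinearEquiv.map_add, ha, hb]
  | tmul v w =>
    have e : ∀ s : V ⊗[k] C, TensorProduct.map LinearMap.id (LinearMap.flip l w) s =
        TensorProduct.rid k V (TensorProduct.map LinearMap.id εC s) ⊗ₜ w := by
      intro s
      induction s using Coact.ind with
      | add a b ha hb => simp only [LinearMap.map_add, LinearEquiv.map_add,
          ha, hb, TensorProduct.add_tmul]
      | tmul v c => simp [hl, TensorProduct.smul_tmul]
    rw [actMap_tmul, e, h.counit]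

theorem actMap_map {l : C →ₗ[k] Module.End k W} {l' : D →ₗ[k] Module.End k W'}
    {κ : C →ₗ[k] D} {ρ : V →ₗ[k] V ⊗[k] C} {ρ' : V' →ₗ[k] V' ⊗[k] D}
    {f : V →ₗ[k] V'} {g : W →ₗ[k] W'} (hl : ∀ c w, g (l c w) = l' (κ c) (g w))
    (hf : ∀ v, TensorProduct.map f κ (ρ v) = ρ' (f v)) (x : V ⊗[k] W) :
    TensorProduct.map f g (actMap l ρ x) = actMap l' ρ' (TensorProduct.map f g x) := by
  induction x using Coact.ind with
  | add a b ha hb => simp only [LinearMap.map_add, LinearEquiv.map_add, ha, hb]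
  | tmul v w =>
    rw [TensorProduct.map_tmul, actMap_tmul, actMap_tmul, ← hf]
    generalize ρ v = s
    induction s using Coact.ind with
    | add a b ha hb => simp only [LinearMap.map_add, LinearEquiv.map_add, ha, hb]
    | tmul v c => simp [hl]

theorem actMap_tensor_left {m : C ⊗[k] D →ₗ[k] E} {ρ : V →ₗ[k] V ⊗[k] C}
    {τ : W →ₗ[k] W ⊗[k] D} {l : E →ₗ[k] Module.End k U} {l₁ : C →ₗ[k] Module.End k U}
    {l₂ : D →ₗ[k] Module.End k U} (hl : ∀ c d u, l (m (c ⊗ₜ d)) u = l₁ c (l₂ d u))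
    (x : V) (y : W) (z : U) :
    TensorProduct.comm k (V ⊗[k] W) U (actMap l (tensor m ρ τ) ((x ⊗ₜ y) ⊗ₜ z)) =
      TensorProduct.assoc k U V W (TensorProduct.map ((TensorProduct.comm k V U).toLinearMap ∘ₗ
        actMap l₁ ρ) LinearMap.id ((TensorProduct.assoc k V U W).symm
          (x ⊗ₜ TensorProduct.comm k W U (actMap l₂ τ (y ⊗ₜ z))))) := by
  simp only [actMap_tmul, tensor, LinearMap.comp_apply, TensorProduct.map_tmul,
    LinearEquiv.coe_coe]
  generalize τ y = t
  induction t using Coact.ind with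
  | add a b ha hb => simp only [LinearMap.map_add, LinearEquiv.map_add,
      ha, hb, TensorProduct.tmul_add]
  | tmul w d =>
    simp only [TensorProduct.map_tmul, TensorProduct.comm_tmul, TensorProduct.assoc_symm_tmul,
      LinearMap.comp_apply, LinearEquiv.coe_coe, LinearMap.id_apply, actMap_tmul]
    generalize ρ x = s
    induction s using Coact.ind with
    | add a b ha hb => simp only [LinearMap.map_add, LinearEquiv.map_add,
        ha, hb, TensorProduct.add_tmul]
    | tmul v c => simp [hl]

end Coact

namespace YD

variable {k : Type u} [Field k] {H : Type v} [Ring H] [HopfAlgebra k H]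
variable {V W U : Type*} [AddCommGroup V] [Module k V] [AddCommGroup W] [Module k W]
  [AddCommGroup U] [Module k U]

theorem actMap_tensor_right {ρ : V →ₗ[k] V ⊗[k] H}
    (h : Coact.IsCoaction (cm k H) Coalgebra.counit ρ)
    (actW : H →ₐ[k] Module.End k W) (actU : H →ₐ[k] Module.End k U) (ζ : H →ₐc[k] H)
    (x : V) (y : W) (z : U) :
    TensorProduct.comm k V (W ⊗[k] U) (Coact.actMap
      ((tensorAct actW actU).comp (ζ : H →ₐ[k] H)).toLinearMap ρ (x ⊗ₜ (y ⊗ₜ z))) =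
      (TensorProduct.assoc k W U V).symm (TensorProduct.map LinearMap.id
        ((TensorProduct.comm k V U).toLinearMap ∘ₗ
          Coact.actMap (actU.comp (ζ : H →ₐ[k] H)).toLinearMap ρ) (TensorProduct.assoc k W V U
          (TensorProduct.comm k V W (Coact.actMap (actW.comp (ζ : H →ₐ[k] H)).toLinearMap ρ
            (x ⊗ₜ y)) ⊗ₜ z))) := by
  have hΔ : ∀ h : H, cm k H (ζ h) = TensorProduct.map (ζ : H →ₗ[k] H) (ζ : H →ₗ[k] H) (cm k H h) :=
    fun h => (CoalgHomClass.map_comp_comul_apply ζ h).symm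
  let L : V ⊗[k] (H ⊗[k] H) →ₗ[k] (W ⊗[k] U) ⊗[k] V :=
    (TensorProduct.comm k V (W ⊗[k] U)).toLinearMap ∘ₗ TensorProduct.map LinearMap.id
      ((TensorProduct.comm k U W).toLinearMap ∘ₗ TensorProduct.map
        ((actU.comp (ζ : H →ₐ[k] H)).toLinearMap.flip z)
        ((actW.comp (ζ : H →ₐ[k] H)).toLinearMap.flip y))
  have e1 : ∀ s : V ⊗[k] H, (TensorProduct.assoc k W U V).symm (TensorProduct.map LinearMap.id
        ((TensorProduct.comm k V U).toLinearMap ∘ₗ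
          Coact.actMap (actU.comp (ζ : H →ₐ[k] H)).toLinearMap ρ) (TensorProduct.assoc k W V U
          (TensorProduct.comm k V W (TensorProduct.map LinearMap.id
            ((actW.comp (ζ : H →ₐ[k] H)).toLinearMap.flip y) s) ⊗ₜ z))) =
      L (TensorProduct.assoc k V H H (TensorProduct.map ρ LinearMap.id s)) := by
    intro s
    induction s using Coact.ind with
    | add a b ha hb => simp only [LinearMap.map_add, LinearEquiv.map_add,
        ha, hb, TensorProduct.add_tmul]
    | tmul v c =>
      simp only [TensorProduct.map_tmul, TensorProduct.comm_tmul, TensorProduct.assoc_tmul,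
        LinearMap.comp_apply, LinearEquiv.coe_coe, LinearMap.id_apply, Coact.actMap_tmul]
      generalize ρ v = t
      induction t using Coact.ind with
      | add a b ha hb => simp only [LinearMap.map_add, LinearEquiv.map_add,
          ha, hb, TensorProduct.add_tmul,
          TensorProduct.tmul_add]
      | tmul v c' => simp [L]
  rw [Coact.actMap_tmul, Coact.actMap_tmul, e1, h.coassoc]
  generalize ρ x = s
  induction s using Coact.ind with
  | add a b ha hb => simp only [LinearMap.map_add, LinearEquiv.map_add, ha, hb]
  | tmul v c =>
    have e2 : tensorAct actW actU (ζ c) (y ⊗ₜ z) = TensorProduct.comm k U W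
      (TensorProduct.map ((actU.comp (ζ : H →ₐ[k] H)).toLinearMap.flip z)
        ((actW.comp (ζ : H →ₐ[k] H)).toLinearMap.flip y) (cm k H c)) := by
      rw [tensorAct_apply, hΔ, Coact.map_map]
      rfl
    exact congrArg (fun q => q ⊗ₜ[k] v) e2

theorem actMap_linear {α β : H →ₗ[k] H} {ζ θ : H →ₐ[k] H}
    {actV : H →ₐ[k] Module.End k V} {ρ : V →ₗ[k] V ⊗[k] H} {actW : H →ₐ[k] Module.End k W}
    (hV : left β actV.toLinearMap ρ = right α actV.toLinearMap ρ)
    (hζ : ∀ x, ζ (α x) = x) (hθ : ∀ x, θ x = ζ (β x)) (h : H) (x : V ⊗[k] W) :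
    TensorProduct.comm k V W (Coact.actMap (actW.comp ζ).toLinearMap ρ (tensorAct actV actW h x)) =
      tensorAct (actW.comp θ) actV h
        (TensorProduct.comm k V W (Coact.actMap (actW.comp ζ).toLinearMap ρ x)) := by
  induction x using Coact.ind with
  | add a b ha hb => simp only [LinearMap.map_add, LinearEquiv.map_add, ha, hb]
  | tmul m n =>
    let K : V ⊗[k] H →ₗ[k] W ⊗[k] V := (TensorProduct.comm k V W).toLinearMap ∘ₗ
      TensorProduct.map LinearMap.id ((actW.comp ζ).toLinearMap.flip n)
    have e1 : ∀ p : H ⊗[k] H, TensorProduct.comm k V W (Coact.actMap (actW.comp ζ).toLinearMap ρ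
        (TensorProduct.comm k W V (TensorProduct.map (actW.toLinearMap.flip n)
          (actV.toLinearMap.flip m) p))) =
        K (mulIn α (TensorProduct.map LinearMap.id (ρ ∘ₗ TensorProduct.lift actV.toLinearMap)
          (TensorProduct.assoc k H H V (p ⊗ₜ m)))) := by
      intro p
      induction p using Coact.ind with
      | add a b ha hb => simp only [LinearMap.map_add, LinearEquiv.map_add,
          ha, hb, TensorProduct.add_tmul]
      | tmul x y =>
        simp only [TensorProduct.map_tmul, TensorProduct.comm_tmul, TensorProduct.assoc_tmul,
          Coact.actMap_tmul, LinearMap.comp_apply, TensorProduct.lift.tmul, LinearMap.id_apply,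
          LinearMap.flip_apply]
        generalize ρ (actV.toLinearMap y m) = s
        induction s using Coact.ind with
        | add a b ha hb => simp only [LinearMap.map_add, LinearEquiv.map_add,
            ha, hb, TensorProduct.tmul_add]
        | tmul v a => simp [K, hζ]
    have e2 : ∀ s : V ⊗[k] H, tensorAct (actW.comp θ) actV h (K s) =
        K (TensorProduct.map (TensorProduct.lift actV.toLinearMap)
          (LinearMap.mul' k H ∘ₗ TensorProduct.map β LinearMap.id)
          (TensorProduct.tensorTensorTensorComm k H H V H (cm k H h ⊗ₜ s))) := by
      intro s
      induction s using Coact.ind with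
      | add a b ha hb => simp only [LinearMap.map_add, LinearEquiv.map_add,
          ha, hb, TensorProduct.tmul_add]
      | tmul v a =>
        simp only [K, LinearMap.comp_apply, TensorProduct.map_tmul, TensorProduct.comm_tmul,
          LinearEquiv.coe_coe, LinearMap.flip_apply, tensorAct_apply]
        generalize cm k H h = p
        induction p using Coact.ind with
        | add a b ha hb => simp only [LinearMap.map_add, LinearEquiv.map_add,
            ha, hb, TensorProduct.add_tmul]
        | tmul x y => simp [hθ]
    have h1 := LinearMap.congr_fun hV (h ⊗ₜ m)
    simp only [left, right, LinearMap.comp_apply, TensorProduct.map_tmul,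
      LinearEquiv.coe_coe, LinearMap.id_apply] at h1
    rw [tensorAct_apply, e1, ← h1, ← e2, Coact.actMap_tmul]
    rfl

theorem actMap_colinear {γ δ : H →ₗ[k] H} {f g f' g' φ : H →ₐ[k] H} {ζ : H →ₐc[k] H}
    {ρ : V →ₗ[k] V ⊗[k] H} {actW : H →ₐ[k] Module.End k W} {τ : W →ₗ[k] W ⊗[k] H}
    (h : Coact.IsCoaction (cm k H) Coalgebra.counit ρ)
    (hW : left δ actW.toLinearMap τ = right γ actW.toLinearMap τ)
    (h1 : ∀ x, f' (φ x) = g x) (h2 : ∀ x, g' x = g (γ (ζ x))) (h3 : ∀ x, g (δ (ζ x)) = f x)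
    (x : V ⊗[k] W) :
    TensorProduct.map ((TensorProduct.comm k V W).toLinearMap ∘ₗ
        Coact.actMap (actW.comp (ζ : H →ₐ[k] H)).toLinearMap ρ) LinearMap.id
      (Coact.tensor (LinearMap.mul' k H ∘ₗ
        TensorProduct.map f.toLinearMap g.toLinearMap) ρ τ x) =
      Coact.tensor (LinearMap.mul' k H ∘ₗ
        TensorProduct.map f'.toLinearMap g'.toLinearMap) (Coact.push φ.toLinearMap τ) ρ
        (TensorProduct.comm k V W (Coact.actMap (actW.comp (ζ : H →ₐ[k] H)).toLinearMap ρ x)) := by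
  have hΔ : ∀ h : H, cm k H (ζ h) = TensorProduct.map (ζ : H →ₗ[k] H) (ζ : H →ₗ[k] H) (cm k H h) :=
    fun h => (CoalgHomClass.map_comp_comul_apply ζ h).symm
  induction x using Coact.ind with
  | add a b ha hb => simp only [LinearMap.map_add, LinearEquiv.map_add, ha, hb]
  | tmul m n =>
  -- insert `v` behind an element of `W ⊗ H` and apply `g` to the second factor
  let J : V ⊗[k] (W ⊗[k] H) →ₗ[k] (W ⊗[k] V) ⊗[k] H :=
    TensorProduct.map (TensorProduct.comm k V W).toLinearMap g.toLinearMap ∘ₗ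
      (TensorProduct.assoc k V W H).symm.toLinearMap
  have h4 := fun c : H => LinearMap.congr_fun hW (ζ c ⊗ₜ n)
  simp only [left, right, LinearMap.comp_apply, TensorProduct.map_tmul,
    LinearEquiv.coe_coe, LinearMap.id_apply, hΔ] at h4
  let P₁ : H ⊗[k] H →ₗ[k] W ⊗[k] H := TensorProduct.map (TensorProduct.lift actW.toLinearMap)
    (LinearMap.mul' k H ∘ₗ TensorProduct.map δ LinearMap.id) ∘ₗ
    (TensorProduct.tensorTensorTensorComm k H H W H).toLinearMap ∘ₗ
    (TensorProduct.mk k (H ⊗[k] H) (W ⊗[k] H)).flip (τ n) ∘ₗ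
    TensorProduct.map (ζ : H →ₗ[k] H) (ζ : H →ₗ[k] H)
  let P₂ : H ⊗[k] H →ₗ[k] W ⊗[k] H := mulIn γ ∘ₗ TensorProduct.map LinearMap.id
    (τ ∘ₗ TensorProduct.lift actW.toLinearMap) ∘ₗ (TensorProduct.assoc k H H W).toLinearMap ∘ₗ
    (TensorProduct.mk k (H ⊗[k] H) W).flip n ∘ₗ
    TensorProduct.map (ζ : H →ₗ[k] H) (ζ : H →ₗ[k] H)
  have hP : P₁ ∘ₗ cm k H = P₂ ∘ₗ cm k H := LinearMap.ext h4
  have e1 : ∀ s : V ⊗[k] H, TensorProduct.map ((TensorProduct.comm k V W).toLinearMap ∘ₗ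
        Coact.actMap (actW.comp (ζ : H →ₐ[k] H)).toLinearMap ρ) LinearMap.id
      (TensorProduct.map LinearMap.id (LinearMap.mul' k H ∘ₗ
        TensorProduct.map f.toLinearMap g.toLinearMap)
        (TensorProduct.tensorTensorTensorComm k V H W H (s ⊗ₜ τ n))) =
      J (TensorProduct.map LinearMap.id P₁
        (TensorProduct.assoc k V H H (TensorProduct.map ρ LinearMap.id s))) := by
    intro s
    induction s using Coact.ind with
    | add a b ha hb => simp only [LinearMap.map_add, LinearEquiv.map_add,
        ha, hb, TensorProduct.add_tmul]
    | tmul v c =>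
      simp only [P₁, LinearMap.comp_apply, TensorProduct.map_tmul, LinearMap.id_apply]
      generalize τ n = t
      induction t using Coact.ind with
      | add a b ha hb => simp only [LinearMap.map_add, LinearEquiv.map_add,
          ha, hb, TensorProduct.tmul_add,
          LinearMap.comp_add, LinearMap.add_comp, TensorProduct.map_add_right, LinearMap.add_apply]
      | tmul w b =>
        simp only [TensorProduct.map_tmul, TensorProduct.tensorTensorTensorComm_tmul,
          LinearMap.comp_apply, LinearMap.id_apply, LinearEquiv.coe_coe, Coact.actMap_tmul]
        generalize ρ v = r
        induction r using Coact.ind with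
        | add a b ha hb => simp only [LinearMap.map_add, LinearEquiv.map_add,
            ha, hb, TensorProduct.add_tmul]
        | tmul v a => simp [J, h3]
  have e2 : ∀ s : V ⊗[k] H, Coact.tensor (LinearMap.mul' k H ∘ₗ
        TensorProduct.map f'.toLinearMap g'.toLinearMap) (Coact.push φ.toLinearMap τ) ρ
        (TensorProduct.comm k V W (TensorProduct.map LinearMap.id
          ((actW.comp (ζ : H →ₐ[k] H)).toLinearMap.flip n) s)) =
      J (TensorProduct.map LinearMap.id P₂
        (TensorProduct.assoc k V H H (TensorProduct.map ρ LinearMap.id s))) := by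
    intro s
    induction s using Coact.ind with
    | add a b ha hb => simp only [LinearMap.map_add, LinearEquiv.map_add, ha, hb]
    | tmul v c =>
      simp only [TensorProduct.map_tmul, TensorProduct.comm_tmul, LinearMap.id_apply,
        Coact.tensor, LinearMap.comp_apply, LinearEquiv.coe_coe, Coact.push_apply]
      generalize ρ v = r
      induction r using Coact.ind with
      | add a b ha hb => simp only [LinearMap.map_add, LinearEquiv.map_add,
          ha, hb, TensorProduct.add_tmul,
          TensorProduct.tmul_add]
      | tmul v a =>
        simp only [P₂, LinearMap.comp_apply, TensorProduct.map_tmul, LinearMap.id_apply,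
          TensorProduct.assoc_tmul, LinearEquiv.coe_coe, LinearMap.flip_apply,
          TensorProduct.mk_apply, TensorProduct.lift.tmul]
        have : (actW.comp (ζ : H →ₐ[k] H)).toLinearMap c n =
          actW.toLinearMap ((ζ : H →ₗ[k] H) c) n := rfl
        rw [this]
        generalize τ (actW.toLinearMap ((ζ : H →ₗ[k] H) c) n) = t
        induction t using Coact.ind with
        | add a b ha hb => simp only [LinearMap.map_add, LinearEquiv.map_add,
            ha, hb, TensorProduct.add_tmul,
            TensorProduct.tmul_add]
        | tmul w b => simp [J, h1, h2]
  have e3 : Coact.tensor (LinearMap.mul' k H ∘ₗ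
        TensorProduct.map f.toLinearMap g.toLinearMap) ρ τ (m ⊗ₜ n) =
      TensorProduct.map LinearMap.id (LinearMap.mul' k H ∘ₗ
        TensorProduct.map f.toLinearMap g.toLinearMap)
        (TensorProduct.tensorTensorTensorComm k V H W H (ρ m ⊗ₜ τ n)) := by simp [Coact.tensor]
  rw [e3, e1, Coact.actMap_tmul, e2, h.coassoc, Coact.map_map, Coact.map_map, hP]

/-- the bijection `v ⊗ w ↦ ζ(v₁) · w ⊗ v₀` -/
noncomputable def braid {ρ : V →ₗ[k] V ⊗[k] H}
    (h : Coact.IsCoaction (cm k H) Coalgebra.counit ρ) (actW : H →ₐ[k] Module.End k W)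
    (ζ : H →ₐ[k] H) : V ⊗[k] W ≃ₗ[k] W ⊗[k] V :=
  LinearEquiv.ofBijective ((TensorProduct.comm k V W).toLinearMap ∘ₗ
      Coact.actMap (actW.comp ζ).toLinearMap ρ) (by
    have e1 : ∀ c : H, (LinearMap.mul' k (Module.End k W) ∘ₗ TensorProduct.map
        ((actW.comp ζ).toLinearMap ∘ₗ HopfAlgebra.antipode k) (actW.comp ζ).toLinearMap ∘ₗ
          cm k H) c = (Coalgebra.counit c : k) • 1 := by
      intro c
      have := congrArg (actW.comp ζ) (HopfAlgebra.mul_antipode_rTensor_comul_apply (R := k) c)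
      rw [AlgHom.commutes, Algebra.algebraMap_eq_smul_one] at this
      rw [← this]
      simp only [LinearMap.comp_apply]
      generalize cm k H c = p
      induction p using Coact.ind with
      | add a b ha hb => simp only [ map_add, ha, hb]
      | tmul x y => simp
    have e2 : ∀ c : H, (LinearMap.mul' k (Module.End k W) ∘ₗ TensorProduct.map
        (actW.comp ζ).toLinearMap ((actW.comp ζ).toLinearMap ∘ₗ HopfAlgebra.antipode k) ∘ₗ
          cm k H) c = (Coalgebra.counit c : k) • 1 := by
      intro c
      have := congrArg (actW.comp ζ) (HopfAlgebra.mul_antipode_lTensor_comul_apply (R := k) c)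
      rw [AlgHom.commutes, Algebra.algebraMap_eq_smul_one] at this
      rw [← this]
      simp only [LinearMap.comp_apply]
      generalize cm k H c = p
      induction p using Coact.ind with
      | add a b ha hb => simp only [ map_add, ha, hb]
      | tmul x y => simp
    rw [LinearMap.coe_comp]
    refine (TensorProduct.comm k V W).bijective.comp
      (Function.bijective_iff_has_inverse.2
        ⟨Coact.actMap ((actW.comp ζ).toLinearMap ∘ₗ HopfAlgebra.antipode k) ρ,
          fun x => ?_, fun x => ?_⟩)
    · rw [Coact.actMap_actMap h, Coact.actMap_counit h e1]
    · rw [Coact.actMap_actMap h, Coact.actMap_counit h e2])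

end YD

/-- The group of Hopf algebra automorphisms of `H` (under composition); a bialgebra automorphism of
a Hopf algebra commutes with the antipode. -/
noncomputable instance bialgAutGroup {k : Type u} [Field k] {H : Type v} [Ring H]
    [HopfAlgebra k H] : Group (H ≃ₐc[k] H) where
  mul f g := g.trans f
  one := BialgEquiv.refl k H
  inv f := f.symm
  mul_assoc _ _ _ := rfl
  one_mul _ := rfl
  mul_one _ := rfl
  inv_mul_cancel f := BialgEquiv.ext fun x => f.symm_apply_apply x

section

variable {k : Type u} [Field k] {H : Type v} [Ring H] [HopfAlgebra k H]

@[simp] theorem bialgAut_mul_apply (f g : H ≃ₐc[k] H) (x : H) : (f * g) x = f (g x) := rfl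
@[simp] theorem bialgAut_one_apply (x : H) : (1 : H ≃ₐc[k] H) x = x := rfl
@[simp] theorem bialgAut_inv_apply (f : H ≃ₐc[k] H) (x : H) : f⁻¹ (f x) = x :=
  f.symm_apply_apply x
@[simp] theorem bialgAut_apply_inv (f : H ≃ₐc[k] H) (x : H) : f (f⁻¹ x) = x :=
  f.apply_symm_apply x

/-- a Hopf algebra automorphism as an algebra map -/
@[reducible] noncomputable def bialgAutAlgHom (f : H ≃ₐc[k] H) : H →ₐ[k] H := ((f : H →ₐc[k] H) : H →ₐ[k] H)

/-- a Hopf algebra automorphism as a linear map -/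
@[reducible] noncomputable def bialgAutLin (f : H ≃ₐc[k] H) : H →ₗ[k] H := (bialgAutAlgHom f).toLinearMap

end

/-- The set `Aut_Hopf(H) × Aut_Hopf(H)`. -/
@[ext]
structure AutPair (k : Type u) [Field k] (H : Type v) [Ring H] [HopfAlgebra k H] where
  fst : H ≃ₐc[k] H
  snd : H ≃ₐc[k] H

namespace AutPair

variable {k : Type u} [Field k] {H : Type v} [Ring H] [HopfAlgebra k H]

/-- The group structure `(α, β) * (γ, δ) = (δ α δ⁻¹ γ, δ β)`. -/
noncomputable instance : Group (AutPair k H) where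
  mul a b := ⟨b.snd * a.fst * b.snd⁻¹ * b.fst, b.snd * a.snd⟩
  one := ⟨1, 1⟩
  inv a := ⟨a.snd⁻¹ * a.fst⁻¹ * a.snd, a.snd⁻¹⟩
  mul_assoc a b c := AutPair.ext
    (show c.snd * (b.snd * a.fst * b.snd⁻¹ * b.fst) * c.snd⁻¹ * c.fst =
      (c.snd * b.snd) * a.fst * (c.snd * b.snd)⁻¹ * (c.snd * b.fst * c.snd⁻¹ * c.fst) by group)
    (mul_assoc c.snd b.snd a.snd).symm
  one_mul a := AutPair.ext (show a.snd * 1 * a.snd⁻¹ * a.fst = a.fst by group) (mul_one _)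
  mul_one a := AutPair.ext (show 1 * a.fst * 1⁻¹ * 1 = a.fst by group) (one_mul _)
  inv_mul_cancel a := AutPair.ext
    (show a.snd * (a.snd⁻¹ * a.fst⁻¹ * a.snd) * a.snd⁻¹ * a.fst = 1 by group)
    (mul_inv_cancel a.snd)

theorem mul_fst (a b : AutPair k H) : (a * b).fst = b.snd * a.fst * b.snd⁻¹ * b.fst := rfl
theorem mul_snd (a b : AutPair k H) : (a * b).snd = b.snd * a.snd := rfl
theorem one_fst : (1 : AutPair k H).fst = 1 := rfl
theorem one_snd : (1 : AutPair k H).snd = 1 := rfl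
theorem inv_fst (a : AutPair k H) : (a⁻¹).fst = a.snd⁻¹ * a.fst⁻¹ * a.snd := rfl
theorem inv_snd (a : AutPair k H) : (a⁻¹).snd = a.snd⁻¹ := rfl

end AutPair

/-- An `(α, β)`-Yetter-Drinfeld module over `H`, with `(α, β) = deg`: a left `H`-module and right
`H`-comodule with `h₁ · v₀ ⊗ β(h₂) v₁ = (h₂ · v)₀ ⊗ (h₂ · v)₁ α(h₁)`. -/
structure YDModule (k : Type u) [Field k] (H : Type v) [Ring H] [HopfAlgebra k H] where
  deg : AutPair k H
  V : Type u
  [addCommGroup : AddCommGroup V]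
  [module : Module k V]
  act : H →ₐ[k] Module.End k V
  coact : V →ₗ[k] V ⊗[k] H
  isCoaction : Coact.IsCoaction Coalgebra.comul Coalgebra.counit coact
  compat : YD.left (bialgAutLin deg.snd) act.toLinearMap coact =
    YD.right (bialgAutLin deg.fst) act.toLinearMap coact

namespace YDModule

attribute [instance] YDModule.addCommGroup YDModule.module

variable {k : Type u} [Field k] {H : Type v} [Ring H] [HopfAlgebra k H]

/-- Morphisms exist only between modules of the same degree, and are the linear and colinear
maps. -/
@[ext]
structure Hom (X Y : YDModule k H) where
  deg_eq : X.deg = Y.deg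
  lin : X.V →ₗ[k] Y.V
  linear : ∀ h x, lin (X.act h x) = Y.act h (lin x)
  colinear : ∀ x, TensorProduct.map lin LinearMap.id (X.coact x) = Y.coact (lin x)

instance instCategory : Category (YDModule k H) where
  Hom := Hom
  id X := ⟨rfl, LinearMap.id, fun _ _ => rfl, fun x => by simp⟩
  comp f g := ⟨f.deg_eq.trans g.deg_eq, g.lin ∘ₗ f.lin,
    fun h x => by rw [LinearMap.comp_apply, f.linear, g.linear, LinearMap.comp_apply],
    fun x => by
      rw [LinearMap.comp_apply, ← g.colinear, ← f.colinear, Coact.map_map, LinearMap.id_comp]⟩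

@[ext] theorem hom_ext {X Y : YDModule k H} {f g : X ⟶ Y} (h : f.lin = g.lin) : f = g := Hom.ext h

@[simp] theorem id_lin (X : YDModule k H) : Hom.lin (𝟙 X) = LinearMap.id := rfl
@[simp] theorem comp_lin {X Y Z : YDModule k H} (f : X ⟶ Y) (g : Y ⟶ Z) :
    (f ≫ g).lin = g.lin ∘ₗ f.lin := rfl

theorem deg_eq {X Y : YDModule k H} (f : X ⟶ Y) : X.deg = Y.deg := f.deg_eq

/-- A bijective morphism is an isomorphism. -/
def isoMk {X Y : YDModule k H} (h : X.deg = Y.deg) (e : X.V ≃ₗ[k] Y.V)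
    (hl : ∀ h x, e (X.act h x) = Y.act h (e x))
    (hc : ∀ x, TensorProduct.map e.toLinearMap LinearMap.id (X.coact x) = Y.coact (e x)) :
    X ≅ Y where
  hom := ⟨h, e.toLinearMap, hl, hc⟩
  inv := ⟨h.symm, e.symm.toLinearMap, fun h y => by
    obtain ⟨x, rfl⟩ := e.surjective y
    rw [← hl]
    simp, fun y => by
    obtain ⟨x, rfl⟩ := e.surjective y
    rw [← hc, Coact.map_map]
    simp⟩
  hom_inv_id := by ext; simp
  inv_hom_id := by ext; simp

theorem mk_eq {V : Type u} [AddCommGroup V] [Module k V] {a b : AutPair k H} (h : a = b)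
    {ac ac' : H →ₐ[k] Module.End k V} {ρ τ : V →ₗ[k] V ⊗[k] H} (h1 h2 h3 h4)
    (ea : ac = ac') (e : ρ = τ) :
    (⟨a, V, ac, ρ, h1, h2⟩ : YDModule k H) = ⟨b, V, ac', τ, h3, h4⟩ := by
  subst h ea e
  rfl

theorem eqToHom_lin {V : Type u} [AddCommGroup V] [Module k V] {a b : AutPair k H}
    {ac ac' : H →ₐ[k] Module.End k V} {ρ τ : V →ₗ[k] V ⊗[k] H} (h1 h2 h3 h4)
    (h : (⟨a, V, ac, ρ, h1, h2⟩ : YDModule k H) = ⟨b, V, ac', τ, h3, h4⟩) :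
    Hom.lin (eqToHom h) = (LinearMap.id : V →ₗ[k] V) := by
  have e1 : a = b := congrArg YDModule.deg h
  subst e1
  have e2 : ac = ac' ∧ ρ = τ := by simpa using h
  obtain ⟨rfl, rfl⟩ := e2
  rfl

theorem heq_of_lin {X Y X' Y' : YDModule k H} (hX : X = X') (hY : Y = Y') (f : X ⟶ Y)
    (g : X' ⟶ Y') {i : X.V →ₗ[k] X'.V} {j : Y'.V →ₗ[k] Y.V} (hi : Hom.lin (eqToHom hX) = i)
    (hj : Hom.lin (eqToHom hY.symm) = j) (h : f.lin = j ∘ₗ g.lin ∘ₗ i) : f ≍ g := by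
  rw [← conj_eqToHom_iff_heq f g hX hY]
  refine hom_ext ?_
  rw [comp_lin, comp_lin, h, hi, hj]
  rfl

/-- the bilinear form of multiplication used for coactions: `x ⊗ y ↦ f(x) g(y)` -/
@[reducible] noncomputable def mulMap (f g : H ≃ₐc[k] H) : H ⊗[k] H →ₗ[k] H :=
  LinearMap.mul' k H ∘ₗ TensorProduct.map (bialgAutLin f) (bialgAutLin g)

theorem comul_aut (f : H ≃ₐc[k] H) (x : H) :
    TensorProduct.map (bialgAutLin f) (bialgAutLin f) (YD.cm k H x) = YD.cm k H (f x) :=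
  CoalgHomClass.map_comp_comul_apply f x

theorem counit_aut (f : H ≃ₐc[k] H) (x : H) :
    Coalgebra.counit (R := k) (f x) = Coalgebra.counit (R := k) x :=
  CoalgHomClass.counit_comp_apply f x

theorem mulMap_comul (f g : H ≃ₐc[k] H) :
    TensorProduct.map (mulMap f g) (mulMap f g) ∘ₗ Coact.tensorComul (YD.cm k H) (YD.cm k H) =
      YD.cm k H ∘ₗ mulMap f g := by
  refine TensorProduct.ext' fun x y => ?_
  have e : YD.cm k H (mulMap f g (x ⊗ₜ y)) = YD.cm k H (f x) * YD.cm k H (g y) := by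
    simp [mulMap, Bialgebra.comul_mul]
  rw [LinearMap.comp_apply, LinearMap.comp_apply, e, ← comul_aut, ← comul_aut]
  simp only [Coact.tensorComul, LinearMap.comp_apply, TensorProduct.map_tmul]
  generalize YD.cm k H x = p
  generalize YD.cm k H y = q
  induction p using Coact.ind with
  | add a b ha hb => simp only [LinearMap.map_add, LinearEquiv.map_add,
      ha, hb, TensorProduct.add_tmul, add_mul]
  | tmul a b =>
  induction q using Coact.ind with
  | add a b ha hb => simp only [LinearMap.map_add, LinearEquiv.map_add,
      ha, hb, TensorProduct.tmul_add, mul_add]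
  | tmul c d => simp [mulMap]

theorem mulMap_counit (f g : H ≃ₐc[k] H) :
    (Coalgebra.counit : H →ₗ[k] k) ∘ₗ mulMap f g =
      Coact.tensorCounit Coalgebra.counit Coalgebra.counit := by
  refine TensorProduct.ext' fun x y => ?_
  simp [mulMap, Coact.tensorCounit, Bialgebra.counit_mul, counit_aut]

/-- The tensor product of `X` of degree `(α, β)` and `Y` of degree `(γ, δ)`: the action is
`h · (x ⊗ y) = h₂ · x ⊗ h₁ · y`, the coaction `x ⊗ y ↦ x₀ ⊗ y₀ ⊗ δ(x₁) δαδ⁻¹(y₁)`. -/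
@[reducible] noncomputable def tensorObj (X Y : YDModule k H) : YDModule k H where
  deg := X.deg * Y.deg
  V := X.V ⊗[k] Y.V
  act := YD.tensorAct X.act Y.act
  coact := Coact.tensor (mulMap Y.deg.snd (Y.deg.snd * X.deg.fst * Y.deg.snd⁻¹)) X.coact Y.coact
  isCoaction := Coact.tensor_isCoaction (mulMap_comul _ _) (mulMap_counit _ _)
    X.isCoaction Y.isCoaction
  compat := YD.compat_tensor X.compat Y.compat
    (fun x => by simp) (fun x => by simp [AutPair.mul_fst]) (fun x => by simp [AutPair.mul_snd])

variable (k H) in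
/-- The ground field with the trivial action and coaction, of degree `(id, id)`. -/
@[reducible] noncomputable def unitObj : YDModule k H where
  deg := 1
  V := k
  act := (Algebra.ofId k (Module.End k k)).comp (Bialgebra.counitAlgHom k H)
  coact := Coact.unit 1
  isCoaction := Coact.unit_isCoaction (by simp [Algebra.TensorProduct.one_def]) (by simp)
  compat := by
    refine TensorProduct.ext' fun h r => ?_
    have e1 : ∀ p : H ⊗[k] H, TensorProduct.map (TensorProduct.lift ((Algebra.ofId k
        (Module.End k k)).comp (Bialgebra.counitAlgHom k H)).toLinearMap)
        (LinearMap.mul' k H ∘ₗ TensorProduct.map LinearMap.id LinearMap.id)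
        (TensorProduct.tensorTensorTensorComm k H H k H (p ⊗ₜ (r ⊗ₜ 1))) =
        TensorProduct.map (r • LinearMap.id) LinearMap.id
          (TensorProduct.map Coalgebra.counit LinearMap.id p) := by
      intro p
      induction p using Coact.ind with
      | add a b ha hb => simp only [LinearMap.map_add, LinearEquiv.map_add,
          ha, hb, TensorProduct.add_tmul]
      | tmul x y => simp [Algebra.ofId_apply, Algebra.algebraMap_eq_smul_one, mul_comm]
    have e2 : ∀ p : H ⊗[k] H, YD.mulIn LinearMap.id (TensorProduct.map LinearMap.id
        (Coact.unit (1 : H) ∘ₗ TensorProduct.lift ((Algebra.ofId k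
        (Module.End k k)).comp (Bialgebra.counitAlgHom k H)).toLinearMap)
        (TensorProduct.assoc k H H k (p ⊗ₜ r))) =
        TensorProduct.map (r • LinearMap.id) LinearMap.id
          (TensorProduct.comm k H k (TensorProduct.map LinearMap.id Coalgebra.counit p)) := by
      intro p
      induction p using Coact.ind with
      | add a b ha hb => simp only [LinearMap.map_add, LinearEquiv.map_add,
          ha, hb, TensorProduct.add_tmul]
      | tmul x y =>
        simp [Algebra.ofId_apply, Algebra.algebraMap_eq_smul_one, mul_comm, Coact.unit]
    have h1 : TensorProduct.map (Coalgebra.counit (R := k) (A := H)) LinearMap.id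
      (YD.cm k H h) = 1 ⊗ₜ h := Coalgebra.rTensor_counit_comul h
    have h2 : TensorProduct.map LinearMap.id (Coalgebra.counit (R := k) (A := H))
      (YD.cm k H h) = h ⊗ₜ 1 := Coalgebra.lTensor_counit_comul h
    have e1' := e1 (YD.cm k H h)
    have e2' := e2 (YD.cm k H h)
    rw [h1] at e1'
    rw [h2] at e2'
    exact e1'.trans (Eq.trans (by simp) e2'.symm)

/-- the tensor product of two morphisms -/
noncomputable def tensorHom {X Y X' Y' : YDModule k H} (f : X ⟶ X') (g : Y ⟶ Y') :
    tensorObj X Y ⟶ tensorObj X' Y' :=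
  ⟨congrArg₂ (· * ·) f.deg_eq g.deg_eq, TensorProduct.map f.lin g.lin, fun h x => by
    have e : ∀ p : H ⊗[k] H, ∀ (v : X.V) (w : Y.V), TensorProduct.map f.lin g.lin
        (TensorProduct.comm k Y.V X.V (TensorProduct.map (Y.act.toLinearMap.flip w)
          (X.act.toLinearMap.flip v) p)) =
        TensorProduct.comm k Y'.V X'.V (TensorProduct.map (Y'.act.toLinearMap.flip (g.lin w))
          (X'.act.toLinearMap.flip (f.lin v)) p) := by
      intro p v w
      induction p using Coact.ind with
      | add a b ha hb => simp only [LinearMap.map_add, LinearEquiv.map_add, ha, hb]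
      | tmul x y => simp [f.linear, g.linear]
    induction x using Coact.ind with
    | add a b ha hb => simp only [LinearMap.map_add, LinearEquiv.map_add, ha, hb]
    | tmul v w =>
      rw [TensorProduct.map_tmul, YD.tensorAct_apply, YD.tensorAct_apply, e], by
    have h1 := f.deg_eq
    have h2 := g.deg_eq
    exact Coact.tensor_map (κ₁ := LinearMap.id) (κ₂ := LinearMap.id)
      (fun c d => by rw [h1, h2]; rfl) f.colinear g.colinear⟩

theorem assoc_linear (X Y Z : YDModule k H) (h : H) (x : (X.V ⊗[k] Y.V) ⊗[k] Z.V) :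
    TensorProduct.assoc k X.V Y.V Z.V (YD.tensorAct (YD.tensorAct X.act Y.act) Z.act h x) =
      YD.tensorAct X.act (YD.tensorAct Y.act Z.act) h (TensorProduct.assoc k X.V Y.V Z.V x) := by
  induction x using Coact.ind with
  | add a b ha hb => simp only [LinearMap.map_add, LinearEquiv.map_add, ha, hb]
  | tmul x z =>
  induction x using Coact.ind with
  | add a b ha hb => simp only [LinearMap.map_add, LinearEquiv.map_add,
      ha, hb, TensorProduct.add_tmul]
  | tmul x y =>
    let L : H ⊗[k] (H ⊗[k] H) →ₗ[k] X.V ⊗[k] (Y.V ⊗[k] Z.V) :=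
      (TensorProduct.comm k _ _).toLinearMap ∘ₗ TensorProduct.map
        ((TensorProduct.comm k _ _).toLinearMap ∘ₗ TensorProduct.map (Z.act.toLinearMap.flip z)
          (Y.act.toLinearMap.flip y)) (X.act.toLinearMap.flip x) ∘ₗ
        (TensorProduct.assoc k H H H).symm.toLinearMap
    have e1 : ∀ p : H ⊗[k] H, TensorProduct.assoc k X.V Y.V Z.V (TensorProduct.comm k _ _
        (TensorProduct.map (Z.act.toLinearMap.flip z)
          ((YD.tensorAct X.act Y.act).toLinearMap.flip (x ⊗ₜ y)) p)) =
        L (TensorProduct.map LinearMap.id (YD.cm k H) p) := by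
      intro p
      induction p using Coact.ind with
      | add a b ha hb => simp only [LinearMap.map_add, LinearEquiv.map_add, ha, hb]
      | tmul a b =>
        simp only [TensorProduct.map_tmul, LinearMap.flip_apply, AlgHom.toLinearMap_apply,
          YD.tensorAct_apply, LinearMap.id_apply]
        generalize YD.cm k H b = q
        induction q using Coact.ind with
        | add a b ha hb => simp only [LinearMap.map_add, LinearEquiv.map_add,
            ha, hb, TensorProduct.tmul_add]
        | tmul c d => simp [L]
    have e2 : ∀ p : H ⊗[k] H, TensorProduct.comm k _ _
        (TensorProduct.map ((YD.tensorAct Y.act Z.act).toLinearMap.flip (y ⊗ₜ z))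
          (X.act.toLinearMap.flip x) p) =
        L (TensorProduct.assoc k H H H (TensorProduct.map (YD.cm k H) LinearMap.id p)) := by
      intro p
      induction p using Coact.ind with
      | add a b ha hb => simp only [LinearMap.map_add, LinearEquiv.map_add, ha, hb]
      | tmul a b =>
        simp only [TensorProduct.map_tmul, LinearMap.flip_apply, AlgHom.toLinearMap_apply,
          YD.tensorAct_apply, LinearMap.id_apply]
        generalize YD.cm k H a = q
        induction q using Coact.ind with
        | add a b ha hb => simp only [LinearMap.map_add, LinearEquiv.map_add,
            ha, hb, TensorProduct.add_tmul,
            TensorProduct.tmul_add]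
        | tmul c d => simp [L]
    have C : TensorProduct.assoc k H H H (TensorProduct.map (YD.cm k H) LinearMap.id
      (YD.cm k H h)) = TensorProduct.map LinearMap.id (YD.cm k H) (YD.cm k H h) :=
        Coalgebra.coassoc_apply h
    rw [TensorProduct.assoc_tmul, YD.tensorAct_apply, YD.tensorAct_apply, e1, e2, C]

theorem lid_linear (X : YDModule k H) (h : H) (x : k ⊗[k] X.V) :
    TensorProduct.lid k X.V (YD.tensorAct (unitObj k H).act X.act h x) =
      X.act h (TensorProduct.lid k X.V x) := by
  induction x using Coact.ind with
  | add a b ha hb => simp only [LinearMap.map_add, LinearEquiv.map_add, ha, hb]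
  | tmul r x =>
    have e1 : ∀ p : H ⊗[k] H, TensorProduct.lid k X.V (TensorProduct.comm k _ _
        (TensorProduct.map (X.act.toLinearMap.flip x)
          ((unitObj k H).act.toLinearMap.flip r) p)) =
        r • X.act (TensorProduct.rid k H (TensorProduct.map LinearMap.id Coalgebra.counit p)) x := by
      intro p
      induction p using Coact.ind with
      | add a b ha hb => simp only [ map_add, ha, hb, LinearMap.add_apply, smul_add]
      | tmul a b =>
        simp [Algebra.ofId_apply, Algebra.algebraMap_eq_smul_one, mul_comm, smul_smul]
    have h2 : TensorProduct.map LinearMap.id (Coalgebra.counit (R := k) (A := H))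
      (YD.cm k H h) = h ⊗ₜ 1 := Coalgebra.lTensor_counit_comul h
    rw [YD.tensorAct_apply, e1, h2]
    simp

theorem rid_linear (X : YDModule k H) (h : H) (x : X.V ⊗[k] k) :
    TensorProduct.rid k X.V (YD.tensorAct X.act (unitObj k H).act h x) =
      X.act h (TensorProduct.rid k X.V x) := by
  induction x using Coact.ind with
  | add a b ha hb => simp only [LinearMap.map_add, LinearEquiv.map_add, ha, hb]
  | tmul x r =>
    have e1 : ∀ p : H ⊗[k] H, TensorProduct.rid k X.V (TensorProduct.comm k _ _
        (TensorProduct.map ((unitObj k H).act.toLinearMap.flip r)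
          (X.act.toLinearMap.flip x) p)) =
        r • X.act (TensorProduct.lid k H (TensorProduct.map Coalgebra.counit LinearMap.id p)) x := by
      intro p
      induction p using Coact.ind with
      | add a b ha hb => simp only [ map_add, ha, hb, LinearMap.add_apply, smul_add]
      | tmul a b =>
        simp [Algebra.ofId_apply, Algebra.algebraMap_eq_smul_one, mul_comm, smul_smul]
    have h2 : TensorProduct.map (Coalgebra.counit (R := k) (A := H)) LinearMap.id
      (YD.cm k H h) = 1 ⊗ₜ h := Coalgebra.rTensor_counit_comul h
    rw [YD.tensorAct_apply, e1, h2]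
    simp

/-- The monoidal structure, with the constraints of vector spaces. -/
noncomputable instance monoidal : MonoidalCategory (YDModule k H) :=
  letI : MonoidalCategoryStruct (YDModule k H) :=
    { tensorObj := tensorObj
      tensorHom := tensorHom
      whiskerLeft := fun X _ _ f => tensorHom (𝟙 X) f
      whiskerRight := fun f Y => tensorHom f (𝟙 Y)
      tensorUnit := unitObj k H
      associator := fun X Y Z => isoMk (mul_assoc _ _ _) (TensorProduct.assoc k X.V Y.V Z.V)
        (assoc_linear X Y Z)
        (Coact.tensor_assoc fun c d f => by
          simp [AutPair.mul_fst, AutPair.mul_snd, mul_assoc])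
      leftUnitor := fun X => isoMk (one_mul _) (TensorProduct.lid k X.V) (lid_linear X)
        (Coact.tensor_unit_left (k := k) (e := (1 : H)) (τ := X.coact) fun d => by
          simp [AutPair.one_fst])
      rightUnitor := fun X => isoMk (mul_one _) (TensorProduct.rid k X.V) (rid_linear X)
        (Coact.tensor_unit_right (k := k) (e := (1 : H)) (ρ := X.coact) fun d => by
          simp [AutPair.one_snd]) }
  MonoidalCategory.ofTensorHom
    (id_tensorHom_id := fun _ _ => hom_ext TensorProduct.map_id)
    (id_tensorHom := fun _ _ _ _ => rfl)
    (tensorHom_id := fun _ _ => rfl)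
    (tensorHom_comp_tensorHom := fun f₁ f₂ g₁ g₂ =>
      hom_ext (TensorProduct.map_comp g₁.lin g₂.lin f₁.lin f₂.lin).symm)
    (associator_naturality := fun _ _ _ => hom_ext (TensorProduct.ext_threefold fun _ _ _ => rfl))
    (leftUnitor_naturality := fun f => hom_ext (TensorProduct.ext' fun r x =>
      (f.lin.map_smul (show k from r) x).symm))
    (rightUnitor_naturality := fun f => hom_ext (TensorProduct.ext' fun x r =>
      (f.lin.map_smul (show k from r) x).symm))
    (pentagon := fun _ _ _ _ => hom_ext (TensorProduct.ext_fourfold fun _ _ _ _ => rfl))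
    (triangle := fun _ _ => hom_ext (TensorProduct.ext_threefold fun x r y =>
      (TensorProduct.smul_tmul (show k from r) x y).symm))

/-- The module `ᵃX` for `a = (α, β)` and `X` of degree `(γ, δ)`: the space of `X` with the action
`h ⇀ x = α⁻¹β(h) · x` and the coaction `x ↦ x₀ ⊗ β⁻¹δαδ⁻¹(x₁)`. -/
@[reducible] noncomputable def conjObj (a : AutPair k H) (X : YDModule k H) : YDModule k H where
  deg := a * X.deg * a⁻¹
  V := X.V
  act := X.act.comp (bialgAutAlgHom (a.fst⁻¹ * a.snd))
  coact := Coact.push (bialgAutLin (a.snd⁻¹ * X.deg.snd * a.fst * X.deg.snd⁻¹)) X.coact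
  isCoaction := Coact.push_isCoaction (comul_aut _) (counit_aut _) X.isCoaction
  compat := YD.compat_conj X.compat
    (fun x => by simp [AutPair.mul_fst, AutPair.inv_fst, AutPair.inv_snd])
    (fun x => by simp [AutPair.mul_snd, AutPair.inv_snd])

theorem push_colinear {V W : Type u} [AddCommGroup V] [Module k V] [AddCommGroup W] [Module k W]
    {ρ : V →ₗ[k] V ⊗[k] H} {τ : W →ₗ[k] W ⊗[k] H} {f : V →ₗ[k] W} {g g' : H →ₗ[k] H}
    (e : g = g') (h : ∀ x, TensorProduct.map f LinearMap.id (ρ x) = τ (f x)) (x : V) :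
    TensorProduct.map f LinearMap.id (Coact.push g ρ x) = Coact.push g' τ (f x) := by
  subst e
  rw [Coact.push_apply, Coact.push_apply, ← h, Coact.map_map, Coact.map_map]
  rfl

/-- the conjugation functor, the identity on the underlying linear maps -/
noncomputable def conj (a : AutPair k H) : YDModule k H ⥤ YDModule k H where
  obj := conjObj a
  map {X Y} f := ⟨congrArg (fun c => a * c * a⁻¹) (deg_eq f), f.lin, fun h x => f.linear _ x,
    push_colinear (congrArg (fun c : AutPair k H =>
      bialgAutLin (a.snd⁻¹ * c.snd * a.fst * c.snd⁻¹)) (deg_eq f)) f.colinear⟩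
  map_id _ := rfl
  map_comp _ _ := rfl

theorem conjObj_one (X : YDModule k H) : conjObj 1 X = X := by
  refine mk_eq (by group) _ _ _ _ ?_ ?_
  · ext h : 1
    exact congrArg X.act (by simp [AutPair.one_fst, AutPair.one_snd])
  · ext x
    rw [Coact.push_apply]
    have : bialgAutLin ((1 : AutPair k H).snd⁻¹ * X.deg.snd * (1 : AutPair k H).fst *
        X.deg.snd⁻¹) = LinearMap.id := by
      ext y; simp [AutPair.one_fst, AutPair.one_snd]
    rw [this, TensorProduct.map_id, LinearMap.id_apply]

theorem conj_aut (b₁ b₂ a₁ a₂ c : H ≃ₐc[k] H) :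
    (b₂ * a₂)⁻¹ * c * (b₂ * a₁ * b₂⁻¹ * b₁) * c⁻¹ =
      (a₂⁻¹ * (b₂⁻¹ * (c * b₂)) * a₁ * (b₂⁻¹ * (c * b₂))⁻¹) * (b₂⁻¹ * c * b₁ * c⁻¹) := by
  group

theorem conj_aut_pair (a b c : AutPair k H) : (a * b).snd⁻¹ * c.snd * (a * b).fst * c.snd⁻¹ =
    (a.snd⁻¹ * (b * c * b⁻¹).snd * a.fst * (b * c * b⁻¹).snd⁻¹) *
      (b.snd⁻¹ * c.snd * b.fst * c.snd⁻¹) := by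
  rw [AutPair.mul_fst, AutPair.mul_snd, AutPair.mul_snd, AutPair.mul_snd, AutPair.inv_snd]
  exact conj_aut _ _ _ _ _

theorem bialgAutLin_mul (f g : H ≃ₐc[k] H) :
    bialgAutLin (f * g) = bialgAutLin f ∘ₗ bialgAutLin g := rfl

theorem conjObj_mul (a b : AutPair k H) (X : YDModule k H) :
    conjObj (a * b) X = conjObj a (conjObj b X) := by
  refine mk_eq (by group) _ _ _ _ ?_ ?_
  · refine AlgHom.ext fun h => congrArg X.act ?_
    have : (a * b).fst⁻¹ * (a * b).snd = (b.fst⁻¹ * b.snd) * (a.fst⁻¹ * a.snd) := by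
      rw [AutPair.mul_fst, AutPair.mul_snd]; group
    rw [this]; rfl
  · rw [conj_aut_pair, bialgAutLin_mul (a.snd⁻¹ * _ * _ * _), Coact.push_push]

theorem conjObj_unit (a : AutPair k H) : conjObj a (unitObj k H) = unitObj k H := by
  refine mk_eq (by group) _ _ _ _ ?_ ?_
  · refine AlgHom.ext fun h => congrArg (Algebra.ofId k (Module.End k k))
      (show Bialgebra.counitAlgHom k H ((a.fst⁻¹ * a.snd) h) = Bialgebra.counitAlgHom k H h from
        counit_aut _ h)
  · refine (Coact.push_unit _ _).trans (congrArg _ ?_)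
    exact map_one (bialgAutAlgHom _)

theorem conjObj_tensor (a : AutPair k H) (X Y : YDModule k H) :
    conjObj a (tensorObj X Y) = tensorObj (conjObj a X) (conjObj a Y) := by
  refine mk_eq (by group) _ _ _ _ ?_ ?_
  · refine AlgHom.ext fun h => TensorProduct.ext' fun x y => ?_
    have e : YD.tensorAct X.act Y.act ((a.fst⁻¹ * a.snd) h) (x ⊗ₜ y) =
        YD.tensorAct (X.act.comp (bialgAutAlgHom (a.fst⁻¹ * a.snd)))
          (Y.act.comp (bialgAutAlgHom (a.fst⁻¹ * a.snd))) h (x ⊗ₜ y) := by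
      rw [YD.tensorAct_apply, YD.tensorAct_apply, ← comul_aut, Coact.map_map]
      rfl
    exact e
  · refine Coact.push_tensor fun c d => ?_
    simp [AutPair.mul_fst, AutPair.mul_snd, AutPair.inv_fst, AutPair.inv_snd]

/-- The braiding `c_{X,Y}(x ⊗ y) = α⁻¹(x₁) · y ⊗ x₀` for `X` of degree `(α, β)`. -/
noncomputable def braiding (X Y : YDModule k H) :
    tensorObj X Y ≅ tensorObj (conjObj X.deg Y) X :=
  isoMk (show X.deg * Y.deg = X.deg * Y.deg * X.deg⁻¹ * X.deg by group)
    (YD.braid X.isCoaction Y.act (bialgAutAlgHom X.deg.fst⁻¹))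
    (YD.actMap_linear X.compat (fun x => by simp) (fun x => by simp))
    (YD.actMap_colinear (ζ := ((X.deg.fst⁻¹ : H ≃ₐc[k] H) : H →ₐc[k] H)) X.isCoaction Y.compat
      (fun x => by simp)
      (fun x => by simp [AutPair.mul_fst, AutPair.mul_snd, AutPair.inv_fst, AutPair.inv_snd])
      (fun x => by simp))

theorem braiding_naturality {X X' Y Y' : YDModule k H} (f : X ⟶ X') (g : Y ⟶ Y')
    (g' : conjObj X.deg Y ⟶ conjObj X.deg Y') (hg : g'.lin = g.lin)
    (h : tensorObj (conjObj X.deg Y') X' = tensorObj (conjObj X'.deg Y') X') :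
    (braiding X Y).hom ≫ tensorHom g' f ≫ eqToHom h = tensorHom f g ≫ (braiding X' Y').hom := by
  refine hom_ext ?_
  have e : Hom.lin (eqToHom h) = (LinearMap.id : Y'.V ⊗[k] X'.V →ₗ[k] Y'.V ⊗[k] X'.V) :=
    eqToHom_lin _ _ _ _ h
  rw [comp_lin, comp_lin, e]
  have e' : (tensorHom g' f).lin = TensorProduct.map g.lin f.lin :=
    congrArg (fun r => TensorProduct.map r f.lin) hg
  rw [e']
  refine TensorProduct.ext' fun x y => ?_
  have h0 := deg_eq f
  have h1 := Coact.actMap_map (l := (Y.act.comp (bialgAutAlgHom X.deg.fst⁻¹)).toLinearMap)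
    (l' := (Y'.act.comp (bialgAutAlgHom X'.deg.fst⁻¹)).toLinearMap) (κ := LinearMap.id)
    (g := g.lin) (fun c w => by rw [h0]; exact g.linear _ w) f.colinear (x ⊗ₜ y)
  exact (TensorProduct.map_comm g.lin f.lin _).trans (congrArg _ h1)

theorem braiding_tensor_left (X Y Z : YDModule k H)
    (h : tensorObj (conjObj (X.deg * Y.deg) Z) (tensorObj X Y) =
      tensorObj (conjObj X.deg (conjObj Y.deg Z)) (tensorObj X Y)) :
    Hom.lin ((braiding (tensorObj X Y) Z).hom ≫ eqToHom h) =
      (TensorProduct.assoc k Z.V X.V Y.V).toLinearMap ∘ₗ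
        TensorProduct.map (braiding X (conjObj Y.deg Z)).hom.lin LinearMap.id ∘ₗ
        (TensorProduct.assoc k X.V Z.V Y.V).symm.toLinearMap ∘ₗ
        TensorProduct.map LinearMap.id (braiding Y Z).hom.lin ∘ₗ
        (TensorProduct.assoc k X.V Y.V Z.V).toLinearMap := by
  have e : Hom.lin (eqToHom h) = (LinearMap.id : Z.V ⊗[k] (X.V ⊗[k] Y.V) →ₗ[k] _) :=
    eqToHom_lin _ _ _ _ h
  rw [comp_lin, e]
  refine TensorProduct.ext_threefold fun x y z => Coact.actMap_tensor_left
    (l₁ := ((conjObj Y.deg Z).act.comp (bialgAutAlgHom X.deg.fst⁻¹)).toLinearMap)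
    (l₂ := (Z.act.comp (bialgAutAlgHom Y.deg.fst⁻¹)).toLinearMap) (fun c d u => ?_) x y z
  simp [AutPair.mul_fst]

theorem braiding_tensor_right (X Y Z : YDModule k H)
    (h : tensorObj (conjObj X.deg (tensorObj Y Z)) X =
      tensorObj (tensorObj (conjObj X.deg Y) (conjObj X.deg Z)) X) :
    Hom.lin ((braiding X (tensorObj Y Z)).hom ≫ eqToHom h) =
      (TensorProduct.assoc k Y.V Z.V X.V).symm.toLinearMap ∘ₗ
        TensorProduct.map LinearMap.id (braiding X Z).hom.lin ∘ₗ
        (TensorProduct.assoc k Y.V X.V Z.V).toLinearMap ∘ₗ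
        TensorProduct.map (braiding X Y).hom.lin LinearMap.id ∘ₗ
        (TensorProduct.assoc k X.V Y.V Z.V).symm.toLinearMap := by
  have e : Hom.lin (eqToHom h) = (LinearMap.id : (Y.V ⊗[k] Z.V) ⊗[k] X.V →ₗ[k] _) :=
    eqToHom_lin _ _ _ _ h
  rw [comp_lin, e]
  exact TensorProduct.ext_threefold' fun x y z => YD.actMap_tensor_right X.isCoaction
    Y.act Z.act ((X.deg.fst⁻¹ : H ≃ₐc[k] H) : H →ₐc[k] H) x y z

theorem conj_braiding_lin (a : AutPair k H) (X Y : YDModule k H) :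
    (braiding (conjObj a X) (conjObj a Y)).hom.lin = (braiding X Y).hom.lin := by
  refine TensorProduct.ext' fun x y => ?_
  have h1 := Coact.actMap_map (l := (Y.act.comp (bialgAutAlgHom X.deg.fst⁻¹)).toLinearMap)
    (l' := ((conjObj a Y).act.comp (bialgAutAlgHom (conjObj a X).deg.fst⁻¹)).toLinearMap)
    (κ := bialgAutLin (a.snd⁻¹ * X.deg.snd * a.fst * X.deg.snd⁻¹)) (g := LinearMap.id)
    (ρ := X.coact) (ρ' := (conjObj a X).coact) (f := LinearMap.id)
    (fun c w => by simp [AutPair.mul_fst, AutPair.mul_snd, AutPair.inv_fst, AutPair.inv_snd])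
    (fun _ => rfl) (x ⊗ₜ y)
  rw [TensorProduct.map_id] at h1
  exact congrArg (TensorProduct.comm k X.V Y.V) h1.symm

theorem conj_braiding_obj (a : AutPair k H) (X Y : YDModule k H) :
    conjObj a (tensorObj (conjObj X.deg Y) X) =
      tensorObj (conjObj (a * X.deg * a⁻¹) (conjObj a Y)) (conjObj a X) := by
  have e : a * X.deg = a * X.deg * a⁻¹ * a := by group
  rw [conjObj_tensor, ← conjObj_mul, ← conjObj_mul, ← e]

theorem deg_tensor (X Y : YDModule k H) : (X ⊗ Y).deg = X.deg * Y.deg :=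
  show (tensorObj X Y).deg = X.deg * Y.deg from rfl

theorem deg_conj (a : AutPair k H) (X : YDModule k H) :
    ((conj a).obj X).deg = a * X.deg * a⁻¹ :=
  show (conjObj a X).deg = a * X.deg * a⁻¹ from rfl

theorem conj_one : conj (1 : AutPair k H) = 𝟭 (YDModule k H) :=
  CategoryTheory.Functor.hext conjObj_one fun X Y f =>
    heq_of_lin (conjObj_one X) (conjObj_one Y) _ _
      (eqToHom_lin (V := X.V) _ _ _ _ (conjObj_one X))
      (eqToHom_lin (V := Y.V) _ _ _ _ (Eq.symm (conjObj_one Y))) rfl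

theorem conj_mul (a b : AutPair k H) : conj (a * b) = conj b ⋙ conj a :=
  CategoryTheory.Functor.hext (conjObj_mul a b) fun X Y f =>
    heq_of_lin (conjObj_mul a b X) (conjObj_mul a b Y) _ _
      (eqToHom_lin (V := X.V) _ _ _ _ (conjObj_mul a b X))
      (eqToHom_lin (V := Y.V) _ _ _ _ (Eq.symm (conjObj_mul a b Y))) rfl

theorem conj_tensorHom (a : AutPair k H) {X Y X' Y' : YDModule k H} (f : X ⟶ X') (g : Y ⟶ Y') :
    (conj a).map (f ⊗ₘ g) ≍ ((conj a).map f ⊗ₘ (conj a).map g) :=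
  heq_of_lin (conjObj_tensor a X Y) (conjObj_tensor a X' Y') _ _
      (eqToHom_lin (V := X.V ⊗[k] Y.V) _ _ _ _ (conjObj_tensor a X Y))
      (eqToHom_lin (V := X'.V ⊗[k] Y'.V) _ _ _ _ (Eq.symm (conjObj_tensor a X' Y'))) rfl

theorem conjObj_tensor_left (a : AutPair k H) (X Y Z : YDModule k H) :
    conjObj a (tensorObj (tensorObj X Y) Z) =
      tensorObj (tensorObj (conjObj a X) (conjObj a Y)) (conjObj a Z) := by
  rw [conjObj_tensor, conjObj_tensor]

theorem conjObj_tensor_right (a : AutPair k H) (X Y Z : YDModule k H) :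
    conjObj a (tensorObj X (tensorObj Y Z)) =
      tensorObj (conjObj a X) (tensorObj (conjObj a Y) (conjObj a Z)) := by
  rw [conjObj_tensor, conjObj_tensor]

theorem conj_associator (a : AutPair k H) (X Y Z : YDModule k H) :
    (conj a).map (α_ X Y Z).hom ≍ (α_ ((conj a).obj X) ((conj a).obj Y) ((conj a).obj Z)).hom :=
  heq_of_lin (conjObj_tensor_left a X Y Z) (conjObj_tensor_right a X Y Z) _ _
      (eqToHom_lin (V := (X.V ⊗[k] Y.V) ⊗[k] Z.V) _ _ _ _ (conjObj_tensor_left a X Y Z))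
      (eqToHom_lin (V := X.V ⊗[k] (Y.V ⊗[k] Z.V)) _ _ _ _ (Eq.symm (conjObj_tensor_right a X Y Z))) rfl

theorem conjObj_unit_tensor (a : AutPair k H) (X : YDModule k H) :
    conjObj a (tensorObj (unitObj k H) X) = tensorObj (unitObj k H) (conjObj a X) := by
  rw [conjObj_tensor, conjObj_unit]

theorem conjObj_tensor_unit (a : AutPair k H) (X : YDModule k H) :
    conjObj a (tensorObj X (unitObj k H)) = tensorObj (conjObj a X) (unitObj k H) := by
  rw [conjObj_tensor, conjObj_unit]

theorem conj_leftUnitor (a : AutPair k H) (X : YDModule k H) :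
    (conj a).map (λ_ X).hom ≍ (λ_ ((conj a).obj X)).hom :=
  heq_of_lin (conjObj_unit_tensor a X) (rfl : conjObj a X = conjObj a X) _ _
      (eqToHom_lin (V := k ⊗[k] X.V) _ _ _ _ (conjObj_unit_tensor a X))
      (eqToHom_lin (V := X.V) _ _ _ _ (Eq.symm (rfl : conjObj a X = conjObj a X))) rfl

theorem conj_rightUnitor (a : AutPair k H) (X : YDModule k H) :
    (conj a).map (ρ_ X).hom ≍ (ρ_ ((conj a).obj X)).hom :=
  heq_of_lin (conjObj_tensor_unit a X) (rfl : conjObj a X = conjObj a X) _ _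
      (eqToHom_lin (V := X.V ⊗[k] k) _ _ _ _ (conjObj_tensor_unit a X))
      (eqToHom_lin (V := X.V) _ _ _ _ (Eq.symm (rfl : conjObj a X = conjObj a X))) rfl

set_option maxRecDepth 4000 in
theorem conj_braiding (a : AutPair k H) (X Y : YDModule k H) :
    (conj a).map (braiding X Y).hom ≍ (braiding ((conj a).obj X) ((conj a).obj Y)).hom :=
  heq_of_lin (conjObj_tensor a X Y) (conj_braiding_obj a X Y) _ _
      (eqToHom_lin (V := X.V ⊗[k] Y.V) _ _ _ _ (conjObj_tensor a X Y))
      (eqToHom_lin (V := Y.V ⊗[k] X.V) _ _ _ _ (Eq.symm (conj_braiding_obj a X Y))) (conj_braiding_lin a X Y).symm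

end YDModule

/-- The braided `T`-category of all `(α, β)`-Yetter-Drinfeld modules over `H`, the disjoint union
over `(α, β)` in the group `Aut_Hopf(H) × Aut_Hopf(H)`. -/
noncomputable def YDHat (k : Type u) [Field k] (H : Type v) [Ring H] [HopfAlgebra k H] :
    BraidedTCategory.{v, u, max (u + 1) v} (AutPair k H) where
  Obj := YDModule k H
  category := YDModule.instCategory
  monoidal := YDModule.monoidal
  deg := YDModule.deg
  deg_eq_of_hom := YDModule.deg_eq
  deg_tensor := YDModule.deg_tensor
  conj := YDModule.conj
  conj_one := YDModule.conj_one
  conj_mul := YDModule.conj_mul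
  deg_conj := YDModule.deg_conj
  conj_unit := YDModule.conjObj_unit
  conj_tensorObj := YDModule.conjObj_tensor
  conj_tensorHom := YDModule.conj_tensorHom
  conj_associator := YDModule.conj_associator
  conj_leftUnitor := YDModule.conj_leftUnitor
  conj_rightUnitor := YDModule.conj_rightUnitor
  braiding := YDModule.braiding
  braiding_naturality := fun f g => YDModule.braiding_naturality f g _ rfl _
  braiding_tensor_left := fun X Y Z => YDModule.hom_ext (YDModule.braiding_tensor_left X Y Z _)
  braiding_tensor_right := fun X Y Z => YDModule.hom_ext (YDModule.braiding_tensor_right X Y Z _)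
  conj_braiding := YDModule.conj_braiding

/-! ### The coquasitriangular crossed Turaev algebra `CT(H)` -/

namespace CT

section maps

variable {k : Type u} [Field k] {H : Type v} [Ring H] [HopfAlgebra k H]

/-- The convolution product of the dual of `H`: `(p q)(h) = p(h₁) q(h₂)`. -/
noncomputable def dualMul : Module.Dual k H ⊗[k] Module.Dual k H →ₗ[k] Module.Dual k H :=
  (Coalgebra.comul (R := k) (A := H)).dualMap ∘ₗ TensorProduct.dualDistrib k H H

/-- `p ↦ f p g` in the dual of `H` -/
noncomputable def dualSandwich (f g : Module.Dual k H) : Module.Dual k H →ₗ[k] Module.Dual k H :=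
  dualMul ∘ₗ (TensorProduct.mk k _ _).flip g ∘ₗ dualMul ∘ₗ TensorProduct.mk k _ _ f

/-- `h ↦ x h y` -/
noncomputable def sandwich (x y : H) : H →ₗ[k] H :=
  LinearMap.mulRight k y ∘ₗ LinearMap.mulLeft k x

variable (k H) in
/-- The inverse `S⁻¹` of the antipode; the antipode of a finite-dimensional Hopf algebra is
bijective, hence a unit of the ring of linear endomorphisms. -/
noncomputable def antipodeInv : H →ₗ[k] H :=
  Ring.inverse (HopfAlgebra.antipode k : Module.End k H)

theorem dualMul_apply (p q : Module.Dual k H) (h : H) :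
    dualMul (p ⊗ₜ q) h = LinearMap.mul' k k (TensorProduct.map p q (Coalgebra.comul h)) := by
  simp only [dualMul, LinearMap.comp_apply, LinearMap.dualMap_apply]
  generalize (Coalgebra.comul h : H ⊗[k] H) = t
  induction t using Coact.ind with
  | add a b ha hb => simp only [map_add, ha, hb]
  | tmul a b => simp

theorem dualSandwich_apply (f g p : Module.Dual k H) :
    dualSandwich f g p = dualMul (dualMul (f ⊗ₜ p) ⊗ₜ g) := rfl

theorem sandwich_apply (x y h : H) : sandwich (k := k) x y h = x * h * y := rfl

/-- the counit `ε(p ⋈ h) = p(1) ε(h)` -/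
noncomputable def counit : Module.Dual k H ⊗[k] H →ₗ[k] k :=
  LinearMap.mul' k k ∘ₗ TensorProduct.map (Module.Dual.eval k H 1) Coalgebra.counit

theorem counit_tmul (p : Module.Dual k H) (h : H) :
    counit (p ⊗ₜ[k] h) = p 1 * Coalgebra.counit (R := k) h := by
  simp [counit]

/-- the multiplication `(p ⋈ h)(q ⋈ h') = q p ⋈ δ(h) δαδ⁻¹(h')` for indices `a = (α, β)` and
`b = (γ, δ)` -/
noncomputable def mul (a b : AutPair k H) : (Module.Dual k H ⊗[k] H) ⊗[k] (Module.Dual k H ⊗[k] H)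
    →ₗ[k] Module.Dual k H ⊗[k] H :=
  TensorProduct.map (dualMul ∘ₗ (TensorProduct.comm k _ _).toLinearMap)
      (YDModule.mulMap b.snd (b.snd * a.fst * b.snd⁻¹)) ∘ₗ
    (TensorProduct.tensorTensorTensorComm k _ _ _ _).toLinearMap

theorem mul_tmul (a b : AutPair k H) (p q : Module.Dual k H) (h h' : H) :
    mul a b ((p ⊗ₜ h) ⊗ₜ (q ⊗ₜ h')) =
      dualMul (q ⊗ₜ p) ⊗ₜ (b.snd h * b.snd (a.fst (b.snd⁻¹ h'))) := by
  simp [mul]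

/-- the crossing `ψ_{(α,β)}(p ⋈ h) = p ∘ α⁻¹β ⋈ β⁻¹δαδ⁻¹(h)` from the component with index
`a = (γ, δ)`, for `c = (α, β)` -/
noncomputable def crossing (c a : AutPair k H) :
    Module.Dual k H ⊗[k] H →ₗ[k] Module.Dual k H ⊗[k] H :=
  TensorProduct.map (bialgAutLin (c.fst⁻¹ * c.snd)).dualMap
    (bialgAutLin (c.snd⁻¹ * a.snd * c.fst * a.snd⁻¹))

theorem crossing_tmul (c a : AutPair k H) (p : Module.Dual k H) (h : H) :
    crossing c a (p ⊗ₜ[k] h) =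
      (p ∘ₗ bialgAutLin (c.fst⁻¹ * c.snd)) ⊗ₜ[k] c.snd⁻¹ (a.snd (c.fst (a.snd⁻¹ h))) := rfl

/-- the form `σ(p ⋈ h, q ⋈ h') = p(δ⁻¹(h')) q(1) ε(h)` on the components with indices
`(α, β)` and `b = (γ, δ)` -/
noncomputable def sigma (b : AutPair k H) :
    (Module.Dual k H ⊗[k] H) ⊗[k] (Module.Dual k H ⊗[k] H) →ₗ[k] k :=
  LinearMap.mul' k k ∘ₗ
    TensorProduct.map
      (contractLeft k H ∘ₗ TensorProduct.map LinearMap.id (bialgAutLin b.snd⁻¹))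
      (LinearMap.mul' k k ∘ₗ TensorProduct.map Coalgebra.counit (Module.Dual.eval k H 1)) ∘ₗ
    (TensorProduct.tensorTensorTensorComm k _ _ _ _).toLinearMap ∘ₗ
    TensorProduct.map LinearMap.id (TensorProduct.comm k _ _).toLinearMap

theorem sigma_tmul (b : AutPair k H) (p q : Module.Dual k H) (h h' : H) :
    sigma b ((p ⊗ₜ h) ⊗ₜ (q ⊗ₜ h')) = p (b.snd⁻¹ h') * q 1 * Coalgebra.counit (R := k) h := by
  have e : sigma b ((p ⊗ₜ h) ⊗ₜ (q ⊗ₜ h')) =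
    p (b.snd⁻¹ h') * (Coalgebra.counit (R := k) h * q 1) := rfl
  rw [e]
  ring

variable [FiniteDimensional k H]

/-- The comultiplication `p ↦ p₁ ⊗ p₂` of the dual of `H`, with `p₁(x) p₂(y) = p(x y)`. -/
noncomputable def dualComul : Module.Dual k H →ₗ[k] Module.Dual k H ⊗[k] Module.Dual k H :=
  (TensorProduct.dualDistribEquiv k H H).symm.toLinearMap ∘ₗ (LinearMap.mul' k H).dualMap

theorem dualComul_apply (p : Module.Dual k H) (x y : H) :
    TensorProduct.dualDistrib k H H (dualComul p) (x ⊗ₜ y) = p (x * y) := by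
  have h : TensorProduct.dualDistrib k H H (dualComul p) = (LinearMap.mul' k H).dualMap p :=
    (TensorProduct.dualDistribEquiv k H H).apply_symm_apply _
  rw [h]
  simp

/-- The comultiplication of the diagonal crossed coproduct `H^{*op} ⋈ H(α, β)`, `a = (α, β)`:
`p ⋈ h ↦ ∑ (p₁ ⋈ β(hⱼ) h₁ S⁻¹(α(hᵢ))) ⊗ (hⁱ p₂ hʲ ⋈ h₂)` with dual bases `hᵢ`, `hⁱ`. -/
noncomputable def comul (a : AutPair k H) : Module.Dual k H ⊗[k] H →ₗ[k]
    (Module.Dual k H ⊗[k] H) ⊗[k] (Module.Dual k H ⊗[k] H) :=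
  (∑ i, ∑ j, TensorProduct.map
    (TensorProduct.map LinearMap.id
      (sandwich (a.snd (Module.finBasis k H j)) (antipodeInv k H (a.fst (Module.finBasis k H i)))))
    (TensorProduct.map
      (dualSandwich ((Module.finBasis k H).coord i) ((Module.finBasis k H).coord j))
      LinearMap.id)) ∘ₗ
  Coact.tensorComul dualComul Coalgebra.comul

/-- The antipode `S(p ⋈ h) = ∑ hⁱ S⁻¹*(p) S⁻¹*(hʲ) ⋈ β⁻¹(hⱼ) β⁻¹α⁻¹(S(h)) β⁻¹α⁻¹β(hᵢ)` on the
component with index `a = (α, β)`, with dual bases `hᵢ`, `hⁱ`. -/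
noncomputable def antipode (a : AutPair k H) :
    Module.Dual k H ⊗[k] H →ₗ[k] Module.Dual k H ⊗[k] H :=
  ∑ i, ∑ j, TensorProduct.map
    (dualSandwich ((Module.finBasis k H).coord i)
      ((antipodeInv k H).dualMap ((Module.finBasis k H).coord j)) ∘ₗ (antipodeInv k H).dualMap)
    (sandwich (a.snd⁻¹ (Module.finBasis k H j))
      ((a.snd⁻¹ * a.fst⁻¹ * a.snd) (Module.finBasis k H i)) ∘ₗ
        bialgAutLin (a.snd⁻¹ * a.fst⁻¹) ∘ₗ HopfAlgebra.antipode k)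

theorem antipode_tmul (a : AutPair k H) (p : Module.Dual k H) (h : H) :
    antipode a (p ⊗ₜ[k] h) = ∑ i, ∑ j,
      dualMul (dualMul ((Module.finBasis k H).coord i ⊗ₜ (p ∘ₗ antipodeInv k H)) ⊗ₜ
          ((Module.finBasis k H).coord j ∘ₗ antipodeInv k H)) ⊗ₜ[k]
        (a.snd⁻¹ (Module.finBasis k H j) * a.snd⁻¹ (a.fst⁻¹ (HopfAlgebra.antipode k h)) *
          a.snd⁻¹ (a.fst⁻¹ (a.snd (Module.finBasis k H i)))) := by
  simp only [antipode, LinearMap.sum_apply]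
  rfl

end maps

end CT

/-- The family `CT(H)` of the diagonal crossed coproducts `H^{*op} ⋈ H(α, β)`, with `H* ⊗ H` as
underlying spaces, with its multiplication, unit `ε ⋈ 1`, antipode, crossing and forms. -/
noncomputable def CT (k : Type u) [Field k] (H : Type v) [Ring H] [HopfAlgebra k H]
    [FiniteDimensional k H] : TuraevData.{v, max u v, u} k (AutPair k H) where
  C _ := Module.Dual k H ⊗[k] H
  comul := CT.comul
  counit _ := CT.counit
  mul := CT.mul
  one := (Coalgebra.counit : H →ₗ[k] k) ⊗ₜ 1
  antipode := CT.antipode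
  crossing := CT.crossing
  sigma _ := CT.sigma

/-!
For `H` of finite dimension, an element `t` of `CT(H)` is identified with the linear map
`x ↦ t(x)` on `H` that sends `p ⋈ h` to `x ↦ p(x) h` (`evalMap`). The structure maps of `CT(H)`
become formulas in opposite convolution products: for the product, the antipode and the crossing
these are `evalMap_mul_CT`, `evalMap_antipode_CT` and `evalMap_crossing_CT`, and for the
comultiplication in degree `(α, β)`

  `(Δ t)(x, y) = ∑ (β(y₃) ⊗ 1) Δ(t(x y₂)) (α(S⁻¹(y₁)) ⊗ 1)`   (`evalAt_comul_CT`).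

The dual bases of the definitions have disappeared. The laws of a coquasitriangular crossed Turaev
algebra are then identities between convolution products, and rest on three facts: convolution is
associative (`convWith_assoc`), a multiplicative map `φ` and `φ ∘ S⁻¹` are inverse to each other
for the opposite convolution (`convolveOp_comp_antipodeInv`), and `S⁻¹` reverses products and
coproducts. That `S` is bijective is itself proved here, from a nonzero integral in `H*`
(`exists_integral`, `antipode_injective`).

For a coaction `τ` of `CT(H)` on `V`, let `τₓ : V → V ⊗ H` be `τ` followed by evaluation at `x`.
Then `V` carries the action `x · v = (1 ⊗ ε) τₓ(v)` and the coaction `ρ = τ₁` of `H`. Evaluated at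
`x` and `y`, coassociativity of `τ` (`coassoc_iff`) says that
`(τₓ ⊗ 1) τ_y(v) = ∑ (β(y₃) ⊗ 1) Δ(τ_{x y₂}(v)) (α(S⁻¹(y₁)) ⊗ 1)`, with all products and `Δ` in the
factors `H`. Applying counits to it gives
`τ_{x y}(v) = x · τ_y(v)`, hence `τₓ(v) = x · v₀ ⊗ v₁` and the module law, and
`ρ(y · v) = ∑ y₂ · v₀ ⊗ β(y₃) v₁ α(S⁻¹(y₁))`. The latter is the Yetter-Drinfeld condition solved for
`ρ(y · v)` (`left_eq_right_iff`). Conversely the formula `τₓ(v) = x · v₀ ⊗ v₁` turns a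
Yetter-Drinfeld module into a comodule (`combinedCoact_isCoaction`). The two constructions are
mutually inverse, do not change linear maps, and match the unit objects, tensor products,
conjugations and braidings (`coactAt_tensor`, `inducedAct_tensor`, `coactAt_crossing`,
`inducedAct_crossing`, `pair_sigma`). So they are an isomorphism of braided `T`-categories
(`corepIso`).
-/

/-! ### Convolution along a bilinear map -/

section convolution

open Coalgebra

variable {k : Type*} [CommSemiring k] {C D : Type*} [AddCommMonoid C] [Module k C] [Coalgebra k C]
  [AddCommMonoid D] [Module k D] [Coalgebra k D]
  {M N P Q R S T U : Type*} [AddCommMonoid M] [Module k M] [AddCommMonoid N] [Module k N]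
  [AddCommMonoid P] [Module k P] [AddCommMonoid Q] [Module k Q] [AddCommMonoid R] [Module k R]
  [AddCommMonoid S] [Module k S] [AddCommMonoid T] [Module k T] [AddCommMonoid U] [Module k U]
  {N' Q' : Type*} [AddCommMonoid N'] [Module k N'] [AddCommMonoid Q'] [Module k Q']

/-- The convolution `c ↦ ∑ B(f(c₁), g(c₂))` of two linear maps on a coalgebra along a bilinear
map `B`. -/
noncomputable def convWith (B : M →ₗ[k] N →ₗ[k] P) (f : C →ₗ[k] M) (g : C →ₗ[k] N) : C →ₗ[k] P :=
  TensorProduct.lift (B.compl₁₂ f g) ∘ₗ comul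

theorem convWith_apply (B : M →ₗ[k] N →ₗ[k] P) (f : C →ₗ[k] M) (g : C →ₗ[k] N) (c : C) :
    convWith B f g c = TensorProduct.lift (B.compl₁₂ f g) (comul c) := rfl

/-- The image of a convolution under `φ` may be computed on the values of the two maps. The
bilinear map and both factors may change, as long as the values agree. -/
theorem comp_convWith {B : M →ₗ[k] N →ₗ[k] P} {B' : Q →ₗ[k] R →ₗ[k] S} {φ : P →ₗ[k] S}
    {f : C →ₗ[k] M} {g : C →ₗ[k] N} {f' : C →ₗ[k] Q} {g' : C →ₗ[k] R}
    (h : ∀ x y, φ (B (f x) (g y)) = B' (f' x) (g' y)) :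
    φ ∘ₗ convWith B f g = convWith B' f' g' := by
  have e : φ ∘ₗ TensorProduct.lift (B.compl₁₂ f g) = TensorProduct.lift (B'.compl₁₂ f' g') :=
    TensorProduct.ext' fun x y => by simpa using h x y
  rw [convWith, convWith, ← LinearMap.comp_assoc, e]

theorem add_convWith (B : M →ₗ[k] N →ₗ[k] P) (f f' : C →ₗ[k] M) (g : C →ₗ[k] N) :
    convWith B (f + f') g = convWith B f g + convWith B f' g := by
  have e : TensorProduct.lift (B.compl₁₂ (f + f') g) =
      TensorProduct.lift (B.compl₁₂ f g) + TensorProduct.lift (B.compl₁₂ f' g) :=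
    TensorProduct.ext' fun x y => by simp
  ext x
  rw [convWith_apply, e]
  rfl

theorem convWith_add (B : M →ₗ[k] N →ₗ[k] P) (f : C →ₗ[k] M) (g g' : C →ₗ[k] N) :
    convWith B f (g + g') = convWith B f g + convWith B f g' := by
  have e : TensorProduct.lift (B.compl₁₂ f (g + g')) =
      TensorProduct.lift (B.compl₁₂ f g) + TensorProduct.lift (B.compl₁₂ f g') :=
    TensorProduct.ext' fun x y => by simp
  ext x
  rw [convWith_apply, e]
  rfl

theorem convWith_add_bilin (B B' : M →ₗ[k] N →ₗ[k] P) (f : C →ₗ[k] M) (g : C →ₗ[k] N) :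
    convWith (B + B') f g = convWith B f g + convWith B' f g := by
  have e : TensorProduct.lift ((B + B').compl₁₂ f g) =
      TensorProduct.lift (B.compl₁₂ f g) + TensorProduct.lift (B'.compl₁₂ f g) :=
    TensorProduct.ext' fun x y => by simp
  ext x
  rw [convWith_apply, e]
  rfl

theorem sum_convWith {ι : Type*} (s : Finset ι) (B : M →ₗ[k] N →ₗ[k] P) (f : ι → C →ₗ[k] M)
    (g : C →ₗ[k] N) : convWith B (∑ i ∈ s, f i) g = ∑ i ∈ s, convWith B (f i) g := by
  have e : TensorProduct.lift (B.compl₁₂ (∑ i ∈ s, f i) g) =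
      ∑ i ∈ s, TensorProduct.lift (B.compl₁₂ (f i) g) :=
    TensorProduct.ext' fun x y => by simp [LinearMap.sum_apply]
  ext x
  rw [convWith_apply, e]
  simp [LinearMap.sum_apply, convWith_apply]

theorem convWith_sum {ι : Type*} (s : Finset ι) (B : M →ₗ[k] N →ₗ[k] P) (f : C →ₗ[k] M)
    (g : ι → C →ₗ[k] N) : convWith B f (∑ i ∈ s, g i) = ∑ i ∈ s, convWith B f (g i) := by
  have e : TensorProduct.lift (B.compl₁₂ f (∑ i ∈ s, g i)) =
      ∑ i ∈ s, TensorProduct.lift (B.compl₁₂ f (g i)) :=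
    TensorProduct.ext' fun x y => by simp [LinearMap.sum_apply]
  ext x
  rw [convWith_apply, e]
  simp [LinearMap.sum_apply, convWith_apply]

theorem convWith_comp {B : M →ₗ[k] N →ₗ[k] P} {f : C →ₗ[k] M} {g : C →ₗ[k] N} {u : D →ₗ[k] C}
    (hu : ∀ x, TensorProduct.map u u (comul x) = comul (u x)) :
    convWith B f g ∘ₗ u = convWith B (f ∘ₗ u) (g ∘ₗ u) := by
  ext x
  have e : TensorProduct.lift (B.compl₁₂ (f ∘ₗ u) (g ∘ₗ u)) =
      TensorProduct.lift (B.compl₁₂ f g) ∘ₗ TensorProduct.map u u :=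
    TensorProduct.ext' fun x y => by simp
  rw [LinearMap.comp_apply, convWith_apply, convWith_apply, e, LinearMap.comp_apply, hu]

/-- Precomposition with an anticomultiplicative map reverses a convolution. -/
theorem convWith_comp_anti {B : M →ₗ[k] N →ₗ[k] P} {f : C →ₗ[k] M} {g : C →ₗ[k] N}
    {u : D →ₗ[k] C}
    (hu : ∀ x, TensorProduct.comm k C C (TensorProduct.map u u (comul x)) = comul (u x)) :
    convWith B f g ∘ₗ u = convWith B.flip (g ∘ₗ u) (f ∘ₗ u) := by
  ext x
  have e : TensorProduct.lift (B.flip.compl₁₂ (g ∘ₗ u) (f ∘ₗ u)) =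
      TensorProduct.lift (B.compl₁₂ f g) ∘ₗ (TensorProduct.comm k C C).toLinearMap ∘ₗ
        TensorProduct.map u u :=
    TensorProduct.ext' fun x y => by simp
  rw [LinearMap.comp_apply, convWith_apply, convWith_apply, e, LinearMap.comp_apply,
    LinearMap.comp_apply, LinearEquiv.coe_coe, hu]

/-- Convolutions inherit every associativity law that holds on the values of the three maps; the
inner maps may be changed along the way. -/
theorem convWith_assoc {B₁ : M →ₗ[k] N →ₗ[k] P} {B₂ : P →ₗ[k] Q →ₗ[k] R}
    {B₃ : S →ₗ[k] T →ₗ[k] R} {B₄ : N' →ₗ[k] Q' →ₗ[k] T}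
    {f : C →ₗ[k] M} {g : C →ₗ[k] N} {h : C →ₗ[k] Q}
    {f' : C →ₗ[k] S} {g' : C →ₗ[k] N'} {h' : C →ₗ[k] Q'}
    (e : ∀ x y z, B₂ (B₁ (f x) (g y)) (h z) = B₃ (f' x) (B₄ (g' y) (h' z))) :
    convWith B₂ (convWith B₁ f g) h = convWith B₃ f' (convWith B₄ g' h') := by
  ext x
  let L : C ⊗[k] (C ⊗[k] C) →ₗ[k] R := TensorProduct.lift
    (B₃.compl₁₂ f' (TensorProduct.lift (B₄.compl₁₂ g' h')))
  have e1 : TensorProduct.lift (B₃.compl₁₂ f' (convWith B₄ g' h')) =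
      L ∘ₗ TensorProduct.map LinearMap.id comul :=
    TensorProduct.ext' fun x y => by simp [L, convWith_apply]
  have e2 : TensorProduct.lift (B₂.compl₁₂ (convWith B₁ f g) h) =
      L ∘ₗ (TensorProduct.assoc k C C C).toLinearMap ∘ₗ TensorProduct.map comul LinearMap.id := by
    refine TensorProduct.ext' fun x z => ?_
    have e3 : B₂.flip (h z) ∘ₗ TensorProduct.lift (B₁.compl₁₂ f g) =
        L ∘ₗ (TensorProduct.assoc k C C C).toLinearMap ∘ₗ (TensorProduct.mk k _ _).flip z :=
      TensorProduct.ext' fun x y => by simp [L, e]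
    simpa [convWith_apply] using LinearMap.congr_fun e3 (comul x)
  have e4 := coassoc_apply (R := k) x
  rw [convWith_apply, convWith_apply, e1, e2]
  simp only [LinearMap.comp_apply, LinearEquiv.coe_coe]
  exact congrArg L e4

/-- A convolution whose first factor contributes only its counit collapses, by the counit law. -/
theorem convWith_of_counit_left {B : M →ₗ[k] N →ₗ[k] P} {f : C →ₗ[k] M} {g : C →ₗ[k] N}
    {g' : C →ₗ[k] P} (h : ∀ x y, B (f x) (g y) = counit (R := k) x • g' y) :
    convWith B f g = g' := by
  ext x
  have e : TensorProduct.lift (B.compl₁₂ f g) =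
      g' ∘ₗ (TensorProduct.lid k C).toLinearMap ∘ₗ TensorProduct.map counit LinearMap.id :=
    TensorProduct.ext' fun x y => by simp [h]
  have := rTensor_counit_comul (R := k) x
  rw [LinearMap.rTensor] at this
  rw [convWith_apply, e, LinearMap.comp_apply, LinearMap.comp_apply, this]
  simp

theorem convWith_of_counit_right {B : M →ₗ[k] N →ₗ[k] P} {f : C →ₗ[k] M} {g : C →ₗ[k] N}
    {f' : C →ₗ[k] P} (h : ∀ x y, B (f x) (g y) = counit (R := k) y • f' x) :
    convWith B f g = f' := by
  ext x
  have e : TensorProduct.lift (B.compl₁₂ f g) =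
      f' ∘ₗ (TensorProduct.rid k C).toLinearMap ∘ₗ TensorProduct.map LinearMap.id counit :=
    TensorProduct.ext' fun x y => by simp [h]
  have := lTensor_counit_comul (R := k) x
  rw [LinearMap.lTensor] at this
  rw [convWith_apply, e, LinearMap.comp_apply, LinearMap.comp_apply, this]
  simp

/-- A convolution factors through the universal one, which is the comultiplication. -/
theorem convWith_eq_comul (B : M →ₗ[k] N →ₗ[k] P) (f : C →ₗ[k] M) (g : C →ₗ[k] N) (c : C) :
    convWith B f g c = TensorProduct.lift B (TensorProduct.map f g (comul c)) := by
  have e : TensorProduct.lift (B.compl₁₂ f g) = TensorProduct.lift B ∘ₗ TensorProduct.map f g :=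
    TensorProduct.ext' fun x y => by simp
  rw [convWith_apply, e, LinearMap.comp_apply]

end convolution

/-! ### Convolution on a tensor product of two coalgebras -/

section tensorConvolution

open Coalgebra

variable {k : Type*} [CommSemiring k] {C D : Type*} [AddCommMonoid C] [Module k C] [Coalgebra k C]
  [AddCommMonoid D] [Module k D] [Coalgebra k D]
  {M N P : Type*} [AddCommMonoid M] [Module k M] [AddCommMonoid N] [Module k N]
  [AddCommMonoid P] [Module k P]

variable (k C D) in
/-- The projection `c ⊗ d ↦ ε(d) c`. -/
noncomputable def projLeft : C ⊗[k] D →ₗ[k] C :=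
  (TensorProduct.rid k C).toLinearMap ∘ₗ TensorProduct.map LinearMap.id counit

variable (k C D) in
/-- The projection `c ⊗ d ↦ ε(c) d`. -/
noncomputable def projRight : C ⊗[k] D →ₗ[k] D :=
  (TensorProduct.lid k D).toLinearMap ∘ₗ TensorProduct.map counit LinearMap.id

@[simp] theorem projLeft_tmul (c : C) (d : D) :
    projLeft k C D (c ⊗ₜ d) = counit (R := k) d • c := by simp [projLeft]

@[simp] theorem projRight_tmul (c : C) (d : D) :
    projRight k C D (c ⊗ₜ d) = counit (R := k) c • d := by simp [projRight]

theorem projLeft_comul (c : C) : projLeft k C C (comul c) = c := by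
  have := lTensor_counit_comul (R := k) c
  rw [LinearMap.lTensor] at this
  rw [projLeft, LinearMap.comp_apply, this]
  simp

theorem projRight_comul (c : C) : projRight k C C (comul c) = c := by
  have := rTensor_counit_comul (R := k) c
  rw [LinearMap.rTensor] at this
  rw [projRight, LinearMap.comp_apply, this]
  simp

/-- On `C ⊗ D` with the first argument fixed, a factor that depends on `D` only is convolved over
`D` alone. The three lemmas that follow are the variants for the other side. -/
theorem convWith_projRight_left (B : M →ₗ[k] N →ₗ[k] P) (f : D →ₗ[k] M) (g : C ⊗[k] D →ₗ[k] N)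
    (c : C) : convWith B (f ∘ₗ projRight k C D) g ∘ₗ TensorProduct.mk k C D c =
      convWith B f (g ∘ₗ TensorProduct.mk k C D c) := by
  have e : ∀ (r : C ⊗[k] C) (s : D ⊗[k] D), TensorProduct.lift (B.compl₁₂ (f ∘ₗ projRight k C D) g)
      (TensorProduct.tensorTensorTensorComm k C C D D (r ⊗ₜ s)) =
      TensorProduct.lift (B.compl₁₂ f (g ∘ₗ TensorProduct.mk k C D (projRight k C C r))) s := by
    intro r s
    induction s with
    | zero => simp
    | add a b ha hb => simp only [TensorProduct.tmul_add, map_add, ha, hb]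
    | tmul d d' =>
      induction r with
      | zero => simp
      | add a b ha hb => simpa [TensorProduct.add_tmul] using congrArg₂ (· + ·) ha hb
      | tmul c c' => simp [← TensorProduct.smul_tmul']
  ext d
  have := e (comul c) (comul d)
  rw [projRight_comul] at this
  exact this

theorem convWith_projRight_right (B : M →ₗ[k] N →ₗ[k] P) (f : C ⊗[k] D →ₗ[k] M) (g : D →ₗ[k] N)
    (c : C) : convWith B f (g ∘ₗ projRight k C D) ∘ₗ TensorProduct.mk k C D c =
      convWith B (f ∘ₗ TensorProduct.mk k C D c) g := by
  have e : ∀ (r : C ⊗[k] C) (s : D ⊗[k] D), TensorProduct.lift (B.compl₁₂ f (g ∘ₗ projRight k C D))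
      (TensorProduct.tensorTensorTensorComm k C C D D (r ⊗ₜ s)) =
      TensorProduct.lift (B.compl₁₂ (f ∘ₗ TensorProduct.mk k C D (projLeft k C C r)) g) s := by
    intro r s
    induction s with
    | zero => simp
    | add a b ha hb => simp only [TensorProduct.tmul_add, map_add, ha, hb]
    | tmul d d' =>
      induction r with
      | zero => simp
      | add a b ha hb => simpa [TensorProduct.add_tmul] using congrArg₂ (· + ·) ha hb
      | tmul c c' => simp [← TensorProduct.smul_tmul']
  ext d
  have := e (comul c) (comul d)
  rw [projLeft_comul] at this
  exact this

theorem convWith_projLeft_left (B : M →ₗ[k] N →ₗ[k] P) (f : C →ₗ[k] M) (g : C ⊗[k] D →ₗ[k] N)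
    (d : D) : convWith B (f ∘ₗ projLeft k C D) g ∘ₗ (TensorProduct.mk k C D).flip d =
      convWith B f (g ∘ₗ (TensorProduct.mk k C D).flip d) := by
  have e : ∀ (r : C ⊗[k] C) (s : D ⊗[k] D), TensorProduct.lift (B.compl₁₂ (f ∘ₗ projLeft k C D) g)
      (TensorProduct.tensorTensorTensorComm k C C D D (r ⊗ₜ s)) =
      TensorProduct.lift (B.compl₁₂ f
        (g ∘ₗ (TensorProduct.mk k C D).flip (projRight k D D s))) r := by
    intro r s
    induction r with
    | zero => simp
    | add a b ha hb => simp only [TensorProduct.add_tmul, map_add, ha, hb]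
    | tmul c c' =>
      induction s with
      | zero => simp
      | add a b ha hb => simpa [TensorProduct.tmul_add] using congrArg₂ (· + ·) ha hb
      | tmul d d' => simp
  ext c
  have := e (comul c) (comul d)
  rw [projRight_comul] at this
  exact this

theorem convWith_projLeft_right (B : M →ₗ[k] N →ₗ[k] P) (f : C ⊗[k] D →ₗ[k] M) (g : C →ₗ[k] N)
    (d : D) : convWith B f (g ∘ₗ projLeft k C D) ∘ₗ (TensorProduct.mk k C D).flip d =
      convWith B (f ∘ₗ (TensorProduct.mk k C D).flip d) g := by
  have e : ∀ (r : C ⊗[k] C) (s : D ⊗[k] D), TensorProduct.lift (B.compl₁₂ f (g ∘ₗ projLeft k C D))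
      (TensorProduct.tensorTensorTensorComm k C C D D (r ⊗ₜ s)) =
      TensorProduct.lift (B.compl₁₂
        (f ∘ₗ (TensorProduct.mk k C D).flip (projLeft k D D s)) g) r := by
    intro r s
    induction r with
    | zero => simp
    | add a b ha hb => simp only [TensorProduct.add_tmul, map_add, ha, hb]
    | tmul c c' =>
      induction s with
      | zero => simp
      | add a b ha hb => simpa [TensorProduct.tmul_add] using congrArg₂ (· + ·) ha hb
      | tmul d d' => simp
  ext c
  have := e (comul c) (comul d)
  rw [projLeft_comul] at this
  exact this

end tensorConvolution
/-! ### The convolution product and its opposite -/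

section convolve

open Coalgebra

variable {k : Type*} [CommSemiring k] {C D : Type*} [AddCommMonoid C] [Module k C] [Coalgebra k C]
  [AddCommMonoid D] [Module k D] [Coalgebra k D]
  {A A' : Type*} [Semiring A] [Algebra k A] [Semiring A'] [Algebra k A']

/-- The convolution product `c ↦ ∑ f(c₁) g(c₂)` of linear maps from a coalgebra to an algebra. -/
noncomputable def convolve (f g : C →ₗ[k] A) : C →ₗ[k] A := convWith (LinearMap.mul k A) f g

/-- The opposite convolution product `c ↦ ∑ g(c₂) f(c₁)`, the convolution product with values in the
opposite algebra. -/
noncomputable def convolveOp (f g : C →ₗ[k] A) : C →ₗ[k] A :=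
  convWith (LinearMap.mul k A).flip f g

infixl:70 " ⋄ " => convolve
infixl:70 " ⋄ᵒ " => convolveOp

variable (k C A) in
/-- The unit `c ↦ ε(c) 1` of both convolution products. -/
noncomputable def convOne : C →ₗ[k] A := Algebra.linearMap k A ∘ₗ counit

theorem convOne_apply (c : C) : convOne k C A c = counit (R := k) c • 1 := by
  simp [convOne, Algebra.algebraMap_eq_smul_one]

theorem convolve_assoc (f g h : C →ₗ[k] A) : f ⋄ g ⋄ h = f ⋄ (g ⋄ h) :=
  convWith_assoc fun _ _ _ => mul_assoc _ _ _

theorem convolveOp_assoc (f g h : C →ₗ[k] A) : f ⋄ᵒ g ⋄ᵒ h = f ⋄ᵒ (g ⋄ᵒ h) :=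
  convWith_assoc fun _ _ _ => (mul_assoc _ _ _).symm

@[simp] theorem convOne_convolve (f : C →ₗ[k] A) : convOne k C A ⋄ f = f :=
  convWith_of_counit_left fun x y => by simp [convOne_apply]

@[simp] theorem convolve_convOne (f : C →ₗ[k] A) : f ⋄ convOne k C A = f :=
  convWith_of_counit_right fun x y => by simp [convOne_apply]

@[simp] theorem convOne_convolveOp (f : C →ₗ[k] A) : convOne k C A ⋄ᵒ f = f :=
  convWith_of_counit_left fun x y => by simp [convOne_apply]

@[simp] theorem convolveOp_convOne (f : C →ₗ[k] A) : f ⋄ᵒ convOne k C A = f :=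
  convWith_of_counit_right fun x y => by simp [convOne_apply]

theorem comp_convolve {φ : A →ₗ[k] A'} (hφ : ∀ x y, φ (x * y) = φ x * φ y) (f g : C →ₗ[k] A) :
    φ ∘ₗ (f ⋄ g) = (φ ∘ₗ f) ⋄ (φ ∘ₗ g) :=
  comp_convWith fun _ _ => hφ _ _

theorem comp_convolveOp {φ : A →ₗ[k] A'} (hφ : ∀ x y, φ (x * y) = φ x * φ y)
    (f g : C →ₗ[k] A) : φ ∘ₗ (f ⋄ᵒ g) = (φ ∘ₗ f) ⋄ᵒ (φ ∘ₗ g) :=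
  comp_convWith fun _ _ => hφ _ _

theorem anti_comp_convolveOp {φ : A →ₗ[k] A'} (hφ : ∀ x y, φ (x * y) = φ y * φ x)
    (f g : C →ₗ[k] A) : φ ∘ₗ (f ⋄ᵒ g) = (φ ∘ₗ f) ⋄ (φ ∘ₗ g) :=
  comp_convWith fun _ _ => hφ _ _

theorem comp_convOne {φ : A →ₗ[k] A'} (hφ : φ 1 = 1) :
    φ ∘ₗ convOne k C A = convOne k C A' := by
  ext; simp [convOne_apply, hφ]

theorem convOne_comp {u : D →ₗ[k] C} (hu : ∀ x, counit (R := k) (u x) = counit (R := k) x) :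
    convOne k C A ∘ₗ u = convOne k D A := by
  ext; simp [convOne_apply, hu]

theorem convolve_comp {u : D →ₗ[k] C}
    (hu : ∀ x, TensorProduct.map u u (comul x) = comul (u x)) (f g : C →ₗ[k] A) :
    (f ⋄ g) ∘ₗ u = (f ∘ₗ u) ⋄ (g ∘ₗ u) := convWith_comp hu

theorem convolveOp_comp {u : D →ₗ[k] C}
    (hu : ∀ x, TensorProduct.map u u (comul x) = comul (u x)) (f g : C →ₗ[k] A) :
    (f ⋄ᵒ g) ∘ₗ u = (f ∘ₗ u) ⋄ᵒ (g ∘ₗ u) := convWith_comp hu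

theorem convolveOp_comp_anti {u : D →ₗ[k] C}
    (hu : ∀ x, TensorProduct.comm k C C (TensorProduct.map u u (comul x)) = comul (u x))
    (f g : C →ₗ[k] A) : (f ⋄ᵒ g) ∘ₗ u = (g ∘ₗ u) ⋄ (f ∘ₗ u) := convWith_comp_anti hu

theorem add_convolveOp (f f' g : C →ₗ[k] A) : (f + f') ⋄ᵒ g = f ⋄ᵒ g + f' ⋄ᵒ g :=
  add_convWith _ f f' g

theorem convolveOp_add (f g g' : C →ₗ[k] A) : f ⋄ᵒ (g + g') = f ⋄ᵒ g + f ⋄ᵒ g' :=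
  convWith_add _ f g g'

theorem smul_convolveOp (c : k) (f g : C →ₗ[k] A) : (c • f) ⋄ᵒ g = c • (f ⋄ᵒ g) := by
  have := comp_convWith (φ := c • (LinearMap.id : A →ₗ[k] A)) (B := (LinearMap.mul k A).flip)
    (f := f) (g := g) (B' := (LinearMap.mul k A).flip) (f' := c • f) (g' := g) (by simp)
  exact this.symm

theorem convolveOp_smul (c : k) (f g : C →ₗ[k] A) : f ⋄ᵒ (c • g) = c • (f ⋄ᵒ g) := by
  have := comp_convWith (φ := c • (LinearMap.id : A →ₗ[k] A)) (B := (LinearMap.mul k A).flip)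
    (f := f) (g := g) (B' := (LinearMap.mul k A).flip) (f' := f) (g' := c • g) (by simp)
  exact this.symm

theorem sum_convolve {ι : Type*} (s : Finset ι) (f : ι → C →ₗ[k] A) (g : C →ₗ[k] A) :
    (∑ i ∈ s, f i) ⋄ g = ∑ i ∈ s, f i ⋄ g := sum_convWith s _ f g

theorem convolve_sum {ι : Type*} (s : Finset ι) (f : C →ₗ[k] A) (g : ι → C →ₗ[k] A) :
    f ⋄ (∑ i ∈ s, g i) = ∑ i ∈ s, f ⋄ g i := convWith_sum s _ f g

theorem sum_convolveOp {ι : Type*} (s : Finset ι) (f : ι → C →ₗ[k] A) (g : C →ₗ[k] A) :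
    (∑ i ∈ s, f i) ⋄ᵒ g = ∑ i ∈ s, f i ⋄ᵒ g := sum_convWith s _ f g

theorem convolveOp_sum {ι : Type*} (s : Finset ι) (f : C →ₗ[k] A) (g : ι → C →ₗ[k] A) :
    f ⋄ᵒ (∑ i ∈ s, g i) = ∑ i ∈ s, f ⋄ᵒ g i := convWith_sum s _ f g

theorem left_inverse_eq_right_inverse {f g h : C →ₗ[k] A} (h₁ : f ⋄ g = convOne k C A)
    (h₂ : g ⋄ h = convOne k C A) : f = h := by
  rw [← convolve_convOne f, ← h₂, ← convolve_assoc, h₁, convOne_convolve]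

end convolve

/-! ### The antipode is anticomultiplicative -/

section antipode

open Coalgebra HopfAlgebra

variable {k : Type*} [Field k] {H : Type*} [Ring H] [HopfAlgebra k H]

theorem antipode_convolve_id : antipode k ⋄ LinearMap.id = convOne k H H := by
  ext x
  rw [convolve, convWith_eq_comul]
  exact mul_antipode_rTensor_comul_apply x

theorem id_convolve_antipode : LinearMap.id ⋄ antipode k = convOne k H H := by
  ext x
  rw [convolve, convWith_eq_comul]
  exact mul_antipode_lTensor_comul_apply x

variable (k H) in
/-- `h ↦ h ⊗ 1` -/
noncomputable def inclLeft : H →ₗ[k] H ⊗[k] H := (TensorProduct.mk k H H).flip 1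

variable (k H) in
/-- `h ↦ 1 ⊗ h` -/
noncomputable def inclRight : H →ₗ[k] H ⊗[k] H := TensorProduct.mk k H H 1

@[simp] theorem inclLeft_apply (h : H) : inclLeft k H h = h ⊗ₜ 1 := rfl
@[simp] theorem inclRight_apply (h : H) : inclRight k H h = 1 ⊗ₜ h := rfl

theorem inclLeft_mul (x y : H) : inclLeft k H (x * y) = inclLeft k H x * inclLeft k H y := by simp
theorem inclRight_mul (x y : H) :
    inclRight k H (x * y) = inclRight k H x * inclRight k H y := by simp

theorem inclLeft_convolve_inclRight : inclLeft k H ⋄ inclRight k H = comul := by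
  ext x
  rw [convolve, convWith_apply]
  have e : TensorProduct.lift ((LinearMap.mul k (H ⊗[k] H)).compl₁₂ (inclLeft k H)
      (inclRight k H)) = LinearMap.id := TensorProduct.ext' fun x y => by simp
  rw [e, LinearMap.id_apply]

/-- The antipode is anticomultiplicative: `S(h₂) ⊗ S(h₁)` and `S(h)₁ ⊗ S(h)₂` are both convolution
inverses of the comultiplication. -/
theorem comul_antipode (h : H) : TensorProduct.comm k H H
    (TensorProduct.map (antipode k) (antipode k) (comul h)) = comul (antipode k h) := by
  have e1 : (inclRight k H ∘ₗ antipode k) ⋄ (inclLeft k H ∘ₗ antipode k) ⋄ comul =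
      convOne k H (H ⊗[k] H) := by
    rw [← inclLeft_convolve_inclRight, convolve_assoc, ← convolve_assoc (inclLeft k H ∘ₗ _),
      show (inclLeft k H ∘ₗ antipode k) ⋄ inclLeft k H = convOne k H (H ⊗[k] H) by
        have := comp_convolve inclLeft_mul (antipode k) (LinearMap.id (R := k) (M := H))
        rw [antipode_convolve_id, comp_convOne rfl, LinearMap.comp_id] at this
        exact this.symm, convOne_convolve]
    have := comp_convolve inclRight_mul (antipode k) (LinearMap.id (R := k) (M := H))
    rw [antipode_convolve_id, comp_convOne rfl, LinearMap.comp_id] at this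
    exact this.symm
  have e2 : comul ⋄ (comul ∘ₗ antipode k) = convOne k H (H ⊗[k] H) := by
    have := comp_convolve (Bialgebra.comul_mul (R := k) (A := H)) LinearMap.id (antipode k)
    rw [id_convolve_antipode, comp_convOne (Bialgebra.comul_one), LinearMap.comp_id] at this
    exact this.symm
  have e3 := LinearMap.congr_fun (left_inverse_eq_right_inverse e1 e2) h
  rw [LinearMap.comp_apply] at e3
  rw [← e3, convolve, convWith_apply]
  generalize (comul h : H ⊗[k] H) = t
  induction t using Coact.ind with
  | add a b ha hb => simp only [map_add, ha, hb]
  | tmul a b => simp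

end antipode
/-! ### Evaluation on tensor products with a dual space -/

/-- Induction on a tensor, from pure tensors and sums. -/
@[elab_as_elim]
theorem tensor_ind {k : Type*} [CommSemiring k] {V W : Type*} [AddCommMonoid V] [Module k V]
    [AddCommMonoid W] [Module k W] {motive : V ⊗[k] W → Prop} (tmul : ∀ v w, motive (v ⊗ₜ w))
    (add : ∀ a b, motive a → motive b → motive (a + b)) (x : V ⊗[k] W) : motive x :=
  TensorProduct.induction_on x (by simpa using tmul 0 0) tmul add

section evalAt

variable {k : Type*} [Field k] {H N V P : Type*} [AddCommGroup H] [Module k H]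
  [AddCommGroup N] [Module k N] [AddCommMonoid V] [Module k V] [AddCommGroup P] [Module k P]

variable (N) in
/-- The evaluation `p ⊗ n ↦ p(x) n` at `x`. -/
noncomputable def evalAt (x : H) : Module.Dual k H ⊗[k] N →ₗ[k] N :=
  (TensorProduct.lid k N).toLinearMap ∘ₗ TensorProduct.map (Module.Dual.eval k H x) LinearMap.id

@[simp] theorem evalAt_tmul (x : H) (p : Module.Dual k H) (n : N) :
    evalAt N x (p ⊗ₜ n) = p x • n := by simp [evalAt]

variable (k H N P) in
/-- The map sending a tensor `t` in `H* ⊗ N` to the linear map `x ↦ t(x)` from `H` to `N`. -/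
noncomputable def evalMap : Module.Dual k H ⊗[k] N →ₗ[k] H →ₗ[k] N := dualTensorHom k H N

@[simp] theorem evalMap_tmul (p : Module.Dual k H) (n : N) :
    evalMap k H N (p ⊗ₜ[k] n) = p.smulRight n := by ext; simp [evalMap]

theorem evalMap_apply (t : Module.Dual k H ⊗[k] N) (x : H) : evalMap k H N t x = evalAt N x t := by
  induction t using tensor_ind with
  | add a b ha hb => simp only [map_add, LinearMap.add_apply, ha, hb]
  | tmul p n => simp

variable (k H N P) in
/-- The map sending a tensor `t` in `(H* ⊗ N) ⊗ (H* ⊗ P)` to the linear map `x ⊗ y ↦ t(x, y)`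
from `H ⊗ H` to `N ⊗ P`. -/
noncomputable def evalMap₂ : (Module.Dual k H ⊗[k] N) ⊗[k] (Module.Dual k H ⊗[k] P) →ₗ[k]
    H ⊗[k] H →ₗ[k] N ⊗[k] P :=
  TensorProduct.homTensorHomMap (RingHom.id k) H H N P ∘ₗ
    TensorProduct.map (evalMap k H N) (evalMap k H P)

@[simp] theorem evalMap₂_tmul (s : Module.Dual k H ⊗[k] N) (t : Module.Dual k H ⊗[k] P) :
    evalMap₂ k H N P (s ⊗ₜ t) = TensorProduct.map (evalMap k H N s) (evalMap k H P t) := rfl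

theorem evalMap₂_apply (s : (Module.Dual k H ⊗[k] N) ⊗[k] (Module.Dual k H ⊗[k] P)) (x y : H) :
    evalMap₂ k H N P s (x ⊗ₜ y) = TensorProduct.map (evalAt N x) (evalAt P y) s := by
  induction s using tensor_ind with
  | add a b ha hb => simp only [map_add, LinearMap.add_apply, ha, hb]
  | tmul s t => simp [evalMap_apply]

variable [FiniteDimensional k H]

theorem sum_tmul_evalAt (t : Module.Dual k H ⊗[k] N) :
    ∑ i, (Module.finBasis k H).coord i ⊗ₜ[k] evalAt N (Module.finBasis k H i) t = t := by
  induction t using Coact.ind with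
  | add a b ha hb => simp only [map_add, TensorProduct.tmul_add, Finset.sum_add_distrib, ha, hb]
  | tmul p n =>
    simp only [evalAt_tmul, TensorProduct.tmul_smul]
    simp only [TensorProduct.smul_tmul', ← TensorProduct.sum_tmul]
    congr 1
    refine (Module.finBasis k H).ext fun j => ?_
    simp [Finsupp.single_apply]

theorem ext_evalAt {s t : Module.Dual k H ⊗[k] N} (h : ∀ x, evalAt N x s = evalAt N x t) :
    s = t := by
  rw [← sum_tmul_evalAt s, ← sum_tmul_evalAt t]
  simp only [h]

theorem ext_map_evalAt_right {s t : V ⊗[k] (Module.Dual k H ⊗[k] N)}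
    (h : ∀ x, TensorProduct.map LinearMap.id (evalAt N x) s =
      TensorProduct.map LinearMap.id (evalAt N x) t) : s = t := by
  have e : ∀ s : V ⊗[k] (Module.Dual k H ⊗[k] N), s =
      ∑ i, TensorProduct.map LinearMap.id (TensorProduct.mk k _ N ((Module.finBasis k H).coord i))
        (TensorProduct.map LinearMap.id (evalAt N (Module.finBasis k H i)) s) := fun s => by
    induction s using tensor_ind with
    | add a b ha hb => simp only [map_add, Finset.sum_add_distrib, ← ha, ← hb]
    | tmul v x =>
      simp only [TensorProduct.map_tmul, LinearMap.id_apply, TensorProduct.mk_apply,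
        ← TensorProduct.tmul_sum]
      rw [sum_tmul_evalAt]
  rw [e s, e t]
  simp only [h]

theorem ext_map_evalAt_left {s t : (Module.Dual k H ⊗[k] N) ⊗[k] V}
    (h : ∀ x, TensorProduct.map (evalAt N x) LinearMap.id s =
      TensorProduct.map (evalAt N x) LinearMap.id t) : s = t := by
  have e : ∀ s : (Module.Dual k H ⊗[k] N) ⊗[k] V, s =
      ∑ i, TensorProduct.map (TensorProduct.mk k _ N ((Module.finBasis k H).coord i)) LinearMap.id
        (TensorProduct.map (evalAt N (Module.finBasis k H i)) LinearMap.id s) := fun s => by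
    induction s using tensor_ind with
    | add a b ha hb => simp only [map_add, Finset.sum_add_distrib, ← ha, ← hb]
    | tmul x v =>
      simp only [TensorProduct.map_tmul, LinearMap.id_apply, TensorProduct.mk_apply,
        ← TensorProduct.sum_tmul]
      rw [sum_tmul_evalAt]
  rw [e s, e t]
  simp only [h]

theorem ext_map_evalAt {s t : (Module.Dual k H ⊗[k] N) ⊗[k] (Module.Dual k H ⊗[k] P)}
    (h : ∀ x y, TensorProduct.map (evalAt N x) (evalAt P y) s =
      TensorProduct.map (evalAt N x) (evalAt P y) t) : s = t := by
  refine ext_map_evalAt_left (V := Module.Dual k H ⊗[k] P) fun x =>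
    ext_map_evalAt_right (V := N) fun y => ?_
  have e : ∀ s : (Module.Dual k H ⊗[k] N) ⊗[k] (Module.Dual k H ⊗[k] P),
      TensorProduct.map LinearMap.id (evalAt P y) (TensorProduct.map (evalAt N x) LinearMap.id s) =
        TensorProduct.map (evalAt N x) (evalAt P y) s := fun s => by
    rw [← LinearMap.comp_apply, ← TensorProduct.map_comp, LinearMap.id_comp, LinearMap.comp_id]
  exact (e s).trans ((h x y).trans (e t).symm)

theorem ext_map_evalAt₃ {Q : Type*} [AddCommGroup Q] [Module k Q]
    {s t : (Module.Dual k H ⊗[k] N) ⊗[k] ((Module.Dual k H ⊗[k] P) ⊗[k] (Module.Dual k H ⊗[k] Q))}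
    (h : ∀ x y z, TensorProduct.map (evalAt N x) (TensorProduct.map (evalAt P y) (evalAt Q z)) s =
      TensorProduct.map (evalAt N x) (TensorProduct.map (evalAt P y) (evalAt Q z)) t) : s = t := by
  refine ext_map_evalAt_left (N := N)
    (V := (Module.Dual k H ⊗[k] P) ⊗[k] (Module.Dual k H ⊗[k] Q)) fun x => ?_
  have e : ∀ s : N ⊗[k] ((Module.Dual k H ⊗[k] P) ⊗[k] (Module.Dual k H ⊗[k] Q)), s =
      ∑ i, ∑ j, TensorProduct.map LinearMap.id (TensorProduct.map
        (TensorProduct.mk k _ P ((Module.finBasis k H).coord i))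
        (TensorProduct.mk k _ Q ((Module.finBasis k H).coord j)))
        (TensorProduct.map LinearMap.id (TensorProduct.map (evalAt P (Module.finBasis k H i))
          (evalAt Q (Module.finBasis k H j))) s) := fun s => by
    induction s using tensor_ind with
    | add a b ha hb => simp only [map_add, Finset.sum_add_distrib, ← ha, ← hb]
    | tmul n x =>
      induction x using tensor_ind with
      | add a b ha hb =>
        simp only [TensorProduct.tmul_add, map_add, Finset.sum_add_distrib, ← ha, ← hb]
      | tmul p q =>
        simp only [TensorProduct.map_tmul, LinearMap.id_apply, TensorProduct.mk_apply,
          ← TensorProduct.tmul_sum, ← TensorProduct.sum_tmul]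
        rw [sum_tmul_evalAt, sum_tmul_evalAt]
  have e' : ∀ (s : (Module.Dual k H ⊗[k] N) ⊗[k]
      ((Module.Dual k H ⊗[k] P) ⊗[k] (Module.Dual k H ⊗[k] Q))) (y z : H),
      TensorProduct.map LinearMap.id (TensorProduct.map (evalAt P y) (evalAt Q z))
        (TensorProduct.map (evalAt N x) LinearMap.id s) =
      TensorProduct.map (evalAt N x) (TensorProduct.map (evalAt P y) (evalAt Q z)) s :=
    fun s y z => by
      rw [← LinearMap.comp_apply, ← TensorProduct.map_comp, LinearMap.id_comp, LinearMap.comp_id]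
  rw [e (TensorProduct.map _ _ s), e (TensorProduct.map _ _ t)]
  simp only [e', h]

theorem evalMap_injective : Function.Injective (evalMap k H N) := fun s t h =>
  ext_evalAt fun x => by rw [← evalMap_apply, ← evalMap_apply, h]

theorem evalMap₂_injective : Function.Injective (evalMap₂ k H N P) := fun s t h =>
  ext_map_evalAt fun x y => by rw [← evalMap₂_apply, ← evalMap₂_apply, h]

variable (k H) in
/-- The canonical element `∑ bⁱ ⊗ bᵢ` of `H* ⊗ H`. -/
noncomputable def coev : Module.Dual k H ⊗[k] H :=
  ∑ i, (Module.finBasis k H).coord i ⊗ₜ[k] Module.finBasis k H i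

@[simp] theorem evalAt_coev (x : H) : evalAt H x (coev k H) = x := by
  simp only [coev, map_sum, evalAt_tmul]
  exact (Module.finBasis k H).sum_repr x

end evalAt
/-! ### Integrals and the injectivity of the antipode -/

section integral

open Coalgebra HopfAlgebra
open CT (dualMul dualMul_apply)

variable {k : Type*} [Field k] {H : Type*} [Ring H] [HopfAlgebra k H]

theorem dualMul_eq_convolve (p q : Module.Dual k H) : dualMul (p ⊗ₜ q) = p ⋄ q := by
  ext x
  rw [dualMul_apply, convolve, convWith_eq_comul]
  rfl

theorem dualMul_assoc (p q r : Module.Dual k H) :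
    dualMul (dualMul (p ⊗ₜ q) ⊗ₜ r) = dualMul (p ⊗ₜ dualMul (q ⊗ₜ r)) := by
  simp only [dualMul_eq_convolve, convolve_assoc]

@[simp] theorem counit_dualMul (p : Module.Dual k H) : dualMul (counit ⊗ₜ[k] p) = p := by
  rw [dualMul_eq_convolve]
  exact convOne_convolve p

@[simp] theorem dualMul_counit (p : Module.Dual k H) : dualMul (p ⊗ₜ[k] counit) = p := by
  rw [dualMul_eq_convolve]
  exact convolve_convOne p

theorem dualMul_apply_eq (p q : Module.Dual k H) (x : H) :
    dualMul (p ⊗ₜ q) x = TensorProduct.dualDistrib k H H (p ⊗ₜ q) (comul x) := rfl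

/-- The right translation `q ↦ q(- h)` of a linear form. -/
noncomputable def dualTranslate : H →ₗ[k] Module.Dual k H →ₗ[k] Module.Dual k H :=
  (LinearMap.llcomp k H H k).flip ∘ₗ (LinearMap.mul k H).flip

@[simp] theorem dualTranslate_apply (h : H) (q : Module.Dual k H) (x : H) :
    dualTranslate h q x = q (x * h) := rfl

theorem dualMul_translate_left (p q : Module.Dual k H) (b x : H) :
    dualMul (dualTranslate b p ⊗ₜ q) x =
      TensorProduct.dualDistrib k H H (p ⊗ₜ q) (comul x * (b ⊗ₜ 1)) := by
  rw [dualMul_apply_eq]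
  generalize (comul x : H ⊗[k] H) = t
  induction t using Coact.ind with
  | add a b ha hb => simp only [map_add, ha, hb, add_mul]
  | tmul a b => simp

theorem dualMul_translate_right (p q : Module.Dual k H) (b x : H) :
    dualMul (p ⊗ₜ dualTranslate b q) x =
      TensorProduct.dualDistrib k H H (p ⊗ₜ q) (comul x * (1 ⊗ₜ b)) := by
  rw [dualMul_apply_eq]
  generalize (comul x : H ⊗[k] H) = t
  induction t using Coact.ind with
  | add a b ha hb => simp only [map_add, ha, hb, add_mul]
  | tmul a b => simp

/-- `∑ S(h₁)₁ h₂ ⊗ S(h₁)₂ = 1 ⊗ S(h)` -/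
theorem comul_antipode_convolve_inclLeft :
    (comul ∘ₗ antipode k) ⋄ inclLeft k H = inclRight k H ∘ₗ antipode k := by
  have e : comul ∘ₗ antipode k =
      (inclRight k H ∘ₗ antipode k) ⋄ (inclLeft k H ∘ₗ antipode k) := by
    ext x
    rw [LinearMap.comp_apply, ← comul_antipode, convolve, convWith_apply]
    generalize (comul x : H ⊗[k] H) = t
    induction t using Coact.ind with
    | add a b ha hb => simp only [map_add, ha, hb]
    | tmul a b => simp
  have := comp_convolve inclLeft_mul (antipode k) (LinearMap.id (R := k) (M := H))
  rw [antipode_convolve_id, comp_convOne rfl, LinearMap.comp_id] at this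
  rw [e, convolve_assoc, ← this, convolve_convOne]

/-- Multiplication in `H*` and the right `H`-action `q · h = q(- S(h))` make `H*` a Hopf module:
`p (q · h) = ∑ (p(- h₂) q) · h₁`. -/
theorem dualMul_translate_antipode (p q : Module.Dual k H) (h x : H) :
    dualMul (p ⊗ₜ dualTranslate (antipode k h) q) x =
      convWith (((LinearMap.mul k (H ⊗[k] H)).compl₁₂ comul (inclLeft k H)).compr₂
        (TensorProduct.dualDistrib k H H (p ⊗ₜ q) ∘ₗ LinearMap.mulLeft k (comul x)))
        (antipode k) LinearMap.id h := by
  have e := comp_convWith (φ := TensorProduct.dualDistrib k H H (p ⊗ₜ q) ∘ₗ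
    LinearMap.mulLeft k (comul x)) (B := LinearMap.mul k (H ⊗[k] H))
    (f := comul ∘ₗ antipode k) (g := inclLeft k H) (B' := ((LinearMap.mul k (H ⊗[k] H)).compl₁₂
      comul (inclLeft k H)).compr₂ (TensorProduct.dualDistrib k H H (p ⊗ₜ q) ∘ₗ
        LinearMap.mulLeft k (comul x))) (f' := antipode k) (g' := LinearMap.id)
    (fun _ _ => rfl)
  rw [← e, ← convolve, comul_antipode_convolve_inclLeft, dualMul_translate_right]
  rfl

/-- The map `p ⊗ h ↦ (p q)(- S²(h))`; at the canonical element of `H* ⊗ H` it is the projection of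
`q` onto the coinvariants of the Hopf module `H*`. -/
noncomputable def integralMap (q : Module.Dual k H) :
    Module.Dual k H ⊗[k] H →ₗ[k] Module.Dual k H :=
  TensorProduct.lift ((dualTranslate ∘ₗ antipode k ∘ₗ antipode k).flip ∘ₗ dualMul ∘ₗ
    (TensorProduct.mk k _ _).flip q)

@[simp] theorem integralMap_tmul (q p : Module.Dual k H) (h : H) :
    integralMap q (p ⊗ₜ h) = dualTranslate (antipode k (antipode k h)) (dualMul (p ⊗ₜ q)) := rfl

/-- The map `p' ⊗ h ↦ ∑ p(- S(h₁)) p' ⊗ h₂`. -/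
noncomputable def coactionMap (p : Module.Dual k H) :
    Module.Dual k H ⊗[k] H →ₗ[k] Module.Dual k H ⊗[k] H :=
  TensorProduct.map (TensorProduct.lift (LinearMap.flip
      (TensorProduct.curry dualMul ∘ₗ dualTranslate.flip p ∘ₗ antipode k))) LinearMap.id ∘ₗ
    (TensorProduct.assoc k _ H H).symm.toLinearMap ∘ₗ TensorProduct.map LinearMap.id comul

/-- Multiplication by `p` passes through `integralMap q` to its argument; with `coactionMap_coev`
this makes the value at the canonical element an integral. -/
theorem dualMul_integralMap (p q : Module.Dual k H) (t : Module.Dual k H ⊗[k] H) :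
    dualMul (p ⊗ₜ integralMap q t) = integralMap q (coactionMap p t) := by
  induction t using Coact.ind with
  | add a b ha hb => simp only [map_add, TensorProduct.tmul_add, ha, hb]
  | tmul p' h =>
    ext x
    rw [integralMap_tmul, dualMul_translate_antipode, ← LinearMap.comp_apply,
      convWith_comp_anti comul_antipode, convWith_apply, coactionMap, LinearMap.comp_apply,
      LinearMap.comp_apply, TensorProduct.map_tmul]
    generalize (comul h : H ⊗[k] H) = t
    induction t using Coact.ind with
    | add a b ha hb => simp only [map_add, TensorProduct.tmul_add, ha, hb, LinearMap.add_apply]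
    | tmul a b =>
      have e := dualMul_translate_left p (dualMul (p' ⊗ₜ q)) (antipode k a)
        (x * antipode k (antipode k b))
      simp only [Bialgebra.comul_mul, mul_assoc] at e
      simp [dualMul_assoc, e]

theorem evalAt_coactionMap (p : Module.Dual k H) (t : Module.Dual k H ⊗[k] H) (y : H) :
    evalAt H y (coactionMap p t) = TensorProduct.lift (LinearMap.lsmul k H ∘ₗ p) (TensorProduct.map
        (LinearMap.mul' k H ∘ₗ TensorProduct.map LinearMap.id (antipode k)) LinearMap.id
      ((TensorProduct.assoc k H H H).symm (TensorProduct.map LinearMap.id comul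
        (TensorProduct.map LinearMap.id (evalMap k H H t) (comul y))))) := by
  induction t using Coact.ind with
  | add a b ha hb =>
    simp only [map_add, TensorProduct.map_add_right, LinearMap.add_apply, ha, hb]
  | tmul p' h =>
    let L (s : H ⊗[k] H) : H ⊗[k] H →ₗ[k] H := (TensorProduct.lid k H).toLinearMap ∘ₗ
      TensorProduct.map (TensorProduct.dualDistrib k H H (p ⊗ₜ p') ∘ₗ LinearMap.mulLeft k s ∘ₗ
        inclLeft k H ∘ₗ antipode k) LinearMap.id
    have e1 : ∀ r : H ⊗[k] H, evalAt H y (TensorProduct.map (TensorProduct.lift (LinearMap.flip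
      (TensorProduct.curry dualMul ∘ₗ dualTranslate.flip p ∘ₗ antipode k))) LinearMap.id
        ((TensorProduct.assoc k _ H H).symm (p' ⊗ₜ r))) = L (comul y) r := fun r => by
      induction r using tensor_ind with
      | add a b ha hb => simp only [map_add, TensorProduct.tmul_add, ha, hb]
      | tmul a b =>
        have := dualMul_translate_left p p' (antipode k a) y
        simp [L, this]
    have e2 : ∀ s r : H ⊗[k] H, TensorProduct.lift (LinearMap.lsmul k H ∘ₗ p) (TensorProduct.map
        (LinearMap.mul' k H ∘ₗ TensorProduct.map LinearMap.id (antipode k)) LinearMap.id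
      ((TensorProduct.assoc k H H H).symm (TensorProduct.map LinearMap.id (p'.smulRight r) s))) =
        L s r := fun s r => by
      induction r using tensor_ind with
      | add a b ha hb =>
        have e : p'.smulRight (a + b) = p'.smulRight a + p'.smulRight b := by ext; simp
        simp only [e, map_add, TensorProduct.map_add_right, LinearMap.add_apply, ha, hb]
      | tmul a b =>
      induction s using tensor_ind with
      | add c d hc hd =>
        have e : L (c + d) (a ⊗ₜ b) = L c (a ⊗ₜ b) + L d (a ⊗ₜ b) := by
          simp [L, add_mul, add_smul]
        simp only [map_add, hc, hd, e]
      | tmul c d => simp [L, TensorProduct.tmul_smul, smul_smul, mul_comm]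
    have e3 : comul ∘ₗ p'.smulRight h = p'.smulRight (comul (R := k) h) := by ext; simp
    rw [coactionMap, LinearMap.comp_apply, LinearMap.comp_apply, TensorProduct.map_tmul,
      LinearEquiv.coe_coe, LinearMap.id_apply, e1, ← e2, evalMap_tmul, Coact.map_map, e3]
    rfl

theorem smulRight_convolve_smulRight {A : Type*} [Ring A] [Algebra k A] (p q : Module.Dual k H)
    (a b : A) : p.smulRight a ⋄ q.smulRight b = (dualMul (p ⊗ₜ q)).smulRight (a * b) := by
  rw [dualMul_eq_convolve]
  exact (comp_convWith (φ := LinearMap.toSpanSingleton k A (a * b)) fun x y => by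
    simp only [LinearMap.toSpanSingleton_apply, LinearMap.mul_apply', LinearMap.smulRight_apply,
      smul_mul_smul_comm]).symm

theorem smulRight_convolveOp_smulRight {A : Type*} [Ring A] [Algebra k A] (p q : Module.Dual k H)
    (a b : A) : p.smulRight a ⋄ᵒ q.smulRight b = (dualMul (p ⊗ₜ q)).smulRight (b * a) := by
  rw [dualMul_eq_convolve]
  exact (comp_convWith (φ := LinearMap.toSpanSingleton k A (b * a)) fun x y => by
    simp only [LinearMap.toSpanSingleton_apply, LinearMap.mul_apply', LinearMap.flip_apply,
      LinearMap.smulRight_apply, smul_mul_smul_comm, mul_comm]).symm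

variable [FiniteDimensional k H]

theorem sum_coord_smulRight {N : Type*} [AddCommMonoid N] [Module k N] (φ : H →ₗ[k] N) :
    ∑ i, ((Module.finBasis k H).coord i).smulRight (φ (Module.finBasis k H i)) = φ := by
  refine (Module.finBasis k H).ext fun j => ?_
  simp [Finsupp.single_apply]

/-- The canonical element `t` satisfies `t(y) = y`, so the value of `coactionMap p t` at `y` is
`∑ p(y₁ S(y₂)) y₃ = p(1) y`. -/
theorem coactionMap_coev (p : Module.Dual k H) : coactionMap p (coev k H) = p 1 • coev k H := by
  refine ext_evalAt fun y => ?_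
  have e : evalMap k H H (coev k H) = LinearMap.id := by ext x; simp [evalMap_apply]
  -- `∑ p(y₁ S(y₂)) y₃ = p(1) y`
  have e1 : convWith (LinearMap.lsmul k H ∘ₗ p) (LinearMap.id ⋄ antipode k) LinearMap.id =
      p 1 • LinearMap.id := by
    rw [id_convolve_antipode]
    exact convWith_of_counit_left fun x y => by simp [convOne_apply, smul_smul]
  have e2 := convWith_assoc (B₁ := LinearMap.mul k H) (B₂ := LinearMap.lsmul k H ∘ₗ p)
    (f := LinearMap.id) (g := antipode k) (h := LinearMap.id)
    (B₃ := TensorProduct.curry (TensorProduct.lift (LinearMap.lsmul k H ∘ₗ p) ∘ₗ TensorProduct.map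
        (LinearMap.mul' k H ∘ₗ TensorProduct.map LinearMap.id (antipode k)) LinearMap.id ∘ₗ
      (TensorProduct.assoc k H H H).symm.toLinearMap)) (B₄ := TensorProduct.mk k H H)
    (f' := LinearMap.id) (g' := LinearMap.id) (h' := LinearMap.id) (fun x y z => by simp)
  have e3 : convWith (TensorProduct.mk k H H) LinearMap.id LinearMap.id = comul := by
    ext x
    have : TensorProduct.lift ((TensorProduct.mk k H H).compl₁₂ LinearMap.id LinearMap.id) =
      LinearMap.id := TensorProduct.ext' fun x y => by simp
    rw [convWith_apply, this, LinearMap.id_apply]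
  rw [e3, ← convolve, e1] at e2
  rw [evalAt_coactionMap, e, TensorProduct.map_id, LinearMap.id_apply, map_smul, evalAt_coev]
  have e4 := LinearMap.congr_fun e2 y
  rw [convWith_eq_comul] at e4
  rw [LinearMap.smul_apply, LinearMap.id_apply] at e4
  rw [e4]
  generalize (comul y : H ⊗[k] H) = s
  induction s using tensor_ind with
  | add a b ha hb => simp only [map_add, ha, hb]
  | tmul a b => simp

/-- A Hopf algebra of finite dimension has a nonzero integral `λ` in its dual, as the Hopf
module `H*` is generated by its coinvariants. -/
theorem exists_integral [Nontrivial H] : ∃ l : Module.Dual k H, l ≠ 0 ∧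
    ∀ p : Module.Dual k H, dualMul (p ⊗ₜ l) = p 1 • l := by
  by_contra! hcon
  have h0 : ∀ q : Module.Dual k H, integralMap q (coev k H) = 0 := fun q => by
    by_contra hq
    obtain ⟨p, hp⟩ := hcon _ hq
    exact hp (by rw [dualMul_integralMap, coactionMap_coev, map_smul])
  -- the coinvariants generate: `q = ∑ P(bⁱ q) · bᵢ` for the projection `P` onto the coinvariants
  have h1 : ∑ i, ∑ j, dualMul ((Module.finBasis k H).coord j ⊗ₜ (Module.finBasis k H).coord i) ⊗ₜ[k]
      (antipode k (Module.finBasis k H j) * Module.finBasis k H i) = counit ⊗ₜ 1 := by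
    refine ext_evalAt fun y => ?_
    simp only [map_sum, ← evalMap_apply, evalMap_tmul, ← smulRight_convolve_smulRight]
    have e : ∀ i, ∑ j, (((Module.finBasis k H).coord j).smulRight
        (antipode k (Module.finBasis k H j)) ⋄
          ((Module.finBasis k H).coord i).smulRight (Module.finBasis k H i)) =
        antipode k ⋄ ((Module.finBasis k H).coord i).smulRight (Module.finBasis k H i) :=
      fun i => by rw [← sum_convolve, sum_coord_smulRight]
    simp only [← LinearMap.sum_apply, e]
    have e' : ∑ i, ((Module.finBasis k H).coord i).smulRight (Module.finBasis k H i) =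
        (LinearMap.id : H →ₗ[k] H) := sum_coord_smulRight LinearMap.id
    rw [← convolve_sum, e', antipode_convolve_id]
    simp [convOne_apply]
  obtain ⟨x, hx⟩ : ∃ x : H, counit (R := k) x ≠ 0 := ⟨1, by simp⟩
  apply hx
  -- the linear map `p ⊗ h ↦ p(x S(h))`
  have h2 := congrArg (TensorProduct.lift ((dualTranslate ∘ₗ antipode k).flip)) h1
  simp only [map_sum, TensorProduct.lift.tmul, LinearMap.flip_apply, LinearMap.comp_apply,
    HopfAlgebra.antipode_one, HopfAlgebra.antipode_mul_antidistrib] at h2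
  have h3 : ∀ i, ∑ j, dualTranslate (antipode k (Module.finBasis k H i) *
      antipode k (antipode k (Module.finBasis k H j)))
        (dualMul ((Module.finBasis k H).coord j ⊗ₜ (Module.finBasis k H).coord i)) =
      dualTranslate (antipode k (Module.finBasis k H i))
        (integralMap ((Module.finBasis k H).coord i) (coev k H)) := fun i => by
    rw [coev, map_sum, map_sum]
    refine Finset.sum_congr rfl fun j _ => ?_
    ext x
    simp [mul_assoc]
  simp only [h3, h0, map_zero, Finset.sum_const_zero] at h2
  simpa using (LinearMap.congr_fun h2 x).symm

/-- For a nonzero integral `l`, the element `∑ l(- S(h₁)) ⊗ h₂` vanishes if `S(h) = 0`, and it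
determines `l(x) h` for each `x`. -/
theorem antipode_injective : Function.Injective (antipode k : H →ₗ[k] H) := by
  rcases subsingleton_or_nontrivial H with _ | _
  · exact Function.injective_of_subsingleton _
  obtain ⟨l, hl, hint⟩ := exists_integral (k := k) (H := H)
  rw [injective_iff_map_eq_zero]
  intro h hh
  let F : H →ₗ[k] Module.Dual k H := dualTranslate.flip l ∘ₗ antipode k
  -- `∑ l(x S(h₁)) p(h₂) = (p (l · h))(x)` vanishes with `S(h)`
  have h1 : convWith (TensorProduct.mk k _ _) F LinearMap.id h = (0 : Module.Dual k H ⊗[k] H) := by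
    refine ext_evalAt fun x => (Module.forall_dual_apply_eq_zero_iff k _).1 fun p => ?_
    have e := dualMul_translate_antipode p l h x
    have e1 := comp_convWith (φ := p ∘ₗ evalAt H x) (B := TensorProduct.mk k _ H) (f := F)
      (g := LinearMap.id) (B' := ((LinearMap.mul k (H ⊗[k] H)).compl₁₂ comul (inclLeft k H)).compr₂
        (TensorProduct.dualDistrib k H H (p ⊗ₜ l) ∘ₗ LinearMap.mulLeft k (comul x)))
      (f' := antipode k) (g' := LinearMap.id) (fun a b => by
        have e2 := dualMul_translate_left p l b (x * antipode k a)
        have e3 := LinearMap.congr_fun (hint (dualTranslate b p)) (x * antipode k a)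
        simp only [Bialgebra.comul_mul, mul_assoc] at e2
        simp only [LinearMap.compr₂_apply, LinearMap.compl₁₂_apply, LinearMap.comp_apply,
          LinearMap.mul_apply', LinearMap.mulLeft_apply, inclLeft_apply, LinearMap.id_apply]
        rw [← e2, e3]
        simp [F, mul_comm])
    rw [← e1, hh, map_zero] at e
    simpa using e.symm
  have h2 : ∀ x, l x • h = 0 := fun x => by
    let φ : H →ₗ[k] k := l ∘ₗ LinearMap.mulLeft k x ∘ₗ antipode k
    let B₁ : Module.Dual k H →ₗ[k] H →ₗ[k] k :=
      (LinearMap.llcomp k H H k).flip (LinearMap.mulLeft k x ∘ₗ antipode k)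
    let B₃ : Module.Dual k H →ₗ[k] H ⊗[k] H →ₗ[k] H :=
      TensorProduct.curry ((TensorProduct.lid k H).toLinearMap ∘ₗ
        TensorProduct.map (TensorProduct.lift B₁) LinearMap.id ∘ₗ
        (TensorProduct.assoc k _ H H).symm.toLinearMap)
    let G : H →ₗ[k] H ⊗[k] H := convWith (TensorProduct.mk k H H) (antipode k) LinearMap.id
    -- `∑ l(x S(h₁ S(h₂))) h₃ = l(x) h`
    have e1 : convWith B₁ F (antipode k) = φ ∘ₗ convOne k H H := by
      rw [← id_convolve_antipode]
      refine (comp_convWith fun a b => ?_).symm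
      simp [φ, F, B₁, HopfAlgebra.antipode_mul_antidistrib, mul_assoc]
    have e2 : convWith (LinearMap.lsmul k H) (convWith B₁ F (antipode k)) LinearMap.id =
        convWith B₃ F G := convWith_assoc fun a b c => by simp [B₃, B₁]
    have e3 : (TensorProduct.lift B₃ ∘ₗ TensorProduct.map LinearMap.id G) ∘ₗ
        convWith (TensorProduct.mk k _ _) F LinearMap.id = convWith B₃ F G :=
      comp_convWith fun a b => by simp
    have e4 : convWith (LinearMap.lsmul k H) (φ ∘ₗ convOne k H H) LinearMap.id =
        l x • LinearMap.id := convWith_of_counit_left fun a b => by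
      simp [convOne_apply, φ, smul_smul]
    rw [e1, e4, ← e3] at e2
    have e5 := LinearMap.congr_fun e2 h
    rw [LinearMap.comp_apply, h1, map_zero] at e5
    exact e5
  obtain ⟨x, hx⟩ : ∃ x, l x ≠ 0 := by
    by_contra! hcon
    exact hl (LinearMap.ext hcon)
  exact (smul_eq_zero.1 (h2 x)).resolve_left hx

end integral
/-! ### The inverse of the antipode -/

section antipodeInv

open Coalgebra HopfAlgebra
open CT (antipodeInv)

variable {k : Type*} [Field k] {H : Type*} [Ring H] [HopfAlgebra k H]

/-- A bialgebra automorphism commutes with the antipode. -/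
theorem bialgAut_antipode (f : H ≃ₐc[k] H) (x : H) : f (antipode k x) = antipode k (f x) := by
  have hf : ∀ x y, bialgAutLin f (x * y) = bialgAutLin f x * bialgAutLin f y :=
    fun x y => map_mul f x y
  have h1 := comp_convolve hf (antipode k) (LinearMap.id (R := k) (M := H))
  rw [antipode_convolve_id, comp_convOne (show bialgAutLin f 1 = 1 from map_one f),
    LinearMap.comp_id] at h1
  have h2 := convolve_comp (YDModule.comul_aut f) (LinearMap.id (R := k) (M := H)) (antipode k)
  rw [id_convolve_antipode, convOne_comp (u := bialgAutLin f) (YDModule.counit_aut f),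
    LinearMap.id_comp] at h2
  exact LinearMap.congr_fun (left_inverse_eq_right_inverse h1.symm h2.symm) x

variable [FiniteDimensional k H]

theorem isUnit_antipode : IsUnit (antipode k : Module.End k H) :=
  (Module.End.isUnit_iff _).2
    ⟨antipode_injective, LinearMap.surjective_of_injective antipode_injective⟩

@[simp] theorem antipode_antipodeInv (x : H) : antipode k (antipodeInv k H x) = x :=
  LinearMap.congr_fun (Ring.mul_inverse_cancel _ isUnit_antipode) x

@[simp] theorem antipodeInv_antipode (x : H) : antipodeInv k H (antipode k x) = x :=
  LinearMap.congr_fun (Ring.inverse_mul_cancel _ isUnit_antipode) x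

theorem antipodeInv_mul (x y : H) :
    antipodeInv k H (x * y) = antipodeInv k H y * antipodeInv k H x :=
  antipode_injective (k := k) (by simp [antipode_mul_antidistrib])

@[simp] theorem antipodeInv_one : antipodeInv k H 1 = 1 :=
  antipode_injective (k := k) (by simp)

@[simp] theorem counit_antipodeInv (x : H) :
    counit (R := k) (antipodeInv k H x) = counit (R := k) x := by
  rw [← counit_antipode (R := k) (antipodeInv k H x), antipode_antipodeInv]

theorem comul_antipodeInv (x : H) : TensorProduct.comm k H H
    (TensorProduct.map (antipodeInv k H) (antipodeInv k H) (comul x)) =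
      comul (antipodeInv k H x) := by
  have h := comul_antipode (k := k) (antipodeInv k H x)
  rw [antipode_antipodeInv] at h
  rw [← h]
  generalize (comul (antipodeInv k H x) : H ⊗[k] H) = t
  induction t using tensor_ind with
  | add a b ha hb => simp only [map_add, ha, hb]
  | tmul a b => simp

@[simp] theorem bialgAut_antipodeInv (f : H ≃ₐc[k] H) (x : H) :
    f (antipodeInv k H x) = antipodeInv k H (f x) :=
  antipode_injective (k := k) (by rw [← bialgAut_antipode]; simp)

/-- `∑ S⁻¹(x₂) x₁ = ε(x) 1` -/
theorem id_convolveOp_antipodeInv : LinearMap.id ⋄ᵒ antipodeInv k H = convOne k H H := by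
  have e : antipode k ∘ₗ (LinearMap.id ⋄ᵒ antipodeInv k H) =
      antipode k ∘ₗ convOne k H H := by
    rw [anti_comp_convolveOp antipode_mul_antidistrib, comp_convOne antipode_one,
      LinearMap.comp_id, show antipode k ∘ₗ antipodeInv k H = LinearMap.id from
        LinearMap.ext antipode_antipodeInv, antipode_convolve_id]
  exact (LinearMap.cancel_left antipode_injective).1 e

/-- `∑ x₂ S⁻¹(x₁) = ε(x) 1` -/
theorem antipodeInv_convolveOp_id : antipodeInv k H ⋄ᵒ LinearMap.id = convOne k H H := by
  have e : antipode k ∘ₗ (antipodeInv k H ⋄ᵒ LinearMap.id) =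
      antipode k ∘ₗ convOne k H H := by
    rw [anti_comp_convolveOp antipode_mul_antidistrib, comp_convOne antipode_one,
      LinearMap.comp_id, show antipode k ∘ₗ antipodeInv k H = LinearMap.id from
        LinearMap.ext antipode_antipodeInv, id_convolve_antipode]
  exact (LinearMap.cancel_left antipode_injective).1 e

/-- A multiplicative map `φ` and `φ ∘ S⁻¹` are inverse to each other for the opposite
convolution. -/
theorem convolveOp_comp_antipodeInv {A : Type*} [Ring A] [Algebra k A] {φ : H →ₗ[k] A}
    (hφ : ∀ x y, φ (x * y) = φ x * φ y) (h1 : φ 1 = 1) :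
    φ ⋄ᵒ (φ ∘ₗ antipodeInv k H) = convOne k H A := by
  rw [← comp_convOne h1, ← id_convolveOp_antipodeInv, comp_convolveOp hφ, LinearMap.comp_id]

theorem comp_antipodeInv_convolveOp {A : Type*} [Ring A] [Algebra k A] {φ : H →ₗ[k] A}
    (hφ : ∀ x y, φ (x * y) = φ x * φ y) (h1 : φ 1 = 1) :
    (φ ∘ₗ antipodeInv k H) ⋄ᵒ φ = convOne k H A := by
  rw [← comp_convOne h1, ← antipodeInv_convolveOp_id, comp_convolveOp hφ, LinearMap.comp_id]

end antipodeInv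
/-! ### The structure maps of `CT(H)` under evaluation -/

section evaluation

open Coalgebra HopfAlgebra
open CT (antipodeInv dualMul dualMul_apply dualComul dualComul_apply dualSandwich_apply
  sandwich_apply)

variable {k : Type*} [Field k] {H : Type*} [Ring H] [HopfAlgebra k H]

/-- The product of `CT(H)` is an opposite convolution product, twisted by automorphisms. -/
theorem evalMap_mul_CT (a b : AutPair k H) (s t : Module.Dual k H ⊗[k] H) :
    evalMap k H H (CT.mul a b (s ⊗ₜ t)) =
      (bialgAutLin (b.snd * a.fst * b.snd⁻¹) ∘ₗ evalMap k H H t) ⋄ᵒ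
        (bialgAutLin b.snd ∘ₗ evalMap k H H s) := by
  induction s using tensor_ind with
  | add s s' hs hs' =>
    simp only [map_add, TensorProduct.add_tmul, hs, hs', LinearMap.comp_add, convolveOp_add]
  | tmul p h =>
    induction t using tensor_ind with
    | add t t' ht ht' =>
      simp only [map_add, TensorProduct.tmul_add, ht, ht', LinearMap.comp_add, add_convolveOp]
    | tmul q h' =>
      rw [CT.mul_tmul, evalMap_tmul, evalMap_tmul, evalMap_tmul,
        show bialgAutLin (b.snd * a.fst * b.snd⁻¹) ∘ₗ q.smulRight h' =
          q.smulRight (b.snd (a.fst (b.snd⁻¹ h'))) from by ext; simp,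
        show bialgAutLin b.snd ∘ₗ p.smulRight h = p.smulRight (b.snd h) from by ext; simp,
        smulRight_convolveOp_smulRight]

theorem evalMap_crossing_CT (c a : AutPair k H) (t : Module.Dual k H ⊗[k] H) :
    evalMap k H H (CT.crossing c a t) = bialgAutLin (c.snd⁻¹ * a.snd * c.fst * a.snd⁻¹) ∘ₗ
      evalMap k H H t ∘ₗ bialgAutLin (c.fst⁻¹ * c.snd) := by
  induction t using tensor_ind with
  | add t t' ht ht' => simp only [map_add, ht, ht', LinearMap.comp_add, LinearMap.add_comp]
  | tmul q h => ext; simp [CT.crossing_tmul]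

theorem counit_CT (t : Module.Dual k H ⊗[k] H) :
    CT.counit t = counit (R := k) (evalMap k H H t 1) := by
  induction t using tensor_ind with
  | add t t' ht ht' => simp only [map_add, ht, ht', LinearMap.add_apply]
  | tmul q h => simp [CT.counit_tmul]

theorem sigma_CT (b : AutPair k H) (s t : Module.Dual k H ⊗[k] H) :
    CT.sigma b (s ⊗ₜ t) = counit (R := k) (evalMap k H H s (b.snd⁻¹ (evalMap k H H t 1))) := by
  induction s using tensor_ind with
  | add s s' hs hs' => simp only [map_add, TensorProduct.add_tmul, hs, hs', LinearMap.add_apply]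
  | tmul p h =>
    induction t using tensor_ind with
    | add t t' ht ht' => simp only [map_add, TensorProduct.tmul_add, ht, ht', LinearMap.add_apply]
    | tmul q h' =>
      simp [CT.sigma_tmul]
      ring

variable [FiniteDimensional k H]

/-- Under evaluation at `x` and `y` the comultiplication of `CT(H)` reads
`(Δ t)(x, y) = ∑ (β(y₃) ⊗ 1) Δ(t(x y₂)) (α(S⁻¹(y₁)) ⊗ 1)`. -/
theorem evalAt_comul_CT (a : AutPair k H) (t : Module.Dual k H ⊗[k] H) (x y : H) :
    TensorProduct.map (evalAt H x) (evalAt H y) (CT.comul a t) =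
      ((inclLeft k H ∘ₗ bialgAutLin a.fst ∘ₗ antipodeInv k H) ⋄ᵒ
        (comul ∘ₗ evalMap k H H t ∘ₗ LinearMap.mulLeft k x) ⋄ᵒ
          (inclLeft k H ∘ₗ bialgAutLin a.snd)) y := by
  induction t using tensor_ind with
  | add t t' ht ht' =>
    simp only [map_add, ht, ht', LinearMap.comp_add, LinearMap.add_comp, add_convolveOp,
      convolveOp_add, LinearMap.add_apply]
  | tmul p h =>
    have key : ∀ (r : Module.Dual k H ⊗[k] Module.Dual k H) (s : H ⊗[k] H),
        TensorProduct.map (evalAt H x) (evalAt H y) ((∑ i, ∑ j, TensorProduct.map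
          (TensorProduct.map LinearMap.id (CT.sandwich (a.snd (Module.finBasis k H j))
            (antipodeInv k H (a.fst (Module.finBasis k H i)))))
          (TensorProduct.map (CT.dualSandwich ((Module.finBasis k H).coord i)
            ((Module.finBasis k H).coord j)) LinearMap.id))
          (TensorProduct.tensorTensorTensorComm k _ _ _ _ (r ⊗ₜ s))) =
      ((inclLeft k H ∘ₗ bialgAutLin a.fst ∘ₗ antipodeInv k H) ⋄ᵒ
        (LinearMap.smulRight (TensorProduct.dualDistrib k H H r ∘ₗ TensorProduct.mk k H H x) s) ⋄ᵒ
          (inclLeft k H ∘ₗ bialgAutLin a.snd)) y := by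
      intro r s
      induction r using tensor_ind with
      | add r r' hr hr' =>
        have e : LinearMap.smulRight
            (TensorProduct.dualDistrib k H H (r + r') ∘ₗ TensorProduct.mk k H H x) s =
          LinearMap.smulRight (TensorProduct.dualDistrib k H H r ∘ₗ TensorProduct.mk k H H x) s +
          LinearMap.smulRight (TensorProduct.dualDistrib k H H r' ∘ₗ TensorProduct.mk k H H x) s :=
          by ext; simp [add_smul]
        rw [TensorProduct.add_tmul, map_add, map_add, map_add, hr, hr', e, convolveOp_add,
          add_convolveOp, LinearMap.add_apply]
      | tmul p₁ p₂ =>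
        induction s using tensor_ind with
        | add s s' hs hs' =>
          have e : ∀ q : Module.Dual k H, q.smulRight (s + s') = q.smulRight s + q.smulRight s' :=
            fun q => by ext; simp
          rw [TensorProduct.tmul_add, map_add, map_add, map_add, hs, hs', e, convolveOp_add,
            add_convolveOp, LinearMap.add_apply]
        | tmul h₁ h₂ =>
          rw [← sum_coord_smulRight (inclLeft k H ∘ₗ bialgAutLin a.fst ∘ₗ antipodeInv k H),
            ← sum_coord_smulRight (inclLeft k H ∘ₗ bialgAutLin a.snd), convolveOp_sum]
          simp only [sum_convolveOp, smulRight_convolveOp_smulRight, LinearMap.sum_apply, map_sum,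
            TensorProduct.tensorTensorTensorComm_tmul]
          rw [Finset.sum_comm]
          refine Finset.sum_congr rfl fun j _ => Finset.sum_congr rfl fun i _ => ?_
          have e : (TensorProduct.dualDistrib k H H (p₁ ⊗ₜ p₂) ∘ₗ TensorProduct.mk k H H x) =
            p₁ x • p₂ := by ext; simp
          simp only [TensorProduct.map_tmul, evalAt_tmul, dualSandwich_apply, sandwich_apply, e,
            LinearMap.id_apply, LinearMap.smulRight_apply, TensorProduct.tmul_smul, map_smul,
            ← TensorProduct.smul_tmul', LinearMap.smul_apply]
          rw [smul_comm]
          simp [mul_assoc, smul_smul]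
    rw [CT.comul, LinearMap.comp_apply, Coact.tensorComul, LinearMap.comp_apply,
      TensorProduct.map_tmul]
    refine (key _ _).trans ?_
    congr 3
    ext z
    rw [LinearMap.smulRight_apply, LinearMap.comp_apply, TensorProduct.mk_apply, dualComul_apply]
    simp

/-- The antipode of `CT(H)` sends `t` to `x ↦ ∑ β⁻¹(S⁻¹(x₃)) β⁻¹α⁻¹(S(t(S⁻¹(x₂)))) β⁻¹α⁻¹β(x₁)`. -/
theorem evalMap_antipode_CT (a : AutPair k H) (t : Module.Dual k H ⊗[k] H) :
    evalMap k H H (CT.antipode a t) = bialgAutLin (a.snd⁻¹ * a.fst⁻¹ * a.snd) ⋄ᵒ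
      (bialgAutLin (a.snd⁻¹ * a.fst⁻¹) ∘ₗ antipode k ∘ₗ evalMap k H H t ∘ₗ antipodeInv k H) ⋄ᵒ
        (bialgAutLin a.snd⁻¹ ∘ₗ antipodeInv k H) := by
  induction t using tensor_ind with
  | add t t' ht ht' =>
    simp only [map_add, ht, ht', LinearMap.comp_add, LinearMap.add_comp, add_convolveOp,
      convolveOp_add]
  | tmul p h =>
    have e1 : bialgAutLin a.snd⁻¹ ∘ₗ antipodeInv k H =
        ∑ j, ((Module.finBasis k H).coord j ∘ₗ antipodeInv k H).smulRight
          (a.snd⁻¹ (Module.finBasis k H j)) := by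
      rw [← sum_coord_smulRight (bialgAutLin a.snd⁻¹)]
      ext
      simp [LinearMap.sum_apply]
    have e2 : bialgAutLin (a.snd⁻¹ * a.fst⁻¹) ∘ₗ antipode k ∘ₗ evalMap k H H (p ⊗ₜ h) ∘ₗ
        antipodeInv k H = LinearMap.smulRight (p ∘ₗ antipodeInv k H)
          (a.snd⁻¹ (a.fst⁻¹ (antipode k h))) := by ext; simp
    rw [e1, e2, ← sum_coord_smulRight (bialgAutLin (a.snd⁻¹ * a.fst⁻¹ * a.snd)), convolveOp_sum,
      CT.antipode_tmul, Finset.sum_comm]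
    simp only [sum_convolveOp, smulRight_convolveOp_smulRight, LinearMap.sum_apply, map_sum,
      evalMap_tmul, mul_assoc]
    rfl

end evaluation
/-! ### The comultiplication of `CT(H)` -/

section tensorLaws

open Coalgebra

variable {k : Type*} [Field k] {H : Type*} [Ring H] [HopfAlgebra k H]
  {A : Type*} [Ring A] [Algebra k A]

/-- The multiplication `H ⊗ H → H` is a coalgebra map. -/
theorem comul_mul' (x : H ⊗[k] H) : TensorProduct.map (LinearMap.mul' k H) (LinearMap.mul' k H)
    (comul x) = comul (LinearMap.mul' k H x) := by
  induction x using tensor_ind with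
  | add a b ha hb => simp only [map_add, ha, hb]
  | tmul a b =>
    rw [TensorProduct.comul_tmul, LinearMap.mul'_apply, Bialgebra.comul_mul]
    generalize (comul a : H ⊗[k] H) = s
    generalize (comul b : H ⊗[k] H) = t
    induction s using tensor_ind with
    | add s s' hs hs' =>
      simp only [TensorProduct.add_tmul, map_add, add_mul, hs, hs']
    | tmul p q =>
      induction t using tensor_ind with
      | add s s' hs hs' => simp only [TensorProduct.tmul_add, map_add, mul_add, hs, hs']
      | tmul p' q' => simp

theorem convolveOp_apply_one (f g : H →ₗ[k] A) : (f ⋄ᵒ g) 1 = g 1 * f 1 := by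
  simp [convolveOp, convWith_apply, Algebra.TensorProduct.one_def]

theorem projLeft_convolveOp_projRight (f g : H →ₗ[k] A) (x y : H) :
    ((f ∘ₗ projLeft k H H) ⋄ᵒ (g ∘ₗ projRight k H H)) (x ⊗ₜ y) = g y * f x := by
  have h := LinearMap.congr_fun
    (convWith_projLeft_left (LinearMap.mul k A).flip f (g ∘ₗ projRight k H H) y) x
  rw [convWith_of_counit_right (f' := LinearMap.mulLeft k (g y) ∘ₗ f) (by simp)] at h
  exact h

theorem projRight_convolveOp_projLeft (f g : H →ₗ[k] A) (x y : H) :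
    ((g ∘ₗ projRight k H H) ⋄ᵒ (f ∘ₗ projLeft k H H)) (x ⊗ₜ y) = f x * g y := by
  have h := LinearMap.congr_fun
    (convWith_projLeft_right (LinearMap.mul k A).flip (g ∘ₗ projRight k H H) f y) x
  rw [convWith_of_counit_left (g' := LinearMap.mulRight k (g y) ∘ₗ f) (by simp)] at h
  exact h

theorem convolveOp_projRight (f g : H →ₗ[k] A) (M : H ⊗[k] H →ₗ[k] A) (x : H) :
    ((f ∘ₗ projRight k H H) ⋄ᵒ M ⋄ᵒ (g ∘ₗ projRight k H H)) ∘ₗ TensorProduct.mk k H H x =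
      f ⋄ᵒ (M ∘ₗ TensorProduct.mk k H H x) ⋄ᵒ g :=
  (convWith_projRight_right _ _ _ _).trans
    (congrArg (· ⋄ᵒ g) (convWith_projRight_left _ _ _ _))

theorem convolveOp_projLeft (f g : H →ₗ[k] A) (M : H ⊗[k] H →ₗ[k] A) (y : H) :
    ((f ∘ₗ projLeft k H H) ⋄ᵒ M ⋄ᵒ (g ∘ₗ projLeft k H H)) ∘ₗ (TensorProduct.mk k H H).flip y =
      f ⋄ᵒ (M ∘ₗ (TensorProduct.mk k H H).flip y) ⋄ᵒ g :=
  (convWith_projLeft_right _ _ _ _).trans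
    (congrArg (· ⋄ᵒ g) (convWith_projLeft_left _ _ _ _))

variable (k H) in
/-- `(Δ ⊗ 1)` on `H ⊗ H`, with values in `H ⊗ (H ⊗ H)` -/
noncomputable def comulLeft : H ⊗[k] H →ₗ[k] H ⊗[k] (H ⊗[k] H) :=
  (TensorProduct.assoc k H H H).toLinearMap ∘ₗ TensorProduct.map comul LinearMap.id

variable (k H) in
/-- `(1 ⊗ Δ)` on `H ⊗ H` -/
noncomputable def comulRight : H ⊗[k] H →ₗ[k] H ⊗[k] (H ⊗[k] H) :=
  TensorProduct.map LinearMap.id comul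

theorem comulLeft_comul (x : H) : comulLeft k H (comul x) = comulRight k H (comul x) :=
  coassoc_apply x

theorem comulLeft_mul (s t : H ⊗[k] H) :
    comulLeft k H (s * t) = comulLeft k H s * comulLeft k H t := by
  induction s using tensor_ind with
  | add s s' hs hs' => simp only [map_add, add_mul, hs, hs']
  | tmul a b =>
    induction t using tensor_ind with
    | add s s' hs hs' => simp only [map_add, mul_add, hs, hs']
    | tmul c d =>
      simp only [comulLeft, LinearMap.comp_apply, Algebra.TensorProduct.tmul_mul_tmul,
        TensorProduct.map_tmul, Bialgebra.comul_mul, LinearMap.id_apply, LinearEquiv.coe_coe]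
      generalize (comul a : H ⊗[k] H) = s
      generalize (comul c : H ⊗[k] H) = t
      induction s using tensor_ind with
      | add s s' hs hs' => simp only [TensorProduct.add_tmul, map_add, add_mul, hs, hs']
      | tmul p q =>
        induction t using tensor_ind with
        | add s s' hs hs' => simp only [TensorProduct.add_tmul, map_add, mul_add, hs, hs']
        | tmul p' q' => simp

theorem comulRight_mul (s t : H ⊗[k] H) :
    comulRight k H (s * t) = comulRight k H s * comulRight k H t := by
  induction s using tensor_ind with
  | add s s' hs hs' => simp only [map_add, add_mul, hs, hs']
  | tmul a b =>
    induction t using tensor_ind with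
    | add s s' hs hs' => simp only [map_add, mul_add, hs, hs']
    | tmul c d => simp [comulRight]

variable (k H) in
/-- `h ↦ h ⊗ (1 ⊗ 1)` -/
noncomputable def inclFirst : H →ₗ[k] H ⊗[k] (H ⊗[k] H) := (TensorProduct.mk k H _).flip 1

variable (k H) in
/-- `h ↦ 1 ⊗ (h ⊗ 1)` -/
noncomputable def inclSecond : H →ₗ[k] H ⊗[k] (H ⊗[k] H) :=
  TensorProduct.mk k H _ 1 ∘ₗ inclLeft k H

@[simp] theorem inclFirst_apply (h : H) : inclFirst k H h = h ⊗ₜ 1 := rfl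
@[simp] theorem inclSecond_apply (h : H) : inclSecond k H h = 1 ⊗ₜ (h ⊗ₜ 1) := rfl

end tensorLaws

section coalgebra

open Coalgebra HopfAlgebra
open CT (antipodeInv dualMul)

variable {k : Type*} [Field k] {H : Type*} [Ring H] [HopfAlgebra k H]

theorem projRight_mul (s t : H ⊗[k] H) :
    projRight k H H (s * t) = projRight k H H s * projRight k H H t := by
  induction s using tensor_ind with
  | add s s' hs hs' => simp only [map_add, add_mul, hs, hs']
  | tmul a b =>
    induction t using tensor_ind with
    | add s s' hs hs' => simp only [map_add, mul_add, hs, hs']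
    | tmul c d => simp [smul_smul, mul_comm]

theorem projLeft_mul (s t : H ⊗[k] H) :
    projLeft k H H (s * t) = projLeft k H H s * projLeft k H H t := by
  induction s using tensor_ind with
  | add s s' hs hs' => simp only [map_add, add_mul, hs, hs']
  | tmul a b =>
    induction t using tensor_ind with
    | add s s' hs hs' => simp only [map_add, mul_add, hs, hs']
    | tmul c d => simp [smul_smul, mul_comm]

variable [FiniteDimensional k H]

/-- The formula `evalAt_comul_CT` as an equality of functions of the second argument. -/
theorem evalMap₂_comul_CT (a : AutPair k H) (t : Module.Dual k H ⊗[k] H) (x : H) :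
    evalMap₂ k H H H (CT.comul a t) ∘ₗ TensorProduct.mk k H H x =
      (inclLeft k H ∘ₗ bialgAutLin a.fst ∘ₗ antipodeInv k H) ⋄ᵒ
        (comul ∘ₗ evalMap k H H t ∘ₗ LinearMap.mulLeft k x) ⋄ᵒ
          (inclLeft k H ∘ₗ bialgAutLin a.snd) := by
  ext y
  rw [← evalAt_comul_CT, ← evalMap₂_apply]
  rfl

theorem evalMap₂_comul_CT_apply_one (a : AutPair k H) (t : Module.Dual k H ⊗[k] H) (x : H) :
    evalMap₂ k H H H (CT.comul a t) (x ⊗ₜ 1) = comul (evalMap k H H t x) := by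
  have := LinearMap.congr_fun (evalMap₂_comul_CT a t x) 1
  rw [convolveOp_apply_one, convolveOp_apply_one] at this
  simpa [← Algebra.TensorProduct.one_def] using this

/-- The counit on the first factor removes the outer factors and leaves `t(x y)`. -/
theorem projRight_evalMap₂_comul_CT (a : AutPair k H) (t : Module.Dual k H ⊗[k] H) (x y : H) :
    projRight k H H (evalMap₂ k H H H (CT.comul a t) (x ⊗ₜ y)) = evalMap k H H t (x * y) := by
  have h := congrArg (fun f => projRight k H H ∘ₗ f) (evalMap₂_comul_CT a t x)
  simp only [comp_convolveOp (projRight_mul (k := k) (H := H))] at h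
  rw [show projRight k H H ∘ₗ inclLeft k H ∘ₗ bialgAutLin a.fst ∘ₗ antipodeInv k H =
      convOne k H H from by ext; simp [convOne_apply, YDModule.counit_aut],
    show projRight k H H ∘ₗ inclLeft k H ∘ₗ bialgAutLin a.snd =
      convOne k H H from by ext; simp [convOne_apply, YDModule.counit_aut],
    convOne_convolveOp, convolveOp_convOne] at h
  have := LinearMap.congr_fun h y
  simpa [projRight_comul] using this

theorem projLeft_evalMap₂_comul_CT (a : AutPair k H) (t : Module.Dual k H ⊗[k] H) (x : H) :
    projLeft k H H ∘ₗ evalMap₂ k H H H (CT.comul a t) ∘ₗ TensorProduct.mk k H H x =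
      (bialgAutLin a.fst ∘ₗ antipodeInv k H) ⋄ᵒ
        (evalMap k H H t ∘ₗ LinearMap.mulLeft k x) ⋄ᵒ bialgAutLin a.snd := by
  rw [evalMap₂_comul_CT, comp_convolveOp (projLeft_mul (k := k) (H := H)),
    comp_convolveOp (projLeft_mul (k := k) (H := H))]
  congr 1
  · congr 1
    · ext; simp
    · ext; simp [projLeft_comul]
  · ext; simp

end coalgebra
/-! ### Coassociativity of `CT(H)` -/

section coassociativity

open Coalgebra HopfAlgebra
open CT (antipodeInv dualMul)

variable {k : Type*} [Field k] {H : Type*} [Ring H] [HopfAlgebra k H] [FiniteDimensional k H]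

theorem evalAt_comul_left_CT (a : AutPair k H)
    (s : (Module.Dual k H ⊗[k] H) ⊗[k] (Module.Dual k H ⊗[k] H)) (x y z : H) :
    TensorProduct.map (evalAt H x) (TensorProduct.map (evalAt H y) (evalAt H z))
      (TensorProduct.assoc k _ _ _ (TensorProduct.map (CT.comul a) LinearMap.id s)) =
      ((inclFirst k H ∘ₗ bialgAutLin a.fst ∘ₗ antipodeInv k H) ⋄ᵒ
        (comulLeft k H ∘ₗ evalMap₂ k H H H s ∘ₗ (TensorProduct.mk k H H).flip z ∘ₗ
          LinearMap.mulLeft k x) ⋄ᵒ (inclFirst k H ∘ₗ bialgAutLin a.snd)) y := by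
  induction s using tensor_ind with
  | add s s' hs hs' =>
    simp only [map_add, LinearMap.comp_add, LinearMap.add_comp, convolveOp_add, add_convolveOp,
      LinearMap.add_apply, hs, hs']
  | tmul u w =>
    have e : ∀ r : (Module.Dual k H ⊗[k] H) ⊗[k] (Module.Dual k H ⊗[k] H),
        TensorProduct.map (evalAt H x) (TensorProduct.map (evalAt H y) (evalAt H z))
          (TensorProduct.assoc k _ _ _ (r ⊗ₜ w)) =
        TensorProduct.assoc k H H H (TensorProduct.map (evalAt H x) (evalAt H y) r ⊗ₜ
          evalAt H z w) := fun r => by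
      induction r using tensor_ind with
      | add r r' hr hr' => simp only [map_add, TensorProduct.add_tmul, hr, hr']
      | tmul r r' => simp
    rw [TensorProduct.map_tmul, LinearMap.id_apply, e, evalAt_comul_CT]
    let φ : H →ₗ[k] H ⊗[k] H →ₗ[k] H ⊗[k] (H ⊗[k] H) :=
      LinearMap.flip (TensorProduct.curry (TensorProduct.assoc k H H H).toLinearMap)
    -- insertion of a third tensor factor is compatible with products
    have hφ : ∀ (a b : H) (s t : H ⊗[k] H), φ (a * b) (s * t) = φ a s * φ b t := fun a b s t => by
      induction s using tensor_ind with
      | add s s' hs hs' => simp only [map_add, add_mul, hs, hs']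
      | tmul p q =>
        induction t using tensor_ind with
        | add s s' hs hs' => simp only [map_add, mul_add, hs, hs']
        | tmul p' q' => simp [φ]
    have h1 : ∀ f : H →ₗ[k] H, φ 1 ∘ₗ (inclLeft k H ∘ₗ f) = inclFirst k H ∘ₗ f :=
      fun f => by ext; simp [φ, Algebra.TensorProduct.one_def]
    have h2 : φ (evalAt H z w) ∘ₗ comul ∘ₗ evalMap k H H u ∘ₗ LinearMap.mulLeft k x =
        comulLeft k H ∘ₗ evalMap₂ k H H H (u ⊗ₜ w) ∘ₗ (TensorProduct.mk k H H).flip z ∘ₗ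
          LinearMap.mulLeft k x := by
      ext y
      simp [φ, comulLeft, evalMap_apply]
    have h3 : ∀ f g : H →ₗ[k] H ⊗[k] H, φ (evalAt H z w) ∘ₗ (f ⋄ᵒ g) =
        (φ 1 ∘ₗ f) ⋄ᵒ (φ (evalAt H z w) ∘ₗ g) := fun f g =>
      comp_convWith fun a b => by simpa using hφ (evalAt H z w) 1 (g b) (f a)
    have h4 : ∀ f g : H →ₗ[k] H ⊗[k] H, φ (evalAt H z w) ∘ₗ (f ⋄ᵒ g) =
        (φ (evalAt H z w) ∘ₗ f) ⋄ᵒ (φ 1 ∘ₗ g) := fun f g =>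
      comp_convWith fun a b => by simpa using hφ 1 (evalAt H z w) (g b) (f a)
    rw [← h2, ← h1, ← h1, ← h3, ← h4]
    rfl

theorem evalAt_comul_right_CT (a : AutPair k H)
    (s : (Module.Dual k H ⊗[k] H) ⊗[k] (Module.Dual k H ⊗[k] H)) (x y z : H) :
    TensorProduct.map (evalAt H x) (TensorProduct.map (evalAt H y) (evalAt H z))
      (TensorProduct.map LinearMap.id (CT.comul a) s) =
      ((inclSecond k H ∘ₗ bialgAutLin a.fst ∘ₗ antipodeInv k H) ⋄ᵒ
        (comulRight k H ∘ₗ evalMap₂ k H H H s ∘ₗ TensorProduct.mk k H H x ∘ₗ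
          LinearMap.mulLeft k y) ⋄ᵒ (inclSecond k H ∘ₗ bialgAutLin a.snd)) z := by
  induction s using tensor_ind with
  | add s s' hs hs' =>
    simp only [map_add, LinearMap.comp_add, LinearMap.add_comp, convolveOp_add, add_convolveOp,
      LinearMap.add_apply, hs, hs']
  | tmul u w =>
    rw [TensorProduct.map_tmul, TensorProduct.map_tmul, LinearMap.id_apply, evalAt_comul_CT]
    let φ : H →ₗ[k] H ⊗[k] H →ₗ[k] H ⊗[k] (H ⊗[k] H) := TensorProduct.mk k H _
    have h1 : ∀ f : H →ₗ[k] H, φ 1 ∘ₗ (inclLeft k H ∘ₗ f) = inclSecond k H ∘ₗ f :=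
      fun f => by ext; simp [φ]
    have h2 : φ (evalAt H x u) ∘ₗ comul ∘ₗ evalMap k H H w ∘ₗ LinearMap.mulLeft k y =
        comulRight k H ∘ₗ evalMap₂ k H H H (u ⊗ₜ w) ∘ₗ TensorProduct.mk k H H x ∘ₗ
          LinearMap.mulLeft k y := by
      ext z
      simp [φ, comulRight, evalMap_apply]
    have h3 : ∀ f g : H →ₗ[k] H ⊗[k] H, φ (evalAt H x u) ∘ₗ (f ⋄ᵒ g) =
        (φ 1 ∘ₗ f) ⋄ᵒ (φ (evalAt H x u) ∘ₗ g) := fun f g => comp_convWith fun a b => by simp [φ]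
    have h4 : ∀ f g : H →ₗ[k] H ⊗[k] H, φ (evalAt H x u) ∘ₗ (f ⋄ᵒ g) =
        (φ (evalAt H x u) ∘ₗ f) ⋄ᵒ (φ 1 ∘ₗ g) := fun f g => comp_convWith fun a b => by simp [φ]
    rw [← h2, ← h1, ← h1, ← h3, ← h4]
    rfl

theorem coassoc_CT (a : AutPair k H) (t : Module.Dual k H ⊗[k] H) :
    TensorProduct.assoc k _ _ _
      (TensorProduct.map (CT.comul a) LinearMap.id (CT.comul a t)) =
    TensorProduct.map LinearMap.id (CT.comul a) (CT.comul a t) := by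
  refine ext_map_evalAt₃ fun x y z => ?_
  rw [evalAt_comul_left_CT, evalAt_comul_right_CT]
  set l : H →ₗ[k] H := bialgAutLin a.fst ∘ₗ antipodeInv k H with hl
  set r : H →ₗ[k] H := bialgAutLin a.snd with hr
  let F : H ⊗[k] H →ₗ[k] H ⊗[k] H :=
    comul ∘ₗ evalMap k H H t ∘ₗ LinearMap.mulLeft k x ∘ₗ LinearMap.mul' k H
  -- both sides as functions of `y ⊗ z`
  have hL : ∀ z, comulLeft k H ∘ₗ evalMap₂ k H H H (CT.comul a t) ∘ₗ
      (TensorProduct.mk k H H).flip z ∘ₗ LinearMap.mulLeft k x =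
      ((comulLeft k H ∘ₗ inclLeft k H ∘ₗ l ∘ₗ projRight k H H) ⋄ᵒ (comulLeft k H ∘ₗ F) ⋄ᵒ
        (comulLeft k H ∘ₗ inclLeft k H ∘ₗ r ∘ₗ projRight k H H)) ∘ₗ
          (TensorProduct.mk k H H).flip z := fun z => by
    ext y
    have e1 := LinearMap.congr_fun (convolveOp_projRight (comulLeft k H ∘ₗ inclLeft k H ∘ₗ l)
      (comulLeft k H ∘ₗ inclLeft k H ∘ₗ r) (comulLeft k H ∘ₗ F) y) z
    have e3 := LinearMap.congr_fun (evalMap₂_comul_CT a t (x * y)) z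
    have e4 : comul ∘ₗ evalMap k H H t ∘ₗ LinearMap.mulLeft k (x * y) =
      F ∘ₗ TensorProduct.mk k H H y := by ext; simp [F, mul_assoc]
    rw [e4] at e3
    have e5 := congrArg (comulLeft k H) e3
    have e6 : comulLeft k H ∘ₗ ((inclLeft k H ∘ₗ l) ⋄ᵒ (F ∘ₗ TensorProduct.mk k H H y) ⋄ᵒ
        (inclLeft k H ∘ₗ r)) = (comulLeft k H ∘ₗ inclLeft k H ∘ₗ l) ⋄ᵒ
          ((comulLeft k H ∘ₗ F) ∘ₗ TensorProduct.mk k H H y) ⋄ᵒ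
            (comulLeft k H ∘ₗ inclLeft k H ∘ₗ r) := by
      rw [comp_convolveOp (comulLeft_mul (k := k) (H := H)),
        comp_convolveOp (comulLeft_mul (k := k) (H := H))]
      rfl
    replace e5 := e5.trans (LinearMap.congr_fun e6 z)
    exact e5.trans e1.symm
  have hR : ∀ y, comulRight k H ∘ₗ evalMap₂ k H H H (CT.comul a t) ∘ₗ TensorProduct.mk k H H x ∘ₗ
      LinearMap.mulLeft k y = ((inclFirst k H ∘ₗ l ∘ₗ LinearMap.mul' k H) ⋄ᵒ
        (comulRight k H ∘ₗ F) ⋄ᵒ (inclFirst k H ∘ₗ r ∘ₗ LinearMap.mul' k H)) ∘ₗ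
          TensorProduct.mk k H H y := fun y => by
    have e1 : ∀ f : H →ₗ[k] H, comulRight k H ∘ₗ inclLeft k H ∘ₗ f = inclFirst k H ∘ₗ f :=
      fun f => by ext; simp [comulRight]
    have e2 := congrArg (fun f => comulRight k H ∘ₗ f) (evalMap₂_comul_CT a t x)
    simp only [comp_convolveOp (comulRight_mul (k := k) (H := H)), ← hl, ← hr, e1] at e2
    have e3 : ((inclFirst k H ∘ₗ l) ⋄ᵒ (comulRight k H ∘ₗ comul ∘ₗ evalMap k H H t ∘ₗ
        LinearMap.mulLeft k x) ⋄ᵒ (inclFirst k H ∘ₗ r)) ∘ₗ LinearMap.mul' k H =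
        (inclFirst k H ∘ₗ l ∘ₗ LinearMap.mul' k H) ⋄ᵒ
          (comulRight k H ∘ₗ F) ⋄ᵒ (inclFirst k H ∘ₗ r ∘ₗ LinearMap.mul' k H) := by
      rw [convolveOp_comp (comul_mul' (k := k) (H := H)),
        convolveOp_comp (comul_mul' (k := k) (H := H))]
      rfl
    ext z
    exact (LinearMap.congr_fun e2 (y * z)).trans (LinearMap.congr_fun e3 (y ⊗ₜ z))
  -- `S⁻¹` reverses products and coproducts, so `∑ l(z)₁ l(y) ⊗ l(z)₂ = ∑ l(y z₂) ⊗ l(z₁)`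
  have hl' : (inclFirst k H ∘ₗ l ∘ₗ projLeft k H H) ⋄ᵒ
      (comulLeft k H ∘ₗ inclLeft k H ∘ₗ l ∘ₗ projRight k H H) =
      (inclSecond k H ∘ₗ l ∘ₗ projRight k H H) ⋄ᵒ (inclFirst k H ∘ₗ l ∘ₗ LinearMap.mul' k H) := by
    refine TensorProduct.ext' fun y z => ?_
    refine (projLeft_convolveOp_projRight (inclFirst k H ∘ₗ l)
      (comulLeft k H ∘ₗ inclLeft k H ∘ₗ l) y z).trans ?_
    refine .trans ?_ (LinearMap.congr_fun (convWith_projRight_left (LinearMap.mul k _).flip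
      (inclSecond k H ∘ₗ l) (inclFirst k H ∘ₗ l ∘ₗ LinearMap.mul' k H) y) z).symm
    have e : comul (l z) = TensorProduct.comm k H H (TensorProduct.map l l (comul (R := k) z)) := by
      rw [hl, LinearMap.comp_apply, TensorProduct.map_comp, LinearMap.comp_apply]
      have := YDModule.comul_aut a.fst (antipodeInv k H z)
      rw [YD.cm] at this
      rw [bialgAutLin, AlgHom.toLinearMap_apply]
      refine this.symm.trans ?_
      rw [← comul_antipodeInv]
      generalize (comul z : H ⊗[k] H) = s
      induction s using tensor_ind with
      | add s s' hs hs' => simp only [map_add, hs, hs']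
      | tmul p q => simp
    rw [convWith_apply]
    simp only [LinearMap.comp_apply, comulLeft, inclLeft_apply, TensorProduct.map_tmul, e,
      LinearEquiv.coe_coe]
    generalize (comul z : H ⊗[k] H) = s
    induction s using tensor_ind with
    | add s s' hs hs' => simp only [map_add, TensorProduct.add_tmul, add_mul, hs, hs']
    | tmul p q => simp [hl, antipodeInv_mul, Algebra.TensorProduct.one_def]
  have hr' : (comulLeft k H ∘ₗ inclLeft k H ∘ₗ r ∘ₗ projRight k H H) ⋄ᵒ
      (inclFirst k H ∘ₗ r ∘ₗ projLeft k H H) =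
      (inclFirst k H ∘ₗ r ∘ₗ LinearMap.mul' k H) ⋄ᵒ (inclSecond k H ∘ₗ r ∘ₗ projRight k H H) := by
    refine TensorProduct.ext' fun y z => ?_
    refine (projRight_convolveOp_projLeft (inclFirst k H ∘ₗ r)
      (comulLeft k H ∘ₗ inclLeft k H ∘ₗ r) y z).trans ?_
    refine .trans ?_ (LinearMap.congr_fun (convWith_projRight_right (LinearMap.mul k _).flip
      (inclFirst k H ∘ₗ r ∘ₗ LinearMap.mul' k H) (inclSecond k H ∘ₗ r) y) z).symm
    have e : comul (r z) = TensorProduct.map r r (comul (R := k) z) :=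
      (YDModule.comul_aut a.snd z).symm
    rw [convWith_apply]
    simp only [LinearMap.comp_apply, comulLeft, inclLeft_apply, TensorProduct.map_tmul, e,
      LinearEquiv.coe_coe]
    generalize (comul z : H ⊗[k] H) = s
    induction s using tensor_ind with
    | add s s' hs hs' => simp only [map_add, TensorProduct.add_tmul, mul_add, hs, hs']
    | tmul p q => simp [hr, Algebra.TensorProduct.one_def]
  have hF : comulLeft k H ∘ₗ F = comulRight k H ∘ₗ F := by
    ext1; ext y z
    exact comulLeft_comul _
  rw [hL, hR]
  refine (LinearMap.congr_fun (convolveOp_projLeft _ _ _ _) y).symm.trans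
    (.trans ?_ (LinearMap.congr_fun (convolveOp_projRight _ _ _ _) z))
  have key : (inclFirst k H ∘ₗ l ∘ₗ projLeft k H H) ⋄ᵒ
      ((comulLeft k H ∘ₗ inclLeft k H ∘ₗ l ∘ₗ projRight k H H) ⋄ᵒ (comulLeft k H ∘ₗ F) ⋄ᵒ
        (comulLeft k H ∘ₗ inclLeft k H ∘ₗ r ∘ₗ projRight k H H)) ⋄ᵒ
          (inclFirst k H ∘ₗ r ∘ₗ projLeft k H H) =
      (inclSecond k H ∘ₗ l ∘ₗ projRight k H H) ⋄ᵒ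
      ((inclFirst k H ∘ₗ l ∘ₗ LinearMap.mul' k H) ⋄ᵒ (comulRight k H ∘ₗ F) ⋄ᵒ
        (inclFirst k H ∘ₗ r ∘ₗ LinearMap.mul' k H)) ⋄ᵒ
          (inclSecond k H ∘ₗ r ∘ₗ projRight k H H) := by
    simp only [convolveOp_assoc]
    rw [hr', ← convolveOp_assoc, hl', hF, convolveOp_assoc]
  exact LinearMap.congr_fun key (y ⊗ₜ z)

end coassociativity
/-! ### Multiplicativity of the comultiplication and the antipode laws -/

section multiplicativity

open Coalgebra HopfAlgebra
open CT (antipodeInv dualMul)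

variable {k : Type*} [Field k] {H : Type*} [Ring H] [HopfAlgebra k H]
  {A : Type*} [Ring A] [Algebra k A] {ι : Type*}

theorem convolveOp_apply_repr (f g : H →ₗ[k] A) {x : H} (R : Coalgebra.Repr k x ι) :
    (f ⋄ᵒ g) x = ∑ i ∈ R.index, g (R.right i) * f (R.left i) := by
  rw [convolveOp, convWith_apply, ← R.eq]
  simp

/-- Since `Δ` is multiplicative, `∑ g(x₂ y₂) f(x₁ y₁)` is, as a function of `y`, a sum of opposite
convolution products over `∑ x₁ ⊗ x₂`. -/
theorem convolveOp_comp_mulLeft (f g : H →ₗ[k] A) {x : H} (R : Coalgebra.Repr k x ι) :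
    (f ⋄ᵒ g) ∘ₗ LinearMap.mulLeft k x =
      ∑ i ∈ R.index, (f ∘ₗ LinearMap.mulLeft k (R.left i)) ⋄ᵒ
        (g ∘ₗ LinearMap.mulLeft k (R.right i)) := by
  ext y
  simp only [LinearMap.comp_apply, LinearMap.mulLeft_apply, LinearMap.sum_apply, convolveOp,
    convWith_apply, Bialgebra.comul_mul]
  rw [← R.eq]
  generalize (comul y : H ⊗[k] H) = t
  induction t using tensor_ind with
  | add a b ha hb => simp only [mul_add, map_add, Finset.sum_add_distrib, ha, hb]
  | tmul a b => simp [Finset.sum_mul]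

theorem evalMap₂_mul_CT (a b : AutPair k H)
    (s r : (Module.Dual k H ⊗[k] H) ⊗[k] (Module.Dual k H ⊗[k] H)) {x : H}
    (R : Coalgebra.Repr k x ι) :
    evalMap₂ k H H H (TensorProduct.map (CT.mul a b) (CT.mul a b)
      (TensorProduct.tensorTensorTensorComm k _ _ _ _ (s ⊗ₜ r))) ∘ₗ TensorProduct.mk k H H x =
      ∑ i ∈ R.index,
        (TensorProduct.map (bialgAutLin (b.snd * a.fst * b.snd⁻¹))
          (bialgAutLin (b.snd * a.fst * b.snd⁻¹)) ∘ₗ evalMap₂ k H H H r ∘ₗ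
            TensorProduct.mk k H H (R.left i)) ⋄ᵒ
        (TensorProduct.map (bialgAutLin b.snd) (bialgAutLin b.snd) ∘ₗ evalMap₂ k H H H s ∘ₗ
          TensorProduct.mk k H H (R.right i)) := by
  induction s using tensor_ind with
  | add s s' hs hs' =>
    simp only [TensorProduct.add_tmul, map_add, LinearMap.add_comp, LinearMap.comp_add, hs, hs',
      convolveOp_add, Finset.sum_add_distrib]
  | tmul s₁ s₂ =>
    induction r using tensor_ind with
    | add r r' hr hr' =>
      simp only [TensorProduct.tmul_add, map_add, LinearMap.add_comp, LinearMap.comp_add, hr, hr',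
        add_convolveOp, Finset.sum_add_distrib]
    | tmul r₁ r₂ =>
      ext y
      simp only [TensorProduct.tensorTensorTensorComm_tmul, TensorProduct.map_tmul,
        evalMap₂_tmul, LinearMap.comp_apply, TensorProduct.mk_apply, evalMap_mul_CT,
        LinearMap.sum_apply]
      rw [convolveOp_apply_repr _ _ R, TensorProduct.sum_tmul]
      refine Finset.sum_congr rfl fun i _ => ?_
      refine LinearMap.congr_fun (f := TensorProduct.mk k H H _ ∘ₗ _) (g := _ ⋄ᵒ _) ?_ y
      exact comp_convWith fun c d => by simp

variable [FiniteDimensional k H]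

theorem comul_mul_CT (a b : AutPair k H) (u v : Module.Dual k H ⊗[k] H) :
    TensorProduct.map (CT.mul a b) (CT.mul a b)
      (TensorProduct.tensorTensorTensorComm k _ _ _ _ (CT.comul a u ⊗ₜ CT.comul b v)) =
    CT.comul (a * b) (CT.mul a b (u ⊗ₜ v)) := by
  refine evalMap₂_injective (TensorProduct.ext (LinearMap.ext fun x => ?_))
  let R := Coalgebra.Repr.arbitrary k x
  refine (evalMap₂_mul_CT a b _ _ R).trans (.trans ?_ (evalMap₂_comul_CT _ _ x).symm)
  have hx : comul ∘ₗ evalMap k H H (CT.mul a b (u ⊗ₜ v)) ∘ₗ LinearMap.mulLeft k x =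
      ∑ i ∈ R.index, ((comul ∘ₗ bialgAutLin (b.snd * a.fst * b.snd⁻¹) ∘ₗ evalMap k H H v) ∘ₗ
        LinearMap.mulLeft k (R.left i)) ⋄ᵒ ((comul ∘ₗ bialgAutLin b.snd ∘ₗ evalMap k H H u) ∘ₗ
          LinearMap.mulLeft k (R.right i)) := by
    rw [evalMap_mul_CT, ← LinearMap.comp_assoc, comp_convolveOp (Bialgebra.comul_mul (R := k)),
      convolveOp_comp_mulLeft _ _ R]
  rw [hx, convolveOp_sum, sum_convolveOp]
  refine Finset.sum_congr rfl fun i _ => ?_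
  set g := b.snd * a.fst * b.snd⁻¹ with hg
  have hmul : ∀ f : H ≃ₐc[k] H, ∀ s t : H ⊗[k] H,
      TensorProduct.map (bialgAutLin f) (bialgAutLin f) (s * t) =
        TensorProduct.map (bialgAutLin f) (bialgAutLin f) s *
          TensorProduct.map (bialgAutLin f) (bialgAutLin f) t := fun f s t => by
    induction s using tensor_ind with
    | add s s' hs hs' => simp only [map_add, add_mul, hs, hs']
    | tmul a b =>
      induction t using tensor_ind with
      | add s s' hs hs' => simp only [map_add, mul_add, hs, hs']
      | tmul c d => simp
  have hincl : ∀ (f : H ≃ₐc[k] H) (φ : H →ₗ[k] H), TensorProduct.map (bialgAutLin f)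
      (bialgAutLin f) ∘ₗ inclLeft k H ∘ₗ φ = inclLeft k H ∘ₗ bialgAutLin f ∘ₗ φ :=
    fun f φ => by ext; simp
  have hcomul : ∀ (f : H ≃ₐc[k] H) (φ : H →ₗ[k] H), TensorProduct.map (bialgAutLin f)
      (bialgAutLin f) ∘ₗ comul ∘ₗ φ = (comul ∘ₗ bialgAutLin f) ∘ₗ φ :=
    fun f φ => by ext z; exact YDModule.comul_aut f (φ z)
  rw [evalMap₂_comul_CT, evalMap₂_comul_CT, comp_convolveOp (hmul _), comp_convolveOp (hmul _),
    comp_convolveOp (hmul _), comp_convolveOp (hmul _)]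
  simp only [hincl, hcomul, convolveOp_assoc]
  -- the factors `β(y₃)` of `Δ v` and `S⁻¹(α(y₁))` of `Δ u` cancel
  have hcancel : (inclLeft k H ∘ₗ bialgAutLin g ∘ₗ bialgAutLin b.snd) ⋄ᵒ
      (inclLeft k H ∘ₗ bialgAutLin b.snd ∘ₗ bialgAutLin a.fst ∘ₗ antipodeInv k H) =
        convOne k H (H ⊗[k] H) := by
    have e : bialgAutLin g ∘ₗ bialgAutLin b.snd = bialgAutLin b.snd ∘ₗ bialgAutLin a.fst := by
      ext; simp [hg]
    rw [e]
    exact convolveOp_comp_antipodeInv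
      (φ := inclLeft k H ∘ₗ bialgAutLin b.snd ∘ₗ bialgAutLin a.fst) (by simp)
      (by simp [Algebra.TensorProduct.one_def])
  rw [← convolveOp_assoc (inclLeft k H ∘ₗ bialgAutLin g ∘ₗ bialgAutLin b.snd), hcancel,
    convOne_convolveOp]
  rfl

end multiplicativity

section antipodeLaws

open Coalgebra HopfAlgebra
open CT (antipodeInv dualMul)

variable {k : Type*} [Field k] {H : Type*} [Ring H] [HopfAlgebra k H]

/-- If `M(z ⊗ p) = ∑ q(z₂ ⊗ p) φ(z₁)` with a form `q` that is `c ε(z)` on `Δ(z)`, then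
`∑ M(z₁ ⊗ z₂) = c φ(z)` by coassociativity. -/
theorem comp_comul_eq_smul {M : H ⊗[k] H →ₗ[k] H} {φ : H →ₗ[k] H} {q : H ⊗[k] H →ₗ[k] k} {c : k}
    (hM : ∀ p, M ∘ₗ (TensorProduct.mk k H H).flip p =
      φ ⋄ (Algebra.linearMap k H ∘ₗ q ∘ₗ (TensorProduct.mk k H H).flip p))
    (hq : ∀ z, q (comul z) = c * counit (R := k) z) : M ∘ₗ comul = c • φ := by
  let B : H ⊗[k] H →ₗ[k] H →ₗ[k] H := TensorProduct.curry (TensorProduct.lift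
    ((LinearMap.lsmul k H).flip.compl₁₂ LinearMap.id q) ∘ₗ
      (TensorProduct.assoc k H H H).toLinearMap)
  have e1 : M = TensorProduct.lift (B.compl₁₂ (convWith (TensorProduct.mk k H H) φ LinearMap.id)
      LinearMap.id) := TensorProduct.ext' fun z p => by
    have h1 := LinearMap.congr_fun (hM p) z
    have h2 := LinearMap.congr_fun (comp_convWith (C := H) (φ := B.flip p)
      (B := TensorProduct.mk k H H) (f := φ) (g := LinearMap.id) (B' := LinearMap.mul k H)
      (f' := φ) (g' := Algebra.linearMap k H ∘ₗ q ∘ₗ (TensorProduct.mk k H H).flip p)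
      fun x y => by
        simp [B, Algebra.algebraMap_eq_smul_one]) z
    simpa using h1.trans h2.symm
  have e2 : M ∘ₗ comul = convWith B (convWith (TensorProduct.mk k H H) φ LinearMap.id)
      LinearMap.id := by
    conv_lhs => rw [e1]
    rfl
  have e3 : convWith (TensorProduct.curry q) LinearMap.id LinearMap.id = c • counit := by
    ext z
    have : TensorProduct.lift ((TensorProduct.curry q).compl₁₂ LinearMap.id LinearMap.id) = q :=
      TensorProduct.ext' fun x y => by simp
    rw [convWith_apply, this, hq]
    simp
  rw [e2, convWith_assoc (B₃ := (LinearMap.lsmul k H).flip) (B₄ := TensorProduct.curry q)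
    (f' := φ) (g' := LinearMap.id) (h' := LinearMap.id) (fun x y z => by simp [B]), e3]
  exact convWith_of_counit_right fun x y => by simp [smul_smul, mul_comm]

variable (k H) in
/-- The bilinear map `(u ⊗ w, c) ↦ u c S(w)`. -/
noncomputable def mulAntipodeRight : H ⊗[k] H →ₗ[k] H →ₗ[k] H :=
  TensorProduct.curry (LinearMap.mul' k H ∘ₗ
    TensorProduct.map (LinearMap.mul' k H) (antipode k) ∘ₗ
    (TensorProduct.assoc k H H H).symm.toLinearMap ∘ₗ
    TensorProduct.map LinearMap.id (TensorProduct.comm k H H).toLinearMap ∘ₗ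
    (TensorProduct.assoc k H H H).toLinearMap)

@[simp] theorem mulAntipodeRight_tmul (u w c : H) :
    mulAntipodeRight k H (u ⊗ₜ w) c = u * c * antipode k w := rfl

theorem mulAntipodeRight_incl_mul (a c : H) (w : H ⊗[k] H) :
    mulAntipodeRight k H (inclLeft k H a * w) c = a * mulAntipodeRight k H w c := by
  induction w using tensor_ind with
  | add w w' hw hw' => simp only [mul_add, map_add, LinearMap.add_apply, hw, hw']
  | tmul u w => simp [mul_assoc]

theorem mulAntipodeRight_mul_incl (b c : H) (w : H ⊗[k] H) :
    mulAntipodeRight k H (w * inclLeft k H b) c = mulAntipodeRight k H w (b * c) := by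
  induction w using tensor_ind with
  | add w w' hw hw' => simp only [add_mul, map_add, LinearMap.add_apply, hw, hw']
  | tmul u w => simp [mul_assoc]

theorem convWith_mulAntipodeRight_left (f h : H →ₗ[k] H) (g : H →ₗ[k] H ⊗[k] H) :
    convWith (mulAntipodeRight k H) ((inclLeft k H ∘ₗ f) ⋄ g) h =
      f ⋄ convWith (mulAntipodeRight k H) g h :=
  convWith_assoc fun _ _ _ => mulAntipodeRight_incl_mul _ _ _

theorem convWith_mulAntipodeRight_right (f h : H →ₗ[k] H) (g : H →ₗ[k] H ⊗[k] H) :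
    convWith (mulAntipodeRight k H) (g ⋄ (inclLeft k H ∘ₗ f)) h =
      convWith (mulAntipodeRight k H) g (f ⋄ h) :=
  convWith_assoc fun _ _ _ => mulAntipodeRight_mul_incl _ _ _

theorem mulAntipodeRight_comul (h : H) :
    mulAntipodeRight k H (comul h) 1 = counit (R := k) h • 1 := by
  have e := LinearMap.congr_fun (id_convolve_antipode (k := k) (H := H)) h
  rw [convOne_apply, convolve, convWith_apply] at e
  rw [← e]
  generalize (comul h : H ⊗[k] H) = w
  induction w using tensor_ind with
  | add w w' hw hw' => simp only [map_add, LinearMap.add_apply, hw, hw']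
  | tmul u w => simp

variable (k H) in
/-- The bilinear map `(u ⊗ w, c) ↦ S(u) c w`. -/
noncomputable def antipodeMulLeft : H ⊗[k] H →ₗ[k] H →ₗ[k] H :=
  TensorProduct.curry (LinearMap.mul' k H ∘ₗ
    TensorProduct.map (antipode k) (LinearMap.mul' k H) ∘ₗ
    TensorProduct.map LinearMap.id (TensorProduct.comm k H H).toLinearMap ∘ₗ
    (TensorProduct.assoc k H H H).toLinearMap)

@[simp] theorem antipodeMulLeft_tmul (u w c : H) :
    antipodeMulLeft k H (u ⊗ₜ w) c = antipode k u * (c * w) := rfl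

theorem antipodeMulLeft_incl_mul (a c : H) (w : H ⊗[k] H) :
    antipodeMulLeft k H (inclLeft k H a * w) c = antipodeMulLeft k H w (antipode k a * c) := by
  induction w using tensor_ind with
  | add w w' hw hw' => simp only [mul_add, map_add, LinearMap.add_apply, hw, hw']
  | tmul u w => simp [mul_assoc, antipode_mul_antidistrib]

theorem antipodeMulLeft_mul_incl (b c : H) (w : H ⊗[k] H) :
    antipodeMulLeft k H (w * inclLeft k H b) c = antipode k b * antipodeMulLeft k H w c := by
  induction w using tensor_ind with
  | add w w' hw hw' => simp only [add_mul, mul_add, map_add, LinearMap.add_apply, hw, hw']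
  | tmul u w => simp [mul_assoc, antipode_mul_antidistrib]

theorem convWith_antipodeMulLeft_right (f h : H →ₗ[k] H) (g : H →ₗ[k] H ⊗[k] H) :
    convWith (antipodeMulLeft k H) (g ⋄ᵒ (inclLeft k H ∘ₗ f)) h =
      convWith (antipodeMulLeft k H) g ((antipode k ∘ₗ f) ⋄ h) :=
  convWith_assoc fun _ _ _ => antipodeMulLeft_incl_mul _ _ _

theorem convWith_antipodeMulLeft_left (f h : H →ₗ[k] H) (g : H →ₗ[k] H ⊗[k] H) :
    convWith (antipodeMulLeft k H) ((inclLeft k H ∘ₗ f) ⋄ᵒ g) h =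
      (antipode k ∘ₗ f) ⋄ convWith (antipodeMulLeft k H) g h :=
  convWith_assoc fun _ _ _ => antipodeMulLeft_mul_incl _ _ _

theorem antipodeMulLeft_comul (h : H) :
    antipodeMulLeft k H (comul h) 1 = counit (R := k) h • 1 := by
  have e := LinearMap.congr_fun (antipode_convolve_id (k := k) (H := H)) h
  rw [convOne_apply, convolve, convWith_apply] at e
  rw [← e]
  generalize (comul h : H ⊗[k] H) = w
  induction w using tensor_ind with
  | add w w' hw hw' => simp only [map_add, LinearMap.add_apply, hw, hw']
  | tmul u w => simp

variable [FiniteDimensional k H]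

/-- The map `z ⊗ p ↦ ∑ u(p) α(S⁻¹(z₂)) S(w(S⁻¹(z₁)))` for `s = u ⊗ w`, which enters the product of
`u` and the antipode of `w` in `CT(H)`. -/
noncomputable def mulAntipodeMap (α : H →ₗ[k] H)
    (s : (Module.Dual k H ⊗[k] H) ⊗[k] (Module.Dual k H ⊗[k] H)) : H ⊗[k] H →ₗ[k] H :=
  convWith (mulAntipodeRight k H) (evalMap₂ k H H H s ∘ₗ (TensorProduct.comm k H H).toLinearMap ∘ₗ
    TensorProduct.map (antipodeInv k H) LinearMap.id)
    ((α ∘ₗ antipodeInv k H) ∘ₗ projLeft k H H)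

theorem mulAntipodeMap_comp (α : H →ₗ[k] H)
    (s : (Module.Dual k H ⊗[k] H) ⊗[k] (Module.Dual k H ⊗[k] H)) (p : H) :
    mulAntipodeMap α s ∘ₗ (TensorProduct.mk k H H).flip p =
      convWith (mulAntipodeRight k H) (evalMap₂ k H H H s ∘ₗ TensorProduct.mk k H H p ∘ₗ
        antipodeInv k H) (α ∘ₗ antipodeInv k H) :=
  (convWith_projLeft_right _ _ _ _).trans (congrArg₂ _ (by ext; simp) rfl)

theorem mulAntipodeMap_tmul (α : H →ₗ[k] H) (u w : Module.Dual k H ⊗[k] H) :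
    mulAntipodeMap α (u ⊗ₜ w) ∘ₗ comul = (antipode k ∘ₗ evalMap k H H w ∘ₗ antipodeInv k H) ⋄ᵒ
      (α ∘ₗ antipodeInv k H) ⋄ᵒ evalMap k H H u := by
  rw [convolveOp, convWith]
  congr 1
  refine TensorProduct.ext' fun z p => ?_
  refine (LinearMap.congr_fun (mulAntipodeMap_comp _ _ p) z).trans ?_
  refine .trans ?_ (LinearMap.congr_fun (f := LinearMap.mulLeft k (evalMap k H H u p) ∘ₗ
    ((antipode k ∘ₗ evalMap k H H w ∘ₗ antipodeInv k H) ⋄ᵒ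
    (α ∘ₗ antipodeInv k H))) (g := _) rfl z)
  refine LinearMap.congr_fun (.symm ?_) z
  exact comp_convWith fun x y => by simp [mul_assoc]

/-- On `Δ t` the two sandwiching factors of the comultiplication cancel, and what is left of `t`
is its counit, by `comp_comul_eq_smul`. -/
theorem mulAntipodeMap_comul_CT (a : AutPair k H) (t : Module.Dual k H ⊗[k] H) :
    mulAntipodeMap (bialgAutLin a.fst) (CT.comul a t) ∘ₗ comul =
      counit (R := k) (evalMap k H H t 1) • (bialgAutLin a.snd ∘ₗ antipodeInv k H) := by
  refine comp_comul_eq_smul (q := counit ∘ₗ evalMap k H H t ∘ₗ LinearMap.mul' k H ∘ₗ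
    (TensorProduct.comm k H H).toLinearMap ∘ₗ TensorProduct.map (antipodeInv k H) LinearMap.id)
    (fun p => ?_) fun z => ?_
  · rw [mulAntipodeMap_comp, ← LinearMap.comp_assoc, evalMap₂_comul_CT,
      convolveOp_comp_anti comul_antipodeInv, convolveOp_comp_anti comul_antipodeInv]
    rw [LinearMap.comp_assoc (antipodeInv k H) (bialgAutLin a.snd),
      LinearMap.comp_assoc (antipodeInv k H) (bialgAutLin a.fst ∘ₗ antipodeInv k H),
      convWith_mulAntipodeRight_left, convWith_mulAntipodeRight_right]
    refine congrArg₂ _ rfl ?_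
    -- `∑ α(S⁻¹(S⁻¹(z₁))) α(S⁻¹(z₂)) = ε(z)`
    have e : ((bialgAutLin a.fst ∘ₗ antipodeInv k H) ∘ₗ antipodeInv k H) ⋄
        (bialgAutLin a.fst ∘ₗ antipodeInv k H) = convOne k H H := by
      rw [← comp_convOne (φ := bialgAutLin a.fst ∘ₗ antipodeInv k H) (by simp),
        ← antipodeInv_convolveOp_id, anti_comp_convolveOp (by simp [antipodeInv_mul])]
      rfl
    rw [e]
    refine convWith_of_counit_right fun x y => ?_
    simp only [convOne_apply, map_smul, LinearMap.comp_apply, mulAntipodeRight_comul]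
    simp [Algebra.algebraMap_eq_smul_one]
  · have e := LinearMap.congr_fun (antipodeInv_convolveOp_id (k := k) (H := H)) z
    rw [convOne_apply, convolveOp, convWith_apply] at e
    have e' : ∀ w : H ⊗[k] H, LinearMap.mul' k H (TensorProduct.comm k H H
      (TensorProduct.map (antipodeInv k H) LinearMap.id w)) = TensorProduct.lift
        ((LinearMap.mul k H).flip.compl₁₂ (antipodeInv k H) LinearMap.id) w := fun w => by
      induction w using tensor_ind with
      | add w w' hw hw' => simp only [map_add, hw, hw']
      | tmul u w => simp
    simp [e', e, mul_comm]

theorem mul_antipode_CT (a : AutPair k H) (t : Module.Dual k H ⊗[k] H) :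
    CT.mul a a⁻¹ (TensorProduct.map LinearMap.id (CT.antipode a) (CT.comul a t)) =
      CT.counit t • (counit (R := k) (A := H) ⊗ₜ[k] (1 : H)) := by
  have h1 : ∀ s, evalMap k H H (CT.mul a a⁻¹ (TensorProduct.map LinearMap.id (CT.antipode a) s)) =
      LinearMap.id ⋄ᵒ (bialgAutLin a.snd⁻¹ ∘ₗ
        mulAntipodeMap (bialgAutLin a.fst) s ∘ₗ comul) := fun s => by
    induction s using tensor_ind with
    | add s s' hs hs' =>
      have : mulAntipodeMap (bialgAutLin a.fst) (s + s') =
          mulAntipodeMap (bialgAutLin a.fst) s + mulAntipodeMap (bialgAutLin a.fst) s' := by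
        simp only [mulAntipodeMap, map_add, LinearMap.add_comp, add_convWith]
      simp only [map_add, this, LinearMap.add_comp, LinearMap.comp_add, convolveOp_add, hs, hs']
    | tmul u w =>
      rw [mulAntipodeMap_tmul, TensorProduct.map_tmul, evalMap_mul_CT, evalMap_antipode_CT,
        LinearMap.id_apply, comp_convolveOp (by simp), comp_convolveOp (by simp),
        comp_convolveOp (by simp), comp_convolveOp (by simp)]
      simp only [convolveOp_assoc]
      refine congrArg₂ _ ?_ (congrArg₂ _ ?_ (congrArg₂ _ ?_ ?_)) <;>
        ext x <;> simp [AutPair.inv_fst, AutPair.inv_snd]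
  refine evalMap_injective ?_
  rw [h1, mulAntipodeMap_comul_CT, map_smul, evalMap_tmul, counit_CT, LinearMap.comp_smul]
  have e : bialgAutLin a.snd⁻¹ ∘ₗ bialgAutLin a.snd ∘ₗ antipodeInv k H = antipodeInv k H := by
    ext; simp
  rw [e, convolveOp_smul, id_convolveOp_antipodeInv]
  congr 1
  ext; simp [convOne_apply]

/-- The map `z ⊗ p ↦ ∑ S(u(S⁻¹(p))) β(z₂) w(z₁)` for `s = u ⊗ w`, which enters the product of
the antipode of `u` and `w` in `CT(H)`. -/
noncomputable def antipodeMulMap (β : H →ₗ[k] H)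
    (s : (Module.Dual k H ⊗[k] H) ⊗[k] (Module.Dual k H ⊗[k] H)) : H ⊗[k] H →ₗ[k] H :=
  convWith (antipodeMulLeft k H) (evalMap₂ k H H H s ∘ₗ (TensorProduct.comm k H H).toLinearMap ∘ₗ
    TensorProduct.map LinearMap.id (antipodeInv k H)) (β ∘ₗ projLeft k H H)

theorem antipodeMulMap_comp (β : H →ₗ[k] H)
    (s : (Module.Dual k H ⊗[k] H) ⊗[k] (Module.Dual k H ⊗[k] H)) (p : H) :
    antipodeMulMap β s ∘ₗ (TensorProduct.mk k H H).flip p = convWith (antipodeMulLeft k H)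
      (evalMap₂ k H H H s ∘ₗ TensorProduct.mk k H H (antipodeInv k H p)) β :=
  (convWith_projLeft_right _ _ _ _).trans (congrArg₂ _ (by ext; simp) rfl)

theorem antipodeMulMap_tmul (β : H →ₗ[k] H) (u w : Module.Dual k H ⊗[k] H) :
    antipodeMulMap β (u ⊗ₜ w) ∘ₗ comul =
      evalMap k H H w ⋄ᵒ β ⋄ᵒ (antipode k ∘ₗ evalMap k H H u ∘ₗ antipodeInv k H) := by
  rw [convolveOp, convWith]
  congr 1
  refine TensorProduct.ext' fun z p => ?_
  refine (LinearMap.congr_fun (antipodeMulMap_comp _ _ p) z).trans ?_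
  refine .trans ?_ (LinearMap.congr_fun (f := LinearMap.mulLeft k
    (antipode k (evalMap k H H u (antipodeInv k H p))) ∘ₗ (evalMap k H H w ⋄ᵒ β)) (g := _) rfl z)
  refine LinearMap.congr_fun (.symm ?_) z
  exact comp_convWith fun x y => by simp

theorem antipodeMulMap_comul_CT (a : AutPair k H) (t : Module.Dual k H ⊗[k] H) :
    antipodeMulMap (bialgAutLin a.snd) (CT.comul a t) ∘ₗ comul =
      counit (R := k) (evalMap k H H t 1) • bialgAutLin a.fst := by
  refine comp_comul_eq_smul (q := counit ∘ₗ evalMap k H H t ∘ₗ LinearMap.mul' k H ∘ₗ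
    (TensorProduct.comm k H H).toLinearMap ∘ₗ TensorProduct.map LinearMap.id (antipodeInv k H))
    (fun p => ?_) fun z => ?_
  · rw [antipodeMulMap_comp, evalMap₂_comul_CT]
    have e : (antipode k ∘ₗ bialgAutLin a.snd) ⋄ bialgAutLin a.snd = convOne k H H := by
      have := convolve_comp (YDModule.comul_aut a.snd) (antipode k) (LinearMap.id (M := H))
      rw [antipode_convolve_id, convOne_comp (u := bialgAutLin a.snd)
        (YDModule.counit_aut a.snd)] at this
      exact this.symm
    have e' : antipode k ∘ₗ bialgAutLin a.fst ∘ₗ antipodeInv k H = bialgAutLin a.fst := by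
      ext; simp
    rw [convWith_antipodeMulLeft_right, e, convWith_antipodeMulLeft_left, e']
    refine congrArg₂ _ rfl ?_
    refine convWith_of_counit_right fun x y => ?_
    simp only [convOne_apply, map_smul, LinearMap.comp_apply, antipodeMulLeft_comul]
    simp [Algebra.algebraMap_eq_smul_one]
  · have e := LinearMap.congr_fun (id_convolveOp_antipodeInv (k := k) (H := H)) z
    rw [convOne_apply, convolveOp, convWith_apply] at e
    have e' : ∀ w : H ⊗[k] H, LinearMap.mul' k H (TensorProduct.comm k H H
      (TensorProduct.map LinearMap.id (antipodeInv k H) w)) = TensorProduct.lift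
        ((LinearMap.mul k H).flip.compl₁₂ LinearMap.id (antipodeInv k H)) w := fun w => by
      induction w using tensor_ind with
      | add w w' hw hw' => simp only [map_add, hw, hw']
      | tmul u w => simp
    simp [e', e, mul_comm]

theorem antipode_mul_CT (a : AutPair k H) (t : Module.Dual k H ⊗[k] H) :
    CT.mul a⁻¹ a (TensorProduct.map (CT.antipode a) LinearMap.id (CT.comul a t)) =
      CT.counit t • (counit (R := k) (A := H) ⊗ₜ[k] (1 : H)) := by
  have h1 : ∀ s, evalMap k H H (CT.mul a⁻¹ a (TensorProduct.map (CT.antipode a) LinearMap.id s)) =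
      (bialgAutLin a.fst⁻¹ ∘ₗ antipodeMulMap (bialgAutLin a.snd) s ∘ₗ comul) ⋄ᵒ
        antipodeInv k H := fun s => by
    induction s using tensor_ind with
    | add s s' hs hs' =>
      have : antipodeMulMap (bialgAutLin a.snd) (s + s') =
          antipodeMulMap (bialgAutLin a.snd) s + antipodeMulMap (bialgAutLin a.snd) s' := by
        simp only [antipodeMulMap, map_add, LinearMap.add_comp, add_convWith]
      simp only [map_add, this, LinearMap.add_comp, LinearMap.comp_add, add_convolveOp, hs, hs']
    | tmul u w =>
      rw [antipodeMulMap_tmul, TensorProduct.map_tmul, evalMap_mul_CT, evalMap_antipode_CT,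
        LinearMap.id_apply, comp_convolveOp (by simp), comp_convolveOp (by simp),
        comp_convolveOp (by simp), comp_convolveOp (by simp)]
      simp only [convolveOp_assoc]
      refine congrArg₂ _ ?_ (congrArg₂ _ ?_ (congrArg₂ _ ?_ ?_)) <;>
        ext x <;> simp [AutPair.inv_fst, AutPair.inv_snd]
  refine evalMap_injective ?_
  rw [h1, antipodeMulMap_comul_CT, map_smul, evalMap_tmul, counit_CT, LinearMap.comp_smul]
  have e : bialgAutLin a.fst⁻¹ ∘ₗ bialgAutLin a.fst = LinearMap.id := by ext; simp
  rw [e, smul_convolveOp, id_convolveOp_antipodeInv]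
  congr 1
  ext; simp [convOne_apply]

end antipodeLaws
/-! ### The forms on `CT(H)` -/

section sigma

open Coalgebra HopfAlgebra
open CT (antipodeInv dualMul)

variable {k : Type*} [Field k] {H : Type*} [Ring H] [HopfAlgebra k H]

/-- The form `s ⊗ t ↦ ε(s(f(t(1))))`. -/
noncomputable def evalForm (f : H →ₗ[k] H) :
    (Module.Dual k H ⊗[k] H) ⊗[k] (Module.Dual k H ⊗[k] H) →ₗ[k] k :=
  counit ∘ₗ TensorProduct.lift (evalMap k H H) ∘ₗ
    TensorProduct.map LinearMap.id (f ∘ₗ evalAt H 1)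

@[simp] theorem evalForm_tmul (f : H →ₗ[k] H) (s t : Module.Dual k H ⊗[k] H) :
    evalForm f (s ⊗ₜ t) = counit (R := k) (evalMap k H H s (f (evalMap k H H t 1))) := by
  simp [evalForm, evalMap_apply]

theorem sigma_eq_evalForm (b : AutPair k H) : CT.sigma b = evalForm (bialgAutLin b.snd⁻¹) :=
  TensorProduct.ext' fun s t => by rw [sigma_CT, evalForm_tmul]; rfl

variable [FiniteDimensional k H]

/-- The convolution of `evalForm f` and `evalForm g` is the form of the convolution product `f ⋄ g`,
so `σ` is inverted by composing with the antipode. -/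
theorem conv_evalForm (a b : AutPair k H) (f g : H →ₗ[k] H) (x y : Module.Dual k H ⊗[k] H) :
    Coact.conv (CT.comul a) (CT.comul b) (evalForm f) (evalForm g) (x ⊗ₜ y) =
      counit (R := k) (evalMap k H H x
        (LinearMap.mul' k H (TensorProduct.map f g (comul (evalMap k H H y 1))))) := by
  have e1 : ∀ r s : (Module.Dual k H ⊗[k] H) ⊗[k] (Module.Dual k H ⊗[k] H),
      LinearMap.mul' k k (TensorProduct.map (evalForm f) (evalForm g)
        (TensorProduct.tensorTensorTensorComm k _ _ _ _ (r ⊗ₜ s))) =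
      counit (R := k) (projRight k H H (evalMap₂ k H H H r
        (TensorProduct.map f g (evalMap₂ k H H H s (1 ⊗ₜ 1))))) := fun r s => by
    induction r using tensor_ind with
    | add r r' hr hr' =>
      simp only [TensorProduct.add_tmul, map_add, LinearMap.add_apply, hr, hr']
    | tmul r₁ r₂ =>
      induction s using tensor_ind with
      | add s s' hs hs' =>
        simp only [TensorProduct.tmul_add, map_add, LinearMap.add_apply, hs, hs']
      | tmul s₁ s₂ => simp
  have e2 : ∀ w : H ⊗[k] H, projRight k H H (evalMap₂ k H H H (CT.comul a x) w) =
      evalMap k H H x (LinearMap.mul' k H w) := fun w => by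
    induction w using tensor_ind with
    | add w w' hw hw' => simp only [map_add, hw, hw']
    | tmul u v => rw [projRight_evalMap₂_comul_CT, LinearMap.mul'_apply]
  refine (e1 _ _).trans ?_
  rw [e2, evalMap₂_comul_CT_apply_one]

theorem conv_sigma_inverse (a b : AutPair k H) (x y : Module.Dual k H ⊗[k] H) :
    Coact.conv (CT.comul a) (CT.comul b) (CT.sigma b)
        (evalForm (bialgAutLin b.snd⁻¹ ∘ₗ antipode k)) (x ⊗ₜ y) = CT.counit x * CT.counit y ∧
      Coact.conv (CT.comul a) (CT.comul b) (evalForm (bialgAutLin b.snd⁻¹ ∘ₗ antipode k))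
        (CT.sigma b) (x ⊗ₜ y) = CT.counit x * CT.counit y := by
  have h1 : ∀ w : H, LinearMap.mul' k H (TensorProduct.map (bialgAutLin b.snd⁻¹)
      (bialgAutLin b.snd⁻¹ ∘ₗ antipode k) (comul w)) = counit (R := k) w • 1 := fun w => by
    have e := congrArg (bialgAutLin b.snd⁻¹)
      (LinearMap.congr_fun (id_convolve_antipode (k := k) (H := H)) w)
    rw [convOne_apply, convolve, convWith_apply, map_smul,
      show bialgAutLin b.snd⁻¹ 1 = 1 from map_one b.snd⁻¹] at e
    rw [← e]
    generalize (comul w : H ⊗[k] H) = t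
    induction t using tensor_ind with
    | add t t' ht ht' => simp only [map_add, ht, ht']
    | tmul p q => simp
  have h2 : ∀ w : H, LinearMap.mul' k H (TensorProduct.map (bialgAutLin b.snd⁻¹ ∘ₗ antipode k)
      (bialgAutLin b.snd⁻¹) (comul w)) = counit (R := k) w • 1 := fun w => by
    have e := congrArg (bialgAutLin b.snd⁻¹)
      (LinearMap.congr_fun (antipode_convolve_id (k := k) (H := H)) w)
    rw [convOne_apply, convolve, convWith_apply, map_smul,
      show bialgAutLin b.snd⁻¹ 1 = 1 from map_one b.snd⁻¹] at e
    rw [← e]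
    generalize (comul w : H ⊗[k] H) = t
    induction t using tensor_ind with
    | add t t' ht ht' => simp only [map_add, ht, ht']
    | tmul p q => simp
  rw [sigma_eq_evalForm]
  constructor
  · rw [conv_evalForm, h1]
    simp [counit_CT, mul_comm]
  · rw [conv_evalForm, h2]
    simp [counit_CT, mul_comm]

theorem sigma_mul_left_CT (a b c : AutPair k H) (x y z : Module.Dual k H ⊗[k] H) :
    CT.sigma c (CT.mul a b (x ⊗ₜ y) ⊗ₜ z) = LinearMap.mul' k k (TensorProduct.map
      (CT.sigma c ∘ₗ TensorProduct.mk k _ _ y) (CT.sigma c ∘ₗ TensorProduct.mk k _ _ x)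
        (CT.comul c z)) := by
  have e1 : ∀ s : (Module.Dual k H ⊗[k] H) ⊗[k] (Module.Dual k H ⊗[k] H),
      LinearMap.mul' k k (TensorProduct.map (CT.sigma c ∘ₗ TensorProduct.mk k _ _ y)
        (CT.sigma c ∘ₗ TensorProduct.mk k _ _ x) s) =
      LinearMap.mul' k k (TensorProduct.map (counit ∘ₗ evalMap k H H y) (counit ∘ₗ evalMap k H H x)
        (TensorProduct.map (bialgAutLin c.snd⁻¹) (bialgAutLin c.snd⁻¹)
          (evalMap₂ k H H H s (1 ⊗ₜ 1)))) := fun s => by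
    induction s using tensor_ind with
    | add s s' hs hs' => simp only [map_add, LinearMap.add_apply, hs, hs']
    | tmul s s' => simp [sigma_CT]
  have e2 := comp_convWith (C := H) (φ := counit (R := k) (A := H)) (B := (LinearMap.mul k H).flip)
    (f := bialgAutLin (b.snd * a.fst * b.snd⁻¹) ∘ₗ evalMap k H H y)
    (g := bialgAutLin b.snd ∘ₗ evalMap k H H x) (B' := LinearMap.mul k k)
    (f' := counit ∘ₗ evalMap k H H y) (g' := counit ∘ₗ evalMap k H H x)
    (fun u v => by
      have h1 := YDModule.counit_aut b.snd (evalMap k H H x v)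
      have h2 := YDModule.counit_aut (b.snd * a.fst * b.snd⁻¹) (evalMap k H H y u)
      simp only [LinearMap.flip_apply, LinearMap.mul_apply', LinearMap.comp_apply,
        Bialgebra.counit_mul]
      exact (congrArg₂ (· * ·) h1 h2).trans (mul_comm _ _))
  rw [e1, evalMap₂_comul_CT_apply_one, sigma_CT, evalMap_mul_CT]
  refine (LinearMap.congr_fun e2 _).trans ?_
  rw [convWith_eq_comul]
  have e3 := YDModule.comul_aut c.snd⁻¹ (evalMap k H H z 1)
  rw [YD.cm] at e3
  rw [e3]
  rfl

theorem sigma_mul_right_CT (a b c : AutPair k H) (x y z : Module.Dual k H ⊗[k] H) :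
    CT.sigma (b * c) (x ⊗ₜ CT.mul b c (y ⊗ₜ z)) = LinearMap.mul' k k (TensorProduct.map
      (CT.sigma b ∘ₗ (TensorProduct.mk k _ _).flip y)
      (CT.sigma c ∘ₗ (TensorProduct.mk k _ _).flip z ∘ₗ CT.crossing b⁻¹ a) (CT.comul a x)) := by
  have e1 : ∀ s : (Module.Dual k H ⊗[k] H) ⊗[k] (Module.Dual k H ⊗[k] H),
      LinearMap.mul' k k (TensorProduct.map (CT.sigma b ∘ₗ (TensorProduct.mk k _ _).flip y)
        (CT.sigma c ∘ₗ (TensorProduct.mk k _ _).flip z ∘ₗ CT.crossing b⁻¹ a) s) =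
      counit (R := k) (projRight k H H (evalMap₂ k H H H s ((b.snd⁻¹ (evalMap k H H y 1)) ⊗ₜ
        (b.snd⁻¹ (b.fst (c.snd⁻¹ (evalMap k H H z 1))))))) := fun s => by
    induction s using tensor_ind with
    | add s s' hs hs' => simp only [map_add, LinearMap.add_apply, hs, hs']
    | tmul s s' =>
      simp [sigma_CT, evalMap_crossing_CT, YDModule.counit_aut, AutPair.inv_fst, AutPair.inv_snd]
  rw [e1, projRight_evalMap₂_comul_CT, sigma_CT, evalMap_mul_CT, convolveOp_apply_one]
  simp [AutPair.mul_snd]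

theorem sigma_comm_CT (a b : AutPair k H) (x y : Module.Dual k H ⊗[k] H) :
    TensorProduct.lid k _ (TensorProduct.map (CT.sigma b)
      (CT.mul b (b⁻¹ * a * b⁻¹⁻¹) ∘ₗ (TensorProduct.comm k _ _).toLinearMap ∘ₗ
          TensorProduct.map (CT.crossing b⁻¹ a) LinearMap.id)
      (TensorProduct.tensorTensorTensorComm k _ _ _ _ (CT.comul a x ⊗ₜ CT.comul b y))) =
    TensorProduct.rid k _ (TensorProduct.map (CT.mul a b) (CT.sigma b)
      (TensorProduct.tensorTensorTensorComm k _ _ _ _ (CT.comul a x ⊗ₜ CT.comul b y))) := by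
  set f : H →ₗ[k] H := bialgAutLin (b.snd * a.snd * b.snd⁻¹) with hf
  set g : H →ₗ[k] H := bialgAutLin (b.snd * a.fst * b.snd⁻¹) with hg
  set θ : H →ₗ[k] H := bialgAutLin (b.snd⁻¹ * b.fst) with hθ
  -- the two products, before the comultiplications are inserted
  obtain ⟨E, hE⟩ : ∃ E : (H ⊗[k] H →ₗ[k] H) →ₗ[k] H →ₗ[k] H ⊗[k] H →ₗ[k] H,
      ∀ G q u v, E G q (u ⊗ₜ v) = f v * G (q ⊗ₜ u) := by
    refine ⟨{ toFun := fun G => TensorProduct.curry (LinearMap.mul' k H ∘ₗ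
              (TensorProduct.comm k H H).toLinearMap ∘ₗ TensorProduct.map G f ∘ₗ
        (TensorProduct.assoc k H H H).symm.toLinearMap)
              map_add' := ?_
              map_smul' := ?_ }, fun G q u v => rfl⟩
    · intro G G'
      ext q u v
      simp [mul_add]
    · intro c G
      ext q u v
      simp
  obtain ⟨D, hD⟩ : ∃ D : (H ⊗[k] H →ₗ[k] H) →ₗ[k] H ⊗[k] H →ₗ[k] H →ₗ[k] H,
      ∀ G q u v, D G (u ⊗ₜ v) q = G (q ⊗ₜ v) * g u := by
    refine ⟨{ toFun := fun G => TensorProduct.curry (LinearMap.mul' k H ∘ₗ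
              TensorProduct.map (G ∘ₗ (TensorProduct.comm k H H).toLinearMap) g ∘ₗ
        (TensorProduct.comm k H _).toLinearMap ∘ₗ (TensorProduct.assoc k H H H).toLinearMap)
              map_add' := ?_
              map_smul' := ?_ }, fun G q u v => rfl⟩
    · intro G G'
      ext q u v
      simp [add_mul]
    · intro c G
      ext q u v
      simp
  have hL : ∀ r s : (Module.Dual k H ⊗[k] H) ⊗[k] (Module.Dual k H ⊗[k] H),
      evalMap k H H (TensorProduct.lid k _ (TensorProduct.map (CT.sigma b)
        (CT.mul b (b⁻¹ * a * b⁻¹⁻¹) ∘ₗ (TensorProduct.comm k _ _).toLinearMap ∘ₗ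
          TensorProduct.map (CT.crossing b⁻¹ a) LinearMap.id)
        (TensorProduct.tensorTensorTensorComm k _ _ _ _ (r ⊗ₜ s)))) =
      convWith (E (bialgAutLin b.snd ∘ₗ projRight k H H ∘ₗ evalMap₂ k H H H r ∘ₗ
        TensorProduct.map (bialgAutLin b.snd⁻¹) LinearMap.id ∘ₗ
          (TensorProduct.comm k H H).toLinearMap)) θ
            (evalMap₂ k H H H s ∘ₗ TensorProduct.mk k H H 1) := fun r s => by
    induction r using tensor_ind with
    | add r r' hr hr' =>
      simp only [TensorProduct.add_tmul, map_add, LinearMap.add_comp, LinearMap.comp_add,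
        convWith_add_bilin, hr, hr']
    | tmul r₁ r₂ =>
      induction s using tensor_ind with
      | add s s' hs hs' =>
        simp only [TensorProduct.tmul_add, map_add, LinearMap.add_comp, convWith_add, hs, hs']
      | tmul s₁ s₂ =>
        simp only [TensorProduct.tensorTensorTensorComm_tmul, TensorProduct.map_tmul,
          LinearMap.comp_apply, LinearEquiv.coe_coe, TensorProduct.comm_tmul, LinearMap.id_apply,
          TensorProduct.lid_tmul, map_smul, evalMap_mul_CT, evalMap_crossing_CT, sigma_CT]
        refine (comp_convWith (φ := LinearMap.lsmul k H _) fun u v => ?_)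
        simp [hE, hf, hθ, AutPair.inv_fst, AutPair.inv_snd, AutPair.mul_snd]
  have hR : ∀ r s : (Module.Dual k H ⊗[k] H) ⊗[k] (Module.Dual k H ⊗[k] H),
      evalMap k H H (TensorProduct.rid k _ (TensorProduct.map (CT.mul a b) (CT.sigma b)
        (TensorProduct.tensorTensorTensorComm k _ _ _ _ (r ⊗ₜ s)))) =
      convWith (D (bialgAutLin b.snd ∘ₗ projLeft k H H ∘ₗ evalMap₂ k H H H r ∘ₗ
        TensorProduct.map LinearMap.id (bialgAutLin b.snd⁻¹)))
          (evalMap₂ k H H H s ∘ₗ (TensorProduct.mk k H H).flip 1) LinearMap.id := fun r s => by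
    induction r using tensor_ind with
    | add r r' hr hr' =>
      simp only [TensorProduct.add_tmul, map_add, LinearMap.add_comp, LinearMap.comp_add,
        convWith_add_bilin, hr, hr']
    | tmul r₁ r₂ =>
      induction s using tensor_ind with
      | add s s' hs hs' =>
        simp only [TensorProduct.tmul_add, map_add, LinearMap.add_comp, add_convWith, hs, hs']
      | tmul s₁ s₂ =>
        simp only [TensorProduct.tensorTensorTensorComm_tmul, TensorProduct.map_tmul,
          TensorProduct.rid_tmul, map_smul, evalMap_mul_CT, sigma_CT]
        refine (comp_convWith (φ := LinearMap.lsmul k H _) fun u v => ?_)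
        simp [hD, hg]
  set Gl : H ⊗[k] H →ₗ[k] H := bialgAutLin b.snd ∘ₗ projRight k H H ∘ₗ
    evalMap₂ k H H H (CT.comul a x) ∘ₗ TensorProduct.map (bialgAutLin b.snd⁻¹) LinearMap.id ∘ₗ
      (TensorProduct.comm k H H).toLinearMap with hGl
  set Gr : H ⊗[k] H →ₗ[k] H := bialgAutLin b.snd ∘ₗ projLeft k H H ∘ₗ
    evalMap₂ k H H H (CT.comul a x) ∘ₗ TensorProduct.map LinearMap.id (bialgAutLin b.snd⁻¹)
    with hGr
  have hGl' : ∀ q u, Gl (q ⊗ₜ u) = b.snd (evalMap k H H x (b.snd⁻¹ u * q)) := fun q u => by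
    rw [← projRight_evalMap₂_comul_CT a]
    rfl
  have hE₁ : ∀ q c w, E Gl (b.snd⁻¹ c * q) w = E Gl q (w * inclLeft k H c) := fun q c w => by
    induction w using tensor_ind with
    | add w w' hw hw' => simp only [map_add, add_mul, hw, hw']
    | tmul u v => simp [hE, hGl', mul_assoc]
  have hED : ∀ w q, E Gl 1 (inclLeft k H (b.snd q) * comul (R := k) w) = D Gr (comul w) q :=
    fun w q => by
    have e1 : D Gr (comul w) q = (g ⋄ᵒ (Gr ∘ₗ TensorProduct.mk k H H q)) w := by
      rw [convolveOp, convWith_apply]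
      generalize (comul w : H ⊗[k] H) = w
      induction w using tensor_ind with
      | add w w' hw hw' => simp only [map_add, LinearMap.add_apply, hw, hw']
      | tmul u v => simp [hD]
    have e2 : E Gl 1 (inclLeft k H (b.snd q) * comul (R := k) w) =
        ((bialgAutLin b.snd ∘ₗ (evalMap k H H x ∘ₗ LinearMap.mulLeft k q) ∘ₗ
          bialgAutLin b.snd⁻¹) ⋄ᵒ f) w := by
      rw [convolveOp, convWith_apply]
      generalize (comul w : H ⊗[k] H) = w
      induction w using tensor_ind with
      | add w w' hw hw' => simp only [map_add, mul_add, hw, hw']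
      | tmul u v => simp [hE, hGl']
    have e3 : Gr ∘ₗ TensorProduct.mk k H H q = (bialgAutLin b.snd ∘ₗ (projLeft k H H ∘ₗ
        evalMap₂ k H H H (CT.comul a x) ∘ₗ TensorProduct.mk k H H q)) ∘ₗ
          bialgAutLin b.snd⁻¹ := rfl
    have e4 : g ∘ₗ antipodeInv k H =
        (bialgAutLin b.snd ∘ₗ bialgAutLin a.fst ∘ₗ antipodeInv k H) ∘ₗ bialgAutLin b.snd⁻¹ := by
      ext; simp [hg]
    have e5 : f = (bialgAutLin b.snd ∘ₗ bialgAutLin a.snd) ∘ₗ bialgAutLin b.snd⁻¹ := rfl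
    rw [e1, e2, e3, projLeft_evalMap₂_comul_CT, comp_convolveOp (by simp),
      comp_convolveOp (by simp), convolveOp_comp (YDModule.comul_aut b.snd⁻¹),
      convolveOp_comp (YDModule.comul_aut b.snd⁻¹), ← e4, ← e5, ← convolveOp_assoc,
      ← convolveOp_assoc, convolveOp_comp_antipodeInv (by simp [hg]) (by simp [hg]),
      convOne_convolveOp]
    rfl
  refine evalMap_injective ?_
  rw [hL, hR, evalMap₂_comul_CT, convolveOp_assoc]
  have e1 : θ ⋄ᵒ (bialgAutLin b.snd⁻¹ ∘ₗ bialgAutLin b.fst ∘ₗ antipodeInv k H) =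
      convOne k H H := convolveOp_comp_antipodeInv (by simp [hθ]) (by simp [hθ])
  have e2 := convWith_assoc (B₁ := (LinearMap.mul k H).flip) (B₂ := E Gl) (f := θ)
    (g := bialgAutLin b.snd⁻¹ ∘ₗ bialgAutLin b.fst ∘ₗ antipodeInv k H)
    (h := (comul ∘ₗ evalMap k H H y ∘ₗ LinearMap.mulLeft k 1) ⋄ᵒ
      (inclLeft k H ∘ₗ bialgAutLin b.snd))
    (B₃ := E Gl) (B₄ := (LinearMap.mul k (H ⊗[k] H)).flip) (f' := θ)
    (g' := inclLeft k H ∘ₗ bialgAutLin b.fst ∘ₗ antipodeInv k H)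
    (h' := (comul ∘ₗ evalMap k H H y ∘ₗ LinearMap.mulLeft k 1) ⋄ᵒ
      (inclLeft k H ∘ₗ bialgAutLin b.snd)) (fun u v w => hE₁ _ _ _)
  rw [← convolveOp, ← convolveOp, e1] at e2
  rw [← e2]
  have e3 : evalMap₂ k H H H (CT.comul b y) ∘ₗ (TensorProduct.mk k H H).flip 1 =
      comul ∘ₗ evalMap k H H y ∘ₗ LinearMap.mulLeft k 1 := by
    ext z
    simpa using evalMap₂_comul_CT_apply_one b y z
  rw [e3, convWith_of_counit_left (g' := E Gl 1 ∘ₗ ((comul ∘ₗ evalMap k H H y ∘ₗ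
    LinearMap.mulLeft k 1) ⋄ᵒ (inclLeft k H ∘ₗ bialgAutLin b.snd)))
    (fun u v => by simp [convOne_apply])]
  exact comp_convWith fun u v => hED _ _

end sigma
/-! ### `CT(H)` is a coquasitriangular crossed Turaev algebra -/

section coquasitriangular

open Coalgebra HopfAlgebra
open CT (antipodeInv dualMul)

variable {k : Type u} [Field k] {H : Type v} [Ring H] [HopfAlgebra k H]

theorem mul_assoc_CT (a b c : AutPair k H) (x y z : Module.Dual k H ⊗[k] H) :
    CT.mul (a * b) c (CT.mul a b (x ⊗ₜ y) ⊗ₜ z) = CT.mul a (b * c) (x ⊗ₜ CT.mul b c (y ⊗ₜ z)) := by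
  induction x using tensor_ind with
  | add x x' hx hx' => simp only [TensorProduct.add_tmul, map_add, hx, hx']
  | tmul p h =>
  induction y using tensor_ind with
  | add x x' hx hx' => simp only [TensorProduct.add_tmul, TensorProduct.tmul_add, map_add, hx, hx']
  | tmul q h' =>
  induction z using tensor_ind with
  | add x x' hx hx' => simp only [TensorProduct.tmul_add, map_add, hx, hx']
  | tmul r h'' => simp [CT.mul_tmul, dualMul_assoc, AutPair.mul_fst, AutPair.mul_snd, mul_assoc]

theorem mul_one_CT (a : AutPair k H) (x : Module.Dual k H ⊗[k] H) :
    CT.mul a 1 (x ⊗ₜ ((counit : H →ₗ[k] k) ⊗ₜ 1)) = x := by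
  induction x using tensor_ind with
  | add x x' hx hx' => simp only [TensorProduct.add_tmul, map_add, hx, hx']
  | tmul p h => simp [CT.mul_tmul, AutPair.one_snd]

theorem one_mul_CT (a : AutPair k H) (x : Module.Dual k H ⊗[k] H) :
    CT.mul 1 a (((counit : H →ₗ[k] k) ⊗ₜ 1) ⊗ₜ x) = x := by
  induction x using tensor_ind with
  | add x x' hx hx' => simp only [TensorProduct.tmul_add, map_add, hx, hx']
  | tmul p h => simp [CT.mul_tmul, AutPair.one_fst]

theorem counit_mul_CT (a b : AutPair k H) (x y : Module.Dual k H ⊗[k] H) :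
    CT.counit (CT.mul a b (x ⊗ₜ y)) = CT.counit x * CT.counit y := by
  rw [counit_CT, counit_CT, counit_CT, evalMap_mul_CT, convolveOp_apply_one, Bialgebra.counit_mul]
  simp [YDModule.counit_aut]

theorem crossing_bijective_CT (b a : AutPair k H) :
    Function.Bijective (CT.crossing b a) := by
  have h : ∀ x, CT.crossing b⁻¹ (b * a * b⁻¹) (CT.crossing b a x) = x := fun x => by
    induction x using tensor_ind with
    | add x x' hx hx' => simp only [map_add, hx, hx']
    | tmul p h =>
      simp only [CT.crossing_tmul]
      congr 1
      · ext x
        simp [AutPair.inv_fst, AutPair.inv_snd]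
      · simp [AutPair.inv_fst, AutPair.inv_snd, AutPair.mul_fst, AutPair.mul_snd]
  have h' : ∀ x, CT.crossing b a (CT.crossing b⁻¹ (b * a * b⁻¹) x) = x := fun x => by
    induction x using tensor_ind with
    | add x x' hx hx' => simp only [map_add, hx, hx']
    | tmul p h =>
      simp only [CT.crossing_tmul]
      congr 1
      · ext x
        simp [AutPair.inv_fst, AutPair.inv_snd]
      · simp [AutPair.inv_fst, AutPair.inv_snd, AutPair.mul_fst, AutPair.mul_snd]
  exact Function.bijective_iff_has_inverse.2 ⟨_, h, h'⟩

theorem crossing_crossing_CT (a b c : AutPair k H) (x : Module.Dual k H ⊗[k] H) :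
    CT.crossing a (b * c * b⁻¹) (CT.crossing b c x) = CT.crossing (a * b) c x := by
  induction x using tensor_ind with
  | add x x' hx hx' => simp only [map_add, hx, hx']
  | tmul p h =>
    simp only [CT.crossing_tmul]
    congr 1
    · ext x
      simp [AutPair.mul_fst, AutPair.mul_snd]
    · simp [AutPair.inv_fst, AutPair.inv_snd, AutPair.mul_fst, AutPair.mul_snd]

theorem sigma_crossing_CT (c b : AutPair k H) (a : AutPair k H) (x y : Module.Dual k H ⊗[k] H) :
    CT.sigma b (x ⊗ₜ y) =
      CT.sigma (c * b * c⁻¹) (CT.crossing c a x ⊗ₜ CT.crossing c b y) := by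
  rw [sigma_CT, sigma_CT, evalMap_crossing_CT, evalMap_crossing_CT]
  simp only [LinearMap.comp_apply, AlgHom.toLinearMap_apply]
  refine .trans ?_ (YDModule.counit_aut _ _).symm
  simp [AutPair.inv_fst, AutPair.inv_snd, AutPair.mul_fst, AutPair.mul_snd]

variable [FiniteDimensional k H]

theorem crossing_mul_CT (c a b : AutPair k H) (x y : Module.Dual k H ⊗[k] H) :
    CT.mul (c * a * c⁻¹) (c * b * c⁻¹) (CT.crossing c a x ⊗ₜ CT.crossing c b y) =
      CT.crossing c (a * b) (CT.mul a b (x ⊗ₜ y)) := by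
  refine evalMap_injective ?_
  rw [evalMap_mul_CT, evalMap_crossing_CT, evalMap_crossing_CT, evalMap_crossing_CT,
    evalMap_mul_CT, convolveOp_comp (YDModule.comul_aut _), comp_convolveOp (by simp)]
  refine congrArg₂ _ ?_ ?_ <;> ext z <;>
    simp [AutPair.inv_fst, AutPair.inv_snd, AutPair.mul_fst, AutPair.mul_snd]

theorem crossing_antipode_CT (b a : AutPair k H) (x : Module.Dual k H ⊗[k] H) :
    CT.crossing b a⁻¹ (CT.antipode a x) = CT.antipode (b * a * b⁻¹) (CT.crossing b a x) := by
  refine evalMap_injective ?_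
  rw [evalMap_antipode_CT, evalMap_crossing_CT, evalMap_crossing_CT, evalMap_antipode_CT,
    convolveOp_comp (YDModule.comul_aut _), convolveOp_comp (YDModule.comul_aut _),
    comp_convolveOp (by simp), comp_convolveOp (by simp)]
  refine congrArg₂ _ (congrArg₂ _ ?_ ?_) ?_ <;> ext z <;>
    simp [AutPair.inv_fst, AutPair.inv_snd, AutPair.mul_fst, AutPair.mul_snd, bialgAut_antipode]

theorem comul_crossing_CT (b a : AutPair k H) (t : Module.Dual k H ⊗[k] H) :
    TensorProduct.map (CT.crossing b a) (CT.crossing b a) (CT.comul a t) =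
      CT.comul (b * a * b⁻¹) (CT.crossing b a t) := by
  refine evalMap₂_injective (TensorProduct.ext (LinearMap.ext fun x => ?_))
  refine .trans ?_ (evalMap₂_comul_CT _ _ x).symm
  set φ := b.snd⁻¹ * a.snd * b.fst * a.snd⁻¹ with hφ
  set θ := b.fst⁻¹ * b.snd with hθ
  have e : ∀ s, evalMap₂ k H H H (TensorProduct.map (CT.crossing b a) (CT.crossing b a) s) ∘ₗ
      TensorProduct.mk k H H x = TensorProduct.map (bialgAutLin φ) (bialgAutLin φ) ∘ₗ
        (evalMap₂ k H H H s ∘ₗ TensorProduct.mk k H H (θ x)) ∘ₗ bialgAutLin θ := fun s => by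
    induction s using tensor_ind with
    | add s s' hs hs' => simp only [map_add, LinearMap.add_comp, LinearMap.comp_add, hs, hs']
    | tmul u v => ext y; simp [evalMap_crossing_CT, ← hφ, ← hθ]
  have hmul : ∀ s t : H ⊗[k] H, TensorProduct.map (bialgAutLin φ) (bialgAutLin φ) (s * t) =
        TensorProduct.map (bialgAutLin φ) (bialgAutLin φ) s *
          TensorProduct.map (bialgAutLin φ) (bialgAutLin φ) t :=
    fun s t => map_mul (Algebra.TensorProduct.map (bialgAutAlgHom φ) (bialgAutAlgHom φ)) s t
  refine (e _).trans ?_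
  rw [evalMap₂_comul_CT, convolveOp_comp (YDModule.comul_aut _),
    convolveOp_comp (YDModule.comul_aut _), comp_convolveOp hmul, comp_convolveOp hmul,
    evalMap_crossing_CT]
  refine congrArg₂ _ (congrArg₂ _ ?_ ?_) ?_
  · ext z
    simp [hφ, hθ, AutPair.inv_fst, AutPair.inv_snd, AutPair.mul_fst, AutPair.mul_snd]
  · ext z
    refine (YDModule.comul_aut φ _).trans ?_
    simp [← hφ, ← hθ]
  · ext z
    simp [hφ, hθ, AutPair.inv_snd, AutPair.mul_snd]

theorem cast_CT {a b : AutPair k H} (h : a = b) (x : Module.Dual k H ⊗[k] H) :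
    (CT k H).cast h x = x := by
  subst h; rfl

theorem isTuraevAlgebra_CT : (CT k H).IsTuraevAlgebra where
  mul_assoc a b c x y z := (cast_CT _ _).trans (mul_assoc_CT a b c x y z)
  mul_one a x := (cast_CT _ _).trans (mul_one_CT a x)
  one_mul a x := (cast_CT _ _).trans (one_mul_CT a x)
  coassoc a x := coassoc_CT a x
  counit_left a x := by
    have e : ∀ s, evalMap k H H (TensorProduct.lid k _
        (TensorProduct.map CT.counit LinearMap.id s)) =
        projRight k H H ∘ₗ evalMap₂ k H H H s ∘ₗ TensorProduct.mk k H H 1 := fun s => by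
      induction s using tensor_ind with
      | add s s' hs hs' => simp only [map_add, LinearMap.add_comp, LinearMap.comp_add, hs, hs']
      | tmul u v => ext z; simp [counit_CT]
    refine evalMap_injective ((e (CT.comul a x)).trans (LinearMap.ext fun z => ?_))
    exact (projRight_evalMap₂_comul_CT a x 1 z).trans (by rw [one_mul])
  counit_right a x := by
    have e : ∀ s, evalMap k H H (TensorProduct.rid k _
        (TensorProduct.map LinearMap.id CT.counit s)) =
        projLeft k H H ∘ₗ evalMap₂ k H H H s ∘ₗ (TensorProduct.mk k H H).flip 1 := fun s => by
      induction s using tensor_ind with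
      | add s s' hs hs' => simp only [map_add, LinearMap.add_comp, LinearMap.comp_add, hs, hs']
      | tmul u v => ext z; simp [counit_CT]
    refine evalMap_injective ((e (CT.comul a x)).trans (LinearMap.ext fun z => ?_))
    exact (congrArg _ (evalMap₂_comul_CT_apply_one a x z)).trans (projLeft_comul _)
  comul_mul a b := TensorProduct.ext' fun u v => comul_mul_CT a b u v
  counit_mul a b := TensorProduct.ext' fun u v => counit_mul_CT a b u v
  comul_one := by
    refine evalMap₂_injective (TensorProduct.ext (LinearMap.ext fun x => ?_))
    refine (evalMap₂_comul_CT 1 _ x).trans ?_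
    have e1 : comul ∘ₗ evalMap k H H ((counit : H →ₗ[k] k) ⊗ₜ 1) ∘ₗ LinearMap.mulLeft k x =
        counit (R := k) x • convOne k H (H ⊗[k] H) := by
      ext y
      simp [convOne_apply, Algebra.TensorProduct.one_def, smul_smul]
    have e2 : bialgAutLin (1 : AutPair k H).fst = LinearMap.id := rfl
    have e3 : bialgAutLin (1 : AutPair k H).snd = LinearMap.id := rfl
    refine (congrArg (fun f => _ ⋄ᵒ f ⋄ᵒ _) e1).trans ?_
    rw [e2, e3, convolveOp_smul, smul_convolveOp, convolveOp_convOne, LinearMap.id_comp,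
      LinearMap.comp_id, comp_antipodeInv_convolveOp (inclLeft_mul (k := k) (H := H))
        Algebra.TensorProduct.one_def.symm]
    ext y
    simp only [LinearMap.smul_apply, convOne_apply, Algebra.TensorProduct.one_def]
    refine .trans ?_ (TensorProduct.smul_tmul_smul (counit (R := k) x) (counit (R := k) y)
      (1 : H) (1 : H)).symm
    rw [smul_smul]
  counit_one := by
    refine (CT.counit_tmul _ _).trans ?_
    simp
  mul_antipode a x := (mul_antipode_CT a x).trans
    (congrArg (CT.counit (k := k) (H := H) x • ·) (cast_CT _ _).symm)
  antipode_mul a x := (antipode_mul_CT a x).trans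
    (congrArg (CT.counit (k := k) (H := H) x • ·) (cast_CT _ _).symm)

theorem isCrossed_CT : (CT k H).IsCrossed where
  toIsTuraevAlgebra := isTuraevAlgebra_CT
  crossing_bijective b a := crossing_bijective_CT b a
  comul_crossing b a x := comul_crossing_CT b a x
  counit_crossing b a x := by
    refine (counit_CT _).trans (.trans ?_ (counit_CT _).symm)
    refine (congrArg (fun f : H →ₗ[k] H => counit (R := k) (f 1))
      (evalMap_crossing_CT b a x)).trans ?_
    simp only [LinearMap.comp_apply, AlgHom.toLinearMap_apply, map_one]
    exact YDModule.counit_aut _ _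
  crossing_crossing a b c x := (cast_CT _ _).trans (crossing_crossing_CT a b c x)
  crossing_mul c a b x y := (cast_CT _ _).trans (crossing_mul_CT c a b x y)
  crossing_one c := (cast_CT _ _).trans <| (CT.crossing_tmul c 1 _ _).trans <| by
    refine congrArg₂ (· ⊗ₜ[k] ·) (LinearMap.ext fun x => YDModule.counit_aut _ x) ?_
    simp only [map_one]
  crossing_antipode b a x := (cast_CT _ _).trans (crossing_antipode_CT b a x)

theorem isCoquasitriangular_CT : (CT k H).IsCoquasitriangular where
  toIsCrossed := isCrossed_CT
  sigma_invertible a b := ⟨evalForm (bialgAutLin b.snd⁻¹ ∘ₗ antipode k),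
    TensorProduct.ext' fun x y => (conv_sigma_inverse a b x y).1,
    TensorProduct.ext' fun x y => (conv_sigma_inverse a b x y).2⟩
  sigma_mul_left a b c x y z := sigma_mul_left_CT a b c x y z
  sigma_mul_right a b c x y z := sigma_mul_right_CT a b c x y z
  sigma_comm a b x y := by
    have e : ∀ {c d : AutPair k H} (h : c = d), (CT k H).cast h = LinearMap.id :=
      fun h => LinearMap.ext (cast_CT h)
    rw [e]
    exact sigma_comm_CT a b x y
  sigma_crossing c a b x y := sigma_crossing_CT c b a x y

end coquasitriangular
/-! ### The Yetter-Drinfeld condition solved for the coaction -/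

section comodules

open Coalgebra HopfAlgebra
open CT (antipodeInv)

variable {k : Type*} [Field k] {H : Type*} [Ring H] [HopfAlgebra k H]
variable {V W : Type*} [AddCommGroup V] [Module k V] [AddCommGroup W] [Module k W]

variable (k V) in
/-- The left multiplication `a · (v ⊗ b) = v ⊗ a b` on the second tensor factor. -/
noncomputable def leftMul (A : Type*) [Ring A] [Algebra k A] : A →ₗ[k] V ⊗[k] A →ₗ[k] V ⊗[k] A :=
  LinearMap.lTensorHom V ∘ₗ LinearMap.mul k A

variable (k V) in
/-- The right multiplication `(v ⊗ b) · a = v ⊗ b a` on the second tensor factor. -/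
noncomputable def rightMul (A : Type*) [Ring A] [Algebra k A] : A →ₗ[k] V ⊗[k] A →ₗ[k] V ⊗[k] A :=
  LinearMap.lTensorHom V ∘ₗ (LinearMap.mul k A).flip

@[simp] theorem leftMul_tmul {A : Type*} [Ring A] [Algebra k A] (a b : A) (v : V) :
    leftMul k V A a (v ⊗ₜ b) = v ⊗ₜ (a * b) := rfl

@[simp] theorem rightMul_tmul {A : Type*} [Ring A] [Algebra k A] (a b : A) (v : V) :
    rightMul k V A a (v ⊗ₜ b) = v ⊗ₜ (b * a) := rfl

variable (k V) in
/-- `sandwichConv l r F` is the map `y ↦ r(y₃) F(y₂) l(y₁)`, for `F` with values in `V ⊗ A`. -/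
noncomputable def sandwichConv {A : Type*} [Ring A] [Algebra k A] (l r : H →ₗ[k] A)
    (F : H →ₗ[k] V ⊗[k] A) : H →ₗ[k] V ⊗[k] A :=
  convWith (leftMul k V A).flip (convWith (rightMul k V A) l F) r

theorem sandwichConv_add {A : Type*} [Ring A] [Algebra k A] (l r : H →ₗ[k] A)
    (F G : H →ₗ[k] V ⊗[k] A) :
    sandwichConv k V l r (F + G) = sandwichConv k V l r F + sandwichConv k V l r G := by
  rw [sandwichConv, convWith_add, add_convWith]
  rfl

theorem comp_sandwichConv {A B : Type*} [Ring A] [Algebra k A] [Ring B] [Algebra k B]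
    {φ : V ⊗[k] A →ₗ[k] W ⊗[k] B} {l r : H →ₗ[k] A} {l' r' : H →ₗ[k] B}
    (hl : ∀ x s, φ (rightMul k V A (l x) s) = rightMul k W B (l' x) (φ s))
    (hr : ∀ x s, φ (leftMul k V A (r x) s) = leftMul k W B (r' x) (φ s))
    (F : H →ₗ[k] V ⊗[k] A) : φ ∘ₗ sandwichConv k V l r F = sandwichConv k W l' r' (φ ∘ₗ F) := by
  have e : φ ∘ₗ convWith (rightMul k V A) l F = convWith (rightMul k W B) l' (φ ∘ₗ F) :=
    comp_convWith fun x y => hl _ _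
  rw [sandwichConv, sandwichConv, ← e]
  exact comp_convWith fun x y => hr _ _

theorem map_sandwichConv {A B : Type*} [Ring A] [Algebra k A] [Ring B] [Algebra k B]
    {φ : A →ₗ[k] B} (hφ : ∀ x y, φ (x * y) = φ x * φ y) (f : V →ₗ[k] W) (l r : H →ₗ[k] A)
    (F : H →ₗ[k] V ⊗[k] A) : TensorProduct.map f φ ∘ₗ sandwichConv k V l r F =
      sandwichConv k W (φ ∘ₗ l) (φ ∘ₗ r) (TensorProduct.map f φ ∘ₗ F) := by
  refine comp_sandwichConv (fun x s => ?_) (fun x s => ?_) F <;> induction s using tensor_ind with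
  | add s t hs ht => simp only [map_add, hs, ht]
  | tmul v b => simp [hφ]

theorem sandwichConv_convOne {A : Type*} [Ring A] [Algebra k A] (F : H →ₗ[k] V ⊗[k] A) :
    sandwichConv k V (convOne k H A) (convOne k H A) F = F := by
  have h1 : leftMul k V A 1 = LinearMap.id := TensorProduct.ext' fun v b => by simp
  have h2 : rightMul k V A 1 = LinearMap.id := TensorProduct.ext' fun v b => by simp
  have e : convWith (rightMul k V A) (convOne k H A) F = F :=
    convWith_of_counit_left fun x y => by simp [convOne_apply, h2]
  rw [sandwichConv, e]
  exact convWith_of_counit_right fun x y => by simp [convOne_apply, h1]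

theorem sandwichConv_apply_one {A : Type*} [Ring A] [Algebra k A] {l r : H →ₗ[k] A}
    (hl : l 1 = 1) (hr : r 1 = 1) (F : H →ₗ[k] V ⊗[k] A) : sandwichConv k V l r F 1 = F 1 := by
  have h1 : leftMul k V A 1 = LinearMap.id := TensorProduct.ext' fun v b => by simp
  have h2 : rightMul k V A 1 = LinearMap.id := TensorProduct.ext' fun v b => by simp
  simp [sandwichConv, convWith_apply, hl, hr, h1, h2, Algebra.TensorProduct.one_def]

/-- The map `v ⊗ b ↦ ε(b) v`. -/
noncomputable def applyCounit (k H V : Type*) [Field k] [Ring H] [HopfAlgebra k H]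
    [AddCommGroup V] [Module k V] : V ⊗[k] H →ₗ[k] V :=
  (TensorProduct.rid k V).toLinearMap ∘ₗ TensorProduct.map LinearMap.id counit

@[simp] theorem applyCounit_tmul (v : V) (b : H) :
    applyCounit k H V (v ⊗ₜ b) = counit (R := k) b • v := by simp [applyCounit]

/-- The map sending `v ⊗ t` to `x ↦ v ⊗ t(x)`. -/
noncomputable def evalTensor (k H V : Type*) [Field k] [Ring H] [HopfAlgebra k H]
    [AddCommGroup V] [Module k V] :
    V ⊗[k] (Module.Dual k H ⊗[k] H) →ₗ[k] H →ₗ[k] V ⊗[k] H :=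
  TensorProduct.lTensorHomToHomLTensor (RingHom.id k) H V H ∘ₗ
    TensorProduct.map LinearMap.id (evalMap k H H)

theorem evalTensor_tmul (v : V) (t : Module.Dual k H ⊗[k] H) :
    evalTensor k H V (v ⊗ₜ t) = TensorProduct.mk k V H v ∘ₗ evalMap k H H t := rfl

theorem evalTensor_apply (c : V ⊗[k] (Module.Dual k H ⊗[k] H)) (x : H) :
    evalTensor k H V c x = TensorProduct.map LinearMap.id (evalAt H x) c := by
  induction c using tensor_ind with
  | add s t hs ht => simp only [map_add, LinearMap.add_apply, hs, ht]
  | tmul v t => simp [evalTensor_tmul, evalMap_apply]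

/-- The map `v ↦ p(x) v₀ ⊗ h` for a coaction `v ↦ v₀ ⊗ (p ⋈ h)`. -/
@[reducible] noncomputable def coactAt (x : H) (τ : V →ₗ[k] V ⊗[k] (Module.Dual k H ⊗[k] H)) :
    V →ₗ[k] V ⊗[k] H :=
  Coact.push (C := Module.Dual k H ⊗[k] H) (evalAt H x) τ

/-- The action of `H` on a comodule over `CT(H)`: `x · v = p(x) ε(h) v₀` for the coaction
`v ↦ v₀ ⊗ (p ⋈ h)`. -/
noncomputable def inducedAct (τ : V →ₗ[k] V ⊗[k] (Module.Dual k H ⊗[k] H)) :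
    H →ₗ[k] V →ₗ[k] V :=
  ((evalTensor k H V ∘ₗ τ).compr₂ (applyCounit k H V)).flip

theorem inducedAct_apply (τ : V →ₗ[k] V ⊗[k] (Module.Dual k H ⊗[k] H)) (x : H) (v : V) :
    inducedAct τ x v = applyCounit k H V (coactAt x τ v) := by
  simp [inducedAct, evalTensor_apply, Coact.push_apply]

/-- The Yetter-Drinfeld compatibility in the form solved for the coaction of `y · v`:
`ρ(y · v) = y₂ · v₀ ⊗ β(y₃) v₁ α(S⁻¹(y₁))`. -/
theorem left_eq_right_iff [FiniteDimensional k H] (f g : H ≃ₐc[k] H) (act : H →ₗ[k] V →ₗ[k] V)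
    (ρ : V →ₗ[k] V ⊗[k] H) :
    YD.left (bialgAutLin g) act ρ = YD.right (bialgAutLin f) act ρ ↔
      ∀ v, ρ ∘ₗ act.flip v = sandwichConv k V (bialgAutLin f ∘ₗ antipodeInv k H) (bialgAutLin g)
        ((LinearMap.rTensorHom H ∘ₗ act).flip (ρ v)) := by
  have hleft : ∀ v, YD.left (bialgAutLin g) act ρ ∘ₗ (TensorProduct.mk k H V).flip v =
      convWith (leftMul k V H).flip ((LinearMap.rTensorHom H ∘ₗ act).flip (ρ v))
        (bialgAutLin g) := fun v => by
    ext h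
    rw [convWith_apply]
    simp only [YD.left, YD.cm, LinearMap.comp_apply, LinearMap.flip_apply, TensorProduct.mk_apply,
      TensorProduct.map_tmul]
    generalize (comul h : H ⊗[k] H) = s
    induction s using tensor_ind with
    | add s t hs ht => simp only [map_add, TensorProduct.add_tmul, hs, ht]
    | tmul a b =>
      generalize ρ v = t
      induction t using tensor_ind with
      | add s t hs ht =>
        simp only [map_add, TensorProduct.tmul_add, hs, ht]
        simp
      | tmul w c => simp
  have hright : ∀ v, YD.right (bialgAutLin f) act ρ ∘ₗ (TensorProduct.mk k H V).flip v =
      convWith (rightMul k V H) (bialgAutLin f) (ρ ∘ₗ act.flip v) := fun v => by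
    ext h
    rw [convWith_apply]
    simp only [YD.right, YD.cm, LinearMap.comp_apply, LinearMap.flip_apply, TensorProduct.mk_apply,
      TensorProduct.map_tmul]
    generalize (comul h : H ⊗[k] H) = s
    induction s using tensor_ind with
    | add s t hs ht => simp only [map_add, TensorProduct.add_tmul, hs, ht]
    | tmul a b =>
      simp only [LinearEquiv.coe_coe, LinearMap.id_apply, TensorProduct.assoc_tmul,
        TensorProduct.map_tmul, LinearMap.comp_apply, TensorProduct.lift.tmul]
      simp only [LinearMap.compl₁₂_apply, LinearMap.comp_apply, LinearMap.flip_apply]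
      generalize ρ (act b v) = t
      induction t using tensor_ind with
      | add s t hs ht => simp only [map_add, TensorProduct.tmul_add, hs, ht]
      | tmul w c => simp
  have hassoc : ∀ (l m : H →ₗ[k] H) (F : H →ₗ[k] V ⊗[k] H),
      convWith (rightMul k V H) l (convWith (rightMul k V H) m F) =
        convWith (rightMul k V H) (l ⋄ᵒ m) F := fun l m F => by
    refine (convWith_assoc fun x y z => ?_).symm
    generalize F z = t
    induction t using tensor_ind with
    | add s t hs ht => simp only [map_add, hs, ht]
    | tmul w c => simp [mul_assoc]
  have hone : ∀ F : H →ₗ[k] V ⊗[k] H, convWith (rightMul k V H) (convOne k H H) F = F := fun F =>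
    convWith_of_counit_left fun x y => by
      rw [convOne_apply]
      generalize F y = t
      induction t using tensor_ind with
      | add s t hs ht => rw [map_add, hs, ht, smul_add]
      | tmul w c => simp
  have hsand : ∀ (l r : H →ₗ[k] H) (F : H →ₗ[k] V ⊗[k] H), sandwichConv k V l r F =
      convWith (rightMul k V H) l (convWith (leftMul k V H).flip F r) := fun l r F => by
    refine convWith_assoc fun x y z => ?_
    generalize F y = t
    simp only [LinearMap.flip_apply]
    induction t using tensor_ind with
    | add s t hs ht => simp only [map_add, hs, ht]
    | tmul w c => simp [mul_assoc]
  have e1 : (bialgAutLin f ∘ₗ antipodeInv k H) ⋄ᵒ bialgAutLin f = convOne k H H :=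
    comp_antipodeInv_convolveOp (map_mul f) (map_one f)
  have e2 : bialgAutLin f ⋄ᵒ (bialgAutLin f ∘ₗ antipodeInv k H) = convOne k H H :=
    convolveOp_comp_antipodeInv (map_mul f) (map_one f)
  constructor
  · intro h v
    have := congrArg (fun F => convWith (rightMul k V H) (bialgAutLin f ∘ₗ antipodeInv k H)
      (F ∘ₗ (TensorProduct.mk k H V).flip v)) h
    simp only [hleft, hright, hassoc, e1, hone] at this
    rw [hsand, this]
  · intro h
    refine TensorProduct.ext (LinearMap.ext fun x => LinearMap.ext fun v => ?_)
    have := congrArg (convWith (rightMul k V H) (bialgAutLin f)) (h v)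
    rw [hsand, hassoc, e2, hone, ← hright, ← hleft] at this
    exact (LinearMap.congr_fun this x).symm

end comodules
/-! ### Coactions of `CT(H)` and Yetter-Drinfeld modules -/

section comodules

open Coalgebra HopfAlgebra
open CT (antipodeInv)

variable {k : Type u} [Field k] {H : Type v} [Ring H] [HopfAlgebra k H] [FiniteDimensional k H]
variable {V : Type u} [AddCommGroup V] [Module k V]

/-- The comultiplication of `CT(H)` under evaluation, on the second factor of `V ⊗ CT(H)`. -/
theorem map_evalAt_comul_CT (a : AutPair k H) (c : V ⊗[k] (Module.Dual k H ⊗[k] H)) (x y : H) :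
    TensorProduct.map LinearMap.id (TensorProduct.map (evalAt H x) (evalAt H y))
      (TensorProduct.map LinearMap.id (CT.comul a) c) =
      sandwichConv k V (inclLeft k H ∘ₗ bialgAutLin a.fst ∘ₗ antipodeInv k H)
        (inclLeft k H ∘ₗ bialgAutLin a.snd) (TensorProduct.map LinearMap.id comul ∘ₗ
          evalTensor k H V c ∘ₗ LinearMap.mulLeft k x) y := by
  induction c using tensor_ind with
  | add s t hs ht =>
    simp only [map_add, LinearMap.comp_add, LinearMap.add_comp, sandwichConv_add,
      LinearMap.add_apply, hs, ht]
  | tmul v t =>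
    have e : TensorProduct.mk k V (H ⊗[k] H) v ∘ₗ
        ((inclLeft k H ∘ₗ bialgAutLin a.fst ∘ₗ antipodeInv k H) ⋄ᵒ
        (comul ∘ₗ evalMap k H H t ∘ₗ LinearMap.mulLeft k x) ⋄ᵒ
          (inclLeft k H ∘ₗ bialgAutLin a.snd)) =
        sandwichConv k V (inclLeft k H ∘ₗ bialgAutLin a.fst ∘ₗ antipodeInv k H)
          (inclLeft k H ∘ₗ bialgAutLin a.snd) (TensorProduct.mk k V (H ⊗[k] H) v ∘ₗ
            comul ∘ₗ evalMap k H H t ∘ₗ LinearMap.mulLeft k x) := by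
      have e1 : ∀ f g : H →ₗ[k] H ⊗[k] H, TensorProduct.mk k V (H ⊗[k] H) v ∘ₗ (f ⋄ᵒ g) =
          convWith (rightMul k V (H ⊗[k] H)) f (TensorProduct.mk k V (H ⊗[k] H) v ∘ₗ g) :=
        fun f g => comp_convWith fun x y => rfl
      rw [sandwichConv, ← e1]
      exact comp_convWith fun x y => rfl
    rw [TensorProduct.map_tmul, TensorProduct.map_tmul, evalAt_comul_CT]
    exact LinearMap.congr_fun e y

/-- Coassociativity of a coaction of `CT(H)`, evaluated on elements of `H`. -/
theorem coassoc_iff (a : AutPair k H) (τ : V →ₗ[k] V ⊗[k] (Module.Dual k H ⊗[k] H)) (v : V) :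
    TensorProduct.assoc k V _ _ (TensorProduct.map τ LinearMap.id (τ v)) =
      TensorProduct.map LinearMap.id (CT.comul a) (τ v) ↔
    ∀ x y, TensorProduct.assoc k V H H
        (TensorProduct.map (coactAt x τ) LinearMap.id
          (coactAt y τ v)) =
      sandwichConv k V (inclLeft k H ∘ₗ bialgAutLin a.fst ∘ₗ antipodeInv k H)
        (inclLeft k H ∘ₗ bialgAutLin a.snd) (TensorProduct.map LinearMap.id comul ∘ₗ
          evalTensor k H V (τ v) ∘ₗ LinearMap.mulLeft k x) y := by
  have e : ∀ x y (t : V ⊗[k] (Module.Dual k H ⊗[k] H)),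
      TensorProduct.map LinearMap.id (TensorProduct.map (evalAt H x) (evalAt H y))
        (TensorProduct.assoc k V _ _ (TensorProduct.map τ LinearMap.id t)) =
      TensorProduct.assoc k V H H
        (TensorProduct.map (coactAt x τ) LinearMap.id
          (TensorProduct.map LinearMap.id (evalAt H y) t)) := fun x y t => by
    induction t using tensor_ind with
    | add s t hs ht => simp only [map_add, hs, ht]
    | tmul w p =>
      simp only [TensorProduct.map_tmul, LinearMap.id_apply, Coact.push_apply]
      generalize τ w = s
      induction s using tensor_ind with
      | add s t hs ht => simp only [map_add, TensorProduct.add_tmul, hs, ht]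
      | tmul w' q => simp
  constructor
  · intro h x y
    rw [← map_evalAt_comul_CT, ← h, e]
    rfl
  · intro h
    have ext : ∀ s t : V ⊗[k] ((Module.Dual k H ⊗[k] H) ⊗[k] (Module.Dual k H ⊗[k] H)),
        (∀ x y, TensorProduct.map LinearMap.id (TensorProduct.map (evalAt H x) (evalAt H y)) s =
          TensorProduct.map LinearMap.id (TensorProduct.map (evalAt H x) (evalAt H y)) t) →
        s = t := fun s t hst => by
      have e' : ∀ s : V ⊗[k] ((Module.Dual k H ⊗[k] H) ⊗[k] (Module.Dual k H ⊗[k] H)), s =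
          ∑ i, ∑ j, TensorProduct.map LinearMap.id (TensorProduct.map
            (TensorProduct.mk k _ H ((Module.finBasis k H).coord i))
            (TensorProduct.mk k _ H ((Module.finBasis k H).coord j)))
            (TensorProduct.map LinearMap.id (TensorProduct.map
              (evalAt H (Module.finBasis k H i)) (evalAt H (Module.finBasis k H j))) s) :=
          fun s => by
        induction s using tensor_ind with
        | add a b ha hb => simp only [map_add, Finset.sum_add_distrib, ← ha, ← hb]
        | tmul n x =>
          induction x using tensor_ind with
          | add a b ha hb =>
            simp only [TensorProduct.tmul_add, map_add, Finset.sum_add_distrib, ← ha, ← hb]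
          | tmul p q =>
            simp only [TensorProduct.map_tmul, LinearMap.id_apply, TensorProduct.mk_apply,
              ← TensorProduct.tmul_sum, ← TensorProduct.sum_tmul]
            rw [sum_tmul_evalAt, sum_tmul_evalAt]
      rw [e' s, e' t]
      simp only [hst]
    refine ext _ _ fun x y => ?_
    rw [map_evalAt_comul_CT, e, ← h]
    rfl

section ofComodule

variable {a : AutPair k H} {τ : V →ₗ[k] V ⊗[k] (Module.Dual k H ⊗[k] H)}

/-- Coassociativity followed by the counit of the middle factor `H`: the action of `x` on the
coaction at `y` is the coaction at `x y`. -/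
theorem map_inducedAct_push
    (hτ : Coact.IsCoaction (C := Module.Dual k H ⊗[k] H) (CT.comul a) CT.counit τ)
    (x y : H) (v : V) :
    TensorProduct.map (inducedAct τ x) LinearMap.id
      (coactAt y τ v) =
      Coact.push (C := Module.Dual k H ⊗[k] H) (evalAt H (x * y)) τ v := by
  have e1 := congrArg (TensorProduct.map LinearMap.id (projRight k H H))
    ((coassoc_iff a τ v).1 (hτ.coassoc v) x y)
  have e2 : ∀ t : V ⊗[k] H, TensorProduct.map LinearMap.id (projRight k H H)
      (TensorProduct.assoc k V H H (TensorProduct.map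
        (coactAt x τ) LinearMap.id t)) =
      TensorProduct.map (inducedAct τ x) LinearMap.id t := fun t => by
    induction t using tensor_ind with
    | add s t hs ht => simp only [map_add, hs, ht]
    | tmul w p =>
      simp only [TensorProduct.map_tmul, inducedAct_apply]
      generalize coactAt x τ w = s
      induction s using tensor_ind with
      | add s t hs ht => simp only [map_add, TensorProduct.add_tmul, hs, ht]
      | tmul w' q => simp [TensorProduct.smul_tmul]
  have e3 := LinearMap.congr_fun (map_sandwichConv (V := V) (projRight_mul (k := k) (H := H))
    LinearMap.id (inclLeft k H ∘ₗ bialgAutLin a.fst ∘ₗ antipodeInv k H)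
        (inclLeft k H ∘ₗ bialgAutLin a.snd) (TensorProduct.map LinearMap.id comul ∘ₗ
          evalTensor k H V (τ v) ∘ₗ LinearMap.mulLeft k x)) y
  have e4 : projRight k H H ∘ₗ inclLeft k H ∘ₗ bialgAutLin a.fst ∘ₗ antipodeInv k H =
      convOne k H H := by ext; simp [convOne_apply, YDModule.counit_aut, counit_antipodeInv]
  have e5 : projRight k H H ∘ₗ inclLeft k H ∘ₗ bialgAutLin a.snd =
      convOne k H H := by ext; simp [convOne_apply, YDModule.counit_aut]
  have e6 : TensorProduct.map LinearMap.id (projRight k H H) ∘ₗ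
      TensorProduct.map LinearMap.id comul ∘ₗ evalTensor k H V (τ v) ∘ₗ LinearMap.mulLeft k x =
        evalTensor k H V (τ v) ∘ₗ LinearMap.mulLeft k x := by
    rw [← LinearMap.comp_assoc, ← TensorProduct.map_comp,
      show projRight k H H ∘ₗ comul = LinearMap.id from LinearMap.ext projRight_comul,
      LinearMap.id_comp, TensorProduct.map_id, LinearMap.id_comp]
  rw [e4, e5, e6, sandwichConv_convOne] at e3
  exact (e2 _).symm.trans (e1.trans (e3.trans (evalTensor_apply _ _)))

/-- Coassociativity followed by the counit of the last factor `H`: with `τₓ` the coaction at `x`,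
`τₓ(y · v) = β(y₃) τ_{x y₂}(v) α(S⁻¹(y₁))`. -/
theorem push_inducedAct
    (hτ : Coact.IsCoaction (C := Module.Dual k H ⊗[k] H) (CT.comul a) CT.counit τ)
    (x y : H) (v : V) :
    coactAt x τ (inducedAct τ y v) =
      sandwichConv k V (bialgAutLin a.fst ∘ₗ antipodeInv k H) (bialgAutLin a.snd)
        (evalTensor k H V (τ v) ∘ₗ LinearMap.mulLeft k x) y := by
  have e1 := congrArg (TensorProduct.map LinearMap.id (projLeft k H H))
    ((coassoc_iff a τ v).1 (hτ.coassoc v) x y)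
  have e2 : ∀ t : V ⊗[k] H, TensorProduct.map LinearMap.id (projLeft k H H)
      (TensorProduct.assoc k V H H (TensorProduct.map
        (coactAt x τ) LinearMap.id t)) =
      coactAt x τ (applyCounit k H V t) := fun t => by
    induction t using tensor_ind with
    | add s t hs ht => simp only [map_add, hs, ht]
    | tmul w p =>
      simp only [TensorProduct.map_tmul, applyCounit_tmul, map_smul]
      generalize coactAt x τ w = s
      induction s using tensor_ind with
      | add s t hs ht => simp only [map_add, TensorProduct.add_tmul, hs, ht, smul_add]
      | tmul w' q => simp
  have e3 := LinearMap.congr_fun (map_sandwichConv (V := V) (projLeft_mul (k := k) (H := H))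
    LinearMap.id (inclLeft k H ∘ₗ bialgAutLin a.fst ∘ₗ antipodeInv k H)
        (inclLeft k H ∘ₗ bialgAutLin a.snd) (TensorProduct.map LinearMap.id comul ∘ₗ
          evalTensor k H V (τ v) ∘ₗ LinearMap.mulLeft k x)) y
  have e4 : ∀ f : H →ₗ[k] H, projLeft k H H ∘ₗ inclLeft k H ∘ₗ f = f := fun f => by ext; simp
  have e6 : TensorProduct.map LinearMap.id (projLeft k H H) ∘ₗ
      TensorProduct.map LinearMap.id comul ∘ₗ evalTensor k H V (τ v) ∘ₗ LinearMap.mulLeft k x =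
        evalTensor k H V (τ v) ∘ₗ LinearMap.mulLeft k x := by
    rw [← LinearMap.comp_assoc, ← TensorProduct.map_comp,
      show projLeft k H H ∘ₗ comul = LinearMap.id from LinearMap.ext projLeft_comul,
      LinearMap.id_comp, TensorProduct.map_id, LinearMap.id_comp]
  rw [e4, e4, e6] at e3
  rw [inducedAct_apply]
  exact (e2 _).symm.trans (e1.trans e3)

theorem inducedAct_mul
    (hτ : Coact.IsCoaction (C := Module.Dual k H ⊗[k] H) (CT.comul a) CT.counit τ)
    (x y : H) (v : V) :
    inducedAct τ (x * y) v = inducedAct τ x (inducedAct τ y v) := by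
  rw [inducedAct_apply, ← map_inducedAct_push hτ, inducedAct_apply τ y]
  generalize coactAt y τ v = s
  induction s using tensor_ind with
  | add s t hs ht => simp only [map_add, hs, ht]
  | tmul w' q => simp

theorem inducedAct_one
    (hτ : Coact.IsCoaction (C := Module.Dual k H ⊗[k] H) (CT.comul a) CT.counit τ)
    (v : V) :
    inducedAct τ 1 v = v := by
  refine .trans ?_ (hτ.counit v)
  rw [inducedAct_apply, Coact.push_apply]
  generalize τ v = s
  induction s using tensor_ind with
  | add s t hs ht => simp only [map_add, hs, ht]
  | tmul w' q => simp [counit_CT, evalMap_apply]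

/-- A coaction of `CT(H)` is determined by the action of `H` and by its value at `1`. -/
theorem push_evalAt_eq
    (hτ : Coact.IsCoaction (C := Module.Dual k H ⊗[k] H) (CT.comul a) CT.counit τ)
    (x : H) (v : V) :
    coactAt x τ v =
      TensorProduct.map (inducedAct τ x) LinearMap.id
        (coactAt 1 τ v) := by
  rw [map_inducedAct_push hτ, mul_one]

theorem push_evalAt_one_isCoaction
    (hτ : Coact.IsCoaction (C := Module.Dual k H ⊗[k] H) (CT.comul a) CT.counit τ)
    :
    Coact.IsCoaction comul counit
      (coactAt 1 τ) where
  coassoc v := by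
    refine ((coassoc_iff a τ v).1 (hτ.coassoc v) 1 1).trans ?_
    rw [sandwichConv_apply_one (by simp [antipodeInv_one, Algebra.TensorProduct.one_def])
      (by simp [Algebra.TensorProduct.one_def])]
    simp [evalTensor_apply, Coact.push_apply]
  counit v := (inducedAct_apply τ 1 v).symm.trans (inducedAct_one hτ v)

theorem inducedAct_compat
    (hτ : Coact.IsCoaction (C := Module.Dual k H ⊗[k] H) (CT.comul a) CT.counit τ)
    :
    YD.left (bialgAutLin a.snd) (inducedAct τ)
        (coactAt 1 τ) =
      YD.right (bialgAutLin a.fst) (inducedAct τ)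
        (coactAt 1 τ) := by
  refine (left_eq_right_iff _ _ _ _).2 fun v => LinearMap.ext fun y => ?_
  refine (push_inducedAct hτ 1 y v).trans ?_
  congr 2
  ext z
  simp only [LinearMap.comp_apply, LinearMap.mulLeft_apply, one_mul, evalTensor_apply]
  exact push_evalAt_eq hτ z v

end ofComodule

section toComodule

/-- The coaction `v ↦ ∑ bᵢ · v₀ ⊗ (bⁱ ⋈ v₁)` of `CT(H)` determined by an action and a coaction
of `H`, with dual bases `bᵢ`, `bⁱ` of `H` and its dual. -/
noncomputable def combinedCoact (act : H →ₗ[k] V →ₗ[k] V) (ρ : V →ₗ[k] V ⊗[k] H) :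
    V →ₗ[k] V ⊗[k] (Module.Dual k H ⊗[k] H) :=
  ∑ i, TensorProduct.map (act (Module.finBasis k H i))
    (TensorProduct.mk k _ H ((Module.finBasis k H).coord i)) ∘ₗ ρ

variable {act : H →ₗ[k] V →ₗ[k] V} {ρ : V →ₗ[k] V ⊗[k] H}

theorem push_combinedCoact (x : H) (v : V) :
    coactAt x (combinedCoact act ρ) v =
      TensorProduct.map (act x) LinearMap.id (ρ v) := by
  rw [Coact.push_apply, combinedCoact, LinearMap.sum_apply, map_sum]
  simp only [LinearMap.comp_apply]
  generalize ρ v = s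
  induction s using tensor_ind with
  | add s t hs ht => simp only [map_add, Finset.sum_add_distrib, hs, ht]
  | tmul w h =>
    simp only [TensorProduct.map_tmul, LinearMap.id_apply, TensorProduct.mk_apply, evalAt_tmul,
      TensorProduct.tmul_smul]
    simp only [TensorProduct.smul_tmul', ← TensorProduct.sum_tmul]
    congr 1
    have e := congrArg (act.flip w) ((Module.finBasis k H).sum_repr x)
    simp only [map_sum, map_smul, LinearMap.flip_apply] at e
    simpa using e

theorem inducedAct_combinedCoact (hρ : Coact.IsCoaction comul counit ρ) :
    inducedAct (combinedCoact act ρ) = act := by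
  ext x v
  rw [inducedAct_apply, push_combinedCoact]
  conv_rhs => rw [← hρ.counit v]
  generalize ρ v = s
  induction s using tensor_ind with
  | add s t hs ht => simp only [map_add, hs, ht]
  | tmul w h => simp

theorem push_combinedCoact_one (h1 : ∀ v, act 1 v = v) :
    coactAt 1 (combinedCoact act ρ) = ρ := by
  ext v
  rw [push_combinedCoact, show act 1 = LinearMap.id from LinearMap.ext h1, TensorProduct.map_id,
    LinearMap.id_apply]

theorem combinedCoact_inducedAct {a : AutPair k H}
    {τ : V →ₗ[k] V ⊗[k] (Module.Dual k H ⊗[k] H)}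

    (hτ : Coact.IsCoaction (C := Module.Dual k H ⊗[k] H) (CT.comul a) CT.counit τ)
    :
    combinedCoact (inducedAct τ)
      (coactAt 1 τ) = τ := by
  ext v
  refine ext_map_evalAt_right fun x => ?_
  exact (push_combinedCoact x v).trans (push_evalAt_eq hτ x v).symm

/-- An action and a coaction of `H` that satisfy the Yetter-Drinfeld condition combine to a coaction
of `CT(H)`: on evaluation, coassociativity is the solved form of that condition. -/
theorem combinedCoact_isCoaction (a : AutPair k H) (hρ : Coact.IsCoaction comul counit ρ)
    (h1 : ∀ v, act 1 v = v) (hmul : ∀ x y v, act (x * y) v = act x (act y v))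
    (hc : YD.left (bialgAutLin a.snd) act ρ = YD.right (bialgAutLin a.fst) act ρ) :
    Coact.IsCoaction (C := Module.Dual k H ⊗[k] H) (CT.comul a) CT.counit
      (combinedCoact act ρ) where
  coassoc v := by
    refine (coassoc_iff a _ v).2 fun x y => ?_
    set l : H →ₗ[k] H := bialgAutLin a.fst ∘ₗ antipodeInv k H with hl
    set r : H →ₗ[k] H := bialgAutLin a.snd with hr
    have e1 : ∀ t : V ⊗[k] H, TensorProduct.assoc k V H H
        (TensorProduct.map (ρ ∘ₗ act y) LinearMap.id t) =
        sandwichConv k V (inclLeft k H ∘ₗ l) (inclLeft k H ∘ₗ r)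
          ((LinearMap.rTensorHom (H ⊗[k] H) ∘ₗ act).flip
            (TensorProduct.assoc k V H H (TensorProduct.map ρ LinearMap.id t))) y := fun t => by
      induction t using tensor_ind with
      | add s t hs ht => simp only [map_add, sandwichConv_add, LinearMap.add_apply, hs, ht]
      | tmul w h =>
        let φ : V ⊗[k] H →ₗ[k] V ⊗[k] (H ⊗[k] H) :=
          TensorProduct.map LinearMap.id ((TensorProduct.mk k H H).flip h)
        have e : ∀ s : V ⊗[k] H, TensorProduct.assoc k V H H (s ⊗ₜ h) = φ s := fun s => by
          induction s using tensor_ind with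
          | add s t hs ht => simp only [map_add, TensorProduct.add_tmul, hs, ht]
          | tmul w h => simp [φ]
        have e2 := congrArg φ (LinearMap.congr_fun ((left_eq_right_iff _ _ _ _).1 hc w) y)
        rw [TensorProduct.map_tmul, TensorProduct.map_tmul, LinearMap.id_apply, e, e]
        refine e2.trans ((LinearMap.congr_fun (comp_sandwichConv (φ := φ) (l' := inclLeft k H ∘ₗ l)
          (r' := inclLeft k H ∘ₗ r) (fun x s => ?_) (fun x s => ?_) _) y).trans ?_)
        · induction s using tensor_ind with
          | add s t hs ht => simp only [map_add, hs, ht]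
          | tmul w h => simp [φ, hl]
        · induction s using tensor_ind with
          | add s t hs ht => simp only [map_add, hs, ht]
          | tmul w h => simp [φ, hr]
        · congr 2
          ext z
          simp only [LinearMap.comp_apply, LinearMap.flip_apply]
          generalize ρ w = s
          induction s using tensor_ind with
          | add s t hs ht => simp only [map_add, hs, ht]
          | tmul w h => simp [φ]
    rw [push_combinedCoact]
    have e2 : ∀ t : V ⊗[k] H, TensorProduct.assoc k V H H (TensorProduct.map
        (coactAt x (combinedCoact act ρ))
        LinearMap.id (TensorProduct.map (act y) LinearMap.id t)) =
        TensorProduct.map (act x) LinearMap.id (TensorProduct.assoc k V H H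
        (TensorProduct.map (ρ ∘ₗ act y) LinearMap.id t)) := fun t => by
      induction t using tensor_ind with
      | add s t hs ht => simp only [map_add, hs, ht]
      | tmul w h =>
        simp only [TensorProduct.map_tmul, LinearMap.comp_apply, push_combinedCoact]
        generalize ρ (act y w) = s
        induction s using tensor_ind with
        | add s t hs ht => simp only [map_add, TensorProduct.add_tmul, hs, ht]
        | tmul w h => simp
    rw [e2, e1, hρ.coassoc]
    refine (LinearMap.congr_fun (map_sandwichConv (V := V) (φ := (LinearMap.id : H ⊗[k] H →ₗ[k] _))
      (fun _ _ => rfl) (act x) _ _ _) y).trans ?_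
    rw [LinearMap.id_comp, LinearMap.id_comp]
    congr 2
    ext z
    simp only [LinearMap.comp_apply, LinearMap.flip_apply, LinearMap.mulLeft_apply,
      evalTensor_apply]
    refine .trans ?_ (congrArg (TensorProduct.map LinearMap.id comul)
      (push_combinedCoact (x * z) v).symm)
    generalize ρ v = s
    induction s using tensor_ind with
    | add s t hs ht => simp only [map_add, hs, ht]
    | tmul w h => simp [hmul]
  counit v := by
    refine .trans ?_ ((LinearMap.congr_fun₂ (inducedAct_combinedCoact (act := act) hρ) 1 v).trans
      (h1 v))
    rw [inducedAct_apply, Coact.push_apply]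
    generalize combinedCoact act ρ v = s
    induction s using tensor_ind with
    | add s t hs ht => simp only [map_add, hs, ht]
    | tmul w' q => simp [counit_CT, evalMap_apply]

end toComodule

end comodules
/-! ### Tensor product, conjugation and braiding under the correspondence -/

section structureMaps

open Coalgebra HopfAlgebra

variable {k : Type u} [Field k] {H : Type v} [Ring H] [HopfAlgebra k H]
variable {V W : Type u} [AddCommGroup V] [Module k V] [AddCommGroup W] [Module k W]
variable {τ : V →ₗ[k] V ⊗[k] (Module.Dual k H ⊗[k] H)}
  {τ' : W →ₗ[k] W ⊗[k] (Module.Dual k H ⊗[k] H)}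

theorem map_coactAt {f : V →ₗ[k] W}
    (hf : ∀ v, TensorProduct.map f LinearMap.id (τ v) = τ' (f v)) (x : H) (v : V) :
    TensorProduct.map f LinearMap.id (coactAt x τ v) = coactAt x τ' (f v) := by
  rw [Coact.push_apply, Coact.push_apply, ← hf]
  generalize τ v = s
  induction s using tensor_ind with
  | add s t hs ht => simp only [map_add, hs, ht]
  | tmul w h => simp

theorem map_inducedAct {f : V →ₗ[k] W}
    (hf : ∀ v, TensorProduct.map f LinearMap.id (τ v) = τ' (f v)) (x : H) (v : V) :
    f (inducedAct τ x v) = inducedAct τ' x (f v) := by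
  rw [inducedAct_apply, inducedAct_apply, ← map_coactAt hf]
  generalize coactAt x τ v = s
  induction s using tensor_ind with
  | add s t hs ht => simp only [map_add, hs, ht]
  | tmul w h => simp

theorem map_combinedCoact [FiniteDimensional k H] {act : H →ₗ[k] V →ₗ[k] V}
    {ρ : V →ₗ[k] V ⊗[k] H} {act' : H →ₗ[k] W →ₗ[k] W} {ρ' : W →ₗ[k] W ⊗[k] H} {f : V →ₗ[k] W}
    (hact : ∀ x v, f (act x v) = act' x (f v))
    (hf : ∀ v, TensorProduct.map f LinearMap.id (ρ v) = ρ' (f v)) (v : V) :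
    TensorProduct.map f LinearMap.id (combinedCoact act ρ v) = combinedCoact act' ρ' (f v) := by
  simp only [combinedCoact, LinearMap.sum_apply, map_sum, LinearMap.comp_apply, ← hf]
  refine Finset.sum_congr rfl fun i _ => ?_
  generalize ρ v = s
  induction s using tensor_ind with
  | add s t hs ht => simp only [map_add, hs, ht]
  | tmul w h => simp [hact]

theorem coactAt_unit (r : k) : coactAt 1 (Coact.unit (k := k) (C := Module.Dual k H ⊗[k] H)
    ((counit : H →ₗ[k] k) ⊗ₜ 1)) r = Coact.unit (1 : H) r := by
  simp [Coact.push_apply, Coact.unit]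

theorem inducedAct_unit (x : H) (r : k) : inducedAct (Coact.unit (k := k)
    (C := Module.Dual k H ⊗[k] H) ((counit : H →ₗ[k] k) ⊗ₜ 1)) x r = counit (R := k) x * r := by
  simp [inducedAct_apply, Coact.push_apply, Coact.unit]

theorem coactAt_tensor (a b : AutPair k H) :
    coactAt 1 (Coact.tensor (C := Module.Dual k H ⊗[k] H) (D := Module.Dual k H ⊗[k] H)
      (E := Module.Dual k H ⊗[k] H) (CT.mul a b) τ τ') =
      Coact.tensor (YDModule.mulMap b.snd (b.snd * a.fst * b.snd⁻¹)) (coactAt 1 τ)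
        (coactAt 1 τ') := by
  refine TensorProduct.ext' fun v w => ?_
  simp only [Coact.push_apply, Coact.tensor, LinearMap.comp_apply, TensorProduct.map_tmul,
    LinearEquiv.coe_coe]
  generalize τ v = s
  generalize τ' w = t
  induction s using tensor_ind with
  | add s s' hs hs' => simp only [map_add, TensorProduct.add_tmul, hs, hs']
  | tmul v p =>
  induction t using tensor_ind with
  | add s s' hs hs' => simp only [map_add, TensorProduct.tmul_add, hs, hs']
  | tmul w q =>
    have e := LinearMap.congr_fun (evalMap_mul_CT a b p q) 1
    rw [convolveOp_apply_one, evalMap_apply] at e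
    simp only [TensorProduct.tensorTensorTensorComm_tmul, TensorProduct.map_tmul,
      LinearMap.id_apply, e]
    simp [evalMap_apply, YDModule.mulMap]

theorem inducedAct_tensor (a b : AutPair k H) (x : H) (v : V) (w : W) :
    inducedAct (Coact.tensor (C := Module.Dual k H ⊗[k] H) (D := Module.Dual k H ⊗[k] H)
      (E := Module.Dual k H ⊗[k] H) (CT.mul a b) τ τ') x (v ⊗ₜ w) =
      TensorProduct.comm k W V (TensorProduct.map ((inducedAct τ').flip w)
        ((inducedAct τ).flip v) (comul x)) := by
  have e1 : ∀ (τ : V →ₗ[k] V ⊗[k] (Module.Dual k H ⊗[k] H)) v,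
      (inducedAct τ).flip v = applyCounit k H V ∘ₗ evalTensor k H V (τ v) := fun τ v => rfl
  have e2 : ∀ (τ : W →ₗ[k] W ⊗[k] (Module.Dual k H ⊗[k] H)) v,
      (inducedAct τ).flip v = applyCounit k H W ∘ₗ evalTensor k H W (τ v) := fun τ v => rfl
  rw [e1, e2, inducedAct_apply]
  simp only [Coact.push_apply, Coact.tensor, LinearMap.comp_apply, TensorProduct.map_tmul,
    LinearEquiv.coe_coe]
  generalize τ v = s
  generalize τ' w = t
  induction s using tensor_ind with
  | add s s' hs hs' =>
    simp only [map_add, TensorProduct.add_tmul, LinearMap.comp_add, TensorProduct.map_add_right,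
      LinearMap.add_apply, hs, hs']
  | tmul v p =>
  induction t using tensor_ind with
  | add s s' hs hs' =>
    simp only [map_add, TensorProduct.tmul_add, LinearMap.comp_add, TensorProduct.map_add_left,
      LinearMap.add_apply, hs, hs']
  | tmul w q =>
    have e := LinearMap.congr_fun (evalMap_mul_CT a b p q) x
    rw [evalMap_apply, convolveOp, convWith_apply] at e
    simp only [TensorProduct.tensorTensorTensorComm_tmul, TensorProduct.map_tmul,
      LinearMap.id_apply, e]
    generalize (comul x : H ⊗[k] H) = r
    induction r using tensor_ind with
    | add s s' hs hs' => simp only [map_add, TensorProduct.tmul_add, ← hs, ← hs']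
    | tmul y z =>
      simp [evalTensor_tmul, YDModule.counit_aut, TensorProduct.smul_tmul', smul_smul]

theorem coactAt_crossing (c a : AutPair k H) :
    coactAt 1 (Coact.push (C := Module.Dual k H ⊗[k] H) (D := Module.Dual k H ⊗[k] H)
      (CT.crossing c a) τ) =
      Coact.push (bialgAutLin (c.snd⁻¹ * a.snd * c.fst * a.snd⁻¹)) (coactAt 1 τ) := by
  refine (Coact.push_push _ _ _).trans (.trans ?_ (Coact.push_push _ _ _).symm)
  congr 1
  refine LinearMap.ext fun t => ?_
  have e := LinearMap.congr_fun (evalMap_crossing_CT c a t) 1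
  rw [evalMap_apply] at e
  refine e.trans ?_
  simp [evalMap_apply]

theorem inducedAct_crossing (c a : AutPair k H) (x : H) (v : V) :
    inducedAct (Coact.push (C := Module.Dual k H ⊗[k] H) (D := Module.Dual k H ⊗[k] H)
      (CT.crossing c a) τ) x v = inducedAct τ ((c.fst⁻¹ * c.snd) x) v := by
  rw [inducedAct_apply, inducedAct_apply]
  simp only [Coact.push_apply]
  generalize τ v = s
  induction s using tensor_ind with
  | add s s' hs hs' => simp only [map_add, hs, hs']
  | tmul w t =>
    have e := LinearMap.congr_fun (evalMap_crossing_CT c a t) x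
    rw [evalMap_apply] at e
    simp only [TensorProduct.map_tmul, LinearMap.id_apply, e]
    simp [evalMap_apply, YDModule.counit_aut]

/-- The form that enters the braiding of comodules, applied to the coactions of `v ⊗ w`, gives
`∑ v₀ ⊗ α⁻¹(v₁) · w`. -/
theorem pair_sigma (a b : AutPair k H) :
    Coact.pair (C := Module.Dual k H ⊗[k] H) (D := Module.Dual k H ⊗[k] H)
      (Coact.twist (C := Module.Dual k H ⊗[k] H) (D := Module.Dual k H ⊗[k] H)
        (D' := Module.Dual k H ⊗[k] H) (CT.sigma a) (CT.crossing a b)) τ τ' =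
      Coact.actMap (inducedAct τ' ∘ₗ bialgAutLin a.fst⁻¹) (coactAt 1 τ) := by
  refine TensorProduct.ext' fun v w => ?_
  rw [Coact.actMap_tmul]
  have e1 : (inducedAct τ' ∘ₗ bialgAutLin a.fst⁻¹).flip w =
      applyCounit k H W ∘ₗ evalTensor k H W (τ' w) ∘ₗ bialgAutLin a.fst⁻¹ := rfl
  rw [e1]
  simp only [Coact.push_apply, Coact.pair, Coact.tensor, LinearMap.comp_apply,
    TensorProduct.map_tmul, LinearEquiv.coe_coe]
  generalize τ v = s
  generalize τ' w = t
  induction s using tensor_ind with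
  | add s s' hs hs' => simp only [map_add, TensorProduct.add_tmul, hs, hs']
  | tmul v p =>
  induction t using tensor_ind with
  | add s s' hs hs' =>
    simp only [map_add, TensorProduct.tmul_add, LinearMap.comp_add, LinearMap.add_comp,
      TensorProduct.map_add_right, LinearMap.add_apply, hs, hs']
  | tmul w q =>
    simp [sigma_CT, evalTensor_tmul, evalMap_crossing_CT, evalMap_apply, YDModule.counit_aut]

end structureMaps
/-! ### The isomorphism of categories -/

section isomorphism

open Coalgebra HopfAlgebra

variable {k : Type u} [Field k] {H : Type v} [Ring H] [HopfAlgebra k H] [FiniteDimensional k H]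

/-- The Yetter-Drinfeld module with the space and the index of a comodule over `CT(H)`. -/
@[reducible] noncomputable def toYDModule (X : Comod (CT k H)) : YDModule k H where
  deg := X.deg
  V := X.V
  act := AlgHom.ofLinearMap (inducedAct X.coact)
    (LinearMap.ext fun v => inducedAct_one (a := X.deg) X.isCoaction v)
    fun x y => LinearMap.ext fun v => inducedAct_mul (a := X.deg) X.isCoaction x y v
  coact := coactAt 1 X.coact
  isCoaction := push_evalAt_one_isCoaction (a := X.deg) X.isCoaction
  compat := inducedAct_compat (a := X.deg) X.isCoaction

/-- The comodule over `CT(H)` with the space and the index of a Yetter-Drinfeld module. -/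
@[reducible] noncomputable def ofYDModule (M : YDModule k H) : Comod (CT k H) where
  deg := M.deg
  V := M.V
  coact := combinedCoact M.act.toLinearMap M.coact
  isCoaction := combinedCoact_isCoaction M.deg M.isCoaction
    (fun v => congrArg (fun f : Module.End k M.V => f v) (map_one M.act))
    (fun x y v => congrArg (fun f : Module.End k M.V => f v) (map_mul M.act x y)) M.compat

/-- The components of `CT(H)` have one and the same underlying space, so the transport between
equal indices in the definition of a morphism is the identity. -/
theorem colinear_CT {X Y : Comod (CT k H)} (f : X ⟶ Y) (v : X.V) :
    TensorProduct.map f.lin (LinearMap.id : Module.Dual k H ⊗[k] H →ₗ[k] _) (X.coact v) =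
      Y.coact (f.lin v) := by
  have e : (CT k H).cast f.deg_eq = LinearMap.id := LinearMap.ext (cast_CT f.deg_eq)
  exact (congrArg (fun g => TensorProduct.map f.lin g (X.coact v)) e).symm.trans (f.colinear v)

/-- The functor from comodules over `CT(H)` to Yetter-Drinfeld modules; it is the identity on the
underlying linear maps. -/
noncomputable def toYD : Comod (CT k H) ⥤ YDModule k H where
  obj := toYDModule
  map f := ⟨f.deg_eq, f.lin, map_inducedAct (colinear_CT f), map_coactAt (colinear_CT f) 1⟩
  map_id _ := rfl
  map_comp _ _ := rfl

/-- The functor from Yetter-Drinfeld modules to comodules over `CT(H)`; it is the identity on the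
underlying linear maps. -/
noncomputable def ofYD : YDModule k H ⥤ Comod (CT k H) where
  obj := ofYDModule
  map {M N} f := ⟨f.deg_eq, f.lin, fun v => by
    have e : (CT k H).cast f.deg_eq = LinearMap.id := LinearMap.ext (cast_CT f.deg_eq)
    exact (congrArg (fun g => TensorProduct.map f.lin g (combinedCoact M.act.toLinearMap
      M.coact v)) e).trans (map_combinedCoact f.linear f.colinear v)⟩
  map_id _ := rfl
  map_comp _ _ := rfl

theorem ofYDModule_toYDModule (X : Comod (CT k H)) : ofYDModule (toYDModule X) = X := by
  refine Comod.mk_eq (A := CT k H) rfl _ X.isCoaction ?_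
  have e : (CT k H).cast (rfl : X.deg = X.deg) = LinearMap.id := LinearMap.ext (cast_CT _)
  refine LinearMap.ext fun v => ?_
  refine (congrArg (fun g => TensorProduct.map LinearMap.id g (combinedCoact (inducedAct X.coact)
    (coactAt 1 X.coact) v)) e).trans ?_
  refine (LinearMap.congr_fun TensorProduct.map_id _).trans ?_
  exact LinearMap.congr_fun (combinedCoact_inducedAct (a := X.deg) X.isCoaction) v

theorem toYDModule_ofYDModule (M : YDModule k H) : toYDModule (ofYDModule M) = M :=
  YDModule.mk_eq rfl _ _ M.isCoaction M.compat
    (AlgHom.ext fun x => LinearMap.congr_fun (inducedAct_combinedCoact M.isCoaction) x)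
    (push_combinedCoact_one fun v => congrArg (fun f : Module.End k M.V => f v) (map_one M.act))

theorem toYDModule_unit (hA : (CT k H).IsTuraevAlgebra) :
    toYDModule (Comod.unitObj hA) = YDModule.unitObj k H :=
  YDModule.mk_eq rfl _ _ _ _
    (AlgHom.ext fun x => LinearMap.ext fun r => inducedAct_unit x r)
    (LinearMap.ext fun r => coactAt_unit r)

theorem toYDModule_tensor (hA : (CT k H).IsTuraevAlgebra) (X Y : Comod (CT k H)) :
    toYDModule (Comod.tensorObj hA X Y) =
      YDModule.tensorObj (toYDModule X) (toYDModule Y) := by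
  have e1 : (toYDModule (Comod.tensorObj hA X Y)).act =
      YD.tensorAct (toYDModule X).act (toYDModule Y).act :=
    AlgHom.ext fun x => TensorProduct.ext' fun v w => by
      rw [YD.tensorAct_apply]
      exact inducedAct_tensor (τ := X.coact) (τ' := Y.coact) X.deg Y.deg x v w
  exact YDModule.mk_eq rfl _ _ _ _ e1
    (coactAt_tensor (τ := X.coact) (τ' := Y.coact) X.deg Y.deg)

theorem toYDModule_conj (hA : (CT k H).IsCrossed) (a : AutPair k H) (X : Comod (CT k H)) :
    toYDModule (Comod.conjObj hA a X) = YDModule.conjObj a (toYDModule X) :=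
  YDModule.mk_eq rfl _ _ _ _
    (AlgHom.ext fun x => LinearMap.ext fun v => inducedAct_crossing (τ := X.coact) a X.deg x v)
    (coactAt_crossing (τ := X.coact) a X.deg)

theorem braiding_lin (hA : (CT k H).IsCoquasitriangular) (X Y : Comod (CT k H)) :
    (Comod.braiding hA X Y).hom.lin =
      (YDModule.braiding (toYDModule X) (toYDModule Y)).hom.lin := by
  have e := pair_sigma (τ := X.coact) (τ' := Y.coact) X.deg Y.deg
  exact congrArg (fun f => (TensorProduct.comm k X.V Y.V).toLinearMap ∘ₗ f) e

end isomorphism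
/-! ### The isomorphism of braided categories -/

section isomorphism

variable {k : Type u} [Field k] {H : Type v} [Ring H] [HopfAlgebra k H] [FiniteDimensional k H]

/-- The functor preserves objects only up to propositional equality; as it does not change linear
maps, equations between morphisms reduce to the underlying linear maps. -/
theorem toYD_map_heq {X Y : Comod (CT k H)} {M N : YDModule k H} (f : X ⟶ Y) (g : M ⟶ N)
    (hX : toYDModule X = M) (hY : toYDModule Y = N) (h : f.lin ≍ g.lin) : toYD.map f ≍ g := by
  subst hX hY
  exact heq_of_eq (YDModule.hom_ext (eq_of_heq h))

theorem ofYD_comp_toYD : ofYD ⋙ toYD = 𝟭 (YDModule k H) :=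
  CategoryTheory.Functor.hext toYDModule_ofYDModule fun M N _ =>
    toYD_map_heq _ _ (toYDModule_ofYDModule M) (toYDModule_ofYDModule N) HEq.rfl

theorem toYD_comp_ofYD : toYD ⋙ ofYD = 𝟭 (Comod (CT k H)) :=
  CategoryTheory.Functor.hext ofYDModule_toYDModule fun X Y _ =>
    Comod.hom_heq (ofYDModule_toYDModule X) (ofYDModule_toYDModule Y) _ _ HEq.rfl

theorem conj_comp_toYD (hA : (CT k H).IsCrossed) (a : AutPair k H) :
    Comod.conj hA a ⋙ toYD = toYD ⋙ YDModule.conj a :=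
  CategoryTheory.Functor.hext (toYDModule_conj hA a) fun X Y _ =>
    toYD_map_heq _ _ (toYDModule_conj hA a X) (toYDModule_conj hA a Y) HEq.rfl

theorem toYDModule_tensor_left (hA : (CT k H).IsTuraevAlgebra) (X Y Z : Comod (CT k H)) :
    toYDModule (Comod.tensorObj hA (Comod.tensorObj hA X Y) Z) =
      YDModule.tensorObj (YDModule.tensorObj (toYDModule X) (toYDModule Y)) (toYDModule Z) := by
  rw [toYDModule_tensor, toYDModule_tensor]

theorem toYDModule_tensor_right (hA : (CT k H).IsTuraevAlgebra) (X Y Z : Comod (CT k H)) :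
    toYDModule (Comod.tensorObj hA X (Comod.tensorObj hA Y Z)) =
      YDModule.tensorObj (toYDModule X) (YDModule.tensorObj (toYDModule Y) (toYDModule Z)) := by
  rw [toYDModule_tensor, toYDModule_tensor]

theorem toYDModule_unit_tensor (hA : (CT k H).IsTuraevAlgebra) (X : Comod (CT k H)) :
    toYDModule (Comod.tensorObj hA (Comod.unitObj hA) X) =
      YDModule.tensorObj (YDModule.unitObj k H) (toYDModule X) := by
  rw [toYDModule_tensor, toYDModule_unit]

theorem toYDModule_tensor_unit (hA : (CT k H).IsTuraevAlgebra) (X : Comod (CT k H)) :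
    toYDModule (Comod.tensorObj hA X (Comod.unitObj hA)) =
      YDModule.tensorObj (toYDModule X) (YDModule.unitObj k H) := by
  rw [toYDModule_tensor, toYDModule_unit]

theorem toYDModule_conj_tensor (hA : (CT k H).IsCoquasitriangular) (X Y : Comod (CT k H)) :
    toYDModule (Comod.tensorObj hA.toIsTuraevAlgebra (Comod.conjObj hA.toIsCrossed X.deg Y) X) =
      YDModule.tensorObj (YDModule.conjObj X.deg (toYDModule Y)) (toYDModule X) := by
  rw [toYDModule_tensor, toYDModule_conj]

/-- The isomorphism of braided `T`-categories. -/
noncomputable def corepIso (hA : (CT k H).IsCoquasitriangular) :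
    BraidedTCategory.Iso (Corep (CT k H) hA) (YDHat k H) where
  functor := toYD
  inverse := ofYD
  functor_comp_inverse := toYD_comp_ofYD
  inverse_comp_functor := ofYD_comp_toYD
  deg_obj _ := rfl
  obj_unit := toYDModule_unit hA.toIsTuraevAlgebra
  obj_tensor := toYDModule_tensor hA.toIsTuraevAlgebra
  map_tensor f g := toYD_map_heq (Comod.tensorHom hA.toIsTuraevAlgebra f g)
    (YDModule.tensorHom (toYD.map f) (toYD.map g))
    (toYDModule_tensor _ _ _) (toYDModule_tensor _ _ _) HEq.rfl
  map_associator X Y Z := toYD_map_heq _ _ (toYDModule_tensor_left hA.toIsTuraevAlgebra X Y Z)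
    (toYDModule_tensor_right hA.toIsTuraevAlgebra X Y Z) HEq.rfl
  map_leftUnitor X := toYD_map_heq _ _ (toYDModule_unit_tensor hA.toIsTuraevAlgebra X) rfl HEq.rfl
  map_rightUnitor X := toYD_map_heq _ _ (toYDModule_tensor_unit hA.toIsTuraevAlgebra X) rfl HEq.rfl
  conj_comp := conj_comp_toYD hA.toIsCrossed
  map_braiding X Y := toYD_map_heq _ _ (toYDModule_tensor hA.toIsTuraevAlgebra X Y)
    (toYDModule_conj_tensor hA X Y) (heq_of_eq (braiding_lin hA X Y))

end isomorphism

theorem theorem3p13 {k : Type u} [Field k] {H : Type v} [Ring H] [HopfAlgebra k H]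
    [FiniteDimensional k H] :
    ∃ hCT : (CT k H).IsCoquasitriangular,
      Nonempty (BraidedTCategory.Iso (Corep (CT k H) hCT) (YDHat k H)) :=
  ⟨isCoquasitriangular_CT, ⟨corepIso _⟩⟩
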